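/- Let $F$ be a number field with algebraic closure $\overline F$ and absolute Galois group $G_F=\mathrm{Gal}(\overline F/F)$, and let $\lambda\in F$ with $\lambda^4\neq 1$. Let $$X_\lambda:\ X_0^4+X_1^4+X_2^4+X_3^4-4\lambda X_0X_1X_2X_3=0\subset\mathbb P^3_F$$ be the Dwork quartic surface, let $\tau(X_0:X_1:X_2:X_3)=(X_1:X_0:X_2:X_3)$, and let $S_{1,\lambda}=X_\lambda/\langle\tau\rangle$ be the quotient surface (a del Pezzo surface of degree two). Let $\overline S_{1,\lambda}=S_{1,\lambda}\times_F\overline F$, and let $NS(\overline S_{1,\lambda})=\mathrm{Pic}(\overline S_{1,\lambda})/\mathrm{Pic}^0(\overline S_{1,\lambda})$ be its Néron–Severi group, with its natural action of $G_F$. For $a\in F^\times$ let $\left(\frac{a}{\bullet}\right):G_F\to\{\pm1\}$ be the character of $F(\sqrt a)/F$, i.e. $\sigma\mapsto\sigma(\sqrt a)/\sqrt a$ (trivial if $a$ is a square in $F$). Then there is an isomorphism of $\mathbf Q$-linear representations of $G_F$ $$NS(\overline S_{1,\lambda})\otimes_{\mathbf Z}\mathbf Q\;\simeq\; \mathrm{id}\;\oplus\;\left(\frac{-(\lambda^2-1)}{\bullet}\right)\;\oplus\;\left(\frac{-(\lambda^2+1)}{\bullet}\right)\;\oplus\;\left(\frac{-2(\lambda^4-1)}{\bullet}\right)^{\oplus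 2}\;\oplus\;\left(\frac{2(\lambda^4-1)}{\bullet}\right)^{\oplus 3},$$ where $\mathrm{id}$ is the trivial character. -/

import Mathlib

open scoped TensorProduct

universe u

/-!
# Divisors, Picard group and Néron-Severi group of a smooth projective surface `Proj R`

The points of `Proj R` are Mathlib's `ProjectiveSpectrum`: the homogeneous prime ideals of `R`
that do not contain the irrelevant ideal.  All definitions are used for a surface `Proj R` over an
algebraically closed field `k`, and for its product `Proj (B ⊗[k] R)` with an affine curve `Spec B`.
-/

namespace ProjDiv

section PrimeDivisors

variable {k R : Type u} [CommRing k] [CommRing R] [Algebra k R]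

/-- A prime divisor (irreducible closed subset of codimension one) of `Proj R`: a point of `Proj R`
whose homogeneous prime ideal has height one. -/
@[ext]
structure PrimeDivisor (𝒜 : ℕ → Submodule k R) [GradedAlgebra 𝒜] where
  point : ProjectiveSpectrum 𝒜
  height_eq_one : point.asHomogeneousIdeal.toIdeal.height = 1

/-- The homogeneous prime ideal of a prime divisor. -/
abbrev PrimeDivisor.ideal {𝒜 : ℕ → Submodule k R} [GradedAlgebra 𝒜] (P : PrimeDivisor 𝒜) :
    Ideal R := P.point.asHomogeneousIdeal.toIdeal

theorem PrimeDivisor.ext_ideal {𝒜 : ℕ → Submodule k R} [GradedAlgebra 𝒜] {P Q : PrimeDivisor 𝒜}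
    (h : P.ideal = Q.ideal) : P = Q :=
  PrimeDivisor.ext (ProjectiveSpectrum.ext (HomogeneousIdeal.toIdeal_injective h))

/-- The group of Weil divisors: the free abelian group on the prime divisors. -/
abbrev Divisor (𝒜 : ℕ → Submodule k R) [GradedAlgebra 𝒜] : Type u := PrimeDivisor 𝒜 →₀ ℤ

/-- The multiplicity of the closed subscheme `V(I)` of `Proj R` along the prime divisor `P`, for a
homogeneous ideal `I`: the length of `R_P / I R_P` over the local ring `R_P`.

The local ring of `Proj R` at `P` is the degree-zero part of the homogeneous localization of `R` at
`P`.  As soon as some element of degree one is not in `P`, that homogeneous localization is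
a Laurent polynomial ring over its degree-zero part, so that the length taken in `R_P` is the length
taken in the local ring of `Proj R`.  For the surface studied below this holds at each `P`, because
its elements of degree one have no common zero (the quotient surface in `P(1,1,1,2)` does not
pass through the point `(0:0:0:1)`). -/
noncomputable def mult {𝒜 : ℕ → Submodule k R} [GradedAlgebra 𝒜] (I : Ideal R)
    (P : PrimeDivisor 𝒜) : ℕ∞ :=
  Module.length (Localization.AtPrime P.ideal)
    (Localization.AtPrime P.ideal ⧸ I.map (algebraMap R (Localization.AtPrime P.ideal)))

/-- `D` is the (effective) divisor of the closed subscheme `V(I)`: its coefficient along each prime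
divisor `P` is the (finite) multiplicity of `V(I)` along `P`. -/
def IsDivisorOf {𝒜 : ℕ → Submodule k R} [GradedAlgebra 𝒜] (I : Ideal R)
    (D : Divisor 𝒜) : Prop :=
  ∀ P : PrimeDivisor 𝒜, ∃ m : ℕ, mult I P = m ∧ D P = m

/-- Transport of a prime divisor along an isomorphism of graded rings. -/
def PrimeDivisor.map {k' R' : Type u} [CommRing k'] [CommRing R'] [Algebra k' R']
    {𝒜 : ℕ → Submodule k R} [GradedAlgebra 𝒜] {ℬ : ℕ → Submodule k' R'} [GradedAlgebra ℬ]
    (e : R ≃+* R') (he : ∀ n, ∀ x ∈ 𝒜 n, e x ∈ ℬ n) (P : PrimeDivisor 𝒜) : PrimeDivisor ℬ where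
  point :=
    { asHomogeneousIdeal := ⟨P.ideal.map e, by
        obtain ⟨s, hs⟩ := (Ideal.IsHomogeneous.iff_exists 𝒜 P.ideal).1
          P.point.asHomogeneousIdeal.isHomogeneous
        rw [hs, Ideal.map_span]
        apply Ideal.homogeneous_span
        rintro _ ⟨_, ⟨x, hx, rfl⟩, rfl⟩
        obtain ⟨n, hn⟩ := x.2
        exact ⟨n, he n _ hn⟩⟩
      isPrime := Ideal.map_isPrime_of_equiv e
      not_irrelevant_le := fun h => P.point.not_irrelevant_le <| by
        rw [HomogeneousIdeal.irrelevant_le] at h ⊢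
        intro i hi x hx
        have h1 := h i hi (he i x hx)
        have h2 : e x ∈ P.ideal.map e := h1
        rw [Ideal.mem_map_of_equiv] at h2
        obtain ⟨y, hy, hyx⟩ := h2
        rw [e.injective hyx] at hy
        exact hy }
  height_eq_one := by
    have := RingEquiv.height_map e P.ideal
    rw [P.height_eq_one] at this
    exact this

theorem PrimeDivisor.map_ideal {k' R' : Type u} [CommRing k'] [CommRing R'] [Algebra k' R']
    {𝒜 : ℕ → Submodule k R} [GradedAlgebra 𝒜] {ℬ : ℕ → Submodule k' R'} [GradedAlgebra ℬ]
    (e : R ≃+* R') (he : ∀ n, ∀ x ∈ 𝒜 n, e x ∈ ℬ n) (P : PrimeDivisor 𝒜) :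
    (P.map (ℬ := ℬ) e he).ideal = P.ideal.map e := rfl

theorem length_quotient_of_ringEquiv {A A' : Type u} [CommRing A] [CommRing A'] (e : A ≃+* A')
    (I : Ideal A) (J : Ideal A') (hJ : J = I.map (e : A →+* A')) :
    Module.length A' (A' ⧸ J) = Module.length A (A ⧸ I) := by
  let _ : RingHomInvPair (e : A →+* A') (e.symm : A' →+* A) := RingHomInvPair.of_ringEquiv e
  let _ : RingHomInvPair (e.symm : A' →+* A) (e : A →+* A') :=
    RingHomInvPair.of_ringEquiv e.symm
  let f : (A ⧸ I) ≃ₛₗ[(e : A →+* A')] (A' ⧸ J) :=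
    { Ideal.quotientEquiv I J e hJ with
      map_smul' := fun a x => by
        obtain ⟨x, rfl⟩ := Ideal.Quotient.mk_surjective x
        change Ideal.quotientEquiv I J e hJ (Ideal.Quotient.mk I (a * x)) =
          Ideal.Quotient.mk J (e a) * Ideal.quotientEquiv I J e hJ (Ideal.Quotient.mk I x)
        simp }
  apply WithBot.coe_injective
  rw [Module.coe_length, Module.coe_length]
  exact (Order.krullDim_eq_of_orderIso (Submodule.orderIsoMapComap f)).symm

theorem mult_map {𝒜 : ℕ → Submodule k R} [GradedAlgebra 𝒜] 
    (e : R ≃+* R) (he : ∀ n, ∀ x ∈ 𝒜 n, e x ∈ 𝒜 n) (P : PrimeDivisor 𝒜) (I : Ideal R) :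
    mult (I.map (e : R →+* R)) (P.map (ℬ := 𝒜) e he) = mult I P := by
  have hc : P.ideal = (P.map (ℬ := 𝒜) e he).ideal.comap e := by
    rw [PrimeDivisor.map_ideal, Ideal.comap_map_of_bijective _ e.bijective]
  have := length_quotient_of_ringEquiv
    (Localization.localRingEquiv P.ideal (P.map (ℬ := 𝒜) e he).ideal e hc)
    (I.map (algebraMap R (Localization.AtPrime P.ideal)))
    ((I.map (e : R →+* R)).map (algebraMap R (Localization.AtPrime (P.map (ℬ := 𝒜) e he).ideal)))
    (by
      rw [Ideal.map_map, Ideal.map_map]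
      congr 1
      ext x
      exact (Localization.localRingHom_to_map P.ideal (P.map (ℬ := 𝒜) e he).ideal
        (e : R →+* R) hc x).symm)
  exact this

end PrimeDivisors

section NeronSeveri

variable {k R : Type u} [Field k] [CommRing R] [Algebra k R]

/-- The group of principal divisors: the divisors of the rational functions `f / g` with `f`, `g`
homogeneous of the same degree (and not zero divisors). -/
noncomputable def principalDivisors (𝒜 : ℕ → Submodule k R) [GradedAlgebra 𝒜] : AddSubgroup (Divisor 𝒜) :=
  AddSubgroup.closure {D | ∃ n, ∃ f ∈ 𝒜 n, ∃ g ∈ 𝒜 n,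
    f ∈ nonZeroDivisors R ∧ g ∈ nonZeroDivisors R ∧ ∃ D₁ D₂ : Divisor 𝒜,
      IsDivisorOf (Ideal.span {f}) D₁ ∧ IsDivisorOf (Ideal.span {g}) D₂ ∧ D = D₁ - D₂}

/-- The group of divisors modulo linear equivalence; for a smooth surface this is the Picard
group. -/
abbrev Pic (𝒜 : ℕ → Submodule k R) [GradedAlgebra 𝒜] : Type u :=
  Divisor 𝒜 ⧸ principalDivisors 𝒜

/-- The grading of `B ⊗[k] R`, whose `Proj` is `Proj R × Spec B`, by the degree in `R`. -/
abbrev familyGrading (𝒜 : ℕ → Submodule k R) (B : Type u) [CommRing B] [Algebra k B] :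
    ℕ → Submodule B (B ⊗[k] R) := fun n => (𝒜 n).baseChange B

/-- Restriction to the fibre of `Proj R × Spec B → Spec B` over the `k`-point `t` of `Spec B`:
the map `b ⊗ r ↦ t(b) r`. -/
noncomputable def specialize {B : Type u} [CommRing B] [Algebra k B] (t : B →ₐ[k] k) :
    B ⊗[k] R →ₐ[k] R :=
  Algebra.TensorProduct.lift ((Algebra.ofId k R).comp t) (AlgHom.id k R)
    (fun _ _ => Commute.all _ _)

/-- `D = V(t₀) - V(t₁)` where `V` is a prime divisor of `Proj R × T`, flat over the nonsingular
affine curve `T = Spec B`, where `t₀`, `t₁` are two `k`-points of `T`, and `V(t)` is the divisor of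
the scheme-theoretic fibre of `V` over `t`.  Flatness over the Dedekind domain `B` means that `V`
dominates `T`, i.e. that its ideal meets `B` in zero.  (Two points of a nonsingular curve always lie
in an affine open subset, so it is enough to use affine curves.  The degenerate case in which `B` is
a field only gives `D = 0`.) -/
def IsFamilyDifference {𝒜 : ℕ → Submodule k R} [GradedAlgebra 𝒜] (D : Divisor 𝒜)
    (B : Type u) [CommRing B] [Algebra k B] : Prop :=
  IsDedekindDomain B ∧ Algebra.FiniteType k B ∧
    ∃ V : PrimeDivisor (familyGrading 𝒜 B),
      V.ideal.comap (algebraMap B (B ⊗[k] R)) = ⊥ ∧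
      ∃ (t₀ t₁ : B →ₐ[k] k) (D₀ D₁ : Divisor 𝒜),
        IsDivisorOf (V.ideal.map (specialize t₀ : B ⊗[k] R →ₐ[k] R)) D₀ ∧
        IsDivisorOf (V.ideal.map (specialize t₁ : B ⊗[k] R →ₐ[k] R)) D₁ ∧ D = D₀ - D₁

/-- The group of the divisors that are algebraically equivalent to zero: it is generated by the
differences of two members of a flat family over a nonsingular curve. -/
noncomputable def algebraicallyTrivial (𝒜 : ℕ → Submodule k R) [GradedAlgebra 𝒜] : AddSubgroup (Divisor 𝒜) :=
  AddSubgroup.closure {D | ∃ (B : Type u) (_ : CommRing B) (_ : Algebra k B),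
    IsFamilyDifference D B}

/-- `Pic⁰`: the classes in `Pic` of the divisors algebraically equivalent to zero. -/
noncomputable def picZero (𝒜 : ℕ → Submodule k R) [GradedAlgebra 𝒜] : AddSubgroup (Pic 𝒜) :=
  (algebraicallyTrivial 𝒜).map (QuotientAddGroup.mk' (principalDivisors 𝒜))

/-- The Néron-Severi group `Pic / Pic⁰`. -/
abbrev NS (𝒜 : ℕ → Submodule k R) [GradedAlgebra 𝒜] : Type u := Pic 𝒜 ⧸ picZero 𝒜

end NeronSeveri

section Conjugation

/-- A ring automorphism of the graded `k`-algebra `R` that is semilinear over the field automorphism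
`σ` of `k` and preserves the grading. -/
structure SemiAut {k R : Type u} [Field k] [CommRing R] [Algebra k R]
    (𝒜 : ℕ → Submodule k R) (σ : k ≃+* k) where
  toRingEquiv : R ≃+* R
  map_smul : ∀ (c : k) (x : R), toRingEquiv (c • x) = σ c • toRingEquiv x
  map_mem_iff : ∀ n x, toRingEquiv x ∈ 𝒜 n ↔ x ∈ 𝒜 n

variable {k R : Type u} [Field k] [CommRing R] [Algebra k R]
variable {𝒜 : ℕ → Submodule k R} {σ : k ≃+* k}

/-- The inverse semilinear automorphism. -/
def SemiAut.symm (φ : SemiAut 𝒜 σ) : SemiAut 𝒜 σ.symm where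
  toRingEquiv := φ.toRingEquiv.symm
  map_smul c x := by
    apply φ.toRingEquiv.injective
    simp [φ.map_smul]
  map_mem_iff n x := by
    rw [← φ.map_mem_iff]
    simp

theorem SemiAut.map_mem (φ : SemiAut 𝒜 σ) (n : ℕ) (x : R) (hx : x ∈ 𝒜 n) :
    φ.toRingEquiv x ∈ 𝒜 n := (φ.map_mem_iff n x).2 hx

/-- The ring `B`, with its `k`-algebra structure composed with the inverse of `σ`: the coordinate
ring of the conjugate curve. -/
def Twist (_ : k ≃+* k) (B : Type u) : Type u := B

instance (σ : k ≃+* k) (B : Type u) [CommRing B] : CommRing (Twist σ B) :=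
  inferInstanceAs (CommRing B)

instance (σ : k ≃+* k) (B : Type u) [CommRing B] [Algebra k B] : Algebra k (Twist σ B) :=
  ((algebraMap k B).comp (σ.symm : k →+* k)).toAlgebra

/-- The identity, as a `σ`-semilinear isomorphism from `B` to its twist. -/
def toTwist (σ : k ≃+* k) (B : Type u) [CommRing B] : B ≃+* Twist σ B := RingEquiv.refl B

theorem toTwist_algebraMap (σ : k ≃+* k) (B : Type u) [CommRing B] [Algebra k B] (c : k) :
    toTwist σ B (algebraMap k B c) = algebraMap k (Twist σ B) (σ c) := by
  change algebraMap k B c = algebraMap k B (σ.symm (σ c))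
  simp

theorem toTwist_smul (σ : k ≃+* k) (B : Type u) [CommRing B] [Algebra k B] (c : k) (b : B) :
    toTwist σ B (c • b) = σ c • toTwist σ B b := by
  rw [Algebra.smul_def, Algebra.smul_def, map_mul, toTwist_algebraMap]

/-- The map `ψ ⊗ φ` for two `σ`-semilinear ring homomorphisms. -/
noncomputable def tensorMap {B B' : Type u} [CommRing B] [Algebra k B] [CommRing B'] [Algebra k B']
    (σ : k →+* k) (ψ : B →+* B') (φ : R →+* R) (hψ : ∀ (c : k) b, ψ (c • b) = σ c • ψ b)
    (hφ : ∀ (c : k) x, φ (c • x) = σ c • φ x) : B ⊗[k] R →+* B' ⊗[k] R :=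
  let f : B ⊗[k] R →+ B' ⊗[k] R := TensorProduct.liftAddHom
    (AddMonoidHom.mk' (fun b => AddMonoidHom.mk' (fun x => ψ b ⊗ₜ[k] φ x)
        (fun x y => by rw [map_add, TensorProduct.tmul_add]))
      (fun a b => by
        ext x
        exact (congrArg (fun z => z ⊗ₜ[k] φ x) (map_add ψ a b)).trans
          (TensorProduct.add_tmul _ _ _)))
    (fun c b x => by
      change ψ (c • b) ⊗ₜ[k] φ x = ψ b ⊗ₜ[k] φ (c • x)
      rw [hψ, hφ, TensorProduct.smul_tmul])
  { f with
    map_one' := by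
      change ψ 1 ⊗ₜ[k] φ 1 = 1
      rw [map_one, map_one]; rfl
    map_mul' := fun x y => by
      change f (x * y) = f x * f y
      induction x using TensorProduct.induction_on with
      | zero => simp
      | add x₁ x₂ h₁ h₂ => rw [add_mul, map_add, h₁, h₂, map_add, add_mul]
      | tmul b r =>
        induction y using TensorProduct.induction_on with
        | zero => simp
        | add x₁ x₂ h₁ h₂ => rw [mul_add, map_add, h₁, h₂, map_add, mul_add]
        | tmul b' r' =>
          rw [Algebra.TensorProduct.tmul_mul_tmul]
          change ψ (b * b') ⊗ₜ[k] φ (r * r') = (ψ b ⊗ₜ[k] φ r) * (ψ b' ⊗ₜ[k] φ r')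
          rw [Algebra.TensorProduct.tmul_mul_tmul, map_mul, map_mul] }

theorem tensorMap_tmul {B B' : Type u} [CommRing B] [Algebra k B] [CommRing B'] [Algebra k B']
    (σ : k →+* k) (ψ : B →+* B') (φ : R →+* R) (hψ : ∀ (c : k) b, ψ (c • b) = σ c • ψ b)
    (hφ : ∀ (c : k) x, φ (c • x) = σ c • φ x) (b : B) (x : R) :
    tensorMap σ ψ φ hψ hφ (b ⊗ₜ x) = ψ b ⊗ₜ φ x := rfl

/-- The conjugate of a family of divisors is a family over the conjugate curve. -/
noncomputable def SemiAut.onFamily (φ : SemiAut 𝒜 σ) (B : Type u) [CommRing B] [Algebra k B] :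
    B ⊗[k] R ≃+* Twist σ B ⊗[k] R :=
  RingEquiv.ofRingHom
    (tensorMap (σ : k →+* k) (toTwist σ B : B →+* Twist σ B) (φ.toRingEquiv : R →+* R)
      (fun c b => toTwist_smul σ B c b) (fun c x => φ.map_smul c x))
    (tensorMap (σ.symm : k →+* k) ((toTwist σ B).symm : Twist σ B →+* B)
      (φ.toRingEquiv.symm : R →+* R)
      (fun c b => by
        apply (toTwist σ B).injective
        have := toTwist_smul σ B (σ.symm c) ((toTwist σ B).symm b)
        simp at this
        simp [this])
      (fun c x => φ.symm.map_smul c x))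
    (by
      apply RingHom.ext
      intro x
      induction x using TensorProduct.induction_on with
      | zero => simp
      | add x₁ x₂ h₁ h₂ => rw [map_add, h₁, h₂, map_add]
      | tmul b r =>
        change toTwist σ B ((toTwist σ B).symm b) ⊗ₜ[k] φ.toRingEquiv (φ.toRingEquiv.symm r) = _
        simp)
    (by
      apply RingHom.ext
      intro x
      induction x using TensorProduct.induction_on with
      | zero => simp
      | add x₁ x₂ h₁ h₂ => rw [map_add, h₁, h₂, map_add]
      | tmul b r =>
        change (toTwist σ B).symm (toTwist σ B b) ⊗ₜ[k] φ.toRingEquiv.symm (φ.toRingEquiv r) = _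
        simp)

theorem SemiAut.onFamily_tmul (φ : SemiAut 𝒜 σ) (B : Type u) [CommRing B] [Algebra k B]
    (b : B) (x : R) : φ.onFamily B (b ⊗ₜ x) = toTwist σ B b ⊗ₜ φ.toRingEquiv x := rfl

theorem SemiAut.onFamily_mem (φ : SemiAut 𝒜 σ) (B : Type u) [CommRing B] [Algebra k B]
    (n : ℕ) (x : B ⊗[k] R) (hx : x ∈ familyGrading 𝒜 B n) :
    φ.onFamily B x ∈ familyGrading 𝒜 (Twist σ B) n := by
  change x ∈ (𝒜 n).baseChange B at hx
  rw [Submodule.baseChange_eq_span] at hx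
  induction hx using Submodule.span_induction with
  | mem x h =>
    obtain ⟨y, hy, rfl⟩ := h
    exact Submodule.tmul_mem_baseChange_of_mem _ (φ.map_mem n y hy)
  | zero => rw [map_zero]; exact Submodule.zero_mem _
  | add x y _ _ hx hy => rw [map_add]; exact Submodule.add_mem _ hx hy
  | smul b x _ hx =>
    have : φ.onFamily B (b • x) = toTwist σ B b • φ.onFamily B x := by
      rw [Algebra.smul_def, map_mul, Algebra.smul_def]
      congr 1
      change φ.onFamily B (b ⊗ₜ 1) = toTwist σ B b ⊗ₜ 1
      rw [φ.onFamily_tmul, map_one]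
    rw [this]
    exact Submodule.smul_mem _ _ hx

/-- The conjugate of a `k`-point. -/
noncomputable def twistPoint {B : Type u} [CommRing B] [Algebra k B] (σ : k ≃+* k)
    (t : B →ₐ[k] k) : Twist σ B →ₐ[k] k where
  toRingHom := ((σ : k →+* k).comp (t : B →+* k)).comp ((toTwist σ B).symm : Twist σ B →+* B)
  commutes' c := by
    change σ (t (algebraMap k B (σ.symm c))) = c
    simp

theorem SemiAut.specialize_onFamily (φ : SemiAut 𝒜 σ) {B : Type u} [CommRing B] [Algebra k B]
    (t : B →ₐ[k] k) (x : B ⊗[k] R) :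
    specialize (R := R) (twistPoint σ t) (φ.onFamily B x) =
      φ.toRingEquiv (specialize (R := R) t x) := by
  induction x using TensorProduct.induction_on with
  | zero => simp
  | add x₁ x₂ h₁ h₂ => rw [map_add, map_add, h₁, h₂, map_add, map_add]
  | tmul b r =>
    rw [φ.onFamily_tmul]
    simp only [specialize, Algebra.TensorProduct.lift_tmul, AlgHom.comp_apply, AlgHom.id_apply,
      Algebra.ofId_apply, ← Algebra.smul_def]
    rw [φ.map_smul]
    rfl

theorem SemiAut.map_specialize (φ : SemiAut 𝒜 σ) {B : Type u} [CommRing B] [Algebra k B]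
    (t : B →ₐ[k] k) (I : Ideal (B ⊗[k] R)) :
    (I.map (φ.onFamily B)).map (specialize (R := R) (twistPoint σ t)) =
      (I.map (specialize (R := R) t)).map (φ.toRingEquiv : R →+* R) := by
  have : (I.map ((φ.onFamily B : B ⊗[k] R ≃+* Twist σ B ⊗[k] R) :
        B ⊗[k] R →+* Twist σ B ⊗[k] R)).map
        ((specialize (R := R) (twistPoint σ t)) : Twist σ B ⊗[k] R →+* R) =
      (I.map ((specialize (R := R) t) : B ⊗[k] R →+* R)).map (φ.toRingEquiv : R →+* R) := by
    rw [Ideal.map_map, Ideal.map_map]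
    congr 1
    exact RingHom.ext (φ.specialize_onFamily t)
  exact this

namespace SemiAut

variable [GradedAlgebra 𝒜] (φ : SemiAut 𝒜 σ)

/-- The action on prime divisors, `P ↦ φ(P)`. -/
def onPrime (P : PrimeDivisor 𝒜) : PrimeDivisor 𝒜 := P.map φ.toRingEquiv φ.map_mem

theorem onPrime_symm_onPrime (P : PrimeDivisor 𝒜) : φ.symm.onPrime (φ.onPrime P) = P := by
  apply PrimeDivisor.ext_ideal
  change (P.ideal.map φ.toRingEquiv).map φ.toRingEquiv.symm = P.ideal
  exact Ideal.map_of_equiv φ.toRingEquiv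

theorem onPrime_onPrime_symm (P : PrimeDivisor 𝒜) : φ.onPrime (φ.symm.onPrime P) = P := by
  apply PrimeDivisor.ext_ideal
  change (P.ideal.map φ.toRingEquiv.symm).map φ.toRingEquiv = P.ideal
  exact Ideal.map_of_equiv φ.toRingEquiv.symm

/-- The action on divisors. -/
noncomputable def onDivisor : Divisor 𝒜 →+ Divisor 𝒜 :=
  Finsupp.mapDomain.addMonoidHom φ.onPrime

theorem isDivisorOf {I : Ideal R} {D : Divisor 𝒜} (h : IsDivisorOf I D) :
    IsDivisorOf (I.map (φ.toRingEquiv : R →+* R)) (φ.onDivisor D) := by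
  intro P
  obtain ⟨m, h1, h2⟩ := h (φ.symm.onPrime P)
  rw [← φ.onPrime_onPrime_symm P]
  refine ⟨m, ?_, ?_⟩
  · rw [onPrime, mult_map, h1]
  · change Finsupp.mapDomain _ D _ = _
    rw [Finsupp.mapDomain_apply (Function.LeftInverse.injective φ.onPrime_symm_onPrime), h2]

theorem principal_le :
    principalDivisors 𝒜 ≤ (principalDivisors 𝒜).comap φ.onDivisor := by
  conv_lhs => unfold principalDivisors
  rw [AddSubgroup.closure_le]
  rintro _ ⟨n, f, hf, g, hg, hf0, hg0, D₁, D₂, h1, h2, rfl⟩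
  have key : ∀ x ∈ nonZeroDivisors R, φ.toRingEquiv x ∈ nonZeroDivisors R := by
    intro x hx
    rw [← MulEquivClass.map_nonZeroDivisors φ.toRingEquiv]
    exact Submonoid.mem_map_of_mem _ hx
  refine AddSubgroup.subset_closure ⟨n, φ.toRingEquiv f, φ.map_mem n f hf, φ.toRingEquiv g,
    φ.map_mem n g hg, key f hf0, key g hg0, φ.onDivisor D₁, φ.onDivisor D₂, ?_, ?_,
    map_sub _ _ _⟩
  · simpa [Ideal.map_span] using φ.isDivisorOf h1
  · simpa [Ideal.map_span] using φ.isDivisorOf h2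

theorem algebraic_le :
    algebraicallyTrivial 𝒜 ≤ (algebraicallyTrivial 𝒜).comap φ.onDivisor := by
  conv_lhs => unfold algebraicallyTrivial
  rw [AddSubgroup.closure_le]
  rintro _ ⟨B, iB, iA, hB, hfin, V, hV, t₀, t₁, D₀, D₁, h0, h1, rfl⟩
  refine AddSubgroup.subset_closure ⟨Twist σ B, inferInstance, inferInstance, hB, ?_,
    V.map (φ.onFamily B) (φ.onFamily_mem B), ?_, twistPoint σ t₀, twistPoint σ t₁,
    φ.onDivisor D₀, φ.onDivisor D₁, ?_, ?_, map_sub _ _ _⟩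
  · have h : (algebraMap k B).FiniteType := RingHom.finiteType_algebraMap.2 hfin
    exact RingHom.finiteType_algebraMap.1 <| h.comp (RingHom.FiniteType.of_surjective (σ.symm : k →+* k) σ.symm.surjective)
  · rw [eq_bot_iff]
    intro b hb
    have hb' : toTwist σ B ((toTwist σ B).symm b) ⊗ₜ[k] (1 : R) ∈ V.ideal.map (φ.onFamily B) := hb
    have : φ.onFamily B ((toTwist σ B).symm b ⊗ₜ[k] (1 : R)) ∈ V.ideal.map (φ.onFamily B) := by
      rw [φ.onFamily_tmul, map_one]; exact hb'
    rw [Ideal.mem_map_of_equiv] at this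
    obtain ⟨y, hy, hyx⟩ := this
    rw [(φ.onFamily B).injective hyx] at hy
    have h3 : (toTwist σ B).symm b ∈ V.ideal.comap (algebraMap B (B ⊗[k] R)) := hy
    rw [hV] at h3
    exact h3
  all_goals
    rw [PrimeDivisor.map_ideal]
  · have := φ.isDivisorOf h0
    convert this using 1
    exact φ.map_specialize t₀ _
  · have := φ.isDivisorOf h1
    convert this using 1
    exact φ.map_specialize t₁ _

/-- The action on divisor classes modulo linear equivalence. -/
noncomputable def onPic : Pic 𝒜 →+ Pic 𝒜 :=
  QuotientAddGroup.map _ _ φ.onDivisor φ.principal_le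

theorem picZero_le : picZero 𝒜 ≤ (picZero 𝒜).comap φ.onPic := by
  rintro _ ⟨D, hD, rfl⟩
  exact ⟨φ.onDivisor D, φ.algebraic_le hD, rfl⟩

/-- The action on the Néron-Severi group. -/
noncomputable def onNS : NS 𝒜 →+ NS 𝒜 :=
  QuotientAddGroup.map _ _ φ.onPic φ.picZero_le

end SemiAut

end Conjugation

section Action

variable {k R : Type u} [Field k] [CommRing R] [Algebra k R]

/-- An action of `G` on the graded `k`-algebra `R` by graded ring automorphisms that are semilinear
over a given action of `G` on the field `k`. -/
structure SemiAction (G : Type u) [Group G] [MulSemiringAction G k]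
    (𝒜 : ℕ → Submodule k R) where
  act : G →* (R ≃+* R)
  act_smul : ∀ (g : G) (c : k) (x : R), act g (c • x) = (g • c) • act g x
  act_mem : ∀ (g : G) (n : ℕ), ∀ x ∈ 𝒜 n, act g x ∈ 𝒜 n

variable {G : Type u} [Group G] [MulSemiringAction G k] {𝒜 : ℕ → Submodule k R}

/-- The semilinear automorphism given by one element of `G`. -/
def SemiAction.semiAut (α : SemiAction G 𝒜) (g : G) :
    SemiAut 𝒜 (MulSemiringAction.toRingEquiv G k g) where
  toRingEquiv := α.act g
  map_smul := α.act_smul g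
  map_mem_iff n x := by
    refine ⟨fun h => ?_, α.act_mem g n x⟩
    have := α.act_mem g⁻¹ n _ h
    have h2 : α.act g⁻¹ (α.act g x) = (α.act g⁻¹ * α.act g) x := rfl
    rw [h2, ← map_mul, inv_mul_cancel, map_one] at this
    exact this

theorem SemiAction.onPrime_one [GradedAlgebra 𝒜] (α : SemiAction G 𝒜) (P : PrimeDivisor 𝒜) :
    (α.semiAut 1).onPrime P = P := by
  apply PrimeDivisor.ext_ideal
  change P.ideal.map (α.act 1 : R →+* R) = P.ideal
  rw [map_one]
  exact Ideal.map_id _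

theorem SemiAction.onPrime_mul [GradedAlgebra 𝒜] (α : SemiAction G 𝒜) (g h : G)
    (P : PrimeDivisor 𝒜) :
    (α.semiAut (g * h)).onPrime P = (α.semiAut g).onPrime ((α.semiAut h).onPrime P) := by
  apply PrimeDivisor.ext_ideal
  change P.ideal.map (α.act (g * h) : R →+* R) =
    (P.ideal.map (α.act h : R →+* R)).map (α.act g : R →+* R)
  rw [Ideal.map_map, map_mul]
  rfl

theorem SemiAction.onNS_mk [GradedAlgebra 𝒜] (α : SemiAction G 𝒜) (g : G)
    (D : Divisor 𝒜) :
    (α.semiAut g).onNS (QuotientAddGroup.mk (QuotientAddGroup.mk D)) =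
      QuotientAddGroup.mk (QuotientAddGroup.mk ((α.semiAut g).onDivisor D)) := rfl

/-- The representation of `G` on `ℚ ⊗ NS`: the class of `D` is sent to the class of `g(D)`. -/
noncomputable def SemiAction.nsRep [GradedAlgebra 𝒜] (α : SemiAction G 𝒜) :
    Representation ℚ G (ℚ ⊗[ℤ] NS 𝒜) where
  toFun g := ((α.semiAut g).onNS.toIntLinearMap).baseChange ℚ
  map_one' := by
    rw [Module.End.one_eq_id, ← LinearMap.baseChange_id]
    congr 1
    apply LinearMap.ext
    intro x
    obtain ⟨x, rfl⟩ := QuotientAddGroup.mk_surjective x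
    obtain ⟨D, rfl⟩ := QuotientAddGroup.mk_surjective x
    change (QuotientAddGroup.mk (QuotientAddGroup.mk ((α.semiAut 1).onDivisor D)) : NS 𝒜) = _
    rw [show (α.semiAut 1).onDivisor D = D from ?_]
    · rfl
    · change Finsupp.mapDomain _ D = D
      rw [show (α.semiAut 1).onPrime = id from funext α.onPrime_one, Finsupp.mapDomain_id]
  map_mul' g h := by
    rw [Module.End.mul_eq_comp, ← LinearMap.baseChange_comp]
    congr 1
    apply LinearMap.ext
    intro x
    obtain ⟨x, rfl⟩ := QuotientAddGroup.mk_surjective x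
    obtain ⟨D, rfl⟩ := QuotientAddGroup.mk_surjective x
    change (QuotientAddGroup.mk (QuotientAddGroup.mk ((α.semiAut (g * h)).onDivisor D)) : NS 𝒜) =
      QuotientAddGroup.mk (QuotientAddGroup.mk
        ((α.semiAut g).onDivisor ((α.semiAut h).onDivisor D)))
    congr 2
    change Finsupp.mapDomain _ D = Finsupp.mapDomain _ (Finsupp.mapDomain _ D)
    rw [← Finsupp.mapDomain_comp]
    congr 1
    exact funext (α.onPrime_mul g h)

end Action

end ProjDiv

namespace GradedHelp
open DirectSum

variable {k A : Type u} [CommRing k] [CommRing A] [Algebra k A]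


/-- The grading induced on the quotient by an ideal. -/
def quotientGrading (𝒜 : ℕ → Submodule k A) (I : Ideal A) : ℕ → Submodule k (A ⧸ I) :=
  fun n => (𝒜 n).map (Ideal.Quotient.mkₐ k I).toLinearMap

theorem quotientGrading_isInternal (𝒜 : ℕ → Submodule k A) [GradedAlgebra 𝒜] (I : Ideal A)
    (hI : I.IsHomogeneous 𝒜) : DirectSum.IsInternal (quotientGrading 𝒜 I) := by
  classical
  constructor
  · rw [injective_iff_map_eq_zero]
    intro d hd
    have hl : ∀ n, ∃ s ∈ 𝒜 n, Ideal.Quotient.mk I s = (d n : A ⧸ I) := fun n => (d n).2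
    choose s hs hsd using hl
    rw [DirectSum.coeAddMonoidHom_eq_dfinsuppSum] at hd
    have h1 : Ideal.Quotient.mk I (∑ n ∈ DFinsupp.support d, s n) = 0 := by
      rw [map_sum, Finset.sum_congr rfl (fun n _ => hsd n)]
      exact hd
    rw [Ideal.Quotient.eq_zero_iff_mem] at h1
    ext n
    change (d n : A ⧸ I) = 0
    by_cases hn : n ∈ DFinsupp.support d
    · have h2 := hI n h1
      rw [DirectSum.decompose_sum, DFinsupp.finsetSum_apply, AddSubmonoidClass.coe_finsetSum,
        Finset.sum_eq_single n] at h2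
      · rw [DirectSum.decompose_of_mem_same _ (hs n)] at h2
        rw [← hsd n, Ideal.Quotient.eq_zero_iff_mem.2 h2]
      · intro m _ hm
        exact DirectSum.decompose_of_mem_ne _ (hs m) hm
      · exact fun h => absurd hn h
    · rw [DFinsupp.notMem_support_iff.1 hn]; rfl
  · intro x
    obtain ⟨x, rfl⟩ := Ideal.Quotient.mk_surjective x
    refine ⟨∑ n ∈ DFinsupp.support (decompose 𝒜 x), DirectSum.of
      (fun n => quotientGrading 𝒜 I n) n ⟨Ideal.Quotient.mk I (decompose 𝒜 x n), _, 
        (decompose 𝒜 x n).2, rfl⟩, ?_⟩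
    rw [map_sum]
    simp only [DirectSum.coeAddMonoidHom_of]
    rw [← map_sum, DirectSum.sum_support_decompose]

theorem quotientGrading_gradedMonoid (𝒜 : ℕ → Submodule k A) [GradedAlgebra 𝒜] (I : Ideal A) :
    SetLike.GradedMonoid (quotientGrading 𝒜 I) where
  one_mem := ⟨1, SetLike.one_mem_graded 𝒜, rfl⟩
  mul_mem := by
    rintro i j _ _ ⟨x, hx, rfl⟩ ⟨y, hy, rfl⟩
    exact ⟨x * y, SetLike.mul_mem_graded hx hy, rfl⟩

/-- The quotient by a homogeneous ideal is a graded algebra. -/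
noncomputable abbrev quotientGradedAlgebra (𝒜 : ℕ → Submodule k A) [GradedAlgebra 𝒜] (I : Ideal A)
    (hI : I.IsHomogeneous 𝒜) : GradedAlgebra (quotientGrading 𝒜 I) :=
  { quotientGrading_gradedMonoid 𝒜 I, (quotientGrading_isInternal 𝒜 I hI).chooseDecomposition with }

/-- The subalgebra of the elements fixed by `τ`. -/
abbrev invariants (τ : A →ₐ[k] A) : Subalgebra k A := AlgHom.equalizer τ (AlgHom.id k A)

/-- The grading induced on the subalgebra of invariants. -/
def invariantGrading (𝒜 : ℕ → Submodule k A) (τ : A →ₐ[k] A) : ℕ → Submodule k (invariants τ) :=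
  fun n => (𝒜 n).comap (invariants τ).val.toLinearMap

theorem invariantGrading_isInternal (𝒜 : ℕ → Submodule k A) [GradedAlgebra 𝒜] (τ : A →ₐ[k] A)
    (hτ : ∀ n, ∀ x ∈ 𝒜 n, τ x ∈ 𝒜 n) : DirectSum.IsInternal (invariantGrading 𝒜 τ) := by
  classical
  have hdec : ∀ x n, (decompose 𝒜 (τ x) n : A) = τ (decompose 𝒜 x n) := by
    intro x n
    conv_lhs => rw [← DirectSum.sum_support_decompose 𝒜 x, map_sum]
    rw [DirectSum.decompose_sum, DFinsupp.finsetSum_apply, AddSubmonoidClass.coe_finsetSum,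
        Finset.sum_eq_single n]
    · rw [DirectSum.decompose_of_mem_same _ (hτ n _ (decompose 𝒜 x n).2)]
    · intro m _ hm
      exact DirectSum.decompose_of_mem_ne _ (hτ m _ (decompose 𝒜 x m).2) hm
    · intro h
      rw [DFinsupp.notMem_support_iff.1 h]
      simp
  constructor
  · rw [injective_iff_map_eq_zero]
    intro d hd
    rw [DirectSum.coeAddMonoidHom_eq_dfinsuppSum] at hd
    have h1 : ∑ n ∈ DFinsupp.support d, ((d n : invariants τ) : A) = 0 := by
      have := congrArg (invariants τ).val hd
      rw [map_zero] at this
      rw [← this]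
      exact (map_sum (invariants τ).val _ _).symm
    ext n
    change ((d n : invariants τ) : A) = 0
    by_cases hn : n ∈ DFinsupp.support d
    · have h2 : (decompose 𝒜 (∑ n ∈ DFinsupp.support d, ((d n : invariants τ) : A)) n : A) = 0 := by
        rw [h1]; simp
      rw [DirectSum.decompose_sum, DFinsupp.finsetSum_apply, AddSubmonoidClass.coe_finsetSum,
        Finset.sum_eq_single n] at h2
      · have h3 := DirectSum.decompose_of_mem_same 𝒜 (x := ((d n : invariants τ) : A)) (d n).2
        rwa [h3] at h2
      · intro m _ hm
        exact DirectSum.decompose_of_mem_ne 𝒜 (d m).2 hm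
      · exact fun h => absurd hn h
    · rw [DFinsupp.notMem_support_iff.1 hn]; rfl
  · intro x
    have hx : τ (x : A) = x := x.2
    have hmem : ∀ n, (decompose 𝒜 (x : A) n : A) ∈ invariants τ := by
      intro n
      change τ _ = _
      rw [← hdec, hx]; rfl
    refine ⟨∑ n ∈ DFinsupp.support (decompose 𝒜 (x : A)), DirectSum.of
      (fun n => invariantGrading 𝒜 τ n) n ⟨⟨decompose 𝒜 (x : A) n, hmem n⟩,
        (decompose 𝒜 (x : A) n).2⟩, ?_⟩
    rw [map_sum]
    simp only [DirectSum.coeAddMonoidHom_of]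
    apply Subtype.ext
    rw [AddSubmonoidClass.coe_finsetSum]
    exact DirectSum.sum_support_decompose 𝒜 (x : A)

theorem invariantGrading_gradedMonoid (𝒜 : ℕ → Submodule k A) [GradedAlgebra 𝒜] (τ : A →ₐ[k] A) :
    SetLike.GradedMonoid (invariantGrading 𝒜 τ) where
  one_mem := SetLike.one_mem_graded 𝒜
  mul_mem := by
    intro i j x y hx hy
    exact SetLike.mul_mem_graded (A := 𝒜) hx hy

/-- The invariants of a graded endomorphism form a graded algebra. -/
noncomputable abbrev invariantGradedAlgebra (𝒜 : ℕ → Submodule k A) [GradedAlgebra 𝒜] (τ : A →ₐ[k] A)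
    (hτ : ∀ n, ∀ x ∈ 𝒜 n, τ x ∈ 𝒜 n) : GradedAlgebra (invariantGrading 𝒜 τ) :=
  { invariantGrading_gradedMonoid 𝒜 τ,
    (invariantGrading_isInternal 𝒜 τ hτ).chooseDecomposition with }
end GradedHelp

namespace Dwork
open MvPolynomial GradedHelp

section Surface

attribute [local instance] MvPolynomial.gradedAlgebra

variable (K : Type u) [Field K]

/-- The Dwork quartic `X₀⁴ + X₁⁴ + X₂⁴ + X₃⁴ - 4 c X₀ X₁ X₂ X₃`. -/
noncomputable def poly (c : K) : MvPolynomial (Fin 4) K :=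
  X 0 ^ 4 + X 1 ^ 4 + X 2 ^ 4 + X 3 ^ 4 - C (4 * c) * X 0 * X 1 * X 2 * X 3

theorem poly_homogeneous (c : K) : (poly K c).IsHomogeneous 4 := by
  unfold poly
  refine IsHomogeneous.sub (((IsHomogeneous.add ?_ ?_).add ?_).add ?_) ?_
  iterate 4 exact isHomogeneous_X_pow _ _
  exact ((((isHomogeneous_C _ (4 * c)).mul (isHomogeneous_X _ 0)).mul
    (isHomogeneous_X _ 1)).mul (isHomogeneous_X _ 2)).mul (isHomogeneous_X _ 3)

/-- The homogeneous coordinate ring of the Dwork surface `X_c ⊂ P³` over `K`. -/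
abbrev CoordRing (c : K) : Type u := MvPolynomial (Fin 4) K ⧸ Ideal.span {poly K c}

/-- The grading of the homogeneous coordinate ring by the degree. -/
noncomputable abbrev grading (c : K) : ℕ → Submodule K (CoordRing K c) :=
  quotientGrading (homogeneousSubmodule (Fin 4) K) (Ideal.span {poly K c})

noncomputable instance (c : K) : GradedAlgebra (grading K c) :=
  quotientGradedAlgebra _ _ (Ideal.homogeneous_span _ _ (by
    rintro _ rfl
    exact ⟨4, poly_homogeneous K c⟩))

theorem rename_swap_poly (c : K) : rename (Equiv.swap (0 : Fin 4) 1) (poly K c) = poly K c := by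
  have h2 : Equiv.swap (0 : Fin 4) 1 2 = 2 := by decide
  have h3 : Equiv.swap (0 : Fin 4) 1 3 = 3 := by decide
  simp only [poly, map_add, map_sub, map_mul, map_pow, rename_X, rename_C, Equiv.swap_apply_left,
    Equiv.swap_apply_right, h2, h3]
  ring

/-- The involution `τ` of `X_c` that swaps `X₀` and `X₁`, on the coordinate ring. -/
noncomputable def swap (c : K) : CoordRing K c →ₐ[K] CoordRing K c :=
  Ideal.quotientMapₐ (Ideal.span {poly K c}) (rename (Equiv.swap (0 : Fin 4) 1)) (by
    rw [Ideal.span_singleton_le_iff_mem, Ideal.mem_comap, rename_swap_poly]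
    exact Ideal.mem_span_singleton_self _)

theorem swap_mem (c : K) (n : ℕ) (x : CoordRing K c) (hx : x ∈ grading K c n) :
    swap K c x ∈ grading K c n := by
  obtain ⟨p, hp, rfl⟩ := hx
  exact ⟨rename (Equiv.swap (0 : Fin 4) 1) p, IsHomogeneous.rename_isHomogeneous hp, rfl⟩

/-- The ring of `τ`-invariants of the homogeneous coordinate ring of `X_c`.  Its `Proj` is the
quotient surface `S_{1,c} = X_c / ⟨τ⟩`. -/
abbrev QuotRing (c : K) : Type u := invariants (swap K c)

/-- The grading of the ring of invariants by the degree. -/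
noncomputable abbrev quotGrading (c : K) : ℕ → Submodule K (QuotRing K c) :=
  invariantGrading (grading K c) (swap K c)

noncomputable instance (c : K) : GradedAlgebra (quotGrading K c) :=
  invariantGradedAlgebra _ _ (swap_mem K c)

variable {K}

theorem map_poly (σ : K ≃+* K) {c : K} (hc : σ c = c) :
    MvPolynomial.map (σ : K →+* K) (poly K c) = poly K c := by
  simp [poly, hc, map_ofNat]

/-- A field automorphism fixing `c` acts on the coordinate ring through the coefficients. -/
noncomputable def conj (σ : K ≃+* K) {c : K} (hc : σ c = c) : CoordRing K c ≃+* CoordRing K c :=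
  Ideal.quotientEquiv _ _ (MvPolynomial.mapEquiv (Fin 4) σ) (by
    rw [Ideal.map_span, Set.image_singleton]
    congr 2
    exact (map_poly σ hc).symm)

theorem conj_mk (σ : K ≃+* K) {c : K} (hc : σ c = c) (p : MvPolynomial (Fin 4) K) :
    conj σ hc (Ideal.Quotient.mk _ p) = Ideal.Quotient.mk _ (MvPolynomial.map (σ : K →+* K) p) :=
  rfl

theorem swap_conj (σ : K ≃+* K) {c : K} (hc : σ c = c) (x : CoordRing K c) :
    swap K c (conj σ hc x) = conj σ hc (swap K c x) := by
  obtain ⟨p, rfl⟩ := Ideal.Quotient.mk_surjective x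
  change Ideal.Quotient.mk _ (rename (Equiv.swap (0 : Fin 4) 1) (MvPolynomial.map (σ : K →+* K) p)) =
    Ideal.Quotient.mk _ (MvPolynomial.map (σ : K →+* K) (rename (Equiv.swap (0 : Fin 4) 1) p))
  rw [MvPolynomial.map_rename]

/-- The same action on the ring of `τ`-invariants. -/
noncomputable def conjQuot (σ : K ≃+* K) {c : K} (hc : σ c = c) : QuotRing K c ≃+* QuotRing K c where
  toFun x := ⟨conj σ hc x, by
    have hx : swap K c x = x := x.2
    change swap K c _ = conj σ hc x
    rw [swap_conj, hx]⟩
  invFun x := ⟨(conj σ hc).symm x, by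
    have hx : swap K c x = x := x.2
    change swap K c _ = (conj σ hc).symm x
    apply (conj σ hc).injective
    rw [← swap_conj, RingEquiv.apply_symm_apply, hx]⟩
  left_inv x := Subtype.ext ((conj σ hc).symm_apply_apply x)
  right_inv x := Subtype.ext ((conj σ hc).apply_symm_apply x)
  map_mul' x y := Subtype.ext (map_mul (conj σ hc) (x : CoordRing K c) y)
  map_add' x y := Subtype.ext (map_add (conj σ hc) (x : CoordRing K c) y)

theorem conj_mem (σ : K ≃+* K) {c : K} (hc : σ c = c) (n : ℕ) (x : CoordRing K c)
    (hx : x ∈ grading K c n) : conj σ hc x ∈ grading K c n := by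
  obtain ⟨p, hp, rfl⟩ := hx
  exact ⟨MvPolynomial.map (σ : K →+* K) p, IsHomogeneous.map hp _, rfl⟩

theorem conj_smul (σ : K ≃+* K) {c : K} (hc : σ c = c) (a : K) (x : CoordRing K c) :
    conj σ hc (a • x) = σ a • conj σ hc x := by
  obtain ⟨p, rfl⟩ := Ideal.Quotient.mk_surjective x
  change Ideal.Quotient.mk _ (MvPolynomial.map (σ : K →+* K) (a • p)) =
    Ideal.Quotient.mk _ (σ a • MvPolynomial.map (σ : K →+* K) p)
  rw [MvPolynomial.smul_eq_C_mul, MvPolynomial.smul_eq_C_mul, map_mul, MvPolynomial.map_C]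
  rfl

end Surface

section Galois

variable (F : Type u) [Field F]

/-- The parameter, as an element of the algebraic closure. -/
noncomputable abbrev param (lam : F) : AlgebraicClosure F := algebraMap F (AlgebraicClosure F) lam

/-- The absolute Galois group of `F` acts on the homogeneous coordinate ring of the base change of
`S_{1,lam} = X_lam / ⟨τ⟩` to the algebraic closure, through the coefficients. -/
noncomputable def galoisAction (lam : F) :
    ProjDiv.SemiAction (AlgebraicClosure F ≃ₐ[F] AlgebraicClosure F)
      (quotGrading (AlgebraicClosure F) (param F lam)) where
  act :=
    { toFun := fun σ => conjQuot (σ : AlgebraicClosure F ≃+* AlgebraicClosure F) (σ.commutes lam)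
      map_one' := by
        apply RingEquiv.ext
        intro x
        apply Subtype.ext
        obtain ⟨p, hp⟩ := Ideal.Quotient.mk_surjective (x : CoordRing _ (param F lam))
        change conj _ _ (x : CoordRing _ (param F lam)) = x
        rw [← hp, conj_mk]
        congr 1
        exact MvPolynomial.map_id p
      map_mul' := fun σ τ => by
        apply RingEquiv.ext
        intro x
        apply Subtype.ext
        obtain ⟨p, hp⟩ := Ideal.Quotient.mk_surjective (x : CoordRing _ (param F lam))
        change conj _ _ (x : CoordRing _ (param F lam)) = conj _ _ (conj _ _ x.1)
        rw [← hp, conj_mk, conj_mk, conj_mk, MvPolynomial.map_map]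
        rfl }
  act_smul σ a x := Subtype.ext (conj_smul _ _ a (x : CoordRing _ (param F lam)))
  act_mem σ n x hx := conj_mem _ (σ.commutes lam) n (x : CoordRing _ (param F lam)) hx

/-- The geometric Néron-Severi group of `S_{1,lam}`. -/
abbrev geomNS (lam : F) : Type u := ProjDiv.NS (quotGrading (AlgebraicClosure F) (param F lam))

/-- The Galois representation on `ℚ ⊗ NS` of the base change of `S_{1,lam}` to the algebraic
closure of `F`. -/
noncomputable def nsRep (lam : F) :
    Representation ℚ (AlgebraicClosure F ≃ₐ[F] AlgebraicClosure F) (ℚ ⊗[ℤ] geomNS F lam) :=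
  (galoisAction F lam).nsRep

end Galois

end Dwork

section Characters

variable {F : Type u} [Field F]

open Classical in
/-- The quadratic character of the absolute Galois group of `F` attached to `F(√a) / F`: it is `1`
on the elements that fix the square roots of `a`, and `-1` on the other ones. -/
noncomputable def quadraticCharacter (a : F) :
    (AlgebraicClosure F ≃ₐ[F] AlgebraicClosure F) →* ℤˣ where
  toFun σ := if ∀ x : AlgebraicClosure F, x ^ 2 = algebraMap F (AlgebraicClosure F) a → σ x = x
    then 1 else -1
  map_one' := if_pos fun _ _ => rfl
  map_mul' σ τ := by
    obtain ⟨s, hs⟩ := IsAlgClosed.exists_pow_nat_eq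
      (algebraMap F (AlgebraicClosure F) a) (n := 2) (by norm_num)
    have key : ∀ g : AlgebraicClosure F ≃ₐ[F] AlgebraicClosure F,
        (∀ x : AlgebraicClosure F, x ^ 2 = algebraMap F (AlgebraicClosure F) a → g x = x) ↔
          g s = s := by
      refine fun g => ⟨fun h => h s hs, fun h x hx => ?_⟩
      rcases sq_eq_sq_iff_eq_or_eq_neg.1 (hx.trans hs.symm) with rfl | rfl
      · exact h
      · rw [map_neg, h]
    have sgn : ∀ g : AlgebraicClosure F ≃ₐ[F] AlgebraicClosure F, g s = s ∨ g s = -s := by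
      intro g
      apply sq_eq_sq_iff_eq_or_eq_neg.1
      rw [← map_pow, hs, AlgEquiv.commutes]
    rw [if_congr (key (σ * τ)) rfl rfl, if_congr (key σ) rfl rfl, if_congr (key τ) rfl rfl,
      AlgEquiv.mul_apply]
    by_cases h0 : -s = s
    · have h1 : ∀ g : AlgebraicClosure F ≃ₐ[F] AlgebraicClosure F, g s = s := fun g =>
        (sgn g).elim id fun h => h.trans h0
      simp [h1]
    · rcases sgn σ with h1 | h1 <;> rcases sgn τ with h2 | h2 <;> simp [h1, h2, h0]

/-- The direct sum of the one-dimensional rational representations given by a family of characters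
with values `1` and `-1`. -/
def characterSum {G ι : Type*} [Group G] (χ : ι → G →* ℤˣ) : Representation ℚ G (ι → ℚ) where
  toFun g := LinearMap.pi fun i => (((χ i g : ℤˣ) : ℤ) : ℚ) • LinearMap.proj i
  map_one' := by
    apply LinearMap.ext
    intro v
    funext i
    simp
  map_mul' g h := by
    apply LinearMap.ext
    intro v
    funext i
    simp [mul_assoc]

end Characters

/-! The invariants of τ are generated by s = X₀ + X₁, u = X₂, v = X₃ and w = X₀X₁ - s² - λuv. They
satisfy 2w² = A² - Q with A = s² + 2λuv and Q = u⁴ + 2λ²u²v² + v⁴. The surface is thus a double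
plane, and a linear form on which A² - Q becomes twice a square cuts out two lines exchanged by w ↦
-w. Three families of four such forms suffice for the theorem: u = bv with b⁴ + 2λ²b² + 1 = 0, then
s = yu - y³λv with y⁴ = 1, and the same with u and v exchanged. Their lines are defined over the
field generated by al = √(1 - λ²), be = √(-1 - λ²), r = √2 and i, and the Galois group acts on these
constants by signs.

Geometry enters through a conic bundle. Write Q as a product ℓ₁ℓ₂ℓ₃ℓ₄ of forms u - bv. Since (A -
rw)(A + rw) = Q, the function (A - rw)/(ℓ₁ℓ₂) is a map to P¹; its six singular fibres are pairs of
lines from the three families. One line over a further form s = k(u + v) is a section, and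
projecting each conic from it parametrizes the complement of the singular fibres and of the two
lines over s = k(u + v). The coordinate ring Λ (`ConicData.Ring`) of that complement is a
localization of a polynomial ring K[τ, ξ] at six explicit primes. Three facts follow. (1) Λ is
factorial, so every divisor is linearly equivalent to one supported on the boundary lines
(`eq_top_of_forall_cl_single_mem`). (2) The units of Λ are known, so a principal divisor supported
on the boundary comes from an explicit monomial. Comparing orders and degrees shows that eight
chosen boundary curves are independent (`eight_le_finrank`). (3) Λ stays factorial after base change
to a principal ideal domain, in particular over the semilocal ring of two points of a curve. A
family of divisors then has one equation up to a constant boundary term, so algebraically equivalent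
divisors are linearly equivalent and Pic⁰ vanishes (`IsChartCover.algebraicallyTrivial_le`).

Whenever a quadratic form θ and its conjugate θ' multiply to a constant times four of the linear
forms, θ vanishes on one line over each of them, and the differences "line minus conjugate line"
chosen in this way add up to zero (`lineClass_sum`). Five such relations cut the twelve differences
down to seven independent directions. With the hyperplane class they give eight vectors that span NS
⊗ ℚ (`span_eigenvector`), hence form a basis by (2). Each of them is an eigenvector of the Galois
group, with a product of the signs on al, be, r, i as its eigenvalue (`nsRep_eigenvector`). -/

set_option linter.unusedSectionVars false

namespace ProjDiv

/-! ### Orders of vanishing along primes with a local generator -/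

section Order

variable {R : Type u} [CommRing R] [IsDomain R]

/-- The order of vanishing along a prime ideal. -/
noncomputable def ordAt (P : Ideal R) [P.IsPrime] (f : R) : ℕ∞ :=
  Ring.ord (Localization.AtPrime P) (algebraMap R (Localization.AtPrime P) f)

/-- `c` generates the prime `P` locally at `P`. -/
structure IsUniformizer (P : Ideal R) (c : R) : Prop where
  mem : c ∈ P
  ne_zero : c ≠ 0
  exists_mul : ∀ x ∈ P, ∃ g ∉ P, ∃ y, g * x = c * y

variable {P : Ideal R} {c : R}

/-- Krull's principal ideal theorem: `P` is minimal over `c`, because a smaller prime containing `c`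
contains `g * x = c * y` but not `g`, hence contains every `x ∈ P`. -/
theorem IsUniformizer.height_eq_one [IsNoetherianRing R] [hP : P.IsPrime]
    (h : IsUniformizer P c) : P.height = 1 := by
  apply le_antisymm
  · apply Ideal.height_le_one_of_isPrincipal_of_mem_minimalPrimes (Ideal.span {c})
    refine ⟨⟨hP, (Ideal.span_singleton_le_iff_mem _).2 h.mem⟩, ?_⟩
    rintro Q ⟨hQ, hcQ⟩ hQP x hx
    obtain ⟨g, hg, y, hy⟩ := h.exists_mul x hx
    have : g * x ∈ Q := by
      rw [hy]
      exact Q.mul_mem_right _ (hcQ (Ideal.mem_span_singleton_self c))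
    exact (hQ.mem_or_mem this).resolve_left fun h' => hg (hQP h')
  · rw [Order.one_le_iff_pos, pos_iff_ne_zero, Ne, Ideal.height_eq_zero_iff_eq_bot]
    intro h0
    exact h.ne_zero (by simpa [h0] using h.mem)

theorem IsUniformizer.maximalIdeal_eq [P.IsPrime] (h : IsUniformizer P c) :
    IsLocalRing.maximalIdeal (Localization.AtPrime P) =
      Ideal.span {algebraMap R (Localization.AtPrime P) c} := by
  rw [← Localization.AtPrime.map_eq_maximalIdeal]
  apply le_antisymm
  · rw [Ideal.map_le_iff_le_comap]
    intro x hx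
    obtain ⟨g, hg, y, hy⟩ := h.exists_mul x hx
    rw [Ideal.mem_comap, Ideal.mem_span_singleton]
    have hu : IsUnit (algebraMap R (Localization.AtPrime P) g) :=
      IsLocalization.map_units (M := P.primeCompl) _ ⟨g, hg⟩
    rw [← hu.dvd_mul_left, ← map_mul, hy, map_mul]
    exact dvd_mul_right _ _
  · rw [Ideal.span_singleton_le_iff_mem]
    exact Ideal.mem_map_of_mem _ h.mem

/-- The localization is a Noetherian local domain whose maximal ideal is nonzero and principal. All
regularity in codimension one is obtained this way, by exhibiting local generators. -/
theorem IsUniformizer.isDiscreteValuationRing [IsNoetherianRing R] [P.IsPrime]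
    (h : IsUniformizer P c) : IsDiscreteValuationRing (Localization.AtPrime P) := by
  have hinj : Function.Injective (algebraMap R (Localization.AtPrime P)) :=
    IsLocalization.injective _ P.primeCompl_le_nonZeroDivisors
  have hne : IsLocalRing.maximalIdeal (Localization.AtPrime P) ≠ ⊥ := by
    rw [h.maximalIdeal_eq, Ne, Ideal.span_singleton_eq_bot]
    exact fun h0 => h.ne_zero (hinj (h0.trans (map_zero _).symm))
  have : IsNoetherianRing (Localization.AtPrime P) :=
    IsLocalization.isNoetherianRing P.primeCompl _ inferInstance
  refine ((IsDiscreteValuationRing.TFAE (Localization.AtPrime P)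
    (IsLocalRing.isField_iff_maximalIdeal_eq.not.2 hne)).out 0 4).2 ?_
  exact ⟨⟨_, h.maximalIdeal_eq⟩⟩

variable [P.IsPrime]

theorem isUnit_localization_iff {f : R} :
    IsUnit (algebraMap R (Localization.AtPrime P) f) ↔ f ∉ P :=
  IsLocalization.AtPrime.isUnit_to_map_iff (Localization.AtPrime P) P f

section DVR

variable [IsDiscreteValuationRing (Localization.AtPrime P)]

theorem ordAt_mul (f g : R) : ordAt P (f * g) = ordAt P f + ordAt P g := by
  simp [ordAt]

theorem ordAt_pow (f : R) (n : ℕ) : ordAt P (f ^ n) = n • ordAt P f := by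
  simp [ordAt]

theorem ordAt_prod {ι : Type*} (s : Finset ι) (f : ι → R) :
    ordAt P (∏ i ∈ s, f i) = ∑ i ∈ s, ordAt P (f i) := by
  classical
  induction s using Finset.induction_on with
  | empty => simp [ordAt]
  | insert a s ha ih => rw [Finset.prod_insert ha, Finset.sum_insert ha, ordAt_mul, ih]

theorem ordAt_eq_top_iff {f : R} : ordAt P f = ⊤ ↔ f = 0 := by
  rw [ordAt, Ring.ord_eq_addVal, IsDiscreteValuationRing.addVal_eq_top_iff]
  have hinj : Function.Injective (algebraMap R (Localization.AtPrime P)) :=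
    IsLocalization.injective _ P.primeCompl_le_nonZeroDivisors
  exact ⟨fun h => hinj (h.trans (map_zero _).symm), fun h => by rw [h, map_zero]⟩

theorem ordAt_eq_zero_iff {f : R} : ordAt P f = 0 ↔ f ∉ P := by
  rw [← isUnit_localization_iff, ordAt]
  constructor
  · intro h
    have := (Ring.ord_eq_iff_associated (algebraMap R (Localization.AtPrime P) f) 1).1
      (by rw [h, Ring.ord_one])
    exact this.symm.isUnit isUnit_one
  · exact Ring.ord_of_isUnit

theorem IsUniformizer.ordAt_eq_one (h : IsUniformizer P c) : ordAt P c = 1 := by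
  apply Ring.ord_of_irreducible
  rw [IsDiscreteValuationRing.irreducible_iff_uniformizer]
  exact h.maximalIdeal_eq

/-- Any element is locally a power of the uniformizer times a unit. -/
theorem IsUniformizer.exists_eq_pow_mul (h : IsUniformizer P c) {f : R} (hf : f ≠ 0) :
    ∃ m : ℕ, ordAt P f = m ∧ ∃ a ∉ P, ∃ b ∉ P, a * f = c ^ m * b := by
  obtain ⟨m, hm⟩ := ENat.ne_top_iff_exists.1 (mt (ordAt_eq_top_iff (P := P)).1 hf)
  refine ⟨m, hm.symm, ?_⟩
  have hinj : Function.Injective (algebraMap R (Localization.AtPrime P)) :=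
    IsLocalization.injective _ P.primeCompl_le_nonZeroDivisors
  obtain ⟨w, hw⟩ := (Ring.ord_eq_iff_associated (algebraMap R (Localization.AtPrime P) (c ^ m))
    (algebraMap R (Localization.AtPrime P) f)).1 (by
      change ordAt P (c ^ m) = ordAt P f
      rw [ordAt_pow, h.ordAt_eq_one, ← hm]; simp)
  obtain ⟨⟨b, a⟩, hab⟩ := IsLocalization.surj P.primeCompl (w : Localization.AtPrime P)
  refine ⟨a, a.2, b, ?_, ?_⟩
  · rw [← isUnit_localization_iff, ← hab]
    exact w.isUnit.mul (IsLocalization.map_units _ a)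
  · apply hinj
    rw [map_mul, map_mul, ← hw, ← hab]
    ring

theorem ordAt_eq_of_mul_eq {m : ℕ} (h : IsUniformizer P c) {a b f : R} (ha : a ∉ P) (hb : b ∉ P)
    (hf : a * f = c ^ m * b) : ordAt P f = m := by
  have := congrArg (ordAt P) hf
  rw [ordAt_mul, ordAt_mul, ordAt_eq_zero_iff.2 ha, ordAt_eq_zero_iff.2 hb, ordAt_pow,
    h.ordAt_eq_one] at this
  simpa using this

theorem ordAt_toNat {f : R} (hf : f ≠ 0) : ((ordAt P f).toNat : ℕ∞) = ordAt P f :=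
  ENat.natCast_toNat (mt ordAt_eq_top_iff.1 hf)

theorem ordAt_toNat_mul {f g : R} (hf : f ≠ 0) (hg : g ≠ 0) :
    (ordAt P (f * g)).toNat = (ordAt P f).toNat + (ordAt P g).toNat := by
  rw [ordAt_mul, ENat.toNat_add (mt ordAt_eq_top_iff.1 hf) (mt ordAt_eq_top_iff.1 hg)]

end DVR

end Order

/-! ### Divisors of homogeneous elements and principal divisors -/

section Divisors

variable {k R : Type u} [Field k] [CommRing R] [Algebra k R] [IsDomain R]
variable {𝒜 : ℕ → Submodule k R} [GradedAlgebra 𝒜]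

theorem mult_span_singleton (f : R) (P : PrimeDivisor 𝒜) :
    mult (Ideal.span {f}) P = ordAt P.ideal f := by
  rw [mult, Ideal.map_span, Set.image_singleton]
  rfl

theorem eq_of_le_of_height_eq_one {P Q : Ideal R} [hP : P.IsPrime] [hQ : Q.IsPrime]
    (hQ1 : Q.height = 1) (hP0 : P ≠ ⊥) (h : P ≤ Q) : P = Q := by
  by_contra hne
  have hlt : P < Q := lt_of_le_of_ne h hne
  have h1 := Ideal.height_add_one_le_of_lt_of_isPrime hlt
  rw [hQ1] at h1
  have h2 : P.height + 1 ≤ 0 + 1 := by simpa using h1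
  rw [ENat.add_le_add_iff_right ENat.one_ne_top, nonpos_iff_eq_zero,
    Ideal.height_eq_zero_iff_eq_bot] at h2
  exact hP0 h2

theorem PrimeDivisor.eq_of_le (P : PrimeDivisor 𝒜) {Q : Ideal R} [Q.IsPrime] (hQ : Q ≠ ⊥)
    (h : Q ≤ P.ideal) : Q = P.ideal :=
  eq_of_le_of_height_eq_one P.height_eq_one hQ h

variable [IsNoetherianRing R]

/-- A height-one prime containing `f ≠ 0` is minimal over `f`, and a Noetherian ring has finitely
many minimal primes over an ideal. -/
theorem finite_setOf_mem {f : R} (hf : f ≠ 0) : {P : PrimeDivisor 𝒜 | f ∈ P.ideal}.Finite := by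
  apply Set.Finite.of_finite_image (f := PrimeDivisor.ideal)
  · refine (Ideal.finite_minimalPrimes_of_isNoetherianRing R (Ideal.span {f})).subset ?_
    rintro _ ⟨P, hP, rfl⟩
    refine ⟨⟨inferInstance, (Ideal.span_singleton_le_iff_mem _).2 hP⟩, ?_⟩
    rintro Q ⟨hQ, hfQ⟩ hQP
    refine (P.eq_of_le ?_ hQP).ge
    rintro rfl
    exact hf (by simpa using hfQ)
  · exact fun P _ Q _ h => PrimeDivisor.ext_ideal h

variable (hR : ∀ P : PrimeDivisor 𝒜, IsDiscreteValuationRing (Localization.AtPrime P.ideal))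

/-- The divisor of zeros of a nonzero element. -/
noncomputable def divisorOf (f : R) (hf : f ≠ 0) : Divisor 𝒜 :=
  Finsupp.onFinset (finite_setOf_mem (𝒜 := 𝒜) hf).toFinset
    (fun P => ((ordAt P.ideal f).toNat : ℤ)) (by
      intro P hP
      rw [Set.Finite.mem_toFinset]
      by_contra hfP
      have := hR P
      rw [ordAt_eq_zero_iff.2 hfP] at hP
      simp at hP)

theorem divisorOf_apply {f : R} (hf : f ≠ 0) (P : PrimeDivisor 𝒜) :
    divisorOf hR f hf P = ((ordAt P.ideal f).toNat : ℤ) := rfl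

theorem divisorOf_mul {f g : R} (hf : f ≠ 0) (hg : g ≠ 0) :
    divisorOf hR (f * g) (mul_ne_zero hf hg) = divisorOf hR f hf + divisorOf hR g hg := by
  ext P
  have := hR P
  rw [Finsupp.add_apply, divisorOf_apply, divisorOf_apply, divisorOf_apply,
    ordAt_toNat_mul hf hg, Nat.cast_add]

include hR in
theorem isDivisorOf_iff {f : R} (hf : f ≠ 0) (D : Divisor 𝒜) :
    IsDivisorOf (Ideal.span {f}) D ↔ D = divisorOf hR f hf := by
  constructor
  · intro h
    ext P
    have := hR P
    obtain ⟨m, h1, h2⟩ := h P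
    rw [mult_span_singleton] at h1
    rw [divisorOf_apply, h1, h2]
    rfl
  · rintro rfl P
    have := hR P
    exact ⟨_, by rw [mult_span_singleton]; exact (ordAt_toNat hf).symm, divisorOf_apply hR hf P⟩

theorem IsDivisorOf.unique {I : Ideal R} {D D' : Divisor 𝒜} (h : IsDivisorOf I D)
    (h' : IsDivisorOf I D') : D = D' := by
  ext P
  obtain ⟨m, h1, h2⟩ := h P
  obtain ⟨m', h1', h2'⟩ := h' P
  rw [h1] at h1'
  rw [h2, h2', Nat.cast_inj.1 h1']

theorem divisorOf_sub_mem_principal {n : ℕ} {f g : R} (hf : f ≠ 0) (hg : g ≠ 0)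
    (hfn : f ∈ 𝒜 n) (hgn : g ∈ 𝒜 n) :
    divisorOf hR f hf - divisorOf hR g hg ∈ principalDivisors 𝒜 :=
  AddSubgroup.subset_closure ⟨n, f, hfn, g, hgn, mem_nonZeroDivisors_of_ne_zero hf,
    mem_nonZeroDivisors_of_ne_zero hg, _, _, (isDivisorOf_iff hR hf _).2 rfl,
    (isDivisorOf_iff hR hg _).2 rfl, rfl⟩

/-- The generators of the subgroup are already closed under sum and negation, since numerators and
denominators multiply. A principal divisor is therefore the divisor of a single fraction. -/
theorem mem_principalDivisors_iff (D : Divisor 𝒜) :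
    D ∈ principalDivisors 𝒜 ↔ ∃ n, ∃ f ∈ 𝒜 n, ∃ g ∈ 𝒜 n, ∃ (hf : f ≠ 0) (hg : g ≠ 0),
      D = divisorOf hR f hf - divisorOf hR g hg := by
  constructor
  · intro h
    induction h using AddSubgroup.closure_induction with
    | mem D h =>
      obtain ⟨n, f, hf, g, hg, hf0, hg0, D₁, D₂, h1, h2, rfl⟩ := h
      have hf1 := nonZeroDivisors.ne_zero hf0
      have hg1 := nonZeroDivisors.ne_zero hg0
      refine ⟨n, f, hf, g, hg, hf1, hg1, ?_⟩
      rw [(isDivisorOf_iff hR hf1 _).1 h1, (isDivisorOf_iff hR hg1 _).1 h2]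
    | zero =>
      exact ⟨0, 1, SetLike.GradedOne.one_mem, 1, SetLike.GradedOne.one_mem, one_ne_zero,
        one_ne_zero, (sub_self _).symm⟩
    | add D D' _ _ h h' =>
      obtain ⟨n, f, hf, g, hg, hf0, hg0, rfl⟩ := h
      obtain ⟨n', f', hf', g', hg', hf0', hg0', rfl⟩ := h'
      refine ⟨n + n', f * f', SetLike.mul_mem_graded hf hf', g * g', SetLike.mul_mem_graded hg hg',
        mul_ne_zero hf0 hf0', mul_ne_zero hg0 hg0', ?_⟩
      rw [divisorOf_mul hR hf0 hf0', divisorOf_mul hR hg0 hg0']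
      abel
    | neg D _ h =>
      obtain ⟨n, f, hf, g, hg, hf0, hg0, rfl⟩ := h
      exact ⟨n, g, hg, f, hf, hg0, hf0, neg_sub _ _⟩
  · rintro ⟨n, f, hf, g, hg, hf0, hg0, rfl⟩
    exact divisorOf_sub_mem_principal hR hf0 hg0 hf hg

end Divisors

end ProjDiv

namespace ProjDiv

/-! ### Dehomogenization and factorial charts -/

section Dehomogenization

variable {B A Λ : Type*} [CommRing B] [CommRing A] [Algebra B A] [CommRing Λ]

/-- A dehomogenization of a graded ring: a ring homomorphism that is injective on each homogeneous
component and sends some element of degree one to one. -/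
structure Dehomogenization (𝒜 : ℕ → Submodule B A) (Λ : Type*) [CommRing Λ] where
  hom : A →+* Λ
  eq_zero : ∀ n, ∀ x ∈ 𝒜 n, hom x = 0 → x = 0
  unit : A
  unit_mem : unit ∈ 𝒜 1
  hom_unit : hom unit = 1

/-- A submonoid of homogeneous elements whose inversion yields all of `Λ`. -/
structure IsChart {𝒜 : ℕ → Submodule B A} (δ : Dehomogenization 𝒜 Λ) (E : Submonoid A) : Prop where
  unit_mem : δ.unit ∈ E
  homogeneous : ∀ e ∈ E, SetLike.IsHomogeneousElem 𝒜 e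
  exists_eq_mul : ∀ p : Λ, ∃ f, SetLike.IsHomogeneousElem 𝒜 f ∧ ∃ e ∈ E, δ.hom f = p * δ.hom e

variable {𝒜 : ℕ → Submodule B A} [GradedAlgebra 𝒜] (δ : Dehomogenization 𝒜 Λ)

namespace Dehomogenization

/-- A dehomogenization is injective on each degree but forgets degrees. Multiplying by powers of
`δ.unit`, of degree one and sent to 1, brings both elements into the same degree. -/
theorem exists_mul_unit_pow_eq {f g : A} (hf : SetLike.IsHomogeneousElem 𝒜 f)
    (hg : SetLike.IsHomogeneousElem 𝒜 g) (h : δ.hom f = δ.hom g) :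
    ∃ a b : ℕ, f * δ.unit ^ a = g * δ.unit ^ b := by
  obtain ⟨m, hm⟩ := hf
  obtain ⟨n, hn⟩ := hg
  refine ⟨n, m, sub_eq_zero.1 (δ.eq_zero (m + n) _ (Submodule.sub_mem _ ?_ ?_) ?_)⟩
  · simpa using SetLike.mul_mem_graded hm (SetLike.pow_mem_graded n δ.unit_mem)
  · simpa [add_comm] using SetLike.mul_mem_graded hn (SetLike.pow_mem_graded m δ.unit_mem)
  · simp [h, δ.hom_unit]

/-- The homogeneous prime ideal defined by a prime element of the dehomogenized ring. -/
noncomputable def primeOf (p : Λ) : Ideal A :=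
  (((Ideal.span {p}).comap δ.hom).homogeneousCore 𝒜).toIdeal

theorem isHomogeneous_primeOf (p : Λ) : (δ.primeOf p).IsHomogeneous 𝒜 :=
  HomogeneousIdeal.isHomogeneous _

theorem mem_primeOf_iff {p : Λ} {x : A} (hx : SetLike.IsHomogeneousElem 𝒜 x) :
    x ∈ δ.primeOf p ↔ p ∣ δ.hom x := by
  rw [← Ideal.mem_span_singleton]
  exact ⟨fun h => Ideal.toIdeal_homogeneousCore_le 𝒜 _ h,
    fun h => Ideal.mem_homogeneousCore_of_homogeneous_of_mem hx h⟩

theorem isPrime_primeOf [IsDomain Λ] {p : Λ} (hp : p = 0 ∨ Prime p) : (δ.primeOf p).IsPrime := by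
  have : (Ideal.span {p}).IsPrime := by
    rcases hp with rfl | hp
    · rw [Set.singleton_zero, Ideal.span_zero]; exact Ideal.isPrime_bot
    · exact (Ideal.span_singleton_prime hp.ne_zero).2 hp
  exact (Ideal.IsPrime.comap δ.hom).homogeneousCore

theorem le_of_homogeneous {I J : Ideal A} (hI : I.IsHomogeneous 𝒜)
    (h : ∀ x, SetLike.IsHomogeneousElem 𝒜 x → x ∈ I → x ∈ J) : I ≤ J := by
  obtain ⟨s, rfl⟩ := (Ideal.IsHomogeneous.iff_exists 𝒜 I).1 hI
  rw [Ideal.span_le]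
  rintro _ ⟨x, hx, rfl⟩
  exact h x x.2 (Ideal.subset_span ⟨x, hx, rfl⟩)

-- The zero ideal is `primeOf 0`, because only zero dehomogenizes to zero among homogeneous
-- elements, and the homogeneous core of a prime ideal is prime.
include δ in
theorem isDomain [IsDomain Λ] : IsDomain A := by
  have h0 : δ.primeOf 0 = ⊥ := by
    rw [eq_bot_iff]
    refine le_of_homogeneous (𝒜 := 𝒜) (δ.isHomogeneous_primeOf 0) fun x hx hx0 => ?_
    rw [δ.mem_primeOf_iff hx, zero_dvd_iff] at hx0
    obtain ⟨n, hn⟩ := hx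
    exact δ.eq_zero n x hn hx0
  have := δ.isPrime_primeOf (p := 0) (Or.inl rfl)
  rw [h0] at this
  exact IsDomain.of_bot_isPrime A

theorem hom_ne_zero {x : A} (hx : SetLike.IsHomogeneousElem 𝒜 x) (h : x ≠ 0) : δ.hom x ≠ 0 := by
  obtain ⟨n, hn⟩ := hx
  exact fun h0 => h (δ.eq_zero n x hn h0)

end Dehomogenization

open Dehomogenization

variable {δ} {E : Submonoid A}

/-- If `p` divides `δ.hom x`, the quotient is a fraction with denominator in `E`; clearing
denominators makes `x` times an element of `E` a multiple of `f`, and `V` avoids `E`. -/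
theorem IsChart.primeOf_le (hE : IsChart δ E) {V : Ideal A} [hV : V.IsPrime]
    (hEV : ∀ e ∈ E, e ∉ V) {p : Λ} {f e : A} (hf : SetLike.IsHomogeneousElem 𝒜 f) (he : e ∈ E)
    (hfe : δ.hom f = p * δ.hom e) (hfV : f ∈ V) : δ.primeOf p ≤ V := by
  refine le_of_homogeneous (𝒜 := 𝒜) (δ.isHomogeneous_primeOf p) fun x hx hxp => ?_
  rw [δ.mem_primeOf_iff hx] at hxp
  obtain ⟨r, hr⟩ := hxp
  obtain ⟨f', hf', e', he', h'⟩ := hE.exists_eq_mul r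
  obtain ⟨a, b, hab⟩ := δ.exists_mul_unit_pow_eq (f := x * (e' * e)) (g := f * f')
    (hx.mul ((hE.homogeneous _ he').mul (hE.homogeneous _ he))) (hf.mul hf') (by
      simp only [map_mul, hr, hfe, h']; ring)
  have h1 : x * ((e' * e) * δ.unit ^ a) ∈ V := by
    rw [← mul_assoc, hab, mul_assoc]
    exact V.mul_mem_right _ hfV
  exact (hV.mem_or_mem h1).resolve_right
    (hEV _ (E.mul_mem (E.mul_mem he' he) (E.pow_mem hE.unit_mem _)))

/-- A homogeneous prime ideal of height one in a chart is given by a prime element. -/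
theorem IsChart.exists_prime [IsDomain Λ] [UniqueFactorizationMonoid Λ] [IsDomain A]
    (hE : IsChart δ E) {V : Ideal A} [hV : V.IsPrime] (hV1 : V.height = 1)
    (hVh : V.IsHomogeneous 𝒜) (hEV : ∀ e ∈ E, e ∉ V) :
    ∃ p : Λ, Prime p ∧ V = δ.primeOf p := by
  suffices h : ∃ p : Λ, Prime p ∧ ∃ f ∈ V, SetLike.IsHomogeneousElem 𝒜 f ∧ ∃ e ∈ E,
      δ.hom f = p * δ.hom e by
    obtain ⟨p, hp, f, hfV, hf, e, he, hfe⟩ := h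
    have := δ.isPrime_primeOf (Or.inr hp)
    refine ⟨p, hp, (eq_of_le_of_height_eq_one hV1 ?_
      (hE.primeOf_le hEV hf he hfe hfV)).symm⟩
    intro h0
    have hf0 : f ∈ δ.primeOf p := (δ.mem_primeOf_iff hf).2 ⟨_, hfe⟩
    rw [h0, Ideal.mem_bot] at hf0
    rw [hf0, map_zero] at hfe
    have he0 : e ≠ 0 := fun h => hEV e he (h ▸ V.zero_mem)
    exact mul_ne_zero hp.ne_zero (δ.hom_ne_zero (hE.homogeneous e he) he0) hfe.symm
  obtain ⟨f₀, hf₀, hf₀V, hne⟩ : ∃ f, SetLike.IsHomogeneousElem 𝒜 f ∧ f ∈ V ∧ f ≠ 0 := by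
    by_contra! h
    exact Ideal.ne_bot_of_height_eq_one hV1 (eq_bot_iff.2 (le_of_homogeneous (𝒜 := 𝒜) hVh
      fun x hx hxV => (Ideal.mem_bot).2 (h x hx hxV)))
  -- Induction on the prime factorization of the dehomogenization of an element of `V`, at the end
  -- applied to `f₀`.
  have key : ∀ q : Λ, q ≠ 0 → (∃ f ∈ V, SetLike.IsHomogeneousElem 𝒜 f ∧ ∃ e ∈ E,
      δ.hom f = q * δ.hom e) → ∃ p : Λ, Prime p ∧ ∃ f ∈ V, SetLike.IsHomogeneousElem 𝒜 f ∧
      ∃ e ∈ E, δ.hom f = p * δ.hom e := by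
    intro q
    induction q using UniqueFactorizationMonoid.induction_on_prime with
    | h₁ => exact fun h => absurd rfl h
    | h₂ q hq =>
      rintro - ⟨f, hfV, hf, e, he, hfe⟩
      obtain ⟨q', hq'⟩ := hq.exists_right_inv
      obtain ⟨f', hf', e', he', h'⟩ := hE.exists_eq_mul q'
      obtain ⟨a, b, hab⟩ := δ.exists_mul_unit_pow_eq (f := f * f') (g := e * e') (hf.mul hf')
        ((hE.homogeneous _ he).mul (hE.homogeneous _ he')) (by
          simp only [map_mul, hfe, h']
          linear_combination (δ.hom e * δ.hom e') * hq')
      refine absurd ?_ (hEV _ (E.mul_mem (E.mul_mem he he') (E.pow_mem hE.unit_mem b)))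
      rw [← hab, mul_assoc]
      exact V.mul_mem_right _ hfV
    | h₃ q p hq0 hp ih =>
      -- Lift the prime factor and the remaining factor to homogeneous `f₁` and `f₂`. Their product
      -- lies in `V` up to `E`, so `V` contains one of them: either the prime is found or the
      -- induction hypothesis applies.
      rintro - ⟨f, hfV, hf, e, he, hfe⟩
      obtain ⟨f₁, hf₁, e₁, he₁, h₁⟩ := hE.exists_eq_mul p
      obtain ⟨f₂, hf₂, e₂, he₂, h₂⟩ := hE.exists_eq_mul q
      obtain ⟨a, b, hab⟩ := δ.exists_mul_unit_pow_eq (f := f * (e₁ * e₂)) (g := f₁ * f₂ * e)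
        (hf.mul ((hE.homogeneous _ he₁).mul (hE.homogeneous _ he₂)))
        ((hf₁.mul hf₂).mul (hE.homogeneous _ he)) (by
          simp only [map_mul, hfe, h₁, h₂]; ring)
      have h3 : f₁ * f₂ * (e * δ.unit ^ b) ∈ V := by
        rw [← mul_assoc, ← hab, mul_assoc]
        exact V.mul_mem_right _ hfV
      rcases hV.mem_or_mem ((hV.mem_or_mem h3).resolve_right
        (hEV _ (E.mul_mem he (E.pow_mem hE.unit_mem b)))) with h | h
      · exact ⟨p, hp, f₁, h, hf₁, e₁, he₁, h₁⟩
      · exact ih hq0 ⟨f₂, h, hf₂, e₂, he₂, h₂⟩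
  exact key (δ.hom f₀) (δ.hom_ne_zero hf₀ hne) ⟨f₀, hf₀V, hf₀, 1, E.one_mem, by simp⟩

/-- A homogeneous element with dehomogenization `p`, up to elements of the chart, generates
`primeOf p` in the chart. -/
theorem IsChart.exists_mul_eq (hE : IsChart δ E) {p : Λ} {c e : A}
    (hc : SetLike.IsHomogeneousElem 𝒜 c) (he : e ∈ E) (hce : δ.hom c = p * δ.hom e) :
    ∀ x ∈ δ.primeOf p, ∃ g ∈ E, ∃ y, g * x = c * y := by
  intro x hx
  -- Divisibility by `p` describes only the homogeneous members of `primeOf p`, so the claim is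
  -- checked on these as generators.
  have hspan : δ.primeOf p = Ideal.span {x | SetLike.IsHomogeneousElem 𝒜 x ∧ p ∣ δ.hom x} := by
    apply le_antisymm
    · exact le_of_homogeneous (𝒜 := 𝒜) (δ.isHomogeneous_primeOf p) fun x hx hxp =>
        Ideal.subset_span ⟨hx, (δ.mem_primeOf_iff hx).1 hxp⟩
    · rw [Ideal.span_le]
      rintro x ⟨hx, hxp⟩
      exact (δ.mem_primeOf_iff hx).2 hxp
  rw [hspan] at hx
  induction hx using Submodule.span_induction with
  | mem x hx =>
    obtain ⟨hx, r, hr⟩ := hx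
    obtain ⟨f', hf', e', he', h'⟩ := hE.exists_eq_mul r
    obtain ⟨a, b, hab⟩ := δ.exists_mul_unit_pow_eq (f := x * (e' * e)) (g := c * f')
      (hx.mul ((hE.homogeneous _ he').mul (hE.homogeneous _ he))) (hc.mul hf') (by
        simp only [map_mul, hr, hce, h']; ring)
    exact ⟨e' * e * δ.unit ^ a, E.mul_mem (E.mul_mem he' he) (E.pow_mem hE.unit_mem _),
      f' * δ.unit ^ b, by linear_combination hab⟩
  | zero => exact ⟨1, E.one_mem, 0, by simp⟩
  | add x y _ _ hx hy =>
    obtain ⟨g, hg, z, hz⟩ := hx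
    obtain ⟨g', hg', z', hz'⟩ := hy
    exact ⟨g * g', E.mul_mem hg hg', g' * z + g * z', by linear_combination g' * hz + g * hz'⟩
  | smul a x _ hx =>
    obtain ⟨g, hg, z, hz⟩ := hx
    exact ⟨g, hg, a * z, by rw [smul_eq_mul]; linear_combination a * hz⟩

end Dehomogenization

/-! ### Prime divisors that meet a chart -/

section Surface

variable {k R : Type u} {Λ : Type*} [Field k] [CommRing R] [Algebra k R] [IsDomain R]
  [IsNoetherianRing R] [CommRing Λ] [IsDomain Λ]
variable {𝒜 : ℕ → Submodule k R} [GradedAlgebra 𝒜] {δ : Dehomogenization 𝒜 Λ} {E : Submonoid R}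

theorem IsChart.notMem_primeOf (hE : IsChart δ E) {p : Λ} (h : ∀ e ∈ E, ¬ p ∣ δ.hom e) :
    ∀ e ∈ E, e ∉ δ.primeOf p :=
  fun e he hep => h e he ((δ.mem_primeOf_iff (hE.homogeneous e he)).1 hep)

theorem IsChart.isUniformizer (hE : IsChart δ E) {p : Λ} (hp : Prime p)
    (hEp : ∀ e ∈ E, ¬ p ∣ δ.hom e) {c e : R} (hc : SetLike.IsHomogeneousElem 𝒜 c) (he : e ∈ E)
    (hce : δ.hom c = p * δ.hom e) : IsUniformizer (δ.primeOf p) c where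
  mem := (δ.mem_primeOf_iff hc).2 ⟨_, hce⟩
  ne_zero := by
    rintro rfl
    rw [map_zero] at hce
    exact mul_ne_zero hp.ne_zero (fun h => hEp e he (by rw [h]; exact dvd_zero p)) hce.symm
  exists_mul x hx := by
    obtain ⟨g, hg, h⟩ := hE.exists_mul_eq hc he hce x hx
    exact ⟨g, hE.notMem_primeOf hEp g hg, h⟩

/-- The prime divisor given by a prime element. -/
noncomputable def IsChart.primeDivisor (hE : IsChart δ E) {p : Λ} (hp : Prime p)
    (hEp : ∀ e ∈ E, ¬ p ∣ δ.hom e) : PrimeDivisor 𝒜 where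
  point :=
    { asHomogeneousIdeal := ⟨δ.primeOf p, δ.isHomogeneous_primeOf p⟩
      isPrime := δ.isPrime_primeOf (Or.inr hp)
      not_irrelevant_le := fun h => by
        refine hE.notMem_primeOf hEp _ hE.unit_mem (h ?_)
        rw [HomogeneousIdeal.mem_irrelevant_iff]
        simp only [GradedRing.proj_apply]
        rw [DirectSum.decompose_of_mem_ne 𝒜 δ.unit_mem one_ne_zero] }
  height_eq_one := by
    have := δ.isPrime_primeOf (Or.inr hp)
    obtain ⟨c, hc, e, he, hce⟩ := hE.exists_eq_mul p
    exact (hE.isUniformizer hp hEp hc he hce).height_eq_one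

/-- In a chart, orders of vanishing are multiplicities in the dehomogenized ring. -/
theorem IsChart.ordAt_eq [UniqueFactorizationMonoid Λ] (hE : IsChart δ E) {p : Λ} (hp : Prime p)
    {P : Ideal R} [P.IsPrime] [IsDiscreteValuationRing (Localization.AtPrime P)]
    (hP : P = δ.primeOf p) (hEp : ∀ e ∈ E, e ∉ P)
    {x : R} (hx : SetLike.IsHomogeneousElem 𝒜 x) (hx0 : x ≠ 0) :
    ordAt P x = emultiplicity p (δ.hom x) := by
  have hEp' : ∀ e ∈ E, ¬ p ∣ δ.hom e := fun e he h =>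
    hEp e he (hP ▸ (δ.mem_primeOf_iff (hE.homogeneous e he)).2 h)
  obtain ⟨c, hc, e₀, he₀, hce⟩ := hE.exists_eq_mul p
  have hu := hE.isUniformizer hp hEp' hc he₀ hce
  rw [← hP] at hu
  have hfin : FiniteMultiplicity p (δ.hom x) :=
    FiniteMultiplicity.of_prime_left hp (δ.hom_ne_zero hx hx0)
  -- Split off the full power of `p` from `δ.hom x` and lift the two factors to homogeneous
  -- elements. The cofactor and the denominators lie outside `P`, so the exponent is the order.
  obtain ⟨r, hr, hpr⟩ := hfin.exists_eq_pow_mul_and_not_dvd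
  rw [hfin.emultiplicity_eq_multiplicity]
  generalize multiplicity p (δ.hom x) = N at hr ⊢
  obtain ⟨f, hf, e, he, hfe⟩ := hE.exists_eq_mul r
  obtain ⟨a, b, hab⟩ := δ.exists_mul_unit_pow_eq (f := x * (e₀ ^ N * e))
    (g := c ^ N * f)
    (hx.mul (hE.homogeneous _ (E.mul_mem (E.pow_mem he₀ _) he)))
    (SetLike.IsHomogeneousElem.mul (by
      obtain ⟨n, hn⟩ := hc
      exact ⟨_, SetLike.pow_mem_graded _ hn⟩) hf) (by
      simp only [map_mul, map_pow, hfe, hce, hr]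
      ring)
  have hE' : ∀ e ∈ E, e ∉ P := hEp
  refine ordAt_eq_of_mul_eq hu (a := e₀ ^ N * e * δ.unit ^ a)
    (b := f * δ.unit ^ b) ?_ ?_ (by linear_combination hab)
  · exact hE' _ (E.mul_mem (E.mul_mem (E.pow_mem he₀ _) he) (E.pow_mem hE.unit_mem _))
  · intro h
    rcases Ideal.IsPrime.mem_or_mem ‹_› h with h | h
    · rw [hP, δ.mem_primeOf_iff hf, hfe] at h
      exact (hp.dvd_or_dvd h).elim hpr (hEp' e he)
    · exact hE' _ (E.pow_mem hE.unit_mem _) h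

variable {ι : Type*} {C : ι → Submonoid R}

/-- The prime divisors that meet the open set covered by the charts `C i`. -/
def IsCovered (C : ι → Submonoid R) (P : PrimeDivisor 𝒜) : Prop := ∃ i, ∀ e ∈ C i, e ∉ P.ideal

variable [UniqueFactorizationMonoid Λ] (hC : ∀ i, IsChart δ (C i))
  (hR : ∀ P : PrimeDivisor 𝒜, IsDiscreteValuationRing (Localization.AtPrime P.ideal))

include hC in
theorem IsCovered.exists_prime {P : PrimeDivisor 𝒜} (hP : IsCovered C P) :
    ∃ p : Λ, Prime p ∧ P.ideal = δ.primeOf p := by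
  obtain ⟨i, hi⟩ := hP
  exact (hC i).exists_prime P.height_eq_one P.point.asHomogeneousIdeal.isHomogeneous hi

include hC hR in
theorem IsCovered.exists_ordAt {P : PrimeDivisor 𝒜} (hP : IsCovered C P) :
    ∃ p : Λ, Prime p ∧ P.ideal = δ.primeOf p ∧
      ∀ x, SetLike.IsHomogeneousElem 𝒜 x → x ≠ 0 →
        ordAt P.ideal x = emultiplicity p (δ.hom x) := by
  obtain ⟨p, hp, hPp⟩ := IsCovered.exists_prime hC hP
  obtain ⟨i, hi⟩ := hP
  have := hR P
  exact ⟨p, hp, hPp, fun x hx hx0 => (hC i).ordAt_eq hp hPp hi hx hx0⟩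

include hC in
theorem IsCovered.isDiscreteValuationRing {P : PrimeDivisor 𝒜} (hP : IsCovered C P) :
    IsDiscreteValuationRing (Localization.AtPrime P.ideal) := by
  obtain ⟨p, hp, hPp⟩ := IsCovered.exists_prime hC hP
  obtain ⟨i, hi⟩ := hP
  obtain ⟨c, hc, e, he, hce⟩ := (hC i).exists_eq_mul p
  have : IsUniformizer P.ideal c := by
    rw [hPp]
    refine (hC i).isUniformizer hp (fun e he h => hi e he ?_) hc he hce
    rw [hPp, δ.mem_primeOf_iff ((hC i).homogeneous e he)]
    exact h
  exact this.isDiscreteValuationRing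

include hC hR in
/-- A prime divisor in the open set is principal up to divisors supported on the complement. -/
theorem IsCovered.exists_principal {P : PrimeDivisor 𝒜} (hP : IsCovered C P) :
    ∃ D ∈ principalDivisors 𝒜, ∀ Q, IsCovered C Q → D Q = Finsupp.single P (1 : ℤ) Q := by
  obtain ⟨p, hp, hPp⟩ := IsCovered.exists_prime hC hP
  obtain ⟨i, hi⟩ := hP
  obtain ⟨c, ⟨m, hc⟩, e, he, hce⟩ := (hC i).exists_eq_mul p
  obtain ⟨n, hn⟩ := (hC i).homogeneous e he
  have hs0 : δ.unit ≠ 0 := fun h => hi _ (hC i).unit_mem (h ▸ P.ideal.zero_mem)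
  have he0 : e ≠ 0 := fun h => hi e he (h ▸ P.ideal.zero_mem)
  have hc0 : c ≠ 0 := by
    rintro rfl
    rw [map_zero] at hce
    exact mul_ne_zero hp.ne_zero (δ.hom_ne_zero ⟨n, hn⟩ he0) hce.symm
  -- The two padded elements have the same degree and the quotient of their dehomogenizations is
  -- `p`. Their fraction is the required rational function.
  have h1 : c * δ.unit ^ n ∈ 𝒜 (m + n) := by
    simpa using SetLike.mul_mem_graded hc (SetLike.pow_mem_graded n δ.unit_mem)
  have h2 : e * δ.unit ^ m ∈ 𝒜 (m + n) := by
    simpa [add_comm] using SetLike.mul_mem_graded hn (SetLike.pow_mem_graded m δ.unit_mem)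
  have h10 : c * δ.unit ^ n ≠ 0 := mul_ne_zero hc0 (pow_ne_zero _ hs0)
  have h20 : e * δ.unit ^ m ≠ 0 := mul_ne_zero he0 (pow_ne_zero _ hs0)
  refine ⟨_, divisorOf_sub_mem_principal hR h10 h20 h1 h2, fun Q hQ => ?_⟩
  obtain ⟨q, hq, hQq, hord⟩ := IsCovered.exists_ordAt hC hR hQ
  have := hR Q
  have h3 : ordAt Q.ideal (c * δ.unit ^ n) =
      ordAt Q.ideal (e * δ.unit ^ m) + emultiplicity q p := by
    rw [hord _ ⟨_, h1⟩ h10, hord _ ⟨_, h2⟩ h20]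
    simp only [map_mul, map_pow, δ.hom_unit, one_pow, mul_one, hce]
    rw [emultiplicity_mul hq, add_comm]
  rw [Finsupp.sub_apply, divisorOf_apply, divisorOf_apply, h3]
  have h4 : emultiplicity q p ≠ ⊤ :=
    finiteMultiplicity_iff_emultiplicity_ne_top.1 (FiniteMultiplicity.of_prime_left hq hp.ne_zero)
  rw [ENat.toNat_add (mt ordAt_eq_top_iff.1 h20) h4, Nat.cast_add, add_sub_cancel_left]
  by_cases hPQ : P = Q
  · subst hPQ
    have hpq : q ∣ p := by
      have : c ∈ δ.primeOf q := by
        rw [← hQq, hPp, δ.mem_primeOf_iff ⟨m, hc⟩, hce]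
        exact dvd_mul_right _ _
      rw [δ.mem_primeOf_iff ⟨m, hc⟩, hce] at this
      refine (hq.dvd_or_dvd this).resolve_right fun h => hi e he ?_
      rw [hQq, δ.mem_primeOf_iff ⟨n, hn⟩]
      exact h
    rw [Finsupp.single_eq_same, ← emultiplicity_eq_of_associated_right
      (hq.irreducible.associated_of_dvd hp.irreducible hpq),
      (FiniteMultiplicity.of_prime_left hq hq.ne_zero).emultiplicity_self]
    rfl
  · rw [Finsupp.single_eq_of_ne (Ne.symm hPQ)]
    have hpq : ¬ q ∣ p := by
      intro h
      apply hPQ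
      apply PrimeDivisor.ext_ideal
      rw [hPp, hQq]
      have := hq.irreducible.associated_of_dvd hp.irreducible h
      rw [Dehomogenization.primeOf, Dehomogenization.primeOf,
        Ideal.span_singleton_eq_span_singleton.2 this]
    rw [emultiplicity_eq_zero.2 hpq]
    rfl

include hC hR in
/-- Homogeneous elements with the same divisor on the open set have associated
dehomogenizations. -/
theorem associated_of_divisorOf_eq
    (hcov : ∀ p : Λ, Prime p → ∃ i, ∀ e ∈ C i, ¬ p ∣ δ.hom e)
    {f g : R} (hf : SetLike.IsHomogeneousElem 𝒜 f) (hg : SetLike.IsHomogeneousElem 𝒜 g)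
    (hf0 : f ≠ 0) (hg0 : g ≠ 0)
    (h : ∀ Q, IsCovered C Q → divisorOf hR f hf0 Q = divisorOf hR g hg0 Q) :
    Associated (δ.hom f) (δ.hom g) := by
  -- Each prime of `Λ` is a prime divisor of one of the charts, where the order of vanishing is the
  -- multiplicity of that prime.
  have key : ∀ p : Λ, Prime p → emultiplicity p (δ.hom f) = emultiplicity p (δ.hom g) := by
    intro p hp
    obtain ⟨i, hi⟩ := hcov p hp
    have hQ : IsCovered C ((hC i).primeDivisor hp hi) := ⟨i, (hC i).notMem_primeOf hi⟩
    have := hR ((hC i).primeDivisor hp hi)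
    have := δ.isPrime_primeOf (Or.inr hp)
    have : IsDiscreteValuationRing (Localization.AtPrime (δ.primeOf p)) :=
      hR ((hC i).primeDivisor hp hi)
    have h1 := h _ hQ
    rw [divisorOf_apply, divisorOf_apply, Nat.cast_inj] at h1
    have h2 := congrArg (fun n : ℕ => (n : ℕ∞)) h1
    simp only [ordAt_toNat hf0, ordAt_toNat hg0] at h2
    have e1 := (hC i).ordAt_eq hp rfl ((hC i).notMem_primeOf hi) hf hf0
    have e2 := (hC i).ordAt_eq hp rfl ((hC i).notMem_primeOf hi) hg hg0
    exact e1.symm.trans (h2.trans e2)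
  apply associated_of_dvd_dvd
  · exact (UniqueFactorizationMonoid.dvd_iff_emultiplicity_le (δ.hom_ne_zero hf hf0)).2
      fun p hp => (key p hp).le
  · exact (UniqueFactorizationMonoid.dvd_iff_emultiplicity_le (δ.hom_ne_zero hg hg0)).2
      fun p hp => (key p hp).ge

end Surface

end ProjDiv

namespace ProjDiv

/-! ### Multiplicities, constant families and semilocal bases -/

section Representable

variable {B A Λ : Type*} [CommRing B] [CommRing A] [Algebra B A] [CommRing Λ]
variable {𝒜 : ℕ → Submodule B A} [GradedAlgebra 𝒜] (δ : Dehomogenization 𝒜 Λ)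

/-- The elements of the dehomogenized ring that are fractions with denominators in `E`. -/
def Dehomogenization.fractions (E : Submonoid A)
    (hE : ∀ e ∈ E, SetLike.IsHomogeneousElem 𝒜 e) : Subsemiring Λ where
  carrier := {p | ∃ f, SetLike.IsHomogeneousElem 𝒜 f ∧ ∃ e ∈ E, δ.hom f = p * δ.hom e}
  one_mem' := ⟨1, ⟨0, SetLike.GradedOne.one_mem⟩, 1, E.one_mem, by simp⟩
  zero_mem' := ⟨0, ⟨0, Submodule.zero_mem _⟩, 1, E.one_mem, by simp⟩
  mul_mem' := by
    rintro p q ⟨f, hf, e, he, h⟩ ⟨f', hf', e', he', h'⟩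
    exact ⟨f * f', hf.mul hf', e * e', E.mul_mem he he', by simp only [map_mul, h, h']; ring⟩
  add_mem' := by
    rintro p q ⟨f, ⟨m, hf⟩, e, he, h⟩ ⟨f', ⟨m', hf'⟩, e', he', h'⟩
    obtain ⟨n, hn⟩ := hE e he
    obtain ⟨n', hn'⟩ := hE e' he'
    -- The common denominator is `e * e'`. The powers of `δ.unit` only make the two terms of the
    -- numerator homogeneous of the same degree.
    refine ⟨f * e' * δ.unit ^ (n + m') + f' * e * δ.unit ^ (n' + m),
      ⟨m + n' + (n + m'), Submodule.add_mem _ ?_ ?_⟩, e * e', E.mul_mem he he', ?_⟩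
    · simpa using SetLike.mul_mem_graded (SetLike.mul_mem_graded hf hn')
        (SetLike.pow_mem_graded (n + m') δ.unit_mem)
    · have : m' + n + (n' + m) = m + n' + (n + m') := by ring
      rw [← this]
      simpa using SetLike.mul_mem_graded (SetLike.mul_mem_graded hf' hn)
        (SetLike.pow_mem_graded (n' + m) δ.unit_mem)
    · simp only [map_add, map_mul, map_pow, δ.hom_unit, one_pow, mul_one, h, h']
      ring

end Representable

section Multiplicity

variable {k R : Type u} [Field k] [CommRing R] [Algebra k R] [IsDomain R]
variable {𝒜 : ℕ → Submodule k R} [GradedAlgebra 𝒜]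

/-- The multiplicity of an ideal that is locally generated by one element. -/
theorem mult_eq_ordAt {I : Ideal R} {P : PrimeDivisor 𝒜} {g : R}
    (h1 : ∃ w ∉ P.ideal, w * g ∈ I) (h2 : ∀ x ∈ I, ∃ w ∉ P.ideal, ∃ y, w * x = g * y) :
    mult I P = ordAt P.ideal g := by
  rw [← mult_span_singleton, mult, mult]
  have : I.map (algebraMap R (Localization.AtPrime P.ideal)) =
      (Ideal.span {g}).map (algebraMap R (Localization.AtPrime P.ideal)) := by
    apply le_antisymm
    · rw [Ideal.map_le_iff_le_comap, Ideal.map_span, Set.image_singleton]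
      intro x hx
      obtain ⟨w, hw, y, hy⟩ := h2 x hx
      rw [Ideal.mem_comap, Ideal.mem_span_singleton, ← (isUnit_localization_iff.2 hw).dvd_mul_left,
        ← map_mul, hy, map_mul]
      exact dvd_mul_right _ _
    · rw [Ideal.map_span, Set.image_singleton, Ideal.span_singleton_le_iff_mem]
      obtain ⟨w, hw, h⟩ := h1
      have := Ideal.mem_map_of_mem (algebraMap R (Localization.AtPrime P.ideal)) h
      rw [map_mul] at this
      exact (Ideal.unit_mul_mem_iff_mem _ (isUnit_localization_iff.2 hw)).1 this
  rw [this]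

end Multiplicity

/-- A family of charts that cover `Proj` outside of finitely many geometrically integral curves. -/
structure IsChartCover {k R Λ : Type u} [Field k] [CommRing R] [Algebra k R] [CommRing Λ]
    {𝒜 : ℕ → Submodule k R} {ι κ : Type*} (δ : Dehomogenization 𝒜 Λ) (C : ι → Submonoid R)
    (L : κ → Ideal R) (c : κ → R) : Prop where
  isChart : ∀ i, IsChart δ (C i)
  isPrime : ∀ j, (L j).IsPrime
  isUniformizer : ∀ j, IsUniformizer (L j) (c j)
  isPrime_map : ∀ j (B : Type u) [CommRing B] [IsDomain B] [Algebra k B],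
    ((L j).map (Algebra.TensorProduct.includeRight : R →ₐ[k] B ⊗[k] R)).IsPrime
  exists_le : ∀ P : Ideal R, P.IsPrime → (∀ i, ∃ e ∈ C i, e ∈ P) → ∃ j, L j ≤ P

section Cover

variable {k R Λ : Type u} [Field k] [CommRing R] [Algebra k R] [IsDomain R] [IsNoetherianRing R]
  [CommRing Λ] [IsDomain Λ] [UniqueFactorizationMonoid Λ]
variable {𝒜 : ℕ → Submodule k R} [GradedAlgebra 𝒜] {ι κ : Type*} {δ : Dehomogenization 𝒜 Λ}
  {C : ι → Submonoid R} {L : κ → Ideal R} {c : κ → R}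

theorem IsChartCover.isCovered_or (h : IsChartCover δ C L c) (P : PrimeDivisor 𝒜) :
    IsCovered C P ∨ ∃ j, L j = P.ideal := by
  by_cases hP : IsCovered C P
  · exact Or.inl hP
  · right
    unfold IsCovered at hP
    push Not at hP
    obtain ⟨j, hj⟩ := h.exists_le P.ideal inferInstance hP
    have := h.isPrime j
    exact ⟨j, P.eq_of_le (fun h0 => (h.isUniformizer j).ne_zero
      (by simpa [h0] using (h.isUniformizer j).mem)) hj⟩

theorem IsChartCover.isDiscreteValuationRing (h : IsChartCover δ C L c) (P : PrimeDivisor 𝒜) :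
    IsDiscreteValuationRing (Localization.AtPrime P.ideal) := by
  rcases h.isCovered_or P with hP | ⟨j, hj⟩
  · exact IsCovered.isDiscreteValuationRing h.isChart hP
  · have hu := h.isUniformizer j
    rw [hj] at hu
    exact hu.isDiscreteValuationRing

end Cover

section Family

variable {k R Λ : Type u} [Field k] [CommRing R] [Algebra k R] [CommRing Λ] [Algebra k Λ]
variable {𝒜 : ℕ → Submodule k R} [GradedAlgebra 𝒜]

theorem specialize_tmul {B : Type u} [CommRing B] [Algebra k B] (t : B →ₐ[k] k) (b : B) (r : R) :
    specialize (R := R) t (b ⊗ₜ r) = algebraMap k R (t b) * r := by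
  simp [specialize, Algebra.ofId_apply]

theorem specialize_surjective {B : Type u} [CommRing B] [Algebra k B] (t : B →ₐ[k] k) :
    Function.Surjective (specialize (R := R) t) := fun r => ⟨1 ⊗ₜ r, by simp [specialize_tmul]⟩

theorem specialize_mem {B : Type u} [CommRing B] [Algebra k B] (t : B →ₐ[k] k) {n : ℕ}
    {x : B ⊗[k] R} (hx : x ∈ familyGrading 𝒜 B n) : specialize t x ∈ 𝒜 n := by
  rw [familyGrading, Submodule.baseChange_eq_span] at hx
  induction hx using Submodule.span_induction with
  | mem x h =>
    obtain ⟨y, hy, rfl⟩ := h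
    simpa [specialize_tmul] using hy
  | zero => rw [map_zero]; exact Submodule.zero_mem _
  | add x y _ _ hx hy => rw [map_add]; exact Submodule.add_mem _ hx hy
  | smul b x _ hx =>
    have : specialize (R := R) t (b • x) = t b • specialize (R := R) t x := by
      rw [Algebra.smul_def, map_mul, Algebra.smul_def]
      congr 1
      exact (specialize_tmul t b 1).trans (mul_one _)
    rw [this]
    exact Submodule.smul_mem _ _ hx

/-- The dehomogenization of a constant family. -/
noncomputable def Dehomogenization.family (δ : Dehomogenization 𝒜 Λ)
    (hδ : ∀ a, δ.hom (algebraMap k R a) = algebraMap k Λ a) (B B' : Type u) [CommRing B]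
    [CommRing B'] [Algebra k B] [Algebra k B'] (f : B →ₐ[k] B') (hf : Function.Injective f) :
    Dehomogenization (familyGrading 𝒜 B) (B' ⊗[k] Λ) where
  hom := (Algebra.TensorProduct.map f ({ δ.hom with commutes' := hδ } : R →ₐ[k] Λ) :
    B ⊗[k] R →ₐ[k] B' ⊗[k] Λ)
  eq_zero n x hx h := by
    obtain ⟨y, rfl⟩ := hx
    let g : R →ₗ[k] Λ := (({ δ.hom with commutes' := hδ } : R →ₐ[k] Λ)).toLinearMap
    have hg : Function.Injective (g ∘ₗ (𝒜 n).subtype) := by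
      rw [injective_iff_map_eq_zero]
      intro a ha
      exact Subtype.ext (δ.eq_zero n _ a.2 ha)
    -- Injectivity on a graded piece survives the tensor product because everything is flat over the
    -- field `k`.
    have hinj := TensorProduct.map_injective_of_flat_flat f.toLinearMap (g ∘ₗ (𝒜 n).subtype) hf hg
    have : y = 0 := by
      apply hinj
      rw [map_zero, ← h]
      induction y using TensorProduct.induction_on with
      | zero => simp
      | tmul a b => rfl
      | add a b ha hb =>
        have key : ∀ z : B ⊗[k] (𝒜 n), TensorProduct.map f.toLinearMap (g ∘ₗ (𝒜 n).subtype) z =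
            (Algebra.TensorProduct.map f ({ δ.hom with commutes' := hδ } : R →ₐ[k] Λ))
              ((𝒜 n).toBaseChange B z : B ⊗[k] R) := by
          intro z
          induction z using TensorProduct.induction_on with
          | zero => simp
          | tmul a b => rfl
          | add a b ha hb => rw [map_add, ha, hb, map_add]; simp
        exact key _
    rw [this, map_zero]
  unit := 1 ⊗ₜ δ.unit
  unit_mem := Submodule.tmul_mem_baseChange_of_mem _ δ.unit_mem
  hom_unit := by
    change (f 1) ⊗ₜ δ.hom δ.unit = 1
    rw [map_one, δ.hom_unit]; rfl

theorem Dehomogenization.family_tmul (δ : Dehomogenization 𝒜 Λ)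
    (hδ : ∀ a, δ.hom (algebraMap k R a) = algebraMap k Λ a) (B B' : Type u) [CommRing B]
    [CommRing B'] [Algebra k B] [Algebra k B'] (f : B →ₐ[k] B') (hf : Function.Injective f)
    (b : B) (r : R) : (δ.family hδ B B' f hf).hom (b ⊗ₜ r) = f b ⊗ₜ δ.hom r := rfl

/-- The elements `b ⊗ e` with `b ∈ M` and `e ∈ E`. -/
def tensorSubmonoid {B : Type u} [CommRing B] [Algebra k B] (M : Submonoid B) (E : Submonoid R) :
    Submonoid (B ⊗[k] R) where
  carrier := {x | ∃ b ∈ M, ∃ e ∈ E, x = b ⊗ₜ e}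
  one_mem' := ⟨1, M.one_mem, 1, E.one_mem, rfl⟩
  mul_mem' := by
    rintro _ _ ⟨b, hb, e, he, rfl⟩ ⟨b', hb', e', he', rfl⟩
    exact ⟨b * b', M.mul_mem hb hb', e * e', E.mul_mem he he', by simp⟩

/-- Fractions form a subsemiring, and a pure tensor is a fraction: clear the denominator of its `B'`
factor in `M` and that of its `Λ` factor in `E`. -/
theorem IsChart.family {δ : Dehomogenization 𝒜 Λ}
    {hδ : ∀ a, δ.hom (algebraMap k R a) = algebraMap k Λ a} {E : Submonoid R} (hE : IsChart δ E)
    {B B' : Type u} [CommRing B] [CommRing B'] [Algebra k B] [Algebra k B'] [Algebra B B']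
    [IsScalarTower k B B'] {M : Submonoid B} [IsLocalization M B']
    (hf : Function.Injective (IsScalarTower.toAlgHom k B B')) :
    IsChart (δ.family hδ B B' (IsScalarTower.toAlgHom k B B') hf) (tensorSubmonoid M E) := by
  have hmem : (δ.family hδ B B' (IsScalarTower.toAlgHom k B B') hf).unit ∈ tensorSubmonoid M E :=
    ⟨1, M.one_mem, _, hE.unit_mem, rfl⟩
  have hhom : ∀ e ∈ tensorSubmonoid M E, SetLike.IsHomogeneousElem (familyGrading 𝒜 B) e := by
    rintro _ ⟨b, hb, e, he, rfl⟩
    obtain ⟨n, hn⟩ := hE.homogeneous e he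
    exact ⟨n, Submodule.tmul_mem_baseChange_of_mem _ hn⟩
  refine ⟨hmem, hhom, fun p => ?_⟩
  suffices h : p ∈ (δ.family hδ B B' (IsScalarTower.toAlgHom k B B') hf).fractions _ hhom from h
  induction p using TensorProduct.induction_on with
  | zero => exact Subsemiring.zero_mem _
  | add x y hx hy => exact Subsemiring.add_mem _ hx hy
  | tmul b' l =>
    obtain ⟨⟨b, m⟩, hbm⟩ := IsLocalization.surj M b'
    obtain ⟨f, ⟨n, hfn⟩, e, he, hfe⟩ := hE.exists_eq_mul l
    refine ⟨b ⊗ₜ f, ⟨n, Submodule.tmul_mem_baseChange_of_mem _ hfn⟩, (m : B) ⊗ₜ e,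
      ⟨m, m.2, e, he, rfl⟩, ?_⟩
    rw [Dehomogenization.family_tmul, Dehomogenization.family_tmul,
      Algebra.TensorProduct.tmul_mul_tmul, hfe]
    congr 1
    exact hbm.symm

end Family

section SemiLocal

variable {k B : Type u} [Field k] [CommRing B] [Algebra k B] (t₀ t₁ : B →ₐ[k] k)

/-- The functions that vanish at neither of two points. -/
def nonvanishing : Submonoid B where
  carrier := {b | t₀ b ≠ 0 ∧ t₁ b ≠ 0}
  one_mem' := by simp
  mul_mem' := by
    rintro a b ⟨h1, h2⟩ ⟨h3, h4⟩
    exact ⟨by simp [h1, h3], by simp [h2, h4]⟩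

/-- Only zero and the kernels of the two points can survive as primes, and a Dedekind domain with
finitely many primes is principal. Both points are kept so that one local equation can later be
specialized at either of them. -/
theorem isPrincipalIdealRing_localization_nonvanishing [IsDedekindDomain B] :
    nonvanishing t₀ t₁ ≤ nonZeroDivisors B ∧
    IsPrincipalIdealRing (Localization (nonvanishing t₀ t₁)) := by
  have hle : nonvanishing t₀ t₁ ≤ nonZeroDivisors B := by
    intro b hb
    refine mem_nonZeroDivisors_of_ne_zero ?_
    rintro rfl
    exact hb.1 (map_zero _)
  refine ⟨hle, ?_⟩
  have := IsLocalization.isDomain_localization hle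
  have : IsDedekindDomain (Localization (nonvanishing t₀ t₁)) :=
    IsLocalization.isDedekindDomain B hle _
  apply IsPrincipalIdealRing.of_finite_primes
  have hfin : ({⊥, RingHom.ker t₀, RingHom.ker t₁} : Set (Ideal B)).Finite := by simp
  refine Set.Finite.of_finite_image (f := Ideal.comap (algebraMap B _)) (hfin.subset ?_) ?_
  · rintro _ ⟨I, hI, rfl⟩
    have hI : I.IsPrime := hI
    have hdis := ((IsLocalization.isPrime_iff_isPrime_disjoint (nonvanishing t₀ t₁)
      (Localization (nonvanishing t₀ t₁)) I).1 hI)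
    obtain ⟨h1, h2⟩ := hdis
    by_cases h0 : Ideal.comap (algebraMap B (Localization (nonvanishing t₀ t₁))) I = ⊥
    · simp [h0]
    have hmax := h1.isMaximal h0
    have hsub : (Ideal.comap (algebraMap B (Localization (nonvanishing t₀ t₁))) I : Set B) ⊆
        (RingHom.ker t₀ : Ideal B) ∪ (RingHom.ker t₁ : Ideal B) := by
      intro x hx
      by_contra hx'
      rw [Set.mem_union, not_or] at hx'
      exact Set.disjoint_left.1 h2 ⟨hx'.1, hx'.2⟩ hx
    -- Prime avoidance for two ideals; a nonzero prime of a Dedekind domain is maximal, so inclusion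
    -- in a kernel is equality.
    rcases (Ideal.subset_union).1 hsub with h | h
    · right; left
      exact hmax.eq_of_le (RingHom.ker_ne_top _) h
    · right; right
      exact hmax.eq_of_le (RingHom.ker_ne_top _) h
  · intro I _ J _ hIJ
    exact IsLocalization.orderEmbedding (nonvanishing t₀ t₁) _ |>.injective hIJ

end SemiLocal

end ProjDiv

namespace ProjDiv

/-! ### Algebraic equivalence implies linear equivalence -/

section FamilyDifference

open Algebra.TensorProduct (includeRight)

variable {k R Λ : Type u} [Field k] [CommRing R] [Algebra k R] [IsDomain R]
variable {B : Type u} [CommRing B] [Algebra k B]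

theorem exists_mul_eq_of_mem_map {P : Ideal R} [hP : P.IsPrime] {c : R} (hc : IsUniformizer P c)
    {x : B ⊗[k] R} (hx : x ∈ P.map (includeRight : R →ₐ[k] B ⊗[k] R)) :
    ∃ r ∉ P, ∃ y, (1 ⊗ₜ r) * x = (1 ⊗ₜ c : B ⊗[k] R) * y := by
  induction hx using Submodule.span_induction with
  | mem x hx =>
    obtain ⟨z, hz, rfl⟩ := hx
    obtain ⟨g, hg, y, hy⟩ := hc.exists_mul z hz
    refine ⟨g, hg, 1 ⊗ₜ y, ?_⟩
    change (1 ⊗ₜ g : B ⊗[k] R) * 1 ⊗ₜ z = _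
    rw [Algebra.TensorProduct.tmul_mul_tmul, Algebra.TensorProduct.tmul_mul_tmul, hy]
  | zero => exact ⟨1, hP.one_notMem, 0, by simp⟩
  | add x y _ _ hx hy =>
    obtain ⟨g, hg, z, hz⟩ := hx
    obtain ⟨g', hg', z', hz'⟩ := hy
    refine ⟨g * g', fun h => (hP.mem_or_mem h).elim hg hg', 1 ⊗ₜ g' * z + 1 ⊗ₜ g * z', ?_⟩
    have : (1 ⊗ₜ (g * g') : B ⊗[k] R) = 1 ⊗ₜ g * 1 ⊗ₜ g' := by simp
    rw [this]
    linear_combination (1 ⊗ₜ g' : B ⊗[k] R) * hz + (1 ⊗ₜ g : B ⊗[k] R) * hz'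
  | smul a x _ hx =>
    obtain ⟨g, hg, z, hz⟩ := hx
    exact ⟨g, hg, a * z, by rw [smul_eq_mul]; linear_combination a * hz⟩

/-- Division by a power of a uniformizer of a prime that does not contain `G`. -/
theorem exists_mul_eq_pow_mul [IsDomain (B ⊗[k] R)] {P : Ideal R} [hP : P.IsPrime] {c : R}
    (hc : IsUniformizer P c) (hc0 : (1 ⊗ₜ c : B ⊗[k] R) ≠ 0)
    (hQ : (P.map (includeRight : R →ₐ[k] B ⊗[k] R)).IsPrime)
    {G : B ⊗[k] R} (hG : G ∉ P.map (includeRight : R →ₐ[k] B ⊗[k] R)) (m : ℕ) :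
    ∀ x y : B ⊗[k] R, (1 ⊗ₜ c) ^ m * x = G * y → ∃ r ∉ P, ∃ z, (1 ⊗ₜ r) * x = G * z := by
  induction m with
  | zero => exact fun x y h => ⟨1, hP.one_notMem, y, by simpa [← Algebra.TensorProduct.one_def] using h⟩
  | succ m ih =>
    intro x y h
    have hcQ : (1 ⊗ₜ c : B ⊗[k] R) ∈ P.map (includeRight : R →ₐ[k] B ⊗[k] R) :=
      Ideal.mem_map_of_mem (includeRight : R →ₐ[k] B ⊗[k] R) hc.mem
    -- The extended ideal is prime and omits `G`, so it contains `y`. Then `y` is locally divisible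
    -- by `c`, and one factor `c` cancels from both sides.
    have hy : G * y ∈ P.map (includeRight : R →ₐ[k] B ⊗[k] R) := by
      rw [← h, pow_succ', mul_assoc]
      exact Ideal.mul_mem_right _ _ hcQ
    obtain ⟨r, hr, y', hy'⟩ := exists_mul_eq_of_mem_map hc ((hQ.mem_or_mem hy).resolve_left hG)
    have h2 : (1 ⊗ₜ c) ^ m * (1 ⊗ₜ r * x) = G * y' := by
      apply mul_left_cancel₀ hc0
      linear_combination (1 ⊗ₜ r : B ⊗[k] R) * h + G * hy'
    obtain ⟨r', hr', z, hz⟩ := ih _ _ h2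
    refine ⟨r' * r, fun h => (hP.mem_or_mem h).elim hr' hr, z, ?_⟩
    rw [← hz, ← mul_assoc, Algebra.TensorProduct.tmul_mul_tmul, mul_one]

variable {𝒜 : ℕ → Submodule k R} [GradedAlgebra 𝒜]

/-- A local equation of a family of divisors specializes to local equations of its members. -/
theorem mult_specialize {V : Ideal (B ⊗[k] R)} (t : B →ₐ[k] k) {P : PrimeDivisor 𝒜}
    {g : B ⊗[k] R} (h1 : ∃ w : B ⊗[k] R, specialize t w ∉ P.ideal ∧ w * g ∈ V)
    (h2 : ∀ x ∈ V, ∃ w, specialize t w ∉ P.ideal ∧ ∃ y, w * x = g * y) :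
    mult (V.map (specialize t)) P = ordAt P.ideal (specialize t g) := by
  apply mult_eq_ordAt
  · obtain ⟨w, hw, h⟩ := h1
    exact ⟨_, hw, by rw [← map_mul]; exact Ideal.mem_map_of_mem _ h⟩
  · intro x hx
    obtain ⟨z, hz, rfl⟩ := (Ideal.mem_map_iff_of_surjective (specialize t)
      (specialize_surjective t)).1 hx
    obtain ⟨w, hw, y, hy⟩ := h2 z hz
    exact ⟨_, hw, specialize t y, by rw [← map_mul, hy, map_mul]⟩

theorem algebraMap_notMem (P : PrimeDivisor 𝒜) {a : k} (ha : a ≠ 0) {r : R} (hr : r ∉ P.ideal) :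
    algebraMap k R a * r ∉ P.ideal := by
  have : IsUnit (algebraMap k R a) := (isUnit_iff_ne_zero.2 ha).map _
  rwa [Ideal.unit_mul_mem_iff_mem _ this]

/-- A power of `c` that divides `F` locally also divides its specialization, whose order along `P`
is finite. There is thus a largest one, and its cofactor cannot lie in the ideal generated by `P`.
-/
theorem exists_maximal_pow [IsNoetherianRing R] {P : PrimeDivisor 𝒜} {c : R}
    (hc : IsUniformizer P.ideal c) (t : B →ₐ[k] k) {F : B ⊗[k] R} (hF : specialize t F ≠ 0) :
    ∃ (n : ℕ) (a : R) (G : B ⊗[k] R), a ∉ P.ideal ∧ (1 ⊗ₜ a) * F = (1 ⊗ₜ c) ^ n * G ∧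
      G ∉ P.ideal.map (includeRight : R →ₐ[k] B ⊗[k] R) := by
  classical
  have := hc.isDiscreteValuationRing
  obtain ⟨N, hN⟩ := ENat.ne_top_iff_exists.1 (mt (ordAt_eq_top_iff (P := P.ideal)).1 hF)
  let p : ℕ → Prop := fun n => ∃ a ∉ P.ideal, ∃ G : B ⊗[k] R, (1 ⊗ₜ a) * F = (1 ⊗ₜ c) ^ n * G
  have hp0 : p 0 := ⟨1, Ideal.IsPrime.one_notMem inferInstance, F, by
    simp [← Algebra.TensorProduct.one_def]⟩
  have hpN : ∀ n, p n → n ≤ N := by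
    rintro n ⟨a, ha, G, h⟩
    have h' := congrArg (fun z => ordAt P.ideal (specialize t z)) h
    simp only [map_mul, map_pow, specialize_tmul, map_one, one_mul, ordAt_mul,
      ordAt_pow, hc.ordAt_eq_one, ordAt_eq_zero_iff.2 ha, zero_add, ← hN] at h'
    have : (n : ℕ∞) ≤ N := by
      rw [h']
      simp
    exact_mod_cast this
  obtain ⟨a, ha, G, h⟩ := Nat.findGreatest_spec (P := p) (Nat.zero_le N) hp0
  refine ⟨_, a, G, ha, h, fun hG => ?_⟩
  obtain ⟨r, hr, G', hG'⟩ := exists_mul_eq_of_mem_map hc hG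
  have hsucc : p (Nat.findGreatest p N + 1) := by
    refine ⟨r * a, fun h => (Ideal.IsPrime.mem_or_mem inferInstance h).elim hr ha, G', ?_⟩
    have : (1 ⊗ₜ (r * a) : B ⊗[k] R) = 1 ⊗ₜ r * 1 ⊗ₜ a := by simp
    rw [this, pow_succ]
    linear_combination (1 ⊗ₜ r : B ⊗[k] R) * h + (1 ⊗ₜ c : B ⊗[k] R) ^ Nat.findGreatest p N * hG'
  exact absurd (Nat.le_findGreatest (hpN _ hsucc) hsucc) (by omega)

variable [CommRing Λ] [IsDomain Λ] [UniqueFactorizationMonoid Λ] [Algebra k Λ] [IsNoetherianRing R]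
variable {ι κ : Type*} {δ : Dehomogenization 𝒜 Λ} {C : ι → Submonoid R} {L : κ → Ideal R}
  {c : κ → R}

theorem tmul_ne_zero_of_ne_zero [Nontrivial B] {r : R} (hr : r ≠ 0) : (1 ⊗ₜ r : B ⊗[k] R) ≠ 0 := by
  intro h
  apply hr
  have hinj : Function.Injective (includeRight : R →ₐ[k] B ⊗[k] R) :=
    Algebra.TensorProduct.includeRight_injective (algebraMap k B).injective
  exact hinj (h.trans (map_zero _).symm)

/-- Over a principal chart, the multiplicities of the members of a family differ from the orders
of the specializations of one homogeneous element by a constant. -/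
theorem IsChartCover.mult_add_eq (hcov : IsChartCover δ C L c)
    {hδ : ∀ a, δ.hom (algebraMap k R a) = algebraMap k Λ a} [IsDomain B] {B' : Type u}
    [CommRing B'] [Algebra k B'] [Algebra B B'] [IsScalarTower k B B'] {M : Submonoid B}
    [IsLocalization M B'] (hf : Function.Injective (IsScalarTower.toAlgHom k B B'))
    [IsDomain (B ⊗[k] R)] [IsDomain (B' ⊗[k] Λ)] {p : B' ⊗[k] Λ}
    {V : Ideal (B ⊗[k] R)} (hVp : V.IsPrime)
    (hV : V = (δ.family hδ B B' (IsScalarTower.toAlgHom k B B') hf).primeOf p) {i : ι}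
    (hEV : ∀ e ∈ tensorSubmonoid M (C i), e ∉ V) {F : B ⊗[k] R} {b : B} {e : R}
    (hF : SetLike.IsHomogeneousElem (familyGrading 𝒜 B) F) (hb : b ∈ M) (he : e ∈ C i)
    (he0 : e ≠ 0)
    (hFp : (δ.family hδ B B' (IsScalarTower.toAlgHom k B B') hf).hom F =
      p * (δ.family hδ B B' (IsScalarTower.toAlgHom k B B') hf).hom (b ⊗ₜ e))
    (t₀ : B →ₐ[k] k) (hF0 : specialize t₀ F ≠ 0) (P : PrimeDivisor 𝒜) :
    ∃ n : ℕ, ∀ t : B →ₐ[k] k, (∀ b ∈ M, t b ≠ 0) →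
      mult (V.map (specialize t)) P + n = ordAt P.ideal (specialize t F) := by
  have hR := hcov.isDiscreteValuationRing
  have := hR P
  have hhom : ∀ i, IsChart (δ.family hδ B B' (IsScalarTower.toAlgHom k B B') hf)
    (tensorSubmonoid M (C i)) := fun i => (hcov.isChart i).family hf
  have hFV : F ∈ V := by
    rw [hV, Dehomogenization.mem_primeOf_iff _ hF, hFp]
    exact dvd_mul_right _ _
  have hlocal : ∀ x ∈ V, ∃ g ∈ tensorSubmonoid M (C i), ∃ y, g * x = F * y := by
    rw [hV]
    exact (hhom i).exists_mul_eq hF ⟨b, hb, e, he, rfl⟩ hFp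
  -- At a covered `P`, a second representative `c'` of the prime `p` generates the family near `P`.
  -- The discrepancy with `F` is the order of the denominator `e`, which does not involve the point
  -- of the base.
  by_cases hP : IsCovered C P
  · obtain ⟨i', hi'⟩ := hP
    obtain ⟨c', hc', e', he', hce⟩ := (hhom i').exists_eq_mul p
    obtain ⟨b', hb', e', he', rfl⟩ := he'
    obtain ⟨n, hn⟩ := ENat.ne_top_iff_exists.1 (mt (ordAt_eq_top_iff (P := P.ideal)).1 he0)
    refine ⟨n, fun t ht => ?_⟩
    have hmul : mult (V.map (specialize t)) P = ordAt P.ideal (specialize t c') := by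
      apply mult_specialize
      · refine ⟨1, ?_, ?_⟩
        · rw [map_one]; exact Ideal.IsPrime.one_notMem inferInstance
        · rw [one_mul, hV, Dehomogenization.mem_primeOf_iff _ hc', hce]
          exact dvd_mul_right _ _
      · intro x hx
        rw [hV] at hx
        obtain ⟨_, ⟨b₁, hb₁, e₁, he₁, rfl⟩, y, hy⟩ := (hhom i').exists_mul_eq hc'
          ⟨b', hb', e', he', rfl⟩ hce x hx
        refine ⟨_, ?_, y, hy⟩
        rw [specialize_tmul]
        exact algebraMap_notMem P (ht b₁ hb₁) (hi' e₁ he₁)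
    obtain ⟨m, m', h⟩ := (δ.family hδ B B' (IsScalarTower.toAlgHom k B B') hf).exists_mul_unit_pow_eq
      (f := c' * (b ⊗ₜ e)) (g := F * (b' ⊗ₜ e'))
      (hc'.mul ((hhom i).homogeneous _ ⟨b, hb, e, he, rfl⟩))
      (hF.mul ((hhom i').homogeneous _ ⟨b', hb', e', he', rfl⟩)) (by
        rw [map_mul, map_mul, hce, hFp]; ring)
    have hu : (δ.family hδ B B' (IsScalarTower.toAlgHom k B B') hf).unit = 1 ⊗ₜ δ.unit := rfl
    rw [hu] at h
    have h' := congrArg (fun z => ordAt P.ideal (specialize t z)) h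
    have hs : δ.unit ∉ P.ideal := hi' _ (hcov.isChart i').unit_mem
    have hun : ∀ {a : k}, a ≠ 0 → ordAt P.ideal (algebraMap k R a) = 0 := by
      intro a ha
      rw [ordAt_eq_zero_iff]
      have := algebraMap_notMem P ha (Ideal.IsPrime.one_notMem inferInstance)
      rwa [mul_one] at this
    simp only [map_mul, map_pow, specialize_tmul, map_one, one_mul, ordAt_mul, ordAt_pow,
      ordAt_eq_zero_iff.2 hs, smul_zero, add_zero, hun (ht b hb), hun (ht b' hb'), zero_add,
      ordAt_eq_zero_iff.2 (hi' e' he')] at h'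
    rw [hmul, hn]
    exact h'
  · obtain ⟨j, hj⟩ := (hcov.isCovered_or P).resolve_left hP
    have hu := hcov.isUniformizer j
    have hQ := hcov.isPrime_map j B
    rw [hj] at hu hQ
    -- Along an exceptional curve, `F` is the power `n` of its uniformizer times a local equation
    -- `G` of the family. The exponent is found at `t₀`, but the factorization holds over the whole
    -- base.
    obtain ⟨n, a, G, ha, haF, hG⟩ := exists_maximal_pow hu t₀ hF0
    have hc0 := tmul_ne_zero_of_ne_zero (k := k) (B := B) hu.ne_zero
    unfold IsCovered at hP
    push Not at hP
    obtain ⟨e₂, he₂, he₂P⟩ := hP i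
    refine ⟨n, fun t ht => ?_⟩
    have hmul : mult (V.map (specialize t)) P = ordAt P.ideal (specialize t G) := by
      apply mult_specialize
      · have h1 : (1 ⊗ₜ c j : B ⊗[k] R) ^ n * G ∈ V := by
          rw [← haF]
          exact V.mul_mem_left _ hFV
        -- Either `G` lies in `V`, or the uniformizer does. In the second case some `a₁ ∉ P` lies in
        -- `V`: the element `e₂` of the chart vanishes along `P`, so it is locally a positive power
        -- of the uniformizer, and it is not in `V`. The family is then empty near `P`.
        rcases hVp.mem_or_mem h1 with h | h
        · have h := hVp.mem_of_pow_mem _ h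
          have hne : e₂ ≠ 0 := by
            rintro rfl
            apply hEV _ ⟨1, M.one_mem, 0, he₂, rfl⟩
            rw [TensorProduct.tmul_zero]
            exact V.zero_mem
          obtain ⟨m, hm, a₁, ha₁, u₁, hu₁, hau⟩ := hu.exists_eq_pow_mul hne
          have hm0 : m ≠ 0 := by
            rintro rfl
            exact ordAt_eq_zero_iff.1 hm he₂P
          refine ⟨1 ⊗ₜ a₁, ?_, ?_⟩
          · rw [specialize_tmul, map_one, map_one, one_mul]
            exact ha₁
          · apply V.mul_mem_right
            refine (hVp.mem_or_mem (y := 1 ⊗ₜ e₂) ?_).resolve_right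
              (hEV _ ⟨1, M.one_mem, e₂, he₂, rfl⟩)
            rw [Algebra.TensorProduct.tmul_mul_tmul, hau, ← Nat.sub_one_add_one hm0, pow_succ',
              mul_assoc, ← Algebra.TensorProduct.tmul_mul_tmul]
            exact V.mul_mem_right _ h
        · refine ⟨1, ?_, by rwa [one_mul]⟩
          rw [map_one]
          exact Ideal.IsPrime.one_notMem inferInstance
      · intro x hx
        obtain ⟨_, ⟨b₁, hb₁, e₁, he₁, rfl⟩, y, hy⟩ := hlocal x hx
        have hne : e₁ ≠ 0 := by
          rintro rfl
          apply hEV _ ⟨1, M.one_mem, 0, he₁, rfl⟩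
          rw [TensorProduct.tmul_zero]
          exact V.zero_mem
        obtain ⟨m, hm, a₁, ha₁, u₁, hu₁, hau⟩ := hu.exists_eq_pow_mul hne
        have hau' : (1 ⊗ₜ a₁ : B ⊗[k] R) * b₁ ⊗ₜ e₁ = (1 ⊗ₜ c j) ^ m * (b₁ ⊗ₜ u₁) := by
          rw [Algebra.TensorProduct.tmul_mul_tmul, hau, Algebra.TensorProduct.tmul_pow,
            Algebra.TensorProduct.tmul_mul_tmul, one_pow]
        -- The chart gives `x` as a multiple of `F` up to an element that may vanish along the
        -- exceptional curve. That element is a unit times a power of the uniformizer, and such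
        -- powers can be cancelled against `G`.
        obtain ⟨r, hr, z, hz⟩ := exists_mul_eq_pow_mul hu hc0 hQ hG m
          (1 ⊗ₜ a * b₁ ⊗ₜ u₁ * x) ((1 ⊗ₜ c j) ^ n * (1 ⊗ₜ a₁) * y) (by
            linear_combination (1 ⊗ₜ a * 1 ⊗ₜ a₁ : B ⊗[k] R) * hy - (1 ⊗ₜ a * x) * hau' +
              (1 ⊗ₜ a₁ * y) * haF)
        refine ⟨1 ⊗ₜ r * (1 ⊗ₜ a * b₁ ⊗ₜ u₁), ?_, z, by rw [← hz]; ring⟩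
        rw [map_mul, map_mul, specialize_tmul, specialize_tmul, specialize_tmul, map_one, map_one,
          one_mul, one_mul]
        exact fun h => (Ideal.IsPrime.mem_or_mem inferInstance h).elim hr fun h =>
          (Ideal.IsPrime.mem_or_mem inferInstance h).elim ha
            (algebraMap_notMem P (ht b₁ hb₁) hu₁)
    have h' := congrArg (fun z => ordAt P.ideal (specialize t z)) haF
    simp only [map_mul, map_pow, specialize_tmul, map_one, one_mul, ordAt_mul, ordAt_pow,
      ordAt_eq_zero_iff.2 ha, hu.ordAt_eq_one, zero_add] at h'
    rw [hmul, h', add_comm]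
    simp

theorem map_specialize_map_includeRight (I : Ideal R) (t : B →ₐ[k] k) :
    (I.map (includeRight : R →ₐ[k] B ⊗[k] R)).map (specialize (R := R) t) = I := by
  apply le_antisymm
  · rw [Ideal.map_le_iff_le_comap, Ideal.map_le_iff_le_comap]
    intro r hr
    simpa [specialize_tmul] using hr
  · intro r hr
    have := Ideal.mem_map_of_mem (specialize (R := R) t)
      (Ideal.mem_map_of_mem (includeRight : R →ₐ[k] B ⊗[k] R) hr)
    simpa [specialize_tmul] using this

set_option maxHeartbeats 1000000 in
/-- Divisors that are algebraically equivalent to zero are principal, if `Proj R` is covered by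
factorial charts up to finitely many geometrically integral curves. -/
theorem IsChartCover.algebraicallyTrivial_le (hcov : IsChartCover δ C L c)
    (hδ : ∀ a, δ.hom (algebraMap k R a) = algebraMap k Λ a)
    (hΛ : ∀ (B : Type u) [CommRing B] [IsDomain B] [IsPrincipalIdealRing B] [Algebra k B],
      ∃ _ : IsDomain (B ⊗[k] Λ), UniqueFactorizationMonoid (B ⊗[k] Λ)) :
    algebraicallyTrivial 𝒜 ≤ principalDivisors 𝒜 := by
  have hR := hcov.isDiscreteValuationRing
  unfold algebraicallyTrivial
  rw [AddSubgroup.closure_le]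
  rintro _ ⟨B, _, _, _, -, V, hV, t₀, t₁, D₀, D₁, h0, h1, rfl⟩
  -- If the members differ, there is at least one prime divisor `P₀`. It is needed below to exclude
  -- a vanishing specialization, which would have infinite multiplicity along it.
  by_cases hD : D₀ = D₁
  · rw [hD, sub_self]; exact AddSubgroup.zero_mem _
  obtain ⟨P₀, -⟩ := DFunLike.ne_iff.1 hD
  obtain ⟨hM, hPID⟩ := isPrincipalIdealRing_localization_nonvanishing t₀ t₁
  have hdom := IsLocalization.isDomain_localization hM
  obtain ⟨hdom', _⟩ := hΛ (Localization (nonvanishing t₀ t₁))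
  have hf : Function.Injective
      (IsScalarTower.toAlgHom k B (Localization (nonvanishing t₀ t₁))) :=
    IsLocalization.injective _ hM
  set δB := δ.family hδ B (Localization (nonvanishing t₀ t₁)) _ hf with hδB
  have hdomA : IsDomain (B ⊗[k] R) := δB.isDomain
  have hchart : ∀ i, IsChart δB (tensorSubmonoid (nonvanishing t₀ t₁) (C i)) :=
    fun i => (hcov.isChart i).family hf
  -- If the family meets no chart, it contains, and by height equals, the constant family of one
  -- exceptional curve, so both members coincide.
  by_cases hVC : ∀ i, ∃ e ∈ C i, (1 ⊗ₜ e : B ⊗[k] R) ∈ V.ideal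
  · obtain ⟨j, hj⟩ := hcov.exists_le (V.ideal.comap (includeRight : R →ₐ[k] B ⊗[k] R))
      (Ideal.IsPrime.comap _) hVC
    refine absurd ?_ hD
    have hp := hcov.isPrime_map j B
    have hu := hcov.isUniformizer j
    have hQ : (L j).map (includeRight : R →ₐ[k] B ⊗[k] R) = V.ideal := by
      refine eq_of_le_of_height_eq_one V.height_eq_one ?_ (Ideal.map_le_iff_le_comap.2 hj)
      intro hbot
      have := Ideal.mem_map_of_mem (includeRight : R →ₐ[k] B ⊗[k] R) hu.mem
      rw [hbot] at this
      exact tmul_ne_zero_of_ne_zero hu.ne_zero ((Submodule.mem_bot _).1 this)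
    have key : ∀ t : B →ₐ[k] k, V.ideal.map (specialize (R := R) t) = L j := by
      intro t
      rw [← hQ, map_specialize_map_includeRight]
    rw [key] at h0 h1
    exact h0.unique h1
  · push Not at hVC
    obtain ⟨i, hi⟩ := hVC
    have hEV : ∀ e ∈ tensorSubmonoid (nonvanishing t₀ t₁) (C i), e ∉ V.ideal := by
      rintro _ ⟨b, hb, e, he, rfl⟩ h
      have hbe : (b ⊗ₜ e : B ⊗[k] R) = b ⊗ₜ 1 * 1 ⊗ₜ e := by simp
      rw [hbe] at h
      refine (Ideal.IsPrime.mem_or_mem inferInstance h).elim (fun h => ?_) (hi e he)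
      have h3 : b ∈ V.ideal.comap (algebraMap B (B ⊗[k] R)) := h
      rw [hV, Ideal.mem_bot] at h3
      exact hb.1 (by rw [h3, map_zero])
    obtain ⟨p, hp, hVp⟩ := (hchart i).exists_prime V.height_eq_one
      V.point.asHomogeneousIdeal.isHomogeneous hEV
    obtain ⟨F, hF, e', ⟨b, hb, e, he, rfl⟩, hFp⟩ := (hchart i).exists_eq_mul p
    have he0 : e ≠ 0 := by
      rintro rfl
      apply hEV _ ⟨b, hb, 0, he, rfl⟩
      rw [TensorProduct.tmul_zero]
      exact Ideal.zero_mem _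
    -- If the specialization of `F` were zero, the whole ideal of the member would be zero,
    -- contradicting its finite multiplicity along `P₀`.
    have hne : ∀ (t : B →ₐ[k] k) (D : Divisor 𝒜), (∀ b ∈ nonvanishing t₀ t₁, t b ≠ 0) →
        IsDivisorOf (V.ideal.map (specialize t)) D → specialize (R := R) t F ≠ 0 := by
      intro t D ht hD hF0
      obtain ⟨m, hm, -⟩ := hD P₀
      have hbot : V.ideal.map (specialize t) = Ideal.span {(0 : R)} := by
        rw [Set.singleton_zero, Ideal.span_zero, eq_bot_iff]
        intro x hx
        obtain ⟨z, hz, rfl⟩ := (Ideal.mem_map_iff_of_surjective (specialize t)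
          (specialize_surjective t)).1 hx
        replace hz : z ∈ δB.primeOf p := hVp ▸ hz
        obtain ⟨_, ⟨b₁, hb₁, e₁, he₁, rfl⟩, y, hy⟩ := (hchart i).exists_mul_eq hF
          ⟨b, hb, e, he, rfl⟩ hFp z hz
        have := congrArg (specialize (R := R) t) hy
        rw [map_mul, map_mul, hF0, zero_mul, specialize_tmul, ← Algebra.smul_def,
          smul_mul_assoc] at this
        have := (smul_eq_zero_iff_right (ht b₁ hb₁)).1 this
        rw [Ideal.mem_bot]
        refine (mul_eq_zero.1 this).resolve_left ?_
        rintro rfl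
        apply hEV _ ⟨b₁, hb₁, 0, he₁, rfl⟩
        rw [TensorProduct.tmul_zero]
        exact Ideal.zero_mem _
      have := hR P₀
      rw [hbot, mult_span_singleton, ordAt_eq_top_iff.2 rfl] at hm
      exact absurd hm (ENat.top_ne_natCast m)
    have ht₀ : ∀ b ∈ nonvanishing t₀ t₁, t₀ b ≠ 0 := fun b hb => hb.1
    have ht₁ : ∀ b ∈ nonvanishing t₀ t₁, t₁ b ≠ 0 := fun b hb => hb.2
    have hF0 := hne t₀ D₀ ht₀ h0
    have hF1 := hne t₁ D₁ ht₁ h1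
    obtain ⟨n, hn⟩ := hF
    -- The correction term at each prime divisor is the same for `t₀` and `t₁` and cancels. What is
    -- left is the divisor of a fraction of two forms of equal degree.
    have hsub : D₀ - D₁ = divisorOf hR _ hF0 - divisorOf hR _ hF1 := by
      ext P
      have := hR P
      obtain ⟨N, hN⟩ := hcov.mult_add_eq hf (inferInstance : V.ideal.IsPrime) hVp hEV ⟨n, hn⟩ hb he he0 hFp t₀ hF0 P
      have e0 := hN t₀ ht₀
      have e1 := hN t₁ ht₁
      obtain ⟨m₀, hm₀, hD₀⟩ := h0 P
      obtain ⟨m₁, hm₁, hD₁⟩ := h1 P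
      rw [hm₀] at e0
      rw [hm₁] at e1
      rw [Finsupp.sub_apply, Finsupp.sub_apply, divisorOf_apply, divisorOf_apply, ← e0, ← e1, hD₀,
        hD₁, ← Nat.cast_add, ← Nat.cast_add, ENat.toNat_natCast, ENat.toNat_natCast]
      push_cast
      ring
    rw [hsub]
    exact divisorOf_sub_mem_principal hR hF0 hF1 (specialize_mem t₀ hn) (specialize_mem t₁ hn)

end FamilyDifference

end ProjDiv

namespace Dwork
open MvPolynomial GradedHelp

/-! ### Irreducibility of the Dwork quartic -/

section Irreducible

variable {K : Type u} [Field K] [CharZero K] [IsAlgClosed K]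

/-- Eisenstein's criterion in X₀ at the maximal ideal of the point (0, η, 1), with η⁴ = -1. The
linear coefficient vanishes there because X₁ does, and the Fermat quartic X₁⁴ + X₂⁴ + X₃⁴ vanishes
there to first order only. -/
theorem irreducible_poly (c : K) : Irreducible (poly K c) := by
  rw [← MulEquiv.irreducible_iff (finSuccEquiv K 3)]
  obtain ⟨η, hη⟩ := IsAlgClosed.exists_pow_nat_eq (-1 : K) (n := 4) (by norm_num)
  have h1 : (1 : Fin 4) = Fin.succ 0 := rfl
  have h2 : (2 : Fin 4) = Fin.succ 1 := rfl
  have h3 : (3 : Fin 4) = Fin.succ 2 := rfl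
  set d : MvPolynomial (Fin 3) K := X 0 ^ 4 + X 1 ^ 4 + X 2 ^ 4 with hd
  set e : MvPolynomial (Fin 3) K := C (4 * c) * X 0 * X 1 * X 2 with he
  have hp : finSuccEquiv K 3 (poly K c) = Polynomial.X ^ 4 + (Polynomial.C (-e) * Polynomial.X +
      Polynomial.C d) := by
    have hC : ∀ a : K, finSuccEquiv K 3 (C a) = Polynomial.C (C a) := fun a => by
      simp [finSuccEquiv_apply]
    rw [poly, h1, h2, h3]
    simp only [map_sub, map_add, map_mul, map_pow, finSuccEquiv_X_succ, finSuccEquiv_X_zero, hC,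
      hd, he, map_neg]
    ring
  have hdeg : (Polynomial.C (-e) * Polynomial.X + Polynomial.C d).degree < ((4 : ℕ) : WithBot ℕ) :=
    lt_of_le_of_lt Polynomial.degree_linear_le (by norm_num)
  have hmonic : (finSuccEquiv K 3 (poly K c)).Monic := by
    rw [hp]
    exact Polynomial.monic_X_pow_add (n := 4) hdeg
  have hnat : (finSuccEquiv K 3 (poly K c)).degree = ((4 : ℕ) : WithBot ℕ) := by
    rw [hp, Polynomial.degree_add_eq_left_of_degree_lt, Polynomial.degree_X_pow]
    rwa [Polynomial.degree_X_pow]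
  let t : Fin 3 → K := ![0, η, 1]
  have hPprime : (RingHom.ker (aeval t : MvPolynomial (Fin 3) K →ₐ[K] K)).IsPrime :=
    RingHom.ker_isPrime _
  have hd0 : (finSuccEquiv K 3 (poly K c)).coeff 0 = d := by
    rw [hp]; simp [Polynomial.coeff_X_pow]
  refine Polynomial.irreducible_of_eisenstein_criterion (P := RingHom.ker (aeval t)) hPprime
    (f := finSuccEquiv K 3 (poly K c)) ?_ ?_ ?_ ?_ hmonic.isPrimitive
  · rw [hmonic.leadingCoeff]
    exact hPprime.one_notMem
  · intro n hn
    rw [hnat] at hn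
    have hn : n < 4 := by exact_mod_cast hn
    have hdm : aeval t d = 0 := by simp [hd, t, hη]
    have hem : aeval t e = 0 := by simp [he, t]
    rw [hp]
    interval_cases n <;> simp [Polynomial.coeff_X_pow, Polynomial.coeff_X, Polynomial.coeff_C,
      RingHom.mem_ker, hdm, hem]
  · rw [hnat]; norm_num
  · rw [hd0]
    intro hmem
    -- First derivatives of elements of the square of the ideal vanish at the point, while ∂/∂X₂ of
    -- the constant term takes the value 4η³.
    have key : ∀ q ∈ (RingHom.ker (aeval t : MvPolynomial (Fin 3) K →ₐ[K] K)) ^ 2,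
        aeval t (pderiv 1 q) = 0 := by
      intro q hq
      rw [pow_two] at hq
      induction hq using Submodule.mul_induction_on' with
      | mem_mul_mem m hm n hn =>
        have hm : aeval t m = 0 := hm
        have hn : aeval t n = 0 := hn
        rw [Derivation.leibniz, map_add, smul_eq_mul, smul_eq_mul, map_mul, map_mul, hm, hn]
        ring
      | add x _ y _ hx hy => rw [map_add, map_add, hx, hy, add_zero]
    have h0 := key _ hmem
    have hη0 : η ≠ 0 := by
      rintro rfl
      norm_num at hη
    have : aeval t (pderiv 1 d) = 4 * η ^ 3 := by
      rw [hd]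
      simp [Derivation.leibniz_pow, pderiv_X, t]
    rw [this] at h0
    exact mul_ne_zero (by norm_num) (pow_ne_zero _ hη0) h0

instance (c : K) : IsDomain (CoordRing K c) := by
  have : (Ideal.span {poly K c}).IsPrime :=
    (Ideal.span_singleton_prime (irreducible_poly c).ne_zero).2 (irreducible_poly c).prime
  exact Ideal.Quotient.isDomain _

end Irreducible

/-! ### Generators and universal property of the ring of invariants -/

section Generators

variable {K : Type u} [Field K] {c : K}

variable (c) in
theorem swap_mk_X (j : Fin 4) : swap K c (Ideal.Quotient.mk _ (X j)) =
    Ideal.Quotient.mk _ (X (Equiv.swap 0 1 j)) := by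
  change Ideal.Quotient.mk _ (rename (Equiv.swap (0 : Fin 4) 1) (X j)) = _
  rw [rename_X]

variable (K c)

/-- The invariant `X₀ + X₁`. -/
noncomputable def elS : QuotRing K c :=
  ⟨Ideal.Quotient.mk _ (X 0) + Ideal.Quotient.mk _ (X 1), by
    change swap K c _ = _
    rw [map_add, swap_mk_X, swap_mk_X, Equiv.swap_apply_left, Equiv.swap_apply_right, add_comm]
    rfl⟩

/-- The invariant `X₂`. -/
noncomputable def elU : QuotRing K c :=
  ⟨Ideal.Quotient.mk _ (X 2), by
    change swap K c _ = _
    rw [swap_mk_X]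
    rfl⟩

/-- The invariant `X₃`. -/
noncomputable def elV : QuotRing K c :=
  ⟨Ideal.Quotient.mk _ (X 3), by
    change swap K c _ = _
    rw [swap_mk_X]
    rfl⟩

/-- The invariant `X₀ X₁`. -/
noncomputable def elP : QuotRing K c :=
  ⟨Ideal.Quotient.mk _ (X 0) * Ideal.Quotient.mk _ (X 1), by
    change swap K c _ = _
    rw [map_mul, swap_mk_X, swap_mk_X, Equiv.swap_apply_left, Equiv.swap_apply_right, mul_comm]
    rfl⟩

/-- The invariant in terms of which the equation of the quotient surface is a quadratic equation
without linear term. -/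
noncomputable def elW : QuotRing K c :=
  elP K c - elS K c ^ 2 - algebraMap K _ c * elU K c * elV K c

variable {K c}

theorem mk_X_mem (j : Fin 4) : Ideal.Quotient.mk (Ideal.span {poly K c}) (X j) ∈ grading K c 1 :=
  ⟨X j, isHomogeneous_X _ _, rfl⟩

theorem elS_mem : elS K c ∈ quotGrading K c 1 := Submodule.add_mem _ (mk_X_mem 0) (mk_X_mem 1)
theorem elU_mem : elU K c ∈ quotGrading K c 1 := mk_X_mem 2
theorem elV_mem : elV K c ∈ quotGrading K c 1 := mk_X_mem 3
theorem elP_mem : elP K c ∈ quotGrading K c 2 := by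
  change Ideal.Quotient.mk _ (X 0) * Ideal.Quotient.mk _ (X 1) ∈ grading K c 2
  exact SetLike.mul_mem_graded (A := grading K c) (i := 1) (j := 1) (mk_X_mem 0) (mk_X_mem 1)

theorem elW_mem : elW K c ∈ quotGrading K c 2 := by
  have h1 : elS K c ^ 2 ∈ quotGrading K c (2 • 1) := SetLike.pow_mem_graded 2 elS_mem
  have h2 : elU K c * elV K c ∈ quotGrading K c (1 + 1) := SetLike.mul_mem_graded elU_mem elV_mem
  have h3 := Submodule.sub_mem _ (Submodule.sub_mem (quotGrading K c 2) elP_mem h1)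
    (Submodule.smul_mem _ c h2)
  rwa [Algebra.smul_def, ← mul_assoc] at h3

theorem mk_poly : Ideal.Quotient.mk (Ideal.span {poly K c}) (poly K c) = 0 :=
  Ideal.Quotient.eq_zero_iff_mem.2 (Ideal.mem_span_singleton_self _)

theorem elP_eq : elP K c = elW K c + elS K c ^ 2 + algebraMap K _ c * elU K c * elV K c := by
  rw [elW]; ring

/-- The equation of the quotient surface. -/
theorem equation : 2 * elW K c ^ 2 = (elS K c ^ 2 + 2 * algebraMap K _ c * elU K c * elV K c) ^ 2 -
    (elU K c ^ 4 + 2 * algebraMap K _ c ^ 2 * elU K c ^ 2 * elV K c ^ 2 + elV K c ^ 4) := by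
  -- The quartic with X₀⁴ + X₁⁴ written as s⁴ - 4s²p + 2p². Completing the square in p = X₀X₁ gives
  -- w.
  have h : elS K c ^ 4 - 4 * elS K c ^ 2 * elP K c + 2 * elP K c ^ 2 + elU K c ^ 4 + elV K c ^ 4 -
      4 * algebraMap K _ c * elP K c * elU K c * elV K c = 0 := by
    apply Subtype.ext
    have h0 : (Ideal.Quotient.mk _ (X 0) : CoordRing K c) ^ 4 + Ideal.Quotient.mk _ (X 1) ^ 4 +
        Ideal.Quotient.mk _ (X 2) ^ 4 + Ideal.Quotient.mk _ (X 3) ^ 4 - algebraMap K _ (4 * c) *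
        Ideal.Quotient.mk _ (X 0) * Ideal.Quotient.mk _ (X 1) * Ideal.Quotient.mk _ (X 2) *
        Ideal.Quotient.mk _ (X 3) = 0 := mk_poly
    rw [map_mul, map_ofNat] at h0
    have : (↑(elS K c ^ 4 - 4 * elS K c ^ 2 * elP K c + 2 * elP K c ^ 2 + elU K c ^ 4 +
        elV K c ^ 4 - 4 * algebraMap K _ c * elP K c * elU K c * elV K c : QuotRing K c) :
        CoordRing K c) = (elS K c : CoordRing K c) ^ 4 - 4 * (elS K c : CoordRing K c) ^ 2 *
        (elP K c) + 2 * (elP K c : CoordRing K c) ^ 2 + (elU K c : CoordRing K c) ^ 4 +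
        (elV K c : CoordRing K c) ^ 4 -
        4 * algebraMap K _ c * (elP K c : CoordRing K c) * elU K c * elV K c := rfl
    rw [this, elS, elP, elU, elV]
    simp only
    rw [ZeroMemClass.coe_zero, ← h0]
    ring
  have hW : elW K c = elP K c - elS K c ^ 2 - algebraMap K _ c * elU K c * elV K c := rfl
  rw [hW]
  linear_combination h

/-- The elements of the coordinate ring that are polynomials in the basic invariants. -/
noncomputable abbrev basicAdjoin (K : Type u) [Field K] (c : K) : Subalgebra K (CoordRing K c) :=
  (Algebra.adjoin K {elS K c, elU K c, elV K c, elW K c}).map (invariants (swap K c)).val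

theorem mem_basicAdjoin {x : QuotRing K c}
    (hx : x ∈ Algebra.adjoin K {elS K c, elU K c, elV K c, elW K c}) :
    (x : CoordRing K c) ∈ basicAdjoin K c := ⟨x, hx, rfl⟩

theorem elP_mem_adjoin : elP K c ∈ Algebra.adjoin K {elS K c, elU K c, elV K c, elW K c} := by
  rw [elP_eq]
  have h : ∀ x ∈ ({elS K c, elU K c, elV K c, elW K c} : Set (QuotRing K c)),
      x ∈ Algebra.adjoin K {elS K c, elU K c, elV K c, elW K c} :=
    fun x hx => Algebra.subset_adjoin hx
  refine add_mem (add_mem (h _ (by simp)) (pow_mem (h _ (by simp)) 2))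
    (mul_mem (mul_mem (Subalgebra.algebraMap_mem _ _) (h _ (by simp))) (h _ (by simp)))

/-- Newton's recurrence for power sums of two variables in terms of X₀ + X₁ and X₀X₁. -/
theorem pow_add_pow_mem (n : ℕ) : (Ideal.Quotient.mk _ (X 0) : CoordRing K c) ^ n +
    (Ideal.Quotient.mk _ (X 1) : CoordRing K c) ^ n ∈ basicAdjoin K c := by
  have hs : (Ideal.Quotient.mk _ (X 0) : CoordRing K c) + Ideal.Quotient.mk _ (X 1) ∈
      basicAdjoin K c :=
    mem_basicAdjoin (x := elS K c) (Algebra.subset_adjoin (by simp))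
  have hp : (Ideal.Quotient.mk _ (X 0) : CoordRing K c) * Ideal.Quotient.mk _ (X 1) ∈
      basicAdjoin K c := mem_basicAdjoin elP_mem_adjoin
  induction n using Nat.twoStepInduction with
  | zero => simpa using add_mem (one_mem (basicAdjoin K c)) (one_mem (basicAdjoin K c))
  | one => simpa using hs
  | more n h0 h1 =>
    have := sub_mem (mul_mem hs h1) (mul_mem hp h0)
    convert this using 1
    ring

theorem pow_mul_pow_add_mem (i j : ℕ) : (Ideal.Quotient.mk _ (X 0) : CoordRing K c) ^ i *
    (Ideal.Quotient.mk _ (X 1) : CoordRing K c) ^ j +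
    (Ideal.Quotient.mk _ (X 1) : CoordRing K c) ^ i *
    (Ideal.Quotient.mk _ (X 0) : CoordRing K c) ^ j ∈ basicAdjoin K c := by
  have hp : (Ideal.Quotient.mk _ (X 0) : CoordRing K c) * Ideal.Quotient.mk _ (X 1) ∈
      basicAdjoin K c := mem_basicAdjoin elP_mem_adjoin
  rcases le_total i j with h | h
  · obtain ⟨d, rfl⟩ := Nat.exists_eq_add_of_le h
    convert mul_mem (pow_mem hp i) (pow_add_pow_mem (K := K) (c := c) d) using 1
    ring
  · obtain ⟨d, rfl⟩ := Nat.exists_eq_add_of_le h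
    convert mul_mem (pow_mem hp j) (pow_add_pow_mem (K := K) (c := c) d) using 1
    ring

theorem mk_add_swap_mem (q : MvPolynomial (Fin 4) K) :
    (Ideal.Quotient.mk _ q : CoordRing K c) + swap K c (Ideal.Quotient.mk _ q) ∈
      basicAdjoin K c := by
  induction q using MvPolynomial.induction_on' with
  | add p q hp hq =>
    convert add_mem hp hq using 1
    rw [map_add, map_add]
    ring
  | monomial d a =>
    have hu : (Ideal.Quotient.mk _ (X 2) : CoordRing K c) ∈ basicAdjoin K c :=
      mem_basicAdjoin (x := elU K c) (Algebra.subset_adjoin (by simp))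
    have hv : (Ideal.Quotient.mk _ (X 3) : CoordRing K c) ∈ basicAdjoin K c :=
      mem_basicAdjoin (x := elV K c) (Algebra.subset_adjoin (by simp))
    have ha : (Ideal.Quotient.mk _ (C a) : CoordRing K c) ∈ basicAdjoin K c :=
      (basicAdjoin K c).algebraMap_mem a
    have hsa : swap K c (Ideal.Quotient.mk _ (C a)) = Ideal.Quotient.mk _ (C a) :=
      (swap K c).commutes a
    rw [monomial_eq, Finsupp.prod_fintype _ _ (by simp), Fin.prod_univ_four]
    simp only [map_mul, map_pow, swap_mk_X, Equiv.swap_apply_left, Equiv.swap_apply_right, hsa]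
    have h2 : Equiv.swap (0 : Fin 4) 1 2 = 2 := by decide
    have h3 : Equiv.swap (0 : Fin 4) 1 3 = 3 := by decide
    rw [h2, h3]
    convert mul_mem (mul_mem (mul_mem ha (pow_mem hu (d 2))) (pow_mem hv (d 3)))
      (pow_mul_pow_add_mem (K := K) (c := c) (d 0) (d 1)) using 1
    ring

/-- An invariant is half the sum of any lift and its image under the swap, and such sums are
polynomials in the symmetric functions of X₀, X₁ and in X₂, X₃. -/
theorem adjoin_eq_top [CharZero K] :
    Algebra.adjoin K {elS K c, elU K c, elV K c, elW K c} = ⊤ := by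
  rw [eq_top_iff]
  intro x _
  obtain ⟨q, hq⟩ := Ideal.Quotient.mk_surjective (x : CoordRing K c)
  have hx : swap K c x = x := x.2
  have h := mk_add_swap_mem (c := c) q
  rw [hq, hx] at h
  obtain ⟨y, hy, hyx⟩ := h
  have : y = x + x := Subtype.ext hyx
  rw [this] at hy
  have h2 := Subalgebra.smul_mem _ hy (2⁻¹ : K)
  have h3 : (2⁻¹ : K) • (x + x) = x := by
    rw [← two_smul K x, smul_smul, inv_mul_cancel₀ two_ne_zero, one_smul]
  rwa [h3] at h2

instance [CharZero K] : IsNoetherianRing (QuotRing K c) := by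
  have : Algebra.FiniteType K (QuotRing K c) :=
    by classical exact ⟨⟨{elS K c, elU K c, elV K c, elW K c}, by
      convert adjoin_eq_top (K := K) (c := c) using 2
      simp⟩⟩
  exact Algebra.FiniteType.isNoetherianRing K _

/-- The universal property of the ring of invariants. -/
theorem exists_lift [CharZero K] {D : Type*} [CommRing D] [IsDomain D] [Algebra K D] (S U V W : D)
    (h : 2 * W ^ 2 = (S ^ 2 + 2 * algebraMap K D c * U * V) ^ 2 -
      (U ^ 4 + 2 * algebraMap K D c ^ 2 * U ^ 2 * V ^ 2 + V ^ 4)) :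
    ∃ f : QuotRing K c →ₐ[K] D, f (elS K c) = S ∧ f (elU K c) = U ∧ f (elV K c) = V ∧
      f (elW K c) = W := by
  let Q := AlgebraicClosure (FractionRing D)
  let ι : D →ₐ[K] Q := IsScalarTower.toAlgHom K D Q
  have hι : Function.Injective ι := by
    change Function.Injective (algebraMap D Q)
    rw [IsScalarTower.algebraMap_eq D (FractionRing D) Q]
    exact (algebraMap (FractionRing D) Q).injective.comp (IsFractionRing.injective D _)
  -- Instead of computing the ideal of relations, recover a value ω for X₀ as a root of ω² - Sω + P
  -- in an algebraically closed field, with P the prescribed value of X₀X₁. The whole coordinate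
  -- ring then maps by X₀ ↦ ω, X₁ ↦ S - ω.
  obtain ⟨ω, hω⟩ : ∃ ω : Q, ω * (ι S - ω) = ι (W + S ^ 2 + algebraMap K D c * U * V) := by
    obtain ⟨ω, hω⟩ := IsAlgClosed.exists_root (Polynomial.X ^ 2 + Polynomial.C (-ι S) *
      Polynomial.X + Polynomial.C (ι (W + S ^ 2 + algebraMap K D c * U * V))) (by
        rw [show Polynomial.X ^ 2 + Polynomial.C (-ι S) * Polynomial.X + Polynomial.C
          (ι (W + S ^ 2 + algebraMap K D c * U * V)) = Polynomial.C (1 : Q) * Polynomial.X ^ 2 +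
          Polynomial.C (-ι S) * Polynomial.X + Polynomial.C
          (ι (W + S ^ 2 + algebraMap K D c * U * V)) by simp,
          Polynomial.degree_quadratic one_ne_zero]
        norm_num)
    refine ⟨ω, ?_⟩
    simp only [Polynomial.IsRoot.def, Polynomial.eval_add, Polynomial.eval_mul,
      Polynomial.eval_pow, Polynomial.eval_X, Polynomial.eval_C] at hω
    linear_combination -hω
  have hιc : ι (algebraMap K D c) = algebraMap K Q c := ι.commutes c
  let g : CoordRing K c →ₐ[K] Q := Ideal.Quotient.liftₐ _ (aeval ![ω, ι S - ω, ι U, ι V]) (by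
    intro q hq
    obtain ⟨q', rfl⟩ := Ideal.mem_span_singleton.1 hq
    rw [map_mul]
    convert zero_mul _
    simp only [poly, map_sub, map_add, map_mul, map_pow, aeval_X, aeval_C, Matrix.cons_val_zero,
      Matrix.cons_val_one, Matrix.cons_val, map_ofNat]
    have h' := congrArg ι h
    simp only [map_sub, map_add, map_mul, map_pow, map_ofNat, hιc] at h' hω
    linear_combination h' + (2 * ω * (ι S - ω) - 4 * ι S ^ 2 - 4 * algebraMap K Q c * ι U * ι V + 2 * (ι W + ι S ^ 2 + algebraMap K Q c * ι U * ι V)) * hω)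
  have hgX : ∀ j, g (Ideal.Quotient.mk _ (X j)) = ![ω, ι S - ω, ι U, ι V] j := fun j => by
    change aeval _ (X j) = _
    rw [aeval_X]
  let g' : QuotRing K c →ₐ[K] Q := g.comp (invariants (swap K c)).val
  have hs : g' (elS K c) = ι S := by
    change g (Ideal.Quotient.mk _ (X 0) + Ideal.Quotient.mk _ (X 1)) = _
    rw [map_add, hgX, hgX]
    simp
  have hu : g' (elU K c) = ι U := hgX 2
  have hv : g' (elV K c) = ι V := hgX 3
  have hp : g' (elP K c) = ι (W + S ^ 2 + algebraMap K D c * U * V) := by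
    change g (Ideal.Quotient.mk _ (X 0) * Ideal.Quotient.mk _ (X 1)) = _
    rw [map_mul, hgX, hgX, ← hω]
    simp
  have hw : g' (elW K c) = ι W := by
    rw [elW, map_sub, map_sub, hp, map_pow, hs, map_mul, map_mul, hu, hv, AlgHom.commutes, map_add,
      map_add, map_mul, map_mul, map_pow, hιc]
    ring
  -- The auxiliary root disappears on invariants: the generators land in `D`, hence so does
  -- everything else.
  have hrange : ∀ x, g' x ∈ ι.range := by
    intro x
    have hx : x ∈ Algebra.adjoin K {elS K c, elU K c, elV K c, elW K c} := by
      rw [adjoin_eq_top]; trivial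
    induction hx using Algebra.adjoin_induction with
    | mem x hx =>
      rcases hx with rfl | rfl | rfl | rfl
      · exact ⟨S, hs.symm⟩
      · exact ⟨U, hu.symm⟩
      · exact ⟨V, hv.symm⟩
      · exact ⟨W, hw.symm⟩
    | algebraMap r => rw [AlgHom.commutes]; exact Subalgebra.algebraMap_mem _ r
    | add x y _ _ hx hy => rw [map_add]; exact add_mem hx hy
    | mul x y _ _ hx hy => rw [map_mul]; exact mul_mem hx hy
  let f : QuotRing K c →ₐ[K] D :=
    ((AlgEquiv.ofInjective ι hι).symm : ι.range →ₐ[K] D).comp (g'.codRestrict ι.range hrange)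
  have hf : ∀ x, ι (f x) = g' x := by
    intro x
    exact congrArg Subtype.val ((AlgEquiv.ofInjective ι hι).apply_symm_apply
      (g'.codRestrict ι.range hrange x))
  exact ⟨f, hι ((hf _).trans hs), hι ((hf _).trans hu), hι ((hf _).trans hv),
    hι ((hf _).trans hw)⟩

end Generators

/-! ### Graded pieces of an algebra with homogeneous generators -/

section Grading

/-- A graded algebra generated by homogeneous elements has no smaller graded subalgebra that
contains them. -/
theorem mem_of_adjoin_eq_top {k R : Type*} [CommRing k] [CommRing R] [Algebra k R]
    (𝒜 : ℕ → Submodule k R) [GradedAlgebra 𝒜] {s : Set R} (hs : Algebra.adjoin k s = ⊤)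
    (M : ℕ → Submodule k R) (hM : ∀ n, M n ≤ 𝒜 n) (h1 : 1 ∈ M 0)
    (hmul : ∀ i j, ∀ x ∈ M i, ∀ y ∈ M j, x * y ∈ M (i + j)) (hsM : ∀ x ∈ s, ∃ n, x ∈ M n)
    {n : ℕ} {x : R} (hx : x ∈ 𝒜 n) : x ∈ M n := by
  have hmul' : ∀ x ∈ ⨆ n, M n, ∀ y ∈ ⨆ n, M n, x * y ∈ ⨆ n, M n := by
    intro x hx y hy
    induction hx using Submodule.iSup_induction' with
    | zero => simp
    | add a b _ _ ha hb => rw [add_mul]; exact add_mem ha hb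
    | mem i a ha =>
      induction hy using Submodule.iSup_induction' with
      | zero => simp
      | add a b _ _ ha hb => rw [mul_add]; exact add_mem ha hb
      | mem j b hb => exact Submodule.mem_iSup_of_mem (i + j) (hmul i j a ha b hb)
  have key : ∀ y : R, y ∈ ⨆ n, M n := by
    intro y
    have hy : y ∈ Algebra.adjoin k s := by rw [hs]; trivial
    induction hy using Algebra.adjoin_induction with
    | mem y hy =>
      obtain ⟨n, hn⟩ := hsM y hy
      exact Submodule.mem_iSup_of_mem n hn
    | algebraMap r =>
      rw [Algebra.algebraMap_eq_smul_one]
      exact Submodule.smul_mem _ _ (Submodule.mem_iSup_of_mem 0 h1)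
    | add x y _ _ hx hy => exact add_mem hx hy
    | mul x y _ _ hx hy => exact hmul' x hx y hy
  have key2 : ∀ y ∈ ⨆ n, M n, ∀ m, (DirectSum.decompose 𝒜 y m : R) ∈ M m := by
    intro y hy m
    induction hy using Submodule.iSup_induction' with
    | zero => simp
    | add a b _ _ ha hb => rw [DirectSum.decompose_add]; exact add_mem ha hb
    | mem i a ha =>
      by_cases him : i = m
      · subst him
        rw [DirectSum.decompose_of_mem_same _ (hM _ ha)]
        exact ha
      · rw [DirectSum.decompose_of_mem_ne _ (hM _ ha) him]
        exact Submodule.zero_mem _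
  have := key2 x (key x) n
  rwa [DirectSum.decompose_of_mem_same _ hx] at this

end Grading

end Dwork

/-! ### Abstract presentation of the quotient surface and its lines -/

namespace Dwork
open ProjDiv
open Algebra.TensorProduct (includeRight)

/-- A presentation of a graded algebra as the homogeneous coordinate ring of the quotient of the
Dwork quartic surface by the involution. -/
structure Presentation {K R : Type u} [Field K] [CommRing R] [Algebra K R]
    (𝒜 : ℕ → Submodule K R) (lam : K) where
  s : R
  u : R
  v : R
  w : R
  s_mem : s ∈ 𝒜 1
  u_mem : u ∈ 𝒜 1
  v_mem : v ∈ 𝒜 1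
  w_mem : w ∈ 𝒜 2
  equation : 2 * w ^ 2 = (s ^ 2 + 2 * algebraMap K R lam * u * v) ^ 2 -
    (u ^ 4 + 2 * algebraMap K R lam ^ 2 * u ^ 2 * v ^ 2 + v ^ 4)
  adjoin_eq_top : Algebra.adjoin K {s, u, v, w} = ⊤
  exists_lift : ∀ (D : Type u) [CommRing D] [IsDomain D] [Algebra K D] (S U V W : D),
    2 * W ^ 2 = (S ^ 2 + 2 * algebraMap K D lam * U * V) ^ 2 -
      (U ^ 4 + 2 * algebraMap K D lam ^ 2 * U ^ 2 * V ^ 2 + V ^ 4) →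
    ∃ f : R →ₐ[K] D, f s = S ∧ f u = U ∧ f v = V ∧ f w = W

/-- A line on the quotient surface, given by a form of degree one and a form of degree two. -/
structure IsLine {K R : Type u} [Field K] [CommRing R] [Algebra K R]
    (𝒜 : ℕ → Submodule K R) (ℓ π : R) : Prop where
  fst_mem : ℓ ∈ 𝒜 1
  snd_mem : π ∈ 𝒜 2
  isPrime : (Ideal.span {ℓ, π}).IsPrime
  isUniformizer : IsUniformizer (Ideal.span {ℓ, π}) ℓ
  isPrime_map : ∀ (B : Type u) [CommRing B] [IsDomain B] [Algebra K B],
    ((Ideal.span {ℓ, π}).map (includeRight : R →ₐ[K] B ⊗[K] R)).IsPrime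
  exists_notMem : ∃ y ∈ 𝒜 1, y ∉ Ideal.span {ℓ, π}

namespace Presentation

variable {K R : Type u} [Field K] [CommRing R] [IsDomain R] [Algebra K R]
  {𝒜 : ℕ → Submodule K R} [GradedAlgebra 𝒜] {lam : K} (M : Presentation 𝒜 lam)

theorem algebraMap_mul_mem {n : ℕ} (a : K) {x : R} (hx : x ∈ 𝒜 n) : algebraMap K R a * x ∈ 𝒜 n := by
  rw [← Algebra.smul_def]
  exact Submodule.smul_mem _ _ hx

theorem mul_mem_two {x y : R} (hx : x ∈ 𝒜 1) (hy : y ∈ 𝒜 1) : x * y ∈ 𝒜 2 :=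
  SetLike.mul_mem_graded hx hy

theorem sq_mem_two {x : R} (hx : x ∈ 𝒜 1) : x ^ 2 ∈ 𝒜 2 := by
  rw [pow_two]; exact mul_mem_two hx hx

/-- The form whose square is the right hand side of the equation up to a product of four linear
forms. -/
def A : R := M.s ^ 2 + 2 * algebraMap K R lam * M.u * M.v

theorem A_mem : M.A ∈ 𝒜 2 := by
  have h : M.A = M.s ^ 2 + algebraMap K R (2 * lam) * (M.u * M.v) := by
    rw [A, map_mul, map_ofNat]; ring
  rw [h]
  exact add_mem (sq_mem_two M.s_mem) (algebraMap_mul_mem _ (mul_mem_two M.u_mem M.v_mem))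

theorem exists_point [CharZero K] [IsAlgClosed K] (m n o : K) :
    ∃ f : R →ₐ[K] K, f M.s = m ∧ f M.u = n ∧ f M.v = o := by
  obtain ⟨q, hq⟩ := IsAlgClosed.exists_pow_nat_eq (((m ^ 2 + 2 * lam * n * o) ^ 2 -
    (n ^ 4 + 2 * lam ^ 2 * n ^ 2 * o ^ 2 + o ^ 4)) / 2) (n := 2) (by norm_num)
  obtain ⟨f, hs, hu, hv, -⟩ := M.exists_lift K m n o q (by
    rw [hq]
    simp only [Algebra.algebraMap_self, RingHom.id_apply]
    ring)
  exact ⟨f, hs, hu, hv⟩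

/-- Modulo the ideal, `J` is inverse to `ev` on the generators, so the ideal is exactly the kernel
of a surjection onto a polynomial ring in two variables. It remains prime after base change for this
reason, and `π * π' = ℓ * z` with `π'` outside makes `ℓ` a local generator. -/
theorem isLine_of_hom {ℓ π π' : R} (hℓ1 : ℓ ∈ 𝒜 1) (hπ2 : π ∈ 𝒜 2)
    (ev : R →ₐ[K] MvPolynomial (Fin 2) K)
    (J : MvPolynomial (Fin 2) K →ₐ[K] R) (hJ : ev.comp J = AlgHom.id K _)
    (hJ1 : J (MvPolynomial.X 1) ∈ 𝒜 1)
    (hℓ : ev ℓ = 0) (hπ : ev π = 0)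
    (hs : M.s - J (ev M.s) ∈ Ideal.span {ℓ, π}) (hu : M.u - J (ev M.u) ∈ Ideal.span {ℓ, π})
    (hv : M.v - J (ev M.v) ∈ Ideal.span {ℓ, π}) (hw : M.w - J (ev M.w) ∈ Ideal.span {ℓ, π})
    (hmul : ∃ z, π * π' = ℓ * z) (hπ' : ev π' ≠ 0) (hℓ0 : ℓ ≠ 0) : IsLine 𝒜 ℓ π := by
  have hle : Ideal.span {ℓ, π} ≤ RingHom.ker ev := by
    rw [Ideal.span_le]
    rintro x (rfl | rfl)
    · exact hℓ
    · exact hπ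
  have hker : RingHom.ker ev = Ideal.span {ℓ, π} := by
    refine le_antisymm (fun x hx => ?_) hle
    have hext : Ideal.Quotient.mkₐ K (Ideal.span {ℓ, π}) =
        (Ideal.Quotient.mkₐ K (Ideal.span {ℓ, π})).comp (J.comp ev) := by
      apply AlgHom.ext_of_adjoin_eq_top M.adjoin_eq_top
      rintro x (rfl | rfl | rfl | rfl) <;> exact Ideal.Quotient.eq.2 (by assumption)
    have h1 := DFunLike.congr_fun hext x
    have hx' : ev x = 0 := hx
    rw [AlgHom.comp_apply, AlgHom.comp_apply, hx', map_zero, map_zero] at h1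
    exact Ideal.Quotient.eq_zero_iff_mem.1 h1
  have hsurj : Function.Surjective ev := fun y => ⟨J y, DFunLike.congr_fun hJ y⟩
  have hprime : (Ideal.span {ℓ, π}).IsPrime := hker ▸ RingHom.ker_isPrime ev
  refine ⟨hℓ1, hπ2, hprime, ⟨Ideal.subset_span (by simp), hℓ0, fun x hx => ?_⟩, ?_,
    J (MvPolynomial.X 1), hJ1, fun h => ?_⟩
  · obtain ⟨a, b, rfl⟩ := Ideal.mem_span_pair.1 hx
    obtain ⟨z, hz⟩ := hmul
    exact ⟨π', fun h => hπ' (hle h), a * π' + b * z, by linear_combination b * hz⟩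
  · intro B _ _ _
    rw [← hker]
    have h := Algebra.TensorProduct.lTensor_ker (A := B) ev hsurj
    have h2 : (RingHom.ker ev).map (includeRight : R →ₐ[K] B ⊗[K] R) =
        RingHom.ker (Algebra.TensorProduct.map (AlgHom.id K B) ev) := h.symm
    rw [h2]
    have : IsDomain (B ⊗[K] MvPolynomial (Fin 2) K) :=
      MulEquiv.isDomain (MvPolynomial (Fin 2) B)
        (MvPolynomial.algebraTensorAlgEquiv K B (σ := Fin 2)).toMulEquiv
    exact RingHom.ker_isPrime _
  · have h2 : ev (J (MvPolynomial.X 1)) = 0 := hle h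
    have h3 : ev (J (MvPolynomial.X 1)) = MvPolynomial.X 1 := DFunLike.congr_fun hJ _
    rw [h3] at h2
    exact MvPolynomial.X_ne_zero _ h2

/-! ### Lines over u = bv -/

section TypeU

variable {b q : K}

/-- The `K`-points of a line of the first type. -/
theorem exists_point_u (hb : b ^ 4 + 2 * lam ^ 2 * b ^ 2 + 1 = 0) (hq : 2 * q ^ 2 = 1) (m n : K) :
    ∃ f : R →ₐ[K] K, f M.s = m ∧ f M.u = b * n ∧ f M.v = n ∧
      f M.w = q * (m ^ 2 + 2 * lam * b * n ^ 2) ∧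
      Ideal.span {M.u - algebraMap K R b * M.v, M.w - algebraMap K R q * M.A} ≤
        RingHom.ker f := by
  obtain ⟨f, hs, hu, hv, hw⟩ := M.exists_lift K m (b * n) n
    (q * (m ^ 2 + 2 * lam * b * n ^ 2)) (by
      simp only [Algebra.algebraMap_self, RingHom.id_apply]
      linear_combination (m ^ 2 + 2 * lam * b * n ^ 2) ^ 2 * hq + n ^ 4 * hb)
  refine ⟨f, hs, hu, hv, hw, ?_⟩
  rw [Ideal.span_le]
  rintro x (rfl | rfl)
  · change f _ = 0
    simp [hu, hv]
  · change f _ = 0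
    simp only [A, map_sub, map_add, map_mul, map_pow, AlgHom.commutes, map_ofNat, hs, hu, hv, hw,
      Algebra.algebraMap_self, RingHom.id_apply]
    ring

/-- The product is w² - A²/2 = -Q/2, and u - bv is a factor of Q because `b` is a root of the
quartic. -/
theorem exists_mul_u [CharZero K] (hb : b ^ 4 + 2 * lam ^ 2 * b ^ 2 + 1 = 0)
    (hq : 2 * q ^ 2 = 1) :
    ∃ z, (M.w - algebraMap K R q * M.A) * (M.w - algebraMap K R (-q) * M.A) =
      (M.u - algebraMap K R b * M.v) * z := by
  have hb' := congrArg (algebraMap K R) hb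
  have hq' := congrArg (algebraMap K R) hq
  have h2 : algebraMap K R 2⁻¹ * 2 = 1 := by
    rw [← map_ofNat (algebraMap K R) 2, ← map_mul, inv_mul_cancel₀ two_ne_zero, map_one]
  simp only [map_add, map_mul, map_pow, map_ofNat, map_one, map_zero] at hb' hq'
  refine ⟨-algebraMap K R 2⁻¹ * (M.u + algebraMap K R b * M.v) *
    (M.u ^ 2 + (2 * algebraMap K R lam ^ 2 + algebraMap K R b ^ 2) * M.v ^ 2), ?_⟩
  have he := M.equation
  rw [A, map_neg]
  linear_combination algebraMap K R 2⁻¹ * he - algebraMap K R 2⁻¹ *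
    (M.s ^ 2 + 2 * algebraMap K R lam * M.u * M.v) ^ 2 * hq' -
    algebraMap K R 2⁻¹ * M.v ^ 4 * hb' - (M.w ^ 2 - algebraMap K R q ^ 2 *
    (M.s ^ 2 + 2 * algebraMap K R lam * M.u * M.v) ^ 2) * h2

theorem isLine_u [CharZero K] [IsAlgClosed K] (hb : b ^ 4 + 2 * lam ^ 2 * b ^ 2 + 1 = 0) (hq : 2 * q ^ 2 = 1) :
    IsLine 𝒜 (M.u - algebraMap K R b * M.v) (M.w - algebraMap K R q * M.A) := by
  obtain ⟨ev, hs, hu, hv, hw⟩ := M.exists_lift (MvPolynomial (Fin 2) K) (MvPolynomial.X 0)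
    (algebraMap K _ b * MvPolynomial.X 1) (MvPolynomial.X 1)
    (algebraMap K _ q * (MvPolynomial.X 0 ^ 2 +
      2 * algebraMap K _ lam * algebraMap K _ b * MvPolynomial.X 1 ^ 2)) (by
      have hb' := congrArg (algebraMap K (MvPolynomial (Fin 2) K)) hb
      have hq' := congrArg (algebraMap K (MvPolynomial (Fin 2) K)) hq
      simp only [map_add, map_mul, map_pow, map_ofNat, map_one, map_zero] at hb' hq'
      linear_combination (MvPolynomial.X 0 ^ 2 +
        2 * algebraMap K _ lam * algebraMap K _ b * MvPolynomial.X 1 ^ 2) ^ 2 * hq' +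
        MvPolynomial.X 1 ^ 4 * hb')
  let J : MvPolynomial (Fin 2) K →ₐ[K] R := MvPolynomial.aeval ![M.s, M.v]
  have hJ0 : J (MvPolynomial.X 0) = M.s := by simp [J]
  have hJ1 : J (MvPolynomial.X 1) = M.v := by simp [J]
  have hl0 : M.u - algebraMap K R b * M.v ≠ 0 := by
    obtain ⟨f, -, hfu, hfv⟩ := M.exists_point 0 1 0
    exact fun h => by simpa [hfu, hfv] using congrArg f h
  refine M.isLine_of_hom (sub_mem M.u_mem (algebraMap_mul_mem _ M.v_mem))
    (sub_mem M.w_mem (algebraMap_mul_mem _ M.A_mem)) ev J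
    (π' := M.w - algebraMap K R (-q) * M.A) ?_ ?_ ?_ ?_ ?_ ?_ ?_ ?_ ?_ ?_ hl0
  · apply MvPolynomial.algHom_ext
    intro i
    fin_cases i
    · change ev (J (MvPolynomial.X 0)) = MvPolynomial.X 0
      rw [hJ0, hs]
    · change ev (J (MvPolynomial.X 1)) = MvPolynomial.X 1
      rw [hJ1, hv]
  · rw [hJ1]; exact M.v_mem
  · rw [map_sub, map_mul, hu, hv, AlgHom.commutes, sub_self]
  · simp only [A, map_sub, map_add, map_mul, map_pow, AlgHom.commutes, map_ofNat, hs, hu, hv, hw]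
    ring
  · rw [hs, hJ0, sub_self]; exact zero_mem _
  · rw [hu, map_mul, hJ1, AlgHom.commutes]; exact Ideal.subset_span (by simp)
  · rw [hv, hJ1, sub_self]; exact zero_mem _
  · rw [hw]
    simp only [map_add, map_mul, map_pow, hJ0, hJ1, AlgHom.commutes, map_ofNat]
    refine Ideal.mem_span_pair.2 ⟨algebraMap K R q * 2 * algebraMap K R lam * M.v, 1, ?_⟩
    rw [A]; ring
  · exact M.exists_mul_u hb hq
  · intro h
    have h2 := congrArg (MvPolynomial.aeval ![(1 : K), 0]) h
    simp only [A, map_sub, map_neg, map_add, map_mul, map_pow, AlgHom.commutes, map_ofNat, hs, hu,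
      hv, hw, MvPolynomial.aeval_X, map_zero] at h2
    simp only [Matrix.cons_val_zero, Matrix.cons_val_one, Algebra.algebraMap_self,
      RingHom.id_apply] at h2
    have h3 : 2 * q = 0 := by linear_combination h2
    have h4 : q = 0 := by simpa using h3
    rw [h4] at hq
    norm_num at hq

end TypeU

/-! ### Lines over s = k₁u + k₂v -/

section TypeS

variable {k₁ k₂ q₀ q₁ q₂ : K}

/-- The condition for the quadratic form `q₀ U² + q₁ U V + q₂ V²` to be a square root of the right
hand side of the equation on the line `S = k₁ U + k₂ V`. -/
def IsRootOn (lam k₁ k₂ q₀ q₁ q₂ : K) : Prop :=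
  ∀ (D : Type u) [CommRing D] [Algebra K D] (U V : D),
    2 * (algebraMap K D q₀ * U ^ 2 + algebraMap K D q₁ * U * V + algebraMap K D q₂ * V ^ 2) ^ 2 =
      ((algebraMap K D k₁ * U + algebraMap K D k₂ * V) ^ 2 +
        2 * algebraMap K D lam * U * V) ^ 2 -
      (U ^ 4 + 2 * algebraMap K D lam ^ 2 * U ^ 2 * V ^ 2 + V ^ 4)

/-- The binary quadratic form with the given coefficients. -/
def quad (q₀ q₁ q₂ : K) : R :=
  algebraMap K R q₀ * M.u ^ 2 + algebraMap K R q₁ * M.u * M.v + algebraMap K R q₂ * M.v ^ 2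

theorem quad_mem : M.quad q₀ q₁ q₂ ∈ 𝒜 2 := by
  rw [quad, mul_assoc (algebraMap K R q₁)]
  exact add_mem (add_mem (algebraMap_mul_mem _ (sq_mem_two M.u_mem))
    (algebraMap_mul_mem _ (mul_mem_two M.u_mem M.v_mem)))
    (algebraMap_mul_mem _ (sq_mem_two M.v_mem))

/-- A linear form that does not vanish at `(1 : 0 : 0)`. -/
def lin (k₁ k₂ : K) : R := M.s - algebraMap K R k₁ * M.u - algebraMap K R k₂ * M.v

theorem lin_mem : M.lin k₁ k₂ ∈ 𝒜 1 :=
  sub_mem (sub_mem M.s_mem (algebraMap_mul_mem _ M.u_mem)) (algebraMap_mul_mem _ M.v_mem)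

/-- The `K`-points of a line of the second type. -/
theorem exists_point_s (h : IsRootOn lam k₁ k₂ q₀ q₁ q₂) (m n : K) :
    ∃ f : R →ₐ[K] K, f M.s = k₁ * m + k₂ * n ∧ f M.u = m ∧ f M.v = n ∧
      f M.w = q₀ * m ^ 2 + q₁ * m * n + q₂ * n ^ 2 ∧
      Ideal.span {M.lin k₁ k₂, M.w - M.quad q₀ q₁ q₂} ≤ RingHom.ker f := by
  obtain ⟨f, hs, hu, hv, hw⟩ := M.exists_lift K (k₁ * m + k₂ * n) m n
    (q₀ * m ^ 2 + q₁ * m * n + q₂ * n ^ 2) (by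
      have := h K m n
      simpa only [Algebra.algebraMap_self, RingHom.id_apply] using this)
  refine ⟨f, hs, hu, hv, hw, ?_⟩
  rw [Ideal.span_le]
  rintro x (rfl | rfl)
  · change f _ = 0
    simp only [lin, map_sub, map_mul, AlgHom.commutes, hs, hu, hv, Algebra.algebraMap_self,
      RingHom.id_apply]
    ring
  · change f _ = 0
    simp only [quad, map_sub, map_add, map_mul, map_pow, AlgHom.commutes, hu, hv, hw,
      Algebra.algebraMap_self, RingHom.id_apply]
    ring

theorem exists_factor_s {D : Type u} [CommRing D] [Algebra K D] (S U V : D) :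
    ∃ z, (S ^ 2 + 2 * algebraMap K D lam * U * V) ^ 2 -
      ((algebraMap K D k₁ * U + algebraMap K D k₂ * V) ^ 2 + 2 * algebraMap K D lam * U * V) ^ 2 =
      (S - algebraMap K D k₁ * U - algebraMap K D k₂ * V) * z :=
  ⟨(S + (algebraMap K D k₁ * U + algebraMap K D k₂ * V)) * (S ^ 2 +
    (algebraMap K D k₁ * U + algebraMap K D k₂ * V) ^ 2 + 4 * algebraMap K D lam * U * V), by ring⟩

theorem exists_mul_s [CharZero K] (h : IsRootOn lam k₁ k₂ q₀ q₁ q₂) :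
    ∃ z, (M.w - M.quad q₀ q₁ q₂) * (M.w - M.quad (-q₀) (-q₁) (-q₂)) = M.lin k₁ k₂ * z := by
  obtain ⟨z, hz⟩ := exists_factor_s (lam := lam) (k₁ := k₁) (k₂ := k₂) M.s M.u M.v
  have h2 : algebraMap K R 2⁻¹ * 2 = 1 := by
    rw [← map_ofNat (algebraMap K R) 2, ← map_mul, inv_mul_cancel₀ two_ne_zero, map_one]
  refine ⟨algebraMap K R 2⁻¹ * z, ?_⟩
  have := h R M.u M.v
  rw [quad, quad, lin, map_neg, map_neg, map_neg]
  linear_combination algebraMap K R 2⁻¹ * (M.equation - this + hz) - (M.w ^ 2 -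
    (algebraMap K R q₀ * M.u ^ 2 + algebraMap K R q₁ * M.u * M.v +
      algebraMap K R q₂ * M.v ^ 2) ^ 2) * h2

/-- The assumption `hne` says that the square root on the line is a nonzero form. The opposite root
then differs from it, which provides the factor outside the ideal. -/
theorem isLine_s [CharZero K] [IsAlgClosed K] (h : IsRootOn lam k₁ k₂ q₀ q₁ q₂)
    (hne : ∃ m n : K, q₀ * m ^ 2 + q₁ * m * n + q₂ * n ^ 2 ≠ 0) :
    IsLine 𝒜 (M.lin k₁ k₂) (M.w - M.quad q₀ q₁ q₂) := by
  obtain ⟨ev, hs, hu, hv, hw⟩ := M.exists_lift (MvPolynomial (Fin 2) K)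
    (algebraMap K _ k₁ * MvPolynomial.X 0 + algebraMap K _ k₂ * MvPolynomial.X 1)
    (MvPolynomial.X 0) (MvPolynomial.X 1)
    (algebraMap K _ q₀ * MvPolynomial.X 0 ^ 2 + algebraMap K _ q₁ * MvPolynomial.X 0 *
      MvPolynomial.X 1 + algebraMap K _ q₂ * MvPolynomial.X 1 ^ 2) (h _ _ _)
  let J : MvPolynomial (Fin 2) K →ₐ[K] R := MvPolynomial.aeval ![M.u, M.v]
  have hJ0 : J (MvPolynomial.X 0) = M.u := by simp [J]
  have hJ1 : J (MvPolynomial.X 1) = M.v := by simp [J]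
  obtain ⟨m, n, hmn⟩ := hne
  have hl0 : M.lin k₁ k₂ ≠ 0 := by
    obtain ⟨f, hfs, hfu, hfv⟩ := M.exists_point 1 0 0
    exact fun h => by simpa [lin, hfs, hfu, hfv] using congrArg f h
  refine M.isLine_of_hom M.lin_mem (sub_mem M.w_mem M.quad_mem) ev J
    (π' := M.w - M.quad (-q₀) (-q₁) (-q₂)) ?_ ?_ ?_ ?_ ?_ ?_ ?_ ?_ ?_ ?_ hl0
  · apply MvPolynomial.algHom_ext
    intro i
    fin_cases i
    · change ev (J (MvPolynomial.X 0)) = MvPolynomial.X 0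
      rw [hJ0, hu]
    · change ev (J (MvPolynomial.X 1)) = MvPolynomial.X 1
      rw [hJ1, hv]
  · rw [hJ1]; exact M.v_mem
  · simp only [lin, map_sub, map_mul, hs, hu, hv, AlgHom.commutes]
    ring
  · simp only [quad, map_sub, map_add, map_mul, map_pow, AlgHom.commutes, hu, hv, hw]
    ring
  · rw [hs, map_add, map_mul, map_mul, hJ0, hJ1, AlgHom.commutes, AlgHom.commutes, ← sub_sub]
    exact Ideal.subset_span (by simp [lin])
  · rw [hu, hJ0, sub_self]; exact zero_mem _
  · rw [hv, hJ1, sub_self]; exact zero_mem _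
  · rw [hw]
    simp only [map_add, map_mul, map_pow, hJ0, hJ1, AlgHom.commutes]
    exact Ideal.subset_span (by simp [quad])
  · exact M.exists_mul_s h
  · intro h0
    have h2 := congrArg (MvPolynomial.aeval ![m, n]) h0
    simp only [quad, map_sub, map_neg, map_add, map_mul, map_pow, AlgHom.commutes, hu, hv, hw,
      MvPolynomial.aeval_X, map_zero] at h2
    simp only [Matrix.cons_val_zero, Matrix.cons_val_one, Algebra.algebraMap_self,
      RingHom.id_apply] at h2
    apply hmn
    have h3 : 2 * (q₀ * m ^ 2 + q₁ * m * n + q₂ * n ^ 2) = 0 := by linear_combination h2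
    simpa using h3

end TypeS

end Presentation

end Dwork

namespace Dwork
open ProjDiv

/-! ### Lines as prime divisors -/

section Lines

variable {K R : Type u} [Field K] [CommRing R] [IsDomain R] [Algebra K R]
  {𝒜 : ℕ → Submodule K R} [GradedAlgebra 𝒜] [IsNoetherianRing R]

/-- A line as a prime divisor. -/
noncomputable def IsLine.divisor {ℓ π : R} (h : IsLine 𝒜 ℓ π) : PrimeDivisor 𝒜 where
  point :=
    { asHomogeneousIdeal := ⟨Ideal.span {ℓ, π}, Ideal.homogeneous_span _ _ (by
        rintro x (rfl | rfl)
        · exact ⟨1, h.fst_mem⟩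
        · exact ⟨2, h.snd_mem⟩)⟩
      isPrime := h.isPrime
      not_irrelevant_le := fun hle => by
        obtain ⟨y, hy, hyn⟩ := h.exists_notMem
        refine hyn (hle ?_)
        rw [HomogeneousIdeal.mem_irrelevant_iff]
        simp only [GradedRing.proj_apply]
        rw [DirectSum.decompose_of_mem_ne 𝒜 hy one_ne_zero] }
  height_eq_one := by
    have := h.isPrime
    exact h.isUniformizer.height_eq_one

theorem IsLine.divisor_ideal {ℓ π : R} (h : IsLine 𝒜 ℓ π) :
    h.divisor.ideal = Ideal.span {ℓ, π} := rfl

theorem IsLine.eq_divisor {ℓ π : R} (h : IsLine 𝒜 ℓ π) {Q : PrimeDivisor 𝒜}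
    (hQ : Ideal.span {ℓ, π} ≤ Q.ideal) : h.divisor = Q := by
  have := h.isPrime
  refine PrimeDivisor.ext_ideal (Q.eq_of_le (fun h0 => h.isUniformizer.ne_zero ?_) hQ)
  have hm : ℓ ∈ h.divisor.ideal := h.isUniformizer.mem
  rwa [h0, Ideal.mem_bot] at hm

theorem IsLine.ne_of_notMem {ℓ π : R} (h : IsLine 𝒜 ℓ π) {Q : PrimeDivisor 𝒜}
    (hQ : ℓ ∉ Q.ideal) : h.divisor ≠ Q := by
  rintro rfl
  exact hQ h.isUniformizer.mem

theorem onPrime_divisor {G : Type u} [Group G] [MulSemiringAction G K] (α : SemiAction G 𝒜) (g : G)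
    {ℓ π ℓ' π' : R} (h : IsLine 𝒜 ℓ π) (h' : IsLine 𝒜 ℓ' π') (hℓ : α.act g ℓ = ℓ')
    (hπ : α.act g π = π') : (α.semiAut g).onPrime h.divisor = h'.divisor := by
  apply PrimeDivisor.ext_ideal
  change (Ideal.span {ℓ, π}).map (α.act g : R →+* R) = Ideal.span {ℓ', π'}
  rw [Ideal.map_span, Set.image_pair, ← hℓ, ← hπ]
  rfl

/-- The two lines cut out by a linear form that is tangent to the branch curve at two points. -/
structure IsLinePair (𝒜 : ℕ → Submodule K R) (ℓ π π' : R) : Prop where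
  fst : IsLine 𝒜 ℓ π
  snd : IsLine 𝒜 ℓ π'
  exists_mul : ∃ z, π * π' = ℓ * z
  notMem : π' ∉ Ideal.span {ℓ, π}

theorem IsLinePair.ne {ℓ π π' : R} (h : IsLinePair 𝒜 ℓ π π') : h.fst.divisor ≠ h.snd.divisor := by
  intro h0
  apply h.notMem
  rw [← h.fst.divisor_ideal, h0, h.snd.divisor_ideal]
  exact Ideal.subset_span (by simp)

variable (hR : ∀ P : PrimeDivisor 𝒜, IsDiscreteValuationRing (Localization.AtPrime P.ideal))

/-- The form `ℓ` is a uniformizer on each of the two lines, and a prime containing `ℓ` contains `π *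
π'`, hence one of the lines. -/
theorem IsLinePair.divisorOf_eq {ℓ π π' : R} (h : IsLinePair 𝒜 ℓ π π') :
    divisorOf hR ℓ h.fst.isUniformizer.ne_zero =
      Finsupp.single h.fst.divisor 1 + Finsupp.single h.snd.divisor 1 := by
  ext Q
  have := hR Q
  rw [divisorOf_apply, Finsupp.add_apply]
  by_cases h1 : h.fst.divisor = Q
  · subst h1
    rw [Finsupp.single_eq_same, Finsupp.single_eq_of_ne h.ne]
    have hu : IsUniformizer h.fst.divisor.ideal ℓ := h.fst.isUniformizer
    rw [hu.ordAt_eq_one]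
    rfl
  by_cases h2 : h.snd.divisor = Q
  · subst h2
    rw [Finsupp.single_eq_same, Finsupp.single_eq_of_ne h.ne.symm]
    have hu : IsUniformizer h.snd.divisor.ideal ℓ := h.snd.isUniformizer
    rw [hu.ordAt_eq_one]
    rfl
  · rw [Finsupp.single_eq_of_ne (Ne.symm h1), Finsupp.single_eq_of_ne (Ne.symm h2),
      ordAt_eq_zero_iff.2]
    · rfl
    intro hℓ
    obtain ⟨z, hz⟩ := h.exists_mul
    have h3 : π * π' ∈ Q.ideal := by rw [hz]; exact Ideal.mul_mem_right _ _ hℓ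
    rcases Ideal.IsPrime.mem_or_mem inferInstance h3 with h4 | h4
    · exact h1 (h.fst.eq_divisor (by
        rw [Ideal.span_le]
        rintro x (rfl | rfl) <;> assumption))
    · exact h2 (h.snd.eq_divisor (by
        rw [Ideal.span_le]
        rintro x (rfl | rfl) <;> assumption))

/-- The divisor of a form that, times its conjugate, is a product of linear forms that cut out
pairs of lines. -/
theorem divisorOf_eq_sum {ι : Type*} [Fintype ι] {ℓ π π' : ι → R}
    (h : ∀ i, IsLinePair 𝒜 (ℓ i) (π i) (π' i)) {θ θ' : R} (hθ0 : θ ≠ 0) {t : K} (ht : t ≠ 0)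
    (hθ : θ * θ' = algebraMap K R t * ∏ i, ℓ i)
    (hmem : ∀ i, θ ∈ Ideal.span {ℓ i, π i}) (hmem' : ∀ i, θ' ∈ Ideal.span {ℓ i, π' i})
    (hne : ∀ i j, i ≠ j → (h i).fst.divisor ≠ (h j).fst.divisor)
    (hne' : ∀ i j, i ≠ j → (h i).fst.divisor ≠ (h j).snd.divisor)
    (hne'' : ∀ i j, i ≠ j → (h i).snd.divisor ≠ (h j).snd.divisor) :
    divisorOf hR θ hθ0 = ∑ i, Finsupp.single (h i).fst.divisor 1 := by
  classical
  have h0 : ∀ i, ℓ i ≠ 0 := fun i => (h i).fst.isUniformizer.ne_zero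
  have hθ0' : θ' ≠ 0 := by
    rintro rfl
    rw [mul_zero] at hθ
    exact mul_ne_zero ((FaithfulSMul.algebraMap_eq_zero_iff K R).not.2 ht)
      (Finset.prod_ne_zero_iff.2 fun i _ => h0 i) hθ.symm
  -- The divisors of `θ` and `θ'` together are all the lines over the forms `ℓ i`, each with
  -- multiplicity one. It remains to decide how they are shared out.
  have key : divisorOf hR θ hθ0 + divisorOf hR θ' hθ0' =
      ∑ i, (Finsupp.single (h i).fst.divisor 1 + Finsupp.single (h i).snd.divisor 1) := by
    simp_rw [← fun i => (h i).divisorOf_eq hR]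
    ext Q
    have := hR Q
    rw [← divisorOf_mul, divisorOf_apply, Finsupp.finsetSum_apply]
    simp_rw [divisorOf_apply]
    rw [hθ, ordAt_mul, ordAt_prod, ordAt_eq_zero_iff.2, zero_add, ← Nat.cast_sum]
    · congr 1
      have : ∑ i, ordAt Q.ideal (ℓ i) = ((∑ i, (ordAt Q.ideal (ℓ i)).toNat : ℕ) : ℕ∞) := by
        rw [Nat.cast_sum]
        exact Finset.sum_congr rfl fun i _ => (ordAt_toNat (h0 i)).symm
      rw [this]
      rfl
    · have := algebraMap_notMem Q ht (Ideal.IsPrime.one_notMem inferInstance)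
      rwa [mul_one] at this
  have hnn : ∀ {f : R} (hf : f ≠ 0) Q, 0 ≤ divisorOf hR f hf Q := fun hf Q => by
    rw [divisorOf_apply]; positivity
  have hpos : ∀ {f : R} (hf : f ≠ 0) (Q : PrimeDivisor 𝒜), f ∈ Q.ideal →
      1 ≤ divisorOf hR f hf Q := fun {f} hf Q hfQ => by
    have := hR Q
    have h1 : divisorOf hR f hf Q ≠ 0 := by
      rw [divisorOf_apply, Nat.cast_ne_zero, Ne, ENat.toNat_eq_zero, not_or]
      exact ⟨fun h => (ordAt_eq_zero_iff.1 h) hfQ, mt ordAt_eq_top_iff.1 hf⟩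
    have := hnn hf Q
    omega
  ext Q
  have hk := DFunLike.congr_fun key Q
  rw [Finsupp.add_apply, Finset.sum_add_distrib, Finsupp.add_apply, Finsupp.finsetSum_apply,
    Finsupp.finsetSum_apply] at hk
  rw [Finsupp.finsetSum_apply]
  by_cases h1 : ∃ i, (h i).fst.divisor = Q
  · obtain ⟨i, rfl⟩ := h1
    have e1 : ∑ j, (Finsupp.single (h j).fst.divisor (1 : ℤ)) (h i).fst.divisor = 1 := by
      rw [Finset.sum_eq_single i, Finsupp.single_eq_same]
      · exact fun j _ hj => Finsupp.single_eq_of_ne (hne i j (Ne.symm hj))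
      · simp
    have e2 : ∑ j, (Finsupp.single (h j).snd.divisor (1 : ℤ)) (h i).fst.divisor = 0 := by
      refine Finset.sum_eq_zero fun j _ => Finsupp.single_eq_of_ne ?_
      by_cases hij : i = j
      · subst hij; exact (h i).ne
      · exact hne' i j hij
    -- The total multiplicity along this line is one and `θ` already vanishes on it, so `θ'` takes
    -- no part of it.
    have := hpos hθ0 (h i).fst.divisor (hmem i)
    have := hnn hθ0' (h i).fst.divisor
    rw [e1, e2] at hk
    rw [e1]
    omega
  · push Not at h1
    have e1 : ∑ j, (Finsupp.single (h j).fst.divisor (1 : ℤ)) Q = 0 :=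
      Finset.sum_eq_zero fun j _ => Finsupp.single_eq_of_ne (Ne.symm (h1 j))
    have := hnn hθ0 Q
    have := hnn hθ0' Q
    rw [e1] at hk ⊢
    by_cases h2 : ∃ i, (h i).snd.divisor = Q
    · obtain ⟨i, rfl⟩ := h2
      have e2 : ∑ j, (Finsupp.single (h j).snd.divisor (1 : ℤ)) (h i).snd.divisor = 1 := by
        rw [Finset.sum_eq_single i, Finsupp.single_eq_same]
        · exact fun j _ hj => Finsupp.single_eq_of_ne (hne'' i j (Ne.symm hj))
        · simp
      have := hpos hθ0' (h i).snd.divisor (hmem' i)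
      rw [e2] at hk
      omega
    · push Not at h2
      have e2 : ∑ j, (Finsupp.single (h j).snd.divisor (1 : ℤ)) Q = 0 :=
        Finset.sum_eq_zero fun j _ => Finsupp.single_eq_of_ne (Ne.symm (h2 j))
      rw [e2] at hk
      omega

end Lines

end Dwork

/-! ### The irrational constants and relations between them -/

namespace Dwork
open ProjDiv

/-- The irrationalities over which the lines are defined. -/
structure Constants {K : Type u} [Field K] (lam : K) where
  al : K
  be : K
  r : K
  i : K
  c : K
  c' : K
  k : K
  al_sq : al ^ 2 = 1 - lam ^ 2
  be_sq : be ^ 2 = -1 - lam ^ 2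
  r_sq : r ^ 2 = 2
  i_sq : i ^ 2 = -1
  c_mul : c * c' = 1
  c_eq : (2 + r * al) * c + 4 * lam + (2 - r * al) * c' = 0
  k_sq : 2 * k ^ 2 = c + c'
  lam_ne : lam ^ 4 ≠ 1

namespace Constants

variable {K : Type u} [Field K] [CharZero K] {lam : K} (C : Constants lam)

/-- The constants c, c' = 1/c and k are dictated by the conic bundle. For x = A - rw one needs 2A -
c'(u + av)(u + a'v) - c(u - av)(u - a'v) = 2(s² - k²(u + v)²). Comparing the coefficients of u² and
v² gives 2k² = c + c', and that of uv gives the equation `c_eq`, because a + a' = r·al. After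
multiplication by c the latter is a quadratic equation for c. -/
theorem nonempty [IsAlgClosed K] (h : lam ^ 4 ≠ 1) : Nonempty (Constants lam) := by
  obtain ⟨al, hal⟩ := IsAlgClosed.exists_pow_nat_eq (1 - lam ^ 2) (n := 2) (by norm_num)
  obtain ⟨be, hbe⟩ := IsAlgClosed.exists_pow_nat_eq (-1 - lam ^ 2) (n := 2) (by norm_num)
  obtain ⟨r, hr⟩ := IsAlgClosed.exists_pow_nat_eq (2 : K) (n := 2) (by norm_num)
  obtain ⟨i, hi⟩ := IsAlgClosed.exists_pow_nat_eq (-1 : K) (n := 2) (by norm_num)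
  -- The product of the outer coefficients is 2(λ² + 1), so the equation is genuinely quadratic and
  -- zero is not a root.
  have key : (2 + r * al) * (2 - r * al) ≠ 0 := by
    intro h0
    apply h
    have : 2 * (lam ^ 2 + 1) = 0 := by linear_combination h0 + al ^ 2 * hr + 2 * hal
    have : lam ^ 2 + 1 = 0 := by simpa using this
    linear_combination (lam ^ 2 - 1) * this
  obtain ⟨h1, h2⟩ := mul_ne_zero_iff.1 key
  obtain ⟨c, hc⟩ := IsAlgClosed.exists_root (Polynomial.C (2 + r * al) * Polynomial.X ^ 2 +
    Polynomial.C (4 * lam) * Polynomial.X + Polynomial.C (2 - r * al)) (by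
      rw [Polynomial.degree_quadratic h1]; norm_num)
  simp only [Polynomial.IsRoot.def, Polynomial.eval_add, Polynomial.eval_mul,
    Polynomial.eval_pow, Polynomial.eval_X, Polynomial.eval_C] at hc
  have hc0 : c ≠ 0 := by
    rintro rfl
    exact h2 (by linear_combination hc)
  obtain ⟨k, hk⟩ := IsAlgClosed.exists_pow_nat_eq ((c + c⁻¹) / 2) (n := 2) (by norm_num)
  refine ⟨⟨al, be, r, i, c, c⁻¹, k, hal, hbe, hr, hi, mul_inv_cancel₀ hc0, ?_, ?_, h⟩⟩
  · field_simp
    linear_combination hc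
  · rw [hk]; ring

/-- The root of `b⁴ + 2 lam² b² + 1` with the given signs. -/
def root (x y : K) : K := (x * C.al + y * C.be) * C.r / 2

/-- For signs x, y the square of the root is xy·al·be - λ², and (al·be)² = λ⁴ - 1: this is the
quadratic formula for b². -/
theorem root_eq {x y : K} (hx : x ^ 2 = 1) (hy : y ^ 2 = 1) :
    C.root x y ^ 4 + 2 * lam ^ 2 * C.root x y ^ 2 + 1 = 0 := by
  have h1 : C.root x y ^ 2 = x * y * C.al * C.be - lam ^ 2 := by
    rw [root]
    linear_combination (x * C.al + y * C.be) ^ 2 / 4 * C.r_sq + C.al ^ 2 / 2 * hx +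
      C.be ^ 2 / 2 * hy + C.al_sq / 2 + C.be_sq / 2
  have h2 : (x * y * C.al * C.be) ^ 2 = lam ^ 4 - 1 := by
    linear_combination y ^ 2 * C.al ^ 2 * C.be ^ 2 * hx + C.al ^ 2 * C.be ^ 2 * hy +
      C.be ^ 2 * C.al_sq + (1 - lam ^ 2) * C.be_sq
  linear_combination (C.root x y ^ 2 + x * y * C.al * C.be + lam ^ 2) * h1 + h2

/-- The constant `a` such that the four linear forms are `u ± a v` and `u ± a⁻¹ v`. -/
def a : K := (C.al + C.be) * C.r / 2

/-- The inverse of `a`. -/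
def a' : K := (C.al - C.be) * C.r / 2

theorem a_mul : C.a * C.a' = 1 := by
  rw [a, a']
  linear_combination (C.al ^ 2 - C.be ^ 2) / 4 * C.r_sq + C.al_sq / 2 - C.be_sq / 2

theorem a_sq : C.a ^ 2 = C.al * C.be - lam ^ 2 := by
  rw [a]
  linear_combination (C.al + C.be) ^ 2 / 4 * C.r_sq + C.al_sq / 2 + C.be_sq / 2

theorem a'_sq : C.a' ^ 2 = -(C.al * C.be) - lam ^ 2 := by
  rw [a']
  linear_combination (C.al - C.be) ^ 2 / 4 * C.r_sq + C.al_sq / 2 + C.be_sq / 2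

theorem a_add : C.a + C.a' = C.r * C.al := by rw [a, a']; ring

theorem albe_sq : (C.al * C.be) ^ 2 = lam ^ 4 - 1 := by
  linear_combination C.be ^ 2 * C.al_sq + (1 - lam ^ 2) * C.be_sq

theorem quartic {b : K} (hb : b = C.a ∨ b = -C.a ∨ b = C.a' ∨ b = -C.a') :
    b ^ 4 + 2 * lam ^ 2 * b ^ 2 + 1 = 0 := by
  rcases hb with rfl | rfl | rfl | rfl
  · linear_combination (C.a ^ 2 + C.al * C.be + lam ^ 2) * C.a_sq + C.albe_sq
  · linear_combination (C.a ^ 2 + C.al * C.be + lam ^ 2) * C.a_sq + C.albe_sq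
  · linear_combination (C.a' ^ 2 - C.al * C.be + lam ^ 2) * C.a'_sq + C.albe_sq
  · linear_combination (C.a' ^ 2 - C.al * C.be + lam ^ 2) * C.a'_sq + C.albe_sq

theorem al_ne : C.al ≠ 0 := by
  intro h
  have := C.al_sq
  apply C.lam_ne
  rw [h] at this
  linear_combination (1 + lam ^ 2) * this

theorem be_ne : C.be ≠ 0 := by
  intro h
  have := C.be_sq
  apply C.lam_ne
  rw [h] at this
  linear_combination (lam ^ 2 - 1) * this

theorem r_ne : C.r ≠ 0 := by
  intro h
  have := C.r_sq
  rw [h] at this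
  norm_num at this

theorem a_ne : C.a ≠ 0 := left_ne_zero_of_mul (by rw [C.a_mul]; exact one_ne_zero)
theorem a'_ne : C.a' ≠ 0 := right_ne_zero_of_mul (by rw [C.a_mul]; exact one_ne_zero)
theorem c_ne : C.c ≠ 0 := left_ne_zero_of_mul (by rw [C.c_mul]; exact one_ne_zero)
theorem c'_ne : C.c' ≠ 0 := right_ne_zero_of_mul (by rw [C.c_mul]; exact one_ne_zero)

theorem a_add_ne : C.a + C.a' ≠ 0 := by
  rw [C.a_add]; exact mul_ne_zero C.r_ne C.al_ne

theorem a_sub_ne : C.a - C.a' ≠ 0 := by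
  have : C.a - C.a' = C.r * C.be := by rw [a, a']; ring
  rw [this]; exact mul_ne_zero C.r_ne C.be_ne

/-- If c were 1 or -1, then c' = c and `c_eq` would force λ = -1 or λ = 1. Needed because c - c'
occurs in the leading coefficient that separates the two lines over s = k(u + v). -/
theorem c_sq_ne : C.c ^ 2 ≠ 1 := by
  intro h
  have h1 : (C.c - 1) * (C.c + 1) = 0 := by linear_combination h
  have h2 := C.c_eq
  have h3 := C.c_mul
  rcases mul_eq_zero.1 h1 with h | h
  · have h4 : C.c = 1 := by linear_combination h
    rw [h4, one_mul] at h3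
    rw [h3, h4] at h2
    have : (4 : K) * (lam + 1) = 0 := by linear_combination h2
    have : lam + 1 = 0 := by simpa using this
    apply C.lam_ne
    linear_combination (lam ^ 2 + 1) * (lam - 1) * this
  · have h4 : C.c = -1 := by linear_combination h
    rw [h4] at h3
    have h5 : C.c' = -1 := by linear_combination -h3
    rw [h5, h4] at h2
    have : (4 : K) * (lam - 1) = 0 := by linear_combination h2
    have : lam - 1 = 0 := by simpa using this
    apply C.lam_ne
    linear_combination (lam ^ 2 + 1) * (lam + 1) * this

theorem half_r : 2 * (C.r / 2) ^ 2 = 1 := by linear_combination C.r_sq / 2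

theorem half_neg_r : 2 * (-(C.r / 2)) ^ 2 = 1 := by linear_combination C.r_sq / 2

end Constants

/-! ### Pairs of lines in the three families -/

namespace Presentation

variable {K R : Type u} [Field K] [CharZero K] [IsAlgClosed K] [CommRing R] [IsDomain R]
  [Algebra K R] [IsNoetherianRing R] {𝒜 : ℕ → Submodule K R} [GradedAlgebra 𝒜] {lam : K}
  (M : Presentation 𝒜 lam)

/-- The quadratic forms that cut out the two lines over `u = b v`. -/
def piU (q : K) : R := M.w - algebraMap K R q * M.A

/-- The linear form `u - b v`. -/
def linU (b : K) : R := M.u - algebraMap K R b * M.v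

theorem isLinePair_u {b q : K} (hb : b ^ 4 + 2 * lam ^ 2 * b ^ 2 + 1 = 0) (hq : 2 * q ^ 2 = 1) :
    IsLinePair 𝒜 (M.linU b) (M.piU q) (M.piU (-q)) where
  fst := M.isLine_u hb hq
  snd := M.isLine_u hb (by rw [neg_sq]; exact hq)
  exists_mul := M.exists_mul_u hb hq
  notMem h := by
    obtain ⟨f, hs, hu, hv, hw, hle⟩ := M.exists_point_u hb hq 1 0
    have h1 : f _ = 0 := hle h
    simp only [piU, A, map_sub, map_neg, map_add, map_mul, map_pow, AlgHom.commutes, map_ofNat, hs,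
      hu, hv, hw, Algebra.algebraMap_self, RingHom.id_apply] at h1
    have h3 : 2 * q = 0 := by linear_combination h1
    have h4 : q = 0 := by simpa using h3
    rw [h4] at hq
    norm_num at hq

theorem IsRootOn.neg {k₁ k₂ q₀ q₁ q₂ : K} (h : IsRootOn lam k₁ k₂ q₀ q₁ q₂) :
    IsRootOn lam k₁ k₂ (-q₀) (-q₁) (-q₂) := by
  intro D _ _ U V
  rw [← h D U V, map_neg, map_neg, map_neg]
  ring

theorem isLinePair_s {k₁ k₂ q₀ q₁ q₂ : K} (h : IsRootOn lam k₁ k₂ q₀ q₁ q₂)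
    (hne : ∃ m n : K, q₀ * m ^ 2 + q₁ * m * n + q₂ * n ^ 2 ≠ 0) :
    IsLinePair 𝒜 (M.lin k₁ k₂) (M.w - M.quad q₀ q₁ q₂) (M.w - M.quad (-q₀) (-q₁) (-q₂)) where
  fst := M.isLine_s h hne
  snd := M.isLine_s (IsRootOn.neg h) (by
    obtain ⟨m, n, hmn⟩ := hne
    exact ⟨m, n, fun h0 => hmn (by linear_combination -h0)⟩)
  exists_mul := M.exists_mul_s h
  notMem h0 := by
    obtain ⟨m, n, hmn⟩ := hne
    obtain ⟨f, hs, hu, hv, hw, hle⟩ := M.exists_point_s h m n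
    have h1 : f _ = 0 := hle h0
    simp only [quad, map_sub, map_neg, map_add, map_mul, map_pow, AlgHom.commutes,
      hu, hv, hw, Algebra.algebraMap_self, RingHom.id_apply] at h1
    apply hmn
    have h3 : 2 * (q₀ * m ^ 2 + q₁ * m * n + q₂ * n ^ 2) = 0 := by linear_combination h1
    simpa using h3

/-- Since y⁴ = 1, the mixed term of A cancels on this form: A = y²(u² + λ²v²). Then A² - Q = (λ⁴ -
1)v⁴ is twice the square of gv². -/
theorem isRootOn_one {y g : K} (hy : y ^ 4 = 1) (hg : 2 * g ^ 2 = lam ^ 4 - 1) :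
    IsRootOn lam y (-(y ^ 3 * lam)) 0 0 g := by
  intro D _ _ U V
  have hy' := congrArg (algebraMap K D) hy
  have hg' := congrArg (algebraMap K D) hg
  simp only [map_sub, map_mul, map_pow, map_one, map_ofNat, map_neg, map_zero] at hy' hg' ⊢
  generalize algebraMap K D y = Y at *
  generalize algebraMap K D g = G at *
  generalize algebraMap K D lam = L at *
  have hS : (Y * U + -(Y ^ 3 * L) * V) ^ 2 + 2 * L * U * V = Y ^ 2 * (U ^ 2 + L ^ 2 * V ^ 2) := by
    linear_combination (Y ^ 2 * L ^ 2 * V ^ 2 - 2 * L * U * V) * hy'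
  rw [hS]
  linear_combination V ^ 4 * hg' - (U ^ 2 + L ^ 2 * V ^ 2) ^ 2 * hy'

/-- The equation is symmetric in u and v. -/
theorem isRootOn_two {y g : K} (hy : y ^ 4 = 1) (hg : 2 * g ^ 2 = lam ^ 4 - 1) :
    IsRootOn lam (-(y ^ 3 * lam)) y g 0 0 := by
  intro D _ _ U V
  have := isRootOn_one hy hg D V U
  linear_combination this

end Presentation

end Dwork

namespace Dwork
open ProjDiv Polynomial

/-! ### Factorial localizations and their units -/

section Localization

theorem isUniqueFactorization_of_isLocalization {D N : Type*} [CommRing D] [IsDomain D]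
    [UniqueFactorizationMonoid D] [CommRing N] [Algebra D N] (M : Submonoid D)
    (hloc : IsLocalization M N) (hM : M ≤ nonZeroDivisors D) :
    ∃ _ : IsDomain N, UniqueFactorizationMonoid N :=
  ⟨IsLocalization.isDomain_of_le_nonZeroDivisors (R := D) (M := M) N hM,
    UniqueFactorizationMonoid.of_isLocalization M N⟩

/-- Localizations of polynomial rings in two variables remain factorial under base change to
principal ideal domains. -/
theorem tensor_localization_isUniqueFactorization {K : Type u} [Field K] (d : K[X][X]) (hd : d ≠ 0)
    (N : Type u) [CommRing N] [Algebra K N] [Algebra K[X][X] N] [IsScalarTower K K[X][X] N]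
    [IsLocalization.Away d N]
    (B : Type u) [CommRing B] [IsDomain B] [IsPrincipalIdealRing B] [Algebra K B] :
    ∃ _ : IsDomain (B ⊗[K] N), UniqueFactorizationMonoid (B ⊗[K] N) := by
  -- Polynomial rings over a principal ideal domain are factorial, and localization commutes with
  -- the base change.
  let e : B ⊗[K] K[X][X] ≃ₐ[B] MvPolynomial (Fin 2) B :=
    (Algebra.TensorProduct.congr AlgEquiv.refl (Polynomial.Bivariate.equivMvPolynomial K)).trans
      (MvPolynomial.algebraTensorAlgEquiv K B)
  have hdom : IsDomain (B ⊗[K] K[X][X]) := MulEquiv.isDomain (MvPolynomial (Fin 2) B) e.toMulEquiv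
  have hufd : UniqueFactorizationMonoid (B ⊗[K] K[X][X]) :=
    e.symm.toMulEquiv.uniqueFactorizationMonoid inferInstance
  let φ : B ⊗[K] K[X][X] →ₐ[B] B ⊗[K] N :=
    Algebra.TensorProduct.map (AlgHom.id B B) (IsScalarTower.toAlgHom K K[X][X] N)
  let _ : Algebra (B ⊗[K] K[X][X]) (B ⊗[K] N) := φ.toRingHom.toAlgebra
  have : IsScalarTower B (B ⊗[K] K[X][X]) (B ⊗[K] N) :=
    ⟨fun b x y => by
      change φ (b • x) * y = b • (φ x * y)
      rw [map_smul, smul_mul_assoc]⟩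
  refine isUniqueFactorization_of_isLocalization _
    (IsLocalization.tensorProduct_tensorProduct_right K B (Submonoid.powers d) N (by
      ext x
      · rfl
      · rfl
      · rfl)) ?_
  rintro _ ⟨_, ⟨n, rfl⟩, rfl⟩
  refine mem_nonZeroDivisors_of_ne_zero fun h => pow_ne_zero n hd ?_
  exact (Algebra.TensorProduct.includeRight_injective (algebraMap K B).injective)
    (h.trans (map_zero _).symm)

theorem exists_associated_prod_pow {D ι : Type*} [CommRing D] [IsDomain D]
    [UniqueFactorizationMonoid D] (s : Finset ι) (p : ι → D) (hp : ∀ i, Prime (p i)) (n : ℕ) (g : D)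
    (hg : g ∣ ∏ i ∈ s, p i ^ n) : ∃ m : ι → ℕ, Associated g (∏ i ∈ s, p i ^ m i) := by
  classical
  induction s using Finset.induction_on generalizing g with
  | empty => exact ⟨0, by simpa [isUnit_iff_dvd_one, associated_one_iff_isUnit] using hg⟩
  | insert a s ha ih =>
    rw [Finset.prod_insert ha] at hg
    obtain ⟨g₁, g₂, h1, h2, rfl⟩ := exists_dvd_and_dvd_of_dvd_mul hg
    obtain ⟨m, hm⟩ := ih g₂ h2
    obtain ⟨l, -, hl⟩ := (dvd_prime_pow (hp a) n).1 h1
    refine ⟨Function.update m a l, ?_⟩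
    rw [Finset.prod_insert ha, Function.update_self]
    refine hl.mul_mul (hm.trans (Associated.of_eq (Finset.prod_congr rfl fun i hi => ?_)))
    rw [Function.update_of_ne (by rintro rfl; exact ha hi)]

/-- Units of the localization at a product of primes are products of powers of these primes. -/
theorem exists_eq_of_isUnit {D N ι : Type*} [CommRing D] [IsDomain D]
    [UniqueFactorizationMonoid D] [CommRing N] [Algebra D N] [Fintype ι] (p : ι → D)
    (hp : ∀ i, Prime (p i)) [IsLocalization.Away (∏ i, p i) N] {x : N} (hx : IsUnit x) : ∃ (g : Dˣ) (n : ℕ) (m : ι → ℕ),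
      x * algebraMap D _ (∏ i, p i) ^ n = algebraMap D _ (g * ∏ i, p i ^ m i) := by
  have h0 : ∏ i, p i ≠ 0 := Finset.prod_ne_zero_iff.2 fun i _ => (hp i).ne_zero
  have hinj : Function.Injective (algebraMap D N) :=
    IsLocalization.injective _ (powers_le_nonZeroDivisors_of_noZeroDivisors h0)
  obtain ⟨y, hxy⟩ := hx.exists_right_inv
  obtain ⟨n, a, ha⟩ := IsLocalization.Away.surj (∏ i, p i) x
  obtain ⟨n', a', ha'⟩ := IsLocalization.Away.surj (∏ i, p i) y
  have h1 : a * a' = ∏ i, p i ^ (n + n') := by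
    apply hinj
    rw [Finset.prod_pow, map_mul, map_pow, ← ha, ← ha', pow_add]
    linear_combination algebraMap D N (∏ i, p i) ^ n *
      algebraMap D N (∏ i, p i) ^ n' * hxy
  obtain ⟨m, hm⟩ := exists_associated_prod_pow Finset.univ p hp (n + n') a ⟨a', h1.symm⟩
  obtain ⟨g, hg⟩ := hm.symm
  exact ⟨g, n, m, by rw [ha, ← hg, mul_comm]⟩

end Localization

/-- The coefficients of the equation `(x - N₂ Y) (x - N₃ X) = 2 s (s + 2 μ) x` of a conic bundle
with a section, with `N₂ = p₂ X + q₂ Y`, `N₃ = p₃ X + q₃ Y` and `μ = m₁ X + m₂ Y`, and the positions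
of the singular fibres. -/
structure ConicData (K : Type u) [Field K] where
  p₂ : K
  q₂ : K
  p₃ : K
  q₃ : K
  m₁ : K
  m₂ : K
  rt : Fin 4 → K
  q₂_ne : q₂ ≠ 0
  det_ne : p₂ * q₃ - p₃ * q₂ ≠ 0
  rt_ne : ∀ i, rt i ≠ 0
  rt_inj : Function.Injective rt
  disc : ∀ (D : Type u) [CommRing D] [Algebra K D] (t : D),
    (algebraMap K D q₂ * t ^ 2 + (algebraMap K D p₂ - algebraMap K D q₃) * t -
      algebraMap K D p₃) ^ 2 -
      8 * algebraMap K D m₂ * t * (algebraMap K D q₂ * t ^ 2 +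
        (algebraMap K D p₂ - algebraMap K D q₃) * t - algebraMap K D p₃) *
        (algebraMap K D m₁ + algebraMap K D m₂ * t) +
      8 * t * (algebraMap K D m₁ + algebraMap K D m₂ * t) ^ 2 *
        (algebraMap K D q₂ * t - algebraMap K D q₃) =
    algebraMap K D q₂ ^ 2 * ∏ i, (t - algebraMap K D (rt i))

/-! ### The factorial coordinate ring of a conic bundle with a section -/

namespace ConicData

variable {K : Type u} [Field K] (d : ConicData K)

/-- The quadratic polynomial `A`. -/
noncomputable def quadA : K[X] := C d.q₂ * X ^ 2 + (C d.p₂ - C d.q₃) * X - C d.p₃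

/-- The linear polynomial `β`. -/
noncomputable def linB : K[X] := C d.m₁ + C d.m₂ * X

/-- The polynomial whose inverse occurs in the parametrization of the conic bundle. -/
noncomputable def polT : K[X][X] := C d.quadA * X + C (-(4 * X * d.linB))

theorem disc_poly : d.quadA ^ 2 - 8 * C d.m₂ * X * d.quadA * d.linB +
    8 * X * d.linB ^ 2 * (C d.q₂ * X - C d.q₃) = C d.q₂ ^ 2 * ∏ i, (X - C (d.rt i)) :=
  d.disc K[X] X

theorem det_eq_zero_of_quadA (h : d.quadA = 0) : False := by
  have h2 := congrArg (fun p => coeff p 2) h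
  simp [quadA] at h2
  exact d.q₂_ne h2

/-- By the discriminant identity multiplied by X, the square of a common factor of A and Xβ divides
X∏(X - rt i), which is squarefree because the roots are distinct and nonzero. -/
theorem isRelPrime [CharZero K] : IsRelPrime d.quadA (-(4 * X * d.linB)) := by
  have hsq : Squarefree (X * ∏ i, (X - C (d.rt i))) := by
    have : (X : K[X]) * ∏ i, (X - C (d.rt i)) =
        ∏ i : Option (Fin 4), (X - C (Option.elim i 0 d.rt)) := by
      rw [Fintype.prod_option]; simp
    rw [this]
    apply Polynomial.Separable.squarefree
    rw [Polynomial.separable_prod_X_sub_C_iff]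
    rintro (_ | i) (_ | j) h
    · rfl
    · exact absurd h.symm (d.rt_ne j)
    · exact absurd h (d.rt_ne i)
    · rw [d.rt_inj h]
  intro q hA hB
  apply hsq q
  have hb' : q ∣ X * d.linB := by
    have h4 : IsUnit (-4 : K[X]) := by
      have : (-4 : K[X]) = C (-4) := by rw [map_neg, map_ofNat]
      rw [this, Polynomial.isUnit_C]
      exact isUnit_iff_ne_zero.2 (by norm_num)
    rw [← h4.dvd_mul_left]
    convert hB using 1
    ring
  obtain ⟨a, ha⟩ := hA
  obtain ⟨b, hb⟩ := hb'
  have hq : IsUnit (C d.q₂ ^ 2 : K[X]) :=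
    (Polynomial.isUnit_C.2 (isUnit_iff_ne_zero.2 d.q₂_ne)).pow 2
  rw [← hq.dvd_mul_left]
  -- The three terms of X times the discriminant contain A², A·(Xβ) and (Xβ)², so each supplies two
  -- factors `q`.
  refine ⟨X * a ^ 2 - 8 * C d.m₂ * X * a * b + 8 * b ^ 2 * (C d.q₂ * X - C d.q₃), ?_⟩
  have := d.disc_poly
  rw [mul_left_comm, ← this, ha]
  have hx : X * (8 * X * d.linB ^ 2 * (C d.q₂ * X - C d.q₃)) =
      8 * (X * d.linB) ^ 2 * (C d.q₂ * X - C d.q₃) := by ring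
  have hy : X * (8 * C d.m₂ * X * (q * a) * d.linB) = 8 * C d.m₂ * X * (q * a) * (X * d.linB) := by
    ring
  rw [mul_add, mul_sub, hx, hy, hb]
  ring

/-- Linear in the fibre parameter with coprime coefficients. -/
theorem prime_polT [CharZero K] : Prime d.polT :=
  (irreducible_C_mul_X_add_C (fun h => d.det_eq_zero_of_quadA h) d.isRelPrime).prime

/-- The primes that are inverted. -/
noncomputable def primes : Option (Option (Fin 4)) → K[X][X]
  | none => d.polT
  | some none => C X
  | some (some i) => C (X - C (d.rt i))

theorem prime_primes [CharZero K] : ∀ i, Prime (d.primes i)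
  | none => d.prime_polT
  | some none => Polynomial.prime_C_iff.2 prime_X
  | some (some i) => Polynomial.prime_C_iff.2 (prime_X_sub_C _)

/-- The dehomogenized coordinate ring. -/
def Ring : Type u := Localization.Away (∏ i, d.primes i)

noncomputable instance : CommRing d.Ring := inferInstanceAs (CommRing (Localization.Away _))
noncomputable instance : Algebra K[X][X] d.Ring :=
  inferInstanceAs (Algebra K[X][X] (Localization.Away (∏ i, d.primes i)))
noncomputable instance : Algebra K d.Ring :=
  inferInstanceAs (Algebra K (Localization.Away (∏ i, d.primes i)))
instance : IsScalarTower K K[X][X] d.Ring :=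
  inferInstanceAs (IsScalarTower K K[X][X] (Localization.Away (∏ i, d.primes i)))
instance : IsLocalization.Away (∏ i, d.primes i) d.Ring :=
  inferInstanceAs (IsLocalization.Away (∏ i, d.primes i) (Localization.Away (∏ i, d.primes i)))

theorem prod_primes_ne_zero [CharZero K] : ∏ i, d.primes i ≠ 0 :=
  Finset.prod_ne_zero_iff.2 fun i _ => (d.prime_primes i).ne_zero

instance instIsDomainRing [CharZero K] : IsDomain d.Ring :=
  IsLocalization.isDomain_of_le_nonZeroDivisors (R := K[X][X]) d.Ring
    (powers_le_nonZeroDivisors_of_noZeroDivisors d.prod_primes_ne_zero)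

theorem isUnit_primes (i) : IsUnit (algebraMap K[X][X] d.Ring (d.primes i)) := by
  refine isUnit_of_dvd_unit (map_dvd _ (Finset.dvd_prod_of_mem d.primes (Finset.mem_univ i))) ?_
  exact IsLocalization.Away.algebraMap_isUnit _

/-- The parameter on the base of the conic bundle. -/
noncomputable def tau : d.Ring := algebraMap K[X][X] d.Ring (C X)

/-- The parameter on the fibres of the conic bundle. -/
noncomputable def xi : d.Ring := algebraMap K[X][X] d.Ring X

theorem algebraMap_C_C (a : K) : algebraMap K[X][X] d.Ring (C (C a)) = algebraMap K d.Ring a := by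
  rw [IsScalarTower.algebraMap_apply K K[X][X] d.Ring]
  rfl

/-- The form `A` in the parameter. -/
noncomputable def elA : d.Ring := algebraMap K d.Ring d.q₂ * d.tau ^ 2 +
  (algebraMap K d.Ring d.p₂ - algebraMap K d.Ring d.q₃) * d.tau - algebraMap K d.Ring d.p₃

/-- The form `β` in the parameter. -/
noncomputable def elB : d.Ring := algebraMap K d.Ring d.m₁ + algebraMap K d.Ring d.m₂ * d.tau

/-- The unit `T`. -/
noncomputable def elT : d.Ring := d.elA * d.xi - 4 * d.tau * d.elB

theorem elT_eq : d.elT = algebraMap K[X][X] d.Ring d.polT := by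
  simp only [elT, elA, elB, tau, xi, polT, quadA, linB, ← algebraMap_C_C, map_add, map_sub, map_mul,
    map_pow, map_neg, map_ofNat]
  ring

theorem isUnit_elT : IsUnit d.elT := by
  rw [elT_eq]
  exact d.isUnit_primes none

theorem isUnit_tau : IsUnit d.tau := d.isUnit_primes (some none)

theorem tau_sub_eq (i) : d.tau - algebraMap K d.Ring (d.rt i) =
    algebraMap K[X][X] d.Ring (C (X - C (d.rt i))) := by
  rw [tau, ← algebraMap_C_C, map_sub, map_sub]

theorem isUnit_tau_sub (i) : IsUnit (d.tau - algebraMap K d.Ring (d.rt i)) := by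
  rw [tau_sub_eq]
  exact d.isUnit_primes (some (some i))

theorem algebraMap_den : algebraMap K[X][X] d.Ring (∏ i, d.primes i) =
    d.elT * (d.tau * ∏ i, (d.tau - algebraMap K d.Ring (d.rt i))) := by
  rw [map_prod, Fintype.prod_option, Fintype.prod_option]
  simp only [elT_eq, tau_sub_eq]
  rfl

/-- The units of the dehomogenized ring. -/
theorem exists_eq_of_isUnit [CharZero K] {x : d.Ring} (hx : IsUnit x) :
    ∃ κ : K, κ ≠ 0 ∧ ∃ (n l j : ℕ) (m : Fin 4 → ℕ),
      x * (d.elT * (d.tau * ∏ i, (d.tau - algebraMap K d.Ring (d.rt i)))) ^ n =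
        algebraMap K d.Ring κ * (d.elT ^ l * (d.tau ^ j *
          ∏ i, (d.tau - algebraMap K d.Ring (d.rt i)) ^ m i)) := by
  obtain ⟨g, n, m, h⟩ := Dwork.exists_eq_of_isUnit d.primes d.prime_primes hx
  obtain ⟨g₁, hg₁, hg⟩ := Polynomial.isUnit_iff.1 g.isUnit
  obtain ⟨κ, hκ, rfl⟩ := Polynomial.isUnit_iff.1 hg₁
  refine ⟨κ, hκ.ne_zero, n, m none, m (some none), fun i => m (some (some i)), ?_⟩
  rw [← hg, algebraMap_den] at h
  rw [h, map_mul, map_prod, Fintype.prod_option, Fintype.prod_option, algebraMap_C_C]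
  simp only [elT_eq, tau_sub_eq, map_pow]
  rfl

/-- A subring that contains the parameters and the inverses of the primes contains everything. -/
theorem mem_of_mem (S : Subsemiring d.Ring) (hK : ∀ a, algebraMap K d.Ring a ∈ S)
    (htau : d.tau ∈ S) (hxi : d.xi ∈ S)
    (hinv : ∃ y ∈ S, y * (d.elT * (d.tau * ∏ i, (d.tau - algebraMap K d.Ring (d.rt i)))) = 1)
    (x : d.Ring) : x ∈ S := by
  have hpol : ∀ f : K[X][X], algebraMap K[X][X] d.Ring f ∈ S := by
    intro f
    have hC : ∀ g : K[X], algebraMap K[X][X] d.Ring (C g) ∈ S := by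
      intro g
      induction g using Polynomial.induction_on' with
      | add p q hp hq => rw [map_add, map_add]; exact add_mem hp hq
      | monomial n a =>
        rw [← C_mul_X_pow_eq_monomial, map_mul, map_mul, map_pow, map_pow, algebraMap_C_C]
        exact mul_mem (hK a) (pow_mem htau n)
    induction f using Polynomial.induction_on' with
    | add p q hp hq => rw [map_add]; exact add_mem hp hq
    | monomial n a =>
      rw [← C_mul_X_pow_eq_monomial, map_mul, map_pow]
      exact mul_mem (hC a) (pow_mem hxi n)
  obtain ⟨n, a, ha⟩ := IsLocalization.Away.surj (∏ i, d.primes i) x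
  obtain ⟨y, hy, hy1⟩ := hinv
  have hx : x = algebraMap K[X][X] d.Ring a * y ^ n := by
    rw [← ha, mul_assoc, ← mul_pow, algebraMap_den, mul_comm _ y, hy1, one_pow, mul_one]
  rw [hx]
  exact mul_mem (hpol a) (pow_mem hy n)

end ConicData

end Dwork

/-! ### Parametrization of the conic bundle -/

namespace Dwork
open ProjDiv

namespace ConicData

variable {K : Type u} [Field K] (d : ConicData K)

section Forms

variable {D : Type*} [CommRing D] [Algebra K D]

/-- The linear form `N₂`. -/
def formN₂ (x y : D) : D := algebraMap K D d.p₂ * x + algebraMap K D d.q₂ * y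

/-- The linear form `N₃`. -/
def formN₃ (x y : D) : D := algebraMap K D d.p₃ * x + algebraMap K D d.q₃ * y

/-- The linear form `μ`. -/
def formM (x y : D) : D := algebraMap K D d.m₁ * x + algebraMap K D d.m₂ * y

/-- The form `A`, homogenized. -/
def formA (x y : D) : D := algebraMap K D d.q₂ * x ^ 2 +
  (algebraMap K D d.p₂ - algebraMap K D d.q₃) * x * y - algebraMap K D d.p₃ * y ^ 2

/-- The equation of the conic bundle. -/
def IsSolution (s X Y x : D) : Prop :=
  (x - d.formN₂ X Y * Y) * (x - d.formN₃ X Y * X) = 2 * s * (s + 2 * d.formM X Y) * x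

end Forms

/-- The inverse of `T`. -/
noncomputable def invT : d.Ring := ↑(d.isUnit_elT.unit⁻¹)

theorem elT_mul_invT : d.elT * d.invT = 1 := d.isUnit_elT.mul_val_inv

/-- The coordinate `X` on the parametrized conic bundle. -/
noncomputable def elX : d.Ring :=
  (2 * d.tau - 4 * algebraMap K _ d.m₂ * d.tau * d.xi +
    (algebraMap K _ d.q₂ * d.tau - algebraMap K _ d.q₃) * d.xi ^ 2) * d.invT

theorem elX_mul : d.elX * d.elT = 2 * d.tau - 4 * algebraMap K _ d.m₂ * d.tau * d.xi +
    (algebraMap K _ d.q₂ * d.tau - algebraMap K _ d.q₃) * d.xi ^ 2 := by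
  rw [elX, mul_assoc, mul_comm d.invT, elT_mul_invT, mul_one]

/-- The coordinate `Y` on the parametrized conic bundle. -/
noncomputable def elY : d.Ring := d.tau * d.elX - d.xi

/-- Put x = τXN₂ and Y = τX - ξ with s = 1. Then x - N₂Y = N₂ξ and x - N₃X = X(τN₂ - N₃), so after
division by XN₂ the equation is linear in X. Its solution is the fraction with denominator T that
defines `elX`: each conic is projected from its point on s = 0, τX = Y. -/
theorem isSolution : d.IsSolution 1 d.elX d.elY (d.tau * (d.elX * d.formN₂ d.elX d.elY)) := by
  have h := d.elX_mul
  simp only [elT, elA, elB] at h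
  simp only [IsSolution, formN₂, formN₃, formM, elY]
  generalize algebraMap K d.Ring d.p₂ = p₂ at *
  generalize algebraMap K d.Ring d.q₂ = q₂ at *
  generalize algebraMap K d.Ring d.p₃ = p₃ at *
  generalize algebraMap K d.Ring d.q₃ = q₃ at *
  generalize algebraMap K d.Ring d.m₁ = m₁ at *
  generalize algebraMap K d.Ring d.m₂ = m₂ at *
  linear_combination d.elX * (p₂ * d.elX + q₂ * (d.tau * d.elX - d.xi)) * h

/-- The inverse of `T` up to factors that depend only on the base. -/
noncomputable def elV : d.Ring := d.elA ^ 2 * d.elX -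
  (algebraMap K _ d.q₂ * d.tau - algebraMap K _ d.q₃) * (d.elA * d.xi + 4 * d.tau * d.elB) +
    4 * algebraMap K _ d.m₂ * d.tau * d.elA

/-- T is linear in ξ and the numerator of X is quadratic in ξ. Eliminating ξ between them leaves 2τ
times the discriminant. This expresses 1/T polynomially in the coordinates once the singular fibres
are removed. -/
theorem elT_mul_elV : d.elT * d.elV =
    2 * algebraMap K _ d.q₂ ^ 2 * d.tau * ∏ i, (d.tau - algebraMap K _ (d.rt i)) := by
  have h := d.elX_mul
  have h2 := d.disc d.Ring d.tau
  have hA : algebraMap K d.Ring d.q₂ * d.tau ^ 2 + (algebraMap K d.Ring d.p₂ -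
    algebraMap K d.Ring d.q₃) * d.tau - algebraMap K d.Ring d.p₃ = d.elA := rfl
  have hB : algebraMap K d.Ring d.m₁ + algebraMap K d.Ring d.m₂ * d.tau = d.elB := rfl
  rw [hA, hB] at h2
  rw [elV]
  simp only [elT] at h ⊢
  linear_combination d.elA ^ 2 * h + 2 * d.tau * h2

theorem lin_ne {m n : K} (h : m ≠ 0 ∨ n ≠ 0) :
    (Polynomial.C m + Polynomial.C n * Polynomial.X : Polynomial K) ≠ 0 := by
  intro h0
  have h1 := congrArg (fun p => Polynomial.coeff p 0) h0
  have h2 := congrArg (fun p => Polynomial.coeff p 1) h0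
  simp at h1 h2
  tauto

theorem quad_ne {l m n : K} (h : n ≠ 0) :
    (Polynomial.C l + Polynomial.C m * Polynomial.X + Polynomial.C n * Polynomial.X ^ 2 :
      Polynomial K) ≠ 0 := by
  intro h0
  have h1 := congrArg (fun p => Polynomial.coeff p 2) h0
  simp at h1
  exact h h1

/-- The coordinate `X` in terms of the parameters. -/
theorem X_mul_eq {L : Type*} [Field L] {p₂ q₂ p₃ q₃ m₁ m₂ s X Y x t ξ : L} (hX : X ≠ 0)
    (hn : p₂ * X + q₂ * Y ≠ 0) (hs : s ≠ 0) (hx : x = t * (X * (p₂ * X + q₂ * Y)))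
    (hY : Y = t * X - ξ * s)
    (h : (x - (p₂ * X + q₂ * Y) * Y) * (x - (p₃ * X + q₃ * Y) * X) =
      2 * s * (s + 2 * (m₁ * X + m₂ * Y)) * x) :
    X * ((q₂ * t ^ 2 + (p₂ - q₃) * t - p₃) * ξ - 4 * t * (m₁ + m₂ * t)) =
      (2 * t - 4 * m₂ * t * ξ + (q₂ * t - q₃) * ξ ^ 2) * s := by
  apply mul_left_cancel₀ (mul_ne_zero (mul_ne_zero hX hn) hs)
  -- After the substitution, the conic equation is the desired linear one multiplied by XN₂s.
  subst hx hY
  linear_combination h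

/-- Homogenization of T: with t = x/D and ξ = (tX - Y)/s, the denominator is D³s. The right-hand
side is the shape of `numT`. -/
theorem clear_denominators {L : Type*} [Field L] {p₂ q₂ p₃ q₃ m₁ m₂ s X Y x D : L} (hD : D ≠ 0)
    (hs : s ≠ 0) :
    ((q₂ * (x / D) ^ 2 + (p₂ - q₃) * (x / D) - p₃) * ((x / D * X - Y) / s) -
      4 * (x / D) * (m₁ + m₂ * (x / D))) * (D ^ 3 * s) =
    (q₂ * x ^ 2 + (p₂ - q₃) * x * D - p₃ * D ^ 2) * (x * X - Y * D) -
      4 * x * D * s * (m₁ * D + m₂ * x) := by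
  field_simp

end ConicData

/-- A presentation of a graded algebra as the homogeneous coordinate ring of a conic bundle. -/
structure ConicPresentation {K R : Type u} [Field K] [CommRing R] [Algebra K R]
    (𝒜 : ℕ → Submodule K R) (d : ConicData K) where
  s : R
  X : R
  Y : R
  x : R
  s_mem : s ∈ 𝒜 1
  X_mem : X ∈ 𝒜 1
  Y_mem : Y ∈ 𝒜 1
  x_mem : x ∈ 𝒜 2
  isSolution : d.IsSolution s X Y x
  adjoin_eq_top : Algebra.adjoin K {s, X, Y, x} = ⊤
  exists_lift : ∀ (D : Type u) [CommRing D] [IsDomain D] [Algebra K D] (S U V W : D),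
    d.IsSolution S U V W → ∃ f : R →ₐ[K] D, f s = S ∧ f X = U ∧ f Y = V ∧ f x = W

/-! ### Inverse of the parametrization and its charts -/

namespace ConicPresentation

variable {K R : Type u} [Field K] [CharZero K] [CommRing R] [IsDomain R] [Algebra K R]
  {𝒜 : ℕ → Submodule K R} [GradedAlgebra 𝒜] {d : ConicData K} (N : ConicPresentation 𝒜 d)

/-- The form `N₂`. -/
def n₂ : R := d.formN₂ N.X N.Y

/-- The form `N₃`. -/
def n₃ : R := d.formN₃ N.X N.Y

/-- The denominator of the parameter on the base. -/
def den : R := N.X * N.n₂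

/-- The numerator of `T`. -/
def numT : R := d.formA N.x N.den * (N.x * N.X - N.Y * N.den) -
  4 * N.x * N.den * N.s * d.formM N.den N.x

/-- The points of one of the components of the fibre at infinity. -/
theorem exists_point_infinity : ∃ f : R →ₐ[K] Polynomial K, f N.s = 0 ∧ f N.X = 1 ∧
    f N.Y = Polynomial.X ∧ f N.x = d.formN₃ 1 Polynomial.X :=
  N.exists_lift (Polynomial K) 0 1 Polynomial.X (d.formN₃ 1 Polynomial.X) (by
    rw [ConicData.IsSolution]; ring)

theorem s_ne : N.s ≠ 0 := by
  obtain ⟨f, hs, -⟩ := N.exists_lift (Polynomial K) 1 0 0 0 (by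
    simp [ConicData.IsSolution, ConicData.formN₂, ConicData.formN₃])
  intro h
  rw [h, map_zero] at hs
  exact zero_ne_one hs

theorem X_ne : N.X ≠ 0 := by
  obtain ⟨f, -, hX, -⟩ := N.exists_point_infinity
  intro h
  rw [h, map_zero] at hX
  exact zero_ne_one hX

theorem map_den_ne {f : R →ₐ[K] Polynomial K} (hX : f N.X = 1) (hY : f N.Y = Polynomial.X) :
    f N.den ≠ 0 := by
  intro h1
  simp only [den, n₂, ConicData.formN₂, map_mul, map_add, AlgHom.commutes, hX, hY,
    one_mul] at h1
  refine ConicData.lin_ne (m := d.p₂) (n := d.q₂) (Or.inr d.q₂_ne) ?_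
  rw [← h1, mul_one]; rfl

theorem map_x_sub_ne {f : R →ₐ[K] Polynomial K} (hX : f N.X = 1) (hY : f N.Y = Polynomial.X)
    (hx : f N.x = d.formN₃ 1 Polynomial.X) (t : K) : f (N.x - algebraMap K R t * N.den) ≠ 0 := by
  intro h1
  simp only [den, n₂, ConicData.formN₂, ConicData.formN₃, map_mul, map_add, map_sub,
    AlgHom.commutes, hX, hY, hx, one_mul, mul_one] at h1
  refine ConicData.lin_ne (m := d.p₃ - t * d.p₂) (n := d.q₃ - t * d.q₂) ?_ ?_
  · by_contra! h2
    exact d.det_ne (by linear_combination d.q₂ * (-h2.1) + d.p₂ * h2.2)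
  · rw [← h1]
    simp only [map_sub, map_mul, Polynomial.algebraMap_eq]
    ring

theorem den_ne : N.den ≠ 0 := by
  obtain ⟨f, -, hX, hY, -⟩ := N.exists_point_infinity
  intro h
  exact N.map_den_ne hX hY (by rw [h, map_zero])

theorem x_sub_ne (t : K) : N.x - algebraMap K R t * N.den ≠ 0 := by
  obtain ⟨f, -, hX, hY, hx⟩ := N.exists_point_infinity
  intro h
  exact N.map_x_sub_ne hX hY hx t (by rw [h, map_zero])

theorem x_ne : N.x ≠ 0 := by
  have := N.x_sub_ne 0
  rwa [map_zero, zero_mul, sub_zero] at this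

/-- On the line s = 0, x = N₃X the second term of `numT` drops out, and two quadratic polynomials
remain whose leading coefficients are q₂·det and -q₂. -/
theorem map_numT_ne {f : R →ₐ[K] Polynomial K} (hs : f N.s = 0) (hX : f N.X = 1)
    (hY : f N.Y = Polynomial.X) (hx : f N.x = d.formN₃ 1 Polynomial.X) : f N.numT ≠ 0 := by
  have h1 : f N.numT = (Polynomial.C (d.q₂ * d.p₃ ^ 2 + (d.p₂ - d.q₃) * d.p₃ * d.p₂ -
        d.p₃ * d.p₂ ^ 2) +
      Polynomial.C (2 * d.q₂ * d.p₃ * d.q₃ + (d.p₂ - d.q₃) * (d.p₃ * d.q₂ + d.q₃ * d.p₂) -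
        2 * d.p₃ * d.p₂ * d.q₂) * Polynomial.X +
      Polynomial.C (d.q₂ * (d.p₂ * d.q₃ - d.p₃ * d.q₂)) * Polynomial.X ^ 2) *
      (Polynomial.C d.p₃ + Polynomial.C (d.q₃ - d.p₂) * Polynomial.X +
        Polynomial.C (-d.q₂) * Polynomial.X ^ 2) := by
    simp only [numT, den, n₂, ConicData.formN₂, ConicData.formN₃, ConicData.formA, ConicData.formM,
      map_mul, map_add, map_sub, map_pow, map_neg, map_ofNat, AlgHom.commutes, hX, hY, hx, hs,
      one_mul, mul_one, Polynomial.algebraMap_eq]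
    ring
  rw [h1]
  refine mul_ne_zero (fun h => ?_) (fun h => ?_)
  · exact ConicData.quad_ne (mul_ne_zero d.q₂_ne d.det_ne) h
  · exact ConicData.quad_ne (neg_ne_zero.2 d.q₂_ne) h

theorem numT_ne : N.numT ≠ 0 := by
  obtain ⟨f, hs, hX, hY, hx⟩ := N.exists_point_infinity
  intro h
  exact N.map_numT_ne hs hX hY hx (by rw [h, map_zero])

/-- The parametrization of the conic bundle, on coordinate rings. -/
theorem exists_hom : ∃ f : R →ₐ[K] d.Ring, f N.s = 1 ∧ f N.X = d.elX ∧ f N.Y = d.elY ∧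
    f N.x = d.tau * (d.elX * d.formN₂ d.elX d.elY) :=
  N.exists_lift d.Ring _ _ _ _ d.isSolution

/-- The parametrization of the conic bundle, on coordinate rings. -/
noncomputable def hom : R →ₐ[K] d.Ring := N.exists_hom.choose

theorem hom_s : N.hom N.s = 1 := N.exists_hom.choose_spec.1
theorem hom_X : N.hom N.X = d.elX := N.exists_hom.choose_spec.2.1
theorem hom_Y : N.hom N.Y = d.elY := N.exists_hom.choose_spec.2.2.1
theorem hom_den : N.hom N.den = d.elX * d.formN₂ d.elX d.elY := by
  simp only [den, n₂, ConicData.formN₂, map_mul, map_add, AlgHom.commutes, hom_X, hom_Y]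
theorem hom_x : N.hom N.x = d.tau * N.hom N.den := by
  rw [hom_den]; exact N.exists_hom.choose_spec.2.2.2

section Inverse

/-- The inverse of the parametrization. -/
theorem exists_inverse : ∃ g : d.Ring →ₐ[K] FractionRing R,
    g d.tau = algebraMap R _ N.x / algebraMap R _ N.den ∧
    g d.xi = (g d.tau * algebraMap R _ N.X - algebraMap R _ N.Y) / algebraMap R _ N.s := by
  have hinj : Function.Injective (algebraMap R (FractionRing R)) := IsFractionRing.injective R _
  have hne : ∀ {y : R}, y ≠ 0 → algebraMap R (FractionRing R) y ≠ 0 := fun h => by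
    rwa [Ne, map_eq_zero_iff _ hinj]
  set L := FractionRing R
  have hD := hne N.den_ne
  have hs := hne N.s_ne
  set t : L := algebraMap R _ N.x / algebraMap R _ N.den with ht
  set ξ : L := (t * algebraMap R _ N.X - algebraMap R _ N.Y) / algebraMap R _ N.s with hξ
  let g₁ : Polynomial K →ₐ[K] L := Polynomial.aeval t
  let g₀ : Polynomial (Polynomial K) →+* L := Polynomial.eval₂RingHom g₁.toRingHom ξ
  have hC : ∀ p, g₀ (Polynomial.C p) = Polynomial.aeval t p := fun p => Polynomial.eval₂_C _ _
  have hX : g₀ Polynomial.X = ξ := Polynomial.eval₂_X _ _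
  -- The inverted primes become nonzero elements of the fraction field: they are fractions with
  -- numerators `numT`, `x` and `x - rt i * den`, all nonzero by restriction to the line used in
  -- `exists_point_infinity`.
  have hunit : IsUnit (g₀ (∏ i, d.primes i)) := by
    rw [isUnit_iff_ne_zero, map_prod, Finset.prod_ne_zero_iff]
    rintro (_ | _ | i) -
    · have h1 : g₀ (d.primes none) * (algebraMap R L N.den ^ 3 * algebraMap R L N.s) =
          algebraMap R L N.numT := by
        have e1 : g₀ (d.primes none) = (algebraMap K L d.q₂ * t ^ 2 + (algebraMap K L d.p₂ -
            algebraMap K L d.q₃) * t - algebraMap K L d.p₃) * ξ -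
            4 * t * (algebraMap K L d.m₁ + algebraMap K L d.m₂ * t) := by
          simp only [ConicData.primes, ConicData.polT, ConicData.quadA, ConicData.linB, map_add,
            map_mul, hC, hX, map_sub, map_neg, map_pow, Polynomial.aeval_C, Polynomial.aeval_X,
            map_ofNat]
          ring
        rw [e1, hξ, ht]
        simp only [numT, ConicData.formA, ConicData.formM, map_add, map_mul, map_sub, map_pow,
          map_ofNat, ← IsScalarTower.algebraMap_apply K R L]
        exact ConicData.clear_denominators hD hs
      intro h0
      rw [h0, zero_mul] at h1
      exact hne N.numT_ne h1.symm
    · change g₀ (Polynomial.C Polynomial.X) ≠ 0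
      rw [hC, Polynomial.aeval_X]
      exact div_ne_zero (hne N.x_ne) hD
    · change g₀ (Polynomial.C (Polynomial.X - Polynomial.C (d.rt i))) ≠ 0
      rw [hC, map_sub, Polynomial.aeval_X, Polynomial.aeval_C, ht, div_sub' hD]
      refine div_ne_zero ?_ hD
      have := hne (N.x_sub_ne (d.rt i))
      rwa [map_sub, map_mul, ← IsScalarTower.algebraMap_apply K R L, mul_comm] at this
  let g : d.Ring →+* L := IsLocalization.Away.lift (S := d.Ring) (∏ i, d.primes i) hunit
  have hg : ∀ p, g (algebraMap _ d.Ring p) = g₀ p := fun p =>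
    IsLocalization.Away.lift_eq (∏ i, d.primes i) hunit p
  refine ⟨⟨g, fun a => ?_⟩, ?_, ?_⟩
  · change g (algebraMap K d.Ring a) = _
    rw [← ConicData.algebraMap_C_C, hg, hC, Polynomial.aeval_C]
  · change g d.tau = t
    rw [ConicData.tau, hg, hC, Polynomial.aeval_X]
  · change g d.xi = (g d.tau * _ - _) / _
    rw [ConicData.xi, hg, hX, ConicData.tau, hg, hC, Polynomial.aeval_X]

/-- The inverse map recovers a form y of degree n from its dehomogenization as g(hom y)·sⁿ. It is
enough to verify this on the four generators. -/
theorem eq_zero_of_hom_eq_zero {n : ℕ} {y : R} (hy : y ∈ 𝒜 n) (h : N.hom y = 0) : y = 0 := by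
  have hinj : Function.Injective (algebraMap R (FractionRing R)) := IsFractionRing.injective R _
  have hne : ∀ {y : R}, y ≠ 0 → algebraMap R (FractionRing R) y ≠ 0 := fun h => by
    rwa [Ne, map_eq_zero_iff _ hinj]
  obtain ⟨g, ht, hξ⟩ := N.exists_inverse
  have hD := hne N.den_ne
  have hs := hne N.s_ne
  have hX : algebraMap R (FractionRing R) N.X = g d.elX * algebraMap R _ N.s := by
    have h1 := congrArg g d.elX_mul
    have h2 : g d.elT ≠ 0 := (d.isUnit_elT.map g).ne_zero
    have h3 := congrArg (algebraMap R (FractionRing R)) N.isSolution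
    have h4 : algebraMap R (FractionRing R) N.den = algebraMap R _ N.X * algebraMap R _ N.n₂ :=
      map_mul _ _ _
    have hX0 := hne N.X_ne
    have hn0 : algebraMap R (FractionRing R) N.n₂ ≠ 0 := right_ne_zero_of_mul (h4 ▸ hD)
    have hxt : algebraMap R (FractionRing R) N.x =
        g d.tau * (algebraMap R _ N.X * algebraMap R _ N.n₂) := by
      rw [ht, ← h4, div_mul_cancel₀ _ hD]
    have hYt : algebraMap R (FractionRing R) N.Y =
        g d.tau * algebraMap R _ N.X - g d.xi * algebraMap R _ N.s := by
      rw [hξ, div_mul_cancel₀ _ hs]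
      ring
    apply mul_right_cancel₀ h2
    simp only [n₂, ConicData.formN₂, ConicData.formN₃, ConicData.formM, map_add, map_mul, map_sub,
      map_ofNat, ← IsScalarTower.algebraMap_apply K R (FractionRing R)] at h3 hn0 hxt
    have h5 := ConicData.X_mul_eq hX0 hn0 hs hxt hYt h3
    have h6 : g d.elT = (algebraMap K (FractionRing R) d.q₂ * g d.tau ^ 2 +
        (algebraMap K (FractionRing R) d.p₂ - algebraMap K (FractionRing R) d.q₃) * g d.tau -
        algebraMap K (FractionRing R) d.p₃) * g d.xi - 4 * g d.tau *
        (algebraMap K (FractionRing R) d.m₁ + algebraMap K (FractionRing R) d.m₂ * g d.tau) := by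
      simp only [ConicData.elT, ConicData.elA, ConicData.elB, map_add, map_sub, map_mul, map_pow,
        map_ofNat, AlgHom.commutes]
    simp only [map_add, map_sub, map_mul, map_pow, map_ofNat, AlgHom.commutes] at h1
    rw [h6, h5, mul_right_comm (g d.elX), ← h6, h1]
  have hY : algebraMap R (FractionRing R) N.Y = g d.elY * algebraMap R _ N.s := by
    rw [ConicData.elY, map_sub, map_mul, sub_mul, mul_assoc, ← hX, hξ, div_mul_cancel₀ _ hs]
    ring
  have hx : algebraMap R (FractionRing R) N.x =
      g (d.tau * (d.elX * d.formN₂ d.elX d.elY)) * algebraMap R _ N.s ^ 2 := by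
    have h4 : algebraMap R (FractionRing R) N.den = g (d.elX * d.formN₂ d.elX d.elY) *
        algebraMap R _ N.s ^ 2 := by
      simp only [den, n₂, ConicData.formN₂, map_mul, map_add, AlgHom.commutes, hX, hY,
        ← IsScalarTower.algebraMap_apply K R (FractionRing R)]
      ring
    rw [map_mul, mul_assoc, ← h4, ht, div_mul_cancel₀ _ hD]
  -- The elements of degree n for which the recovery formula holds; these are closed under products,
  -- so `mem_of_adjoin_eq_top` applies.
  let G : ℕ → Submodule K R := fun n =>
    { carrier := {y | y ∈ 𝒜 n ∧ algebraMap R (FractionRing R) y =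
        g (N.hom y) * algebraMap R _ N.s ^ n}
      zero_mem' := ⟨zero_mem _, by simp⟩
      add_mem' := by
        rintro a b ⟨h1, h2⟩ ⟨h3, h4⟩
        exact ⟨add_mem h1 h3, by rw [map_add, map_add, map_add, add_mul, h2, h4]⟩
      smul_mem' := by
        rintro c a ⟨h1, h2⟩
        refine ⟨Submodule.smul_mem _ c h1, ?_⟩
        rw [Algebra.smul_def, map_mul, map_mul, map_mul, AlgHom.commutes, AlgHom.commutes, h2,
          ← IsScalarTower.algebraMap_apply K R (FractionRing R), mul_assoc] }
  have key : y ∈ G n := by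
    refine mem_of_adjoin_eq_top 𝒜 N.adjoin_eq_top G (fun _ _ h => h.1)
      ⟨SetLike.one_mem_graded 𝒜, by simp⟩ ?_ ?_ hy
    · rintro i j a ⟨h1, h2⟩ b ⟨h3, h4⟩
      refine ⟨SetLike.mul_mem_graded h1 h3, ?_⟩
      rw [map_mul, map_mul, map_mul, h2, h4]
      ring
    · rintro a (rfl | rfl | rfl | rfl)
      · exact ⟨1, N.s_mem, by rw [hom_s, map_one, one_mul, pow_one]⟩
      · exact ⟨1, N.X_mem, by rw [hom_X, hX, pow_one]⟩
      · exact ⟨1, N.Y_mem, by rw [hom_Y, hY, pow_one]⟩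
      · exact ⟨2, N.x_mem, by rw [hom_x, hom_den, hx]⟩
  apply hinj
  rw [key.2, h, map_zero, map_zero, zero_mul]

end Inverse

/-- The coordinate ring of the conic bundle, dehomogenized. -/
noncomputable def dehomogenization : Dehomogenization 𝒜 d.Ring where
  hom := N.hom
  eq_zero _ _ hy h := N.eq_zero_of_hom_eq_zero hy h
  unit := N.s
  unit_mem := N.s_mem
  hom_unit := N.hom_s

/-- The elements inverted on a chart on which the parameter on the base is `x' / D'`. -/
def chart (D' x' : R) : Submonoid R := Submonoid.closure
  ({N.s, D', x'} ∪ Set.range fun i => x' - algebraMap K R (d.rt i) * D')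

theorem homogeneous_of_mem_chart {n : ℕ} {D' x' : R} (hD : D' ∈ 𝒜 n) (hx : x' ∈ 𝒜 n) :
    ∀ e ∈ N.chart D' x', SetLike.IsHomogeneousElem 𝒜 e := by
  intro e he
  induction he using Submonoid.closure_induction with
  | mem y hy =>
    rcases hy with (rfl | rfl | rfl) | ⟨i, rfl⟩
    · exact ⟨1, N.s_mem⟩
    · exact ⟨n, hD⟩
    · exact ⟨n, hx⟩
    · exact ⟨n, sub_mem hx (by rw [← Algebra.smul_def]; exact Submodule.smul_mem _ _ hD)⟩
  | one => exact ⟨0, SetLike.one_mem_graded 𝒜⟩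
  | mul a b _ _ ha hb => exact ha.mul hb

/-- The parameters τ and ξ and the inverses of τ and τ - rt i are visibly fractions over the chart.
The inverse of T also is one, since T divides 2q₂²τ∏(τ - rt i) with cofactor `elV`, a polynomial in
elements already known to be fractions. Hence `numT` need not be inverted. -/
theorem isChart {n : ℕ} {D' x' : R} (hD : D' ∈ 𝒜 n) (hx : x' ∈ 𝒜 n)
    (h : N.hom x' = d.tau * N.hom D') : IsChart N.dehomogenization (N.chart D' x') := by
  have hom := N.homogeneous_of_mem_chart hD hx
  have hs : N.s ∈ N.chart D' x' := Submonoid.subset_closure (by simp)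
  have hD' : D' ∈ N.chart D' x' := Submonoid.subset_closure (by simp)
  have hx' : x' ∈ N.chart D' x' := Submonoid.subset_closure (by simp)
  have hi : ∀ i, x' - algebraMap K R (d.rt i) * D' ∈ N.chart D' x' := fun i =>
    Submonoid.subset_closure (Or.inr ⟨i, rfl⟩)
  refine ⟨hs, hom, fun p => ?_⟩
  change p ∈ N.dehomogenization.fractions _ hom
  have mem_iff : ∀ {q : d.Ring} {f : R} {m : ℕ}, f ∈ 𝒜 m → ∀ e ∈ N.chart D' x',
      N.hom f = q * N.hom e → q ∈ N.dehomogenization.fractions _ hom :=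
    fun {q f m} hf e he hq => ⟨f, ⟨m, hf⟩, e, he, hq⟩
  have hK : ∀ a, algebraMap K d.Ring a ∈ N.dehomogenization.fractions _ hom := fun a =>
    mem_iff (m := 0) (f := algebraMap K R a) (by
      rw [Algebra.algebraMap_eq_smul_one]
      exact Submodule.smul_mem _ _ (SetLike.one_mem_graded 𝒜)) 1 (one_mem _) (by simp)
  have hneg : ∀ a, -a ∈ N.dehomogenization.fractions _ hom ↔
      a ∈ N.dehomogenization.fractions _ hom := by
    have h1 : (-1 : d.Ring) ∈ N.dehomogenization.fractions _ hom := by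
      have := hK (-1); rwa [map_neg, map_one] at this
    refine fun a => ⟨fun ha => ?_, fun ha => ?_⟩
    · have := mul_mem h1 ha; rwa [neg_one_mul, neg_neg] at this
    · have := mul_mem h1 ha; rwa [neg_one_mul] at this
  have hsub : ∀ {a b}, a ∈ N.dehomogenization.fractions _ hom →
      b ∈ N.dehomogenization.fractions _ hom → a - b ∈ N.dehomogenization.fractions _ hom := by
    intro a b ha hb
    rw [sub_eq_add_neg]
    exact add_mem ha ((hneg b).2 hb)
  have htau : d.tau ∈ N.dehomogenization.fractions _ hom := mem_iff hx D' hD' h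
  have hX : d.elX ∈ N.dehomogenization.fractions _ hom :=
    mem_iff N.X_mem N.s hs (by rw [N.hom_X, N.hom_s, mul_one])
  have hY : d.elY ∈ N.dehomogenization.fractions _ hom :=
    mem_iff N.Y_mem N.s hs (by rw [N.hom_Y, N.hom_s, mul_one])
  have hxi : d.xi ∈ N.dehomogenization.fractions _ hom := by
    have : d.xi = d.tau * d.elX - d.elY := by rw [ConicData.elY]; ring
    rw [this]
    exact hsub (mul_mem htau hX) hY
  have htau' : ∃ y ∈ N.dehomogenization.fractions _ hom, y * d.tau = 1 := by
    obtain ⟨y, hy⟩ := d.isUnit_tau.exists_left_inv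
    exact ⟨y, mem_iff hD x' hx' (by rw [h, ← mul_assoc, hy, one_mul]), hy⟩
  have hrt' : ∀ i, ∃ y ∈ N.dehomogenization.fractions _ hom,
      y * (d.tau - algebraMap K _ (d.rt i)) = 1 := by
    intro i
    obtain ⟨y, hy⟩ := (d.isUnit_tau_sub i).exists_left_inv
    refine ⟨y, mem_iff hD _ (hi i) ?_, hy⟩
    rw [map_sub, map_mul, AlgHom.commutes, h, ← sub_mul, ← mul_assoc, hy, one_mul]
  obtain ⟨t, ht, ht1⟩ := htau'
  choose y hy hy1 using hrt'
  have hA : d.elA ∈ N.dehomogenization.fractions _ hom :=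
    hsub (add_mem (mul_mem (hK _) (pow_mem htau 2)) (mul_mem (hsub (hK _) (hK _)) htau)) (hK _)
  have hB : d.elB ∈ N.dehomogenization.fractions _ hom := add_mem (hK _) (mul_mem (hK _) htau)
  have hnat : ∀ m : ℕ, (m : d.Ring) ∈ N.dehomogenization.fractions _ hom := fun m =>
    natCast_mem _ m
  have hV : d.elV ∈ N.dehomogenization.fractions _ hom := by
    have h4 : (4 : d.Ring) ∈ N.dehomogenization.fractions _ hom := hnat 4
    exact add_mem (hsub (mul_mem (pow_mem hA 2) hX) (mul_mem (hsub (mul_mem (hK _) htau) (hK _))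
      (add_mem (mul_mem hA hxi) (mul_mem (mul_mem h4 htau) hB))))
      (mul_mem (mul_mem (mul_mem h4 (hK _)) htau) hA)
  refine d.mem_of_mem _ hK htau hxi ?_ p
  -- One copy of `t * ∏ i, y i` inverts τ∏(τ - rt i); the other turns `elV`, up to the scalar, into
  -- the inverse of T.
  refine ⟨algebraMap K d.Ring ((2 * d.q₂ ^ 2)⁻¹) * (t * ∏ i, y i) * d.elV * (t * ∏ i, y i),
    mul_mem (mul_mem (mul_mem (hK _) (mul_mem ht (prod_mem fun i _ => hy i))) hV)
      (mul_mem ht (prod_mem fun i _ => hy i)), ?_⟩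
  have h1 : (t * ∏ i, y i) * (d.tau * ∏ i, (d.tau - algebraMap K _ (d.rt i))) = 1 := by
    rw [mul_mul_mul_comm, ht1, ← Finset.prod_mul_distrib, Finset.prod_congr rfl fun i _ => hy1 i,
      Finset.prod_const_one, one_mul]
  have h2 : algebraMap K d.Ring ((2 * d.q₂ ^ 2)⁻¹) * (2 * algebraMap K _ d.q₂ ^ 2) = 1 := by
    have : (2 : d.Ring) * algebraMap K _ d.q₂ ^ 2 = algebraMap K _ (2 * d.q₂ ^ 2) := by
      rw [map_mul, map_pow, map_ofNat]
    rw [this, ← map_mul, inv_mul_cancel₀ (mul_ne_zero two_ne_zero (pow_ne_zero 2 d.q₂_ne)), map_one]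
  set P := ∏ i, (d.tau - algebraMap K _ (d.rt i))
  set Q := ∏ i, y i
  linear_combination algebraMap K d.Ring ((2 * d.q₂ ^ 2)⁻¹) * (t * Q) ^ 2 * (d.tau * P) *
    d.elT_mul_elV + (t * Q * (d.tau * P)) ^ 2 * h2 + (t * Q * (d.tau * P) + 1) * h1

end ConicPresentation

end Dwork

/-! ### The conic bundle on the Dwork quotient -/

namespace Dwork
open ProjDiv

namespace Constants

variable {K : Type u} [Field K] [CharZero K] {lam : K} (C : Constants lam)

/-- Isolate 4λ in `c_eq`, square, and eliminate λ² by a² + a'² = -2λ² and aa' = 1. -/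
theorem c_a_rel : (2 + C.a + C.a') ^ 2 * C.c ^ 2 + (2 - C.a - C.a') ^ 2 * C.c' ^ 2 +
    6 * (C.a + C.a') ^ 2 - 8 = 0 := by
  have h6 := C.c_eq
  rw [← C.a_add] at h6
  linear_combination ((2 + (C.a + C.a')) * C.c - 4 * lam + (2 - (C.a + C.a')) * C.c') * h6 +
    8 * (C.a_sq + C.a'_sq) - 2 * (2 + (C.a + C.a')) * (2 - (C.a + C.a')) * C.c_mul + 16 * C.a_mul

/-- This and the next two statements give the coefficients of t³, t and t² in the discriminant,
after removal of the common factor (a + a')⁻². The result is even in t, with roots ±c and ±ca'². -/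
theorem disc_three : 2 * (2 * C.a * C.c') * (C.c' * (C.a' - C.a) - C.c * (C.a - C.a')) +
    8 * (C.k * (C.a' - 1)) * (C.k * (C.a + 1)) * (2 * C.a * C.c') * (C.a + C.a')⁻¹ -
      8 * (C.k * (C.a + 1)) ^ 2 * (C.c' * (C.a' - C.a)) * (C.a + C.a')⁻¹ = 0 := by
  have h1 := C.a_mul
  have h2 := C.c_mul
  have h3 := C.k_sq
  have h4 := mul_inv_cancel₀ C.a_add_ne
  generalize (C.a + C.a')⁻¹ = g at *
  generalize C.a = a at *
  generalize C.a' = a' at *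
  generalize C.c = c at *
  generalize C.c' = c' at *
  generalize C.k = k at *
  grind

theorem disc_one : -2 * (2 * C.a' * C.c) * (C.c' * (C.a' - C.a) - C.c * (C.a - C.a')) +
    8 * (C.k * (C.a' - 1)) * (C.k * (C.a + 1)) * (2 * C.a' * C.c) * (C.a + C.a')⁻¹ -
      8 * (C.k * (C.a' - 1)) ^ 2 * (C.c * (C.a - C.a')) * (C.a + C.a')⁻¹ = 0 := by
  have h1 := C.a_mul
  have h2 := C.c_mul
  have h3 := C.k_sq
  have h4 := mul_inv_cancel₀ C.a_add_ne
  generalize (C.a + C.a')⁻¹ = g at *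
  generalize C.a = a at *
  generalize C.a' = a' at *
  generalize C.c = c at *
  generalize C.c' = c' at *
  generalize C.k = k at *
  grind

theorem disc_two : (C.c' * (C.a' - C.a) - C.c * (C.a - C.a')) ^ 2 -
    2 * (2 * C.a * C.c') * (2 * C.a' * C.c) - 8 * (C.k * (C.a' - 1)) * (C.k * (C.a + 1)) *
      (C.c' * (C.a' - C.a) - C.c * (C.a - C.a')) * (C.a + C.a')⁻¹ +
    8 * (C.k * (C.a + 1)) ^ 2 * (2 * C.a' * C.c) * (C.a + C.a')⁻¹ +
    8 * (C.k * (C.a' - 1)) ^ 2 * (2 * C.a * C.c') * (C.a + C.a')⁻¹ -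
    16 * (C.k * (C.a' - 1)) * (C.k * (C.a + 1)) * (C.c * (C.a - C.a')) * (C.a + C.a')⁻¹ =
    -(2 * C.a * C.c') ^ 2 * C.c ^ 2 * (1 + C.a' ^ 4) := by
  have h1 := C.a_mul
  have h2 := C.c_mul
  have h3 := C.k_sq
  have h4 := mul_inv_cancel₀ C.a_add_ne
  have h5 := C.c_a_rel
  generalize (C.a + C.a')⁻¹ = g at *
  generalize C.a = a at *
  generalize C.a' = a' at *
  generalize C.c = c at *
  generalize C.c' = c' at *
  generalize C.k = k at *
  grind

theorem a'_sq_ne_one : C.a' ^ 2 ≠ 1 := by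
  intro h
  apply C.a_sub_ne
  linear_combination C.a' * C.a_mul - C.a * h

theorem a'_sq_ne_neg_one : C.a' ^ 2 ≠ -1 := by
  intro h
  apply C.a_add_ne
  linear_combination C.a * h - C.a' * C.a_mul

/-- The positions of the singular fibres. -/
def rt : Fin 4 → K := ![C.c, -C.c, C.c * C.a' ^ 2, -(C.c * C.a' ^ 2)]

theorem rt_injective : Function.Injective C.rt := by
  have h0 := C.c_ne
  have h1 : C.a' ^ 2 ≠ 0 := pow_ne_zero 2 C.a'_ne
  have h2 := C.a'_sq_ne_one
  have h3 := C.a'_sq_ne_neg_one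
  have n1 : C.c ≠ -C.c := self_ne_neg.2 h0
  have n2 : C.c ≠ C.c * C.a' ^ 2 := fun h => h2 (mul_left_cancel₀ h0 (by linear_combination -h))
  have n3 : C.c ≠ -(C.c * C.a' ^ 2) := fun h =>
    h3 (mul_left_cancel₀ h0 (by linear_combination h))
  have n4 : -C.c ≠ C.c * C.a' ^ 2 := fun h => h3 (mul_left_cancel₀ h0 (by linear_combination -h))
  have n5 : -C.c ≠ -(C.c * C.a' ^ 2) := fun h => n2 (neg_injective h)
  have n6 : C.c * C.a' ^ 2 ≠ -(C.c * C.a' ^ 2) := self_ne_neg.2 (mul_ne_zero h0 h1)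
  intro i j h
  fin_cases i <;> fin_cases j <;> first
    | rfl
    | exact absurd h ‹_›
    | exact absurd h.symm ‹_›

/-- The conic bundle structure on the quotient of the Dwork surface. -/
noncomputable def conicData : ConicData K where
  p₂ := C.c' * (C.a' - C.a) * (C.a + C.a')⁻¹
  q₂ := 2 * C.a * C.c' * (C.a + C.a')⁻¹
  p₃ := 2 * C.a' * C.c * (C.a + C.a')⁻¹
  q₃ := C.c * (C.a - C.a') * (C.a + C.a')⁻¹
  m₁ := C.k * (C.a' - 1) * (C.a + C.a')⁻¹
  m₂ := C.k * (C.a + 1) * (C.a + C.a')⁻¹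
  rt := C.rt
  q₂_ne := mul_ne_zero (mul_ne_zero (mul_ne_zero two_ne_zero C.a_ne) C.c'_ne)
    (inv_ne_zero C.a_add_ne)
  det_ne := by
    -- The coefficients of N₂ = c'(u + av) and N₃ = c(u - a'v) in the basis X = u - av, Y = u + a'v;
    -- their determinant is -1.
    have h : C.c' * (C.a' - C.a) * (C.a + C.a')⁻¹ * (C.c * (C.a - C.a') * (C.a + C.a')⁻¹) -
        2 * C.a' * C.c * (C.a + C.a')⁻¹ * (2 * C.a * C.c' * (C.a + C.a')⁻¹) = -1 := by
      have h4 := mul_inv_cancel₀ C.a_add_ne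
      linear_combination (-((C.a + C.a') * (C.a + C.a')⁻¹) - 1) * h4 -
        (C.a + C.a') ^ 2 * (C.a + C.a')⁻¹ ^ 2 * C.c_mul
    rw [h]
    exact neg_ne_zero.2 one_ne_zero
  rt_ne i := by
    have h1 := mul_ne_zero C.c_ne (pow_ne_zero 2 C.a'_ne)
    fin_cases i
    · exact C.c_ne
    · exact neg_ne_zero.2 C.c_ne
    · exact h1
    · exact neg_ne_zero.2 h1
  rt_inj := C.rt_injective
  disc D _ _ t := by
    have e3 := congrArg (algebraMap K D) C.disc_three
    have e2 := congrArg (algebraMap K D) C.disc_two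
    have e1 := congrArg (algebraMap K D) C.disc_one
    have h1 := congrArg (algebraMap K D) C.a_mul
    have h2 := congrArg (algebraMap K D) C.c_mul
    simp only [Fin.prod_univ_four, rt, Matrix.cons_val, map_sub, map_add, map_mul, map_pow,
      map_neg, map_ofNat, map_one, map_zero] at e3 e2 e1 h1 h2 ⊢
    generalize algebraMap K D (C.a + C.a')⁻¹ = g at *
    generalize algebraMap K D C.a = a at *
    generalize algebraMap K D C.a' = a' at *
    generalize algebraMap K D C.c = c at *
    generalize algebraMap K D C.c' = c' at *
    generalize algebraMap K D C.k = k at *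
    -- The constant coefficient of the discriminant, from aa' = cc' = 1.
    have e0 : (2 * a' * c) ^ 2 = (2 * a * c') ^ 2 * c ^ 4 * a' ^ 4 := by
      linear_combination -(4 * a' ^ 2 * c ^ 2) *
        ((a * a' + 1) * (c * c') ^ 2 * h1 + (c * c' + 1) * h2)
    linear_combination g ^ 2 * (t ^ 3 * e3 + t ^ 2 * e2 + t * e1 + e0)

end Constants

namespace Presentation

variable {K R : Type u} [Field K] [CharZero K] [IsAlgClosed K] [CommRing R] [IsDomain R]
  [Algebra K R] [IsNoetherianRing R] {𝒜 : ℕ → Submodule K R} [GradedAlgebra 𝒜] {lam : K}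
  (M : Presentation 𝒜 lam) (C : Constants lam)

theorem formN₂_eq {D : Type*} [CommRing D] [Algebra K D] (u v : D) :
    C.conicData.formN₂ (u - algebraMap K D C.a * v) (u + algebraMap K D C.a' * v) =
      algebraMap K D C.c' * (u + algebraMap K D C.a * v) := by
  have h4 := congrArg (algebraMap K D) (mul_inv_cancel₀ C.a_add_ne)
  simp only [ConicData.formN₂, Constants.conicData, map_sub, map_add, map_mul, map_one,
    map_ofNat] at h4 ⊢
  linear_combination algebraMap K D C.c' * (u + algebraMap K D C.a * v) * h4

theorem formN₃_eq {D : Type*} [CommRing D] [Algebra K D] (u v : D) :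
    C.conicData.formN₃ (u - algebraMap K D C.a * v) (u + algebraMap K D C.a' * v) =
      algebraMap K D C.c * (u - algebraMap K D C.a' * v) := by
  have h4 := congrArg (algebraMap K D) (mul_inv_cancel₀ C.a_add_ne)
  simp only [ConicData.formN₃, Constants.conicData, map_sub, map_add, map_mul, map_one,
    map_ofNat] at h4 ⊢
  linear_combination algebraMap K D C.c * (u - algebraMap K D C.a' * v) * h4

theorem formM_eq {D : Type*} [CommRing D] [Algebra K D] (u v : D) :
    C.conicData.formM (u - algebraMap K D C.a * v) (u + algebraMap K D C.a' * v) =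
      algebraMap K D C.k * (u + v) := by
  have h4 := congrArg (algebraMap K D) (mul_inv_cancel₀ C.a_add_ne)
  simp only [ConicData.formM, Constants.conicData, map_sub, map_add, map_mul, map_one] at h4 ⊢
  linear_combination algebraMap K D C.k * (u + v) * h4

theorem prod_lin_eq {D : Type*} [CommRing D] [Algebra K D] (u v : D) :
    (u - algebraMap K D C.a * v) * (u + algebraMap K D C.a * v) *
      ((u - algebraMap K D C.a' * v) * (u + algebraMap K D C.a' * v)) =
    u ^ 4 + 2 * algebraMap K D lam ^ 2 * u ^ 2 * v ^ 2 + v ^ 4 := by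
  have h1 := congrArg (algebraMap K D) C.a_mul
  have h2 := congrArg (algebraMap K D) C.a_sq
  have h3 := congrArg (algebraMap K D) C.a'_sq
  simp only [map_sub, map_mul, map_pow, map_one, map_neg] at h1 h2 h3
  linear_combination -(u ^ 2 * v ^ 2) * (h2 + h3) +
    v ^ 4 * (algebraMap K D C.a * algebraMap K D C.a' + 1) * h1

/-- The equation of the surface is equivalent to that of the conic bundle. -/
theorem isSolution_iff {D : Type*} [CommRing D] [Algebra K D] (s u v w : D) :
    C.conicData.IsSolution (s - algebraMap K D C.k * (u + v)) (u - algebraMap K D C.a * v)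
      (u + algebraMap K D C.a' * v)
      (s ^ 2 + 2 * algebraMap K D lam * u * v - algebraMap K D C.r * w) ↔
    2 * w ^ 2 = (s ^ 2 + 2 * algebraMap K D lam * u * v) ^ 2 -
      (u ^ 4 + 2 * algebraMap K D lam ^ 2 * u ^ 2 * v ^ 2 + v ^ 4) := by
  rw [ConicData.IsSolution, formN₂_eq, formN₃_eq, formM_eq, ← prod_lin_eq C]
  have h1 := congrArg (algebraMap K D) C.a_mul
  have h2 := congrArg (algebraMap K D) C.c_mul
  have h3 := congrArg (algebraMap K D) C.k_sq
  have h4 := C.c_eq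
  rw [← C.a_add] at h4
  have h4 := congrArg (algebraMap K D) h4
  have h5 := congrArg (algebraMap K D) C.r_sq
  simp only [map_sub, map_add, map_mul, map_one, map_pow, map_zero, map_ofNat] at h1 h2 h3 h4 h5
  generalize algebraMap K D C.a = a at *
  generalize algebraMap K D C.a' = a' at *
  generalize algebraMap K D C.c = c at *
  generalize algebraMap K D C.c' = c' at *
  generalize algebraMap K D C.k = k at *
  generalize algebraMap K D C.r = r at *
  generalize algebraMap K D lam = l at *
  -- For x = A - rw the double plane reads x² - 2Ax + Q = 0. The product on the left has constant
  -- term Q in x, because cc' = 1, and the right choice of c and k makes the linear terms agree.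
  have key : (s ^ 2 + 2 * l * u * v - r * w - c' * (u + a * v) * (u + a' * v)) *
      (s ^ 2 + 2 * l * u * v - r * w - c * (u - a' * v) * (u - a * v)) -
      2 * (s - k * (u + v)) * (s - k * (u + v) + 2 * (k * (u + v))) *
      (s ^ 2 + 2 * l * u * v - r * w) =
      2 * w ^ 2 - ((s ^ 2 + 2 * l * u * v) ^ 2 - (u - a * v) * (u + a * v) *
        ((u - a' * v) * (u + a' * v))) := by
    grind
  constructor
  · intro h
    linear_combination h - key
  · intro h
    linear_combination h + key

end Presentation
end Dwork

/-! ### Lines on the boundary and the singular fibres -/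

namespace Dwork
open ProjDiv

namespace Constants

variable {K : Type u} [Field K] [CharZero K] {lam : K} (C : Constants lam)

/-- A square root of `(lam⁴ - 1) / 2`. -/
def rho : K := C.al * C.be * C.r / 2

theorem rho_sq : 2 * C.rho ^ 2 = lam ^ 4 - 1 := by
  rw [rho]
  linear_combination (C.al * C.be) ^ 2 / 2 * C.r_sq + C.albe_sq

theorem i_pow_four : C.i ^ 4 = 1 := by linear_combination (C.i ^ 2 - 1) * C.i_sq

theorem neg_i_pow_four : (-C.i) ^ 4 = 1 := by linear_combination (C.i ^ 2 - 1) * C.i_sq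

end Constants

namespace Presentation

variable {K R : Type u} [Field K] [CharZero K] [IsAlgClosed K] [CommRing R] [IsDomain R]
  [Algebra K R] [IsNoetherianRing R] {𝒜 : ℕ → Submodule K R} [GradedAlgebra 𝒜] {lam : K}
  (M : Presentation 𝒜 lam) (C : Constants lam)

section Lines

/-- The linear form of a pair of lines of the second type. -/
def linOne (y : K) : R := M.lin y (-(y ^ 3 * lam))

/-- The linear form of a pair of lines of the third type. -/
def linTwo (y : K) : R := M.lin (-(y ^ 3 * lam)) y

/-- The quadratic form of a line of the second type. -/
def piOne (g : K) : R := M.w - M.quad 0 0 g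

/-- The quadratic form of a line of the third type. -/
def piTwo (g : K) : R := M.w - M.quad g 0 0

theorem ne_zero_of_sq {g : K} (hlam : lam ^ 4 ≠ 1) (hg : 2 * g ^ 2 = lam ^ 4 - 1) : g ≠ 0 := by
  rintro rfl
  exact hlam (by linear_combination -hg)

theorem isLinePair_one (hlam : lam ^ 4 ≠ 1) {y g : K} (hy : y ^ 4 = 1)
    (hg : 2 * g ^ 2 = lam ^ 4 - 1) :
    IsLinePair 𝒜 (M.linOne y) (M.piOne g) (M.piOne (-g)) := by
  have := M.isLinePair_s (isRootOn_one hy hg) ⟨0, 1, by simpa using ne_zero_of_sq hlam hg⟩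
  rwa [neg_zero] at this

theorem isLinePair_two (hlam : lam ^ 4 ≠ 1) {y g : K} (hy : y ^ 4 = 1)
    (hg : 2 * g ^ 2 = lam ^ 4 - 1) :
    IsLinePair 𝒜 (M.linTwo y) (M.piTwo g) (M.piTwo (-g)) := by
  have := M.isLinePair_s (isRootOn_two hy hg) ⟨1, 0, by simpa using ne_zero_of_sq hlam hg⟩
  rwa [neg_zero] at this

/-- Symmetry in u and v suggests a root eu² + fuv + ev². The identities `e1`, `e2`, `e3` compare the
coefficients of u⁴, u³v and u²v² with those of A² - Q at s = k(u + v). -/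
theorem isRootOn_infinity : IsRootOn lam C.k C.k (C.r * (C.c - C.c') / 4)
    (-(C.al * (C.c + C.c') / 2)) (C.r * (C.c - C.c') / 4) := by
  intro D _ _ U V
  have h4 : C.r * C.al * (C.c - C.c') = -(4 * lam) - 2 * (C.c + C.c') := by
    linear_combination C.c_eq
  have e1 : 2 * (C.r * (C.c - C.c') / 4) ^ 2 = C.k ^ 4 - 1 := by
    linear_combination (C.c - C.c') ^ 2 / 8 * C.r_sq - C.c_mul -
      (2 * C.k ^ 2 + C.c + C.c') / 4 * C.k_sq
  have e2 : 4 * (C.r * (C.c - C.c') / 4) * (-(C.al * (C.c + C.c') / 2)) =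
      4 * C.k ^ 4 + 4 * lam * C.k ^ 2 := by
    linear_combination -(C.c + C.c') / 2 * h4 - (2 * C.k ^ 2 + 2 * lam + C.c + C.c') * C.k_sq
  have e3 : 4 * (C.r * (C.c - C.c') / 4) ^ 2 + 2 * (-(C.al * (C.c + C.c') / 2)) ^ 2 =
      6 * C.k ^ 4 + 8 * lam * C.k ^ 2 + 2 * lam ^ 2 := by
    have h1 := C.k_sq
    have h2 := C.c_mul
    have h3 := C.r_sq
    have h5 := C.al_sq
    generalize C.al = al at *
    generalize C.c = c at *
    generalize C.c' = c' at *
    generalize C.k = k at *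
    generalize C.r = r at *
    have h6 : (al * (c - c')) ^ 2 * 2 = (4 * lam + 2 * (c + c')) ^ 2 := by
      linear_combination (r * al * (c - c') - (4 * lam + 2 * (c + c'))) * h4 -
        (al * (c - c')) ^ 2 * h3
    linear_combination (c - c') ^ 2 / 4 * h3 + h6 / 4 + 2 * al ^ 2 * h2 + 2 * h5 -
      (3 * k ^ 2 + 4 * lam + 3 * (c + c') / 2) * h1 - 2 * h2
  have e1 := congrArg (algebraMap K D) e1
  have e2 := congrArg (algebraMap K D) e2
  have e3 := congrArg (algebraMap K D) e3
  generalize C.r * (C.c - C.c') / 4 = e at *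
  generalize -(C.al * (C.c + C.c') / 2) = f at *
  simp only [map_sub, map_add, map_mul, map_one, map_pow, map_ofNat] at e1 e2 e3
  linear_combination (U ^ 4 + V ^ 4) * e1 + U * V * (U ^ 2 + V ^ 2) * e2 + U ^ 2 * V ^ 2 * e3

/-- The two lines of the fibre at infinity. -/
theorem isLinePair_infinity : IsLinePair 𝒜 (M.lin C.k C.k)
    (M.w - M.quad (C.r * (C.c - C.c') / 4) (-(C.al * (C.c + C.c') / 2)) (C.r * (C.c - C.c') / 4))
    (M.w - M.quad (-(C.r * (C.c - C.c') / 4)) (-(-(C.al * (C.c + C.c') / 2)))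
      (-(C.r * (C.c - C.c') / 4))) :=
  M.isLinePair_s (isRootOn_infinity C) ⟨1, 0, by
    have h : C.c - C.c' ≠ 0 := fun h => C.c_sq_ne (by linear_combination C.c * h + C.c_mul)
    simpa using And.intro C.r_ne h⟩

end Lines

/-- The form `x`. -/
def elX : R := M.A - algebraMap K R C.r * M.w

/-- The form conjugate to `x`. -/
def elX' : R := M.A + algebraMap K R C.r * M.w

theorem lin_k : M.lin C.k C.k = M.s - algebraMap K R C.k * (M.u + M.v) := by rw [lin]; ring

theorem linU_neg (b : K) : M.linU (-b) = M.u + algebraMap K R b * M.v := by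
  rw [linU, map_neg]; ring

theorem linU_mem (b : K) : M.linU b ∈ 𝒜 1 :=
  sub_mem M.u_mem (algebraMap_mul_mem _ M.v_mem)

theorem elX_mem : M.elX C ∈ 𝒜 2 := sub_mem M.A_mem (algebraMap_mul_mem _ M.w_mem)
theorem elX'_mem : M.elX' C ∈ 𝒜 2 := add_mem M.A_mem (algebraMap_mul_mem _ M.w_mem)

theorem adjoin_conic : Algebra.adjoin K {M.lin C.k C.k, M.linU C.a, M.linU (-C.a'), M.elX C} = ⊤ := by
  rw [eq_top_iff, ← M.adjoin_eq_top, Algebra.adjoin_le_iff]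
  set S := Algebra.adjoin K {M.lin C.k C.k, M.linU C.a, M.linU (-C.a'), M.elX C}
  have h1 : M.lin C.k C.k ∈ S := Algebra.subset_adjoin (by simp)
  have h2 : M.linU C.a ∈ S := Algebra.subset_adjoin (by simp)
  have h3 : M.linU (-C.a') ∈ S := Algebra.subset_adjoin (by simp)
  have h4 : M.elX C ∈ S := Algebra.subset_adjoin (by simp)
  have hK : ∀ a, algebraMap K R a ∈ S := S.algebraMap_mem
  have e1 := congrArg (algebraMap K R) (mul_inv_cancel₀ C.a_add_ne)
  have e2 := congrArg (algebraMap K R) C.r_sq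
  have e3 := congrArg (algebraMap K R) (mul_inv_cancel₀ (two_ne_zero (α := K)))
  simp only [map_mul, map_add, map_one, map_pow, map_ofNat] at e1 e2 e3
  have hv : M.v ∈ S := by
    have : M.v = (M.linU (-C.a') - M.linU C.a) * algebraMap K R (C.a + C.a')⁻¹ := by
      rw [linU_neg, linU]
      linear_combination -M.v * e1
    rw [this]
    exact mul_mem (sub_mem h3 h2) (hK _)
  have hu : M.u ∈ S := by
    have : M.u = M.linU C.a + algebraMap K R C.a * M.v := by rw [linU]; ring
    rw [this]
    exact add_mem h2 (mul_mem (hK _) hv)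
  have hs : M.s ∈ S := by
    have : M.s = M.lin C.k C.k + algebraMap K R C.k * (M.u + M.v) := by rw [lin_k]; ring
    rw [this]
    exact add_mem h1 (mul_mem (hK _) (add_mem hu hv))
  have hw : M.w ∈ S := by
    have : M.w = (M.s ^ 2 + algebraMap K R (2 * lam) * M.u * M.v - M.elX C) *
        (algebraMap K R C.r * algebraMap K R 2⁻¹) := by
      rw [elX, A, map_mul, map_ofNat]
      linear_combination -M.w * e3 - M.w * algebraMap K R 2⁻¹ * e2
    rw [this]
    exact mul_mem (sub_mem (add_mem (pow_mem hs 2) (mul_mem (mul_mem (hK _) hu) hv)) h4)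
      (mul_mem (hK _) (hK _))
  rintro x (rfl | rfl | rfl | rfl) <;> assumption

/-- The quotient of the Dwork surface as a conic bundle. -/
noncomputable def conic : ConicPresentation 𝒜 C.conicData where
  s := M.lin C.k C.k
  X := M.linU C.a
  Y := M.linU (-C.a')
  x := M.elX C
  s_mem := M.lin_mem
  X_mem := M.linU_mem _
  Y_mem := M.linU_mem _
  x_mem := M.elX_mem C
  isSolution := by
    rw [lin_k, linU_neg, linU, elX, A, isSolution_iff]
    exact M.equation
  adjoin_eq_top := M.adjoin_conic C
  exists_lift D _ _ _ S U V W h := by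
    have e1 := congrArg (algebraMap K D) (mul_inv_cancel₀ C.a_add_ne)
    have e2 := congrArg (algebraMap K D) C.r_sq
    have e3 := congrArg (algebraMap K D) (mul_inv_cancel₀ (two_ne_zero (α := K)))
    simp only [map_mul, map_add, map_one, map_pow, map_ofNat] at e1 e2 e3
    obtain ⟨v, hv⟩ : ∃ v, v = (V - U) * algebraMap K D (C.a + C.a')⁻¹ := ⟨_, rfl⟩
    obtain ⟨u, hu⟩ : ∃ u, u = U + algebraMap K D C.a * v := ⟨_, rfl⟩
    obtain ⟨s, hs⟩ : ∃ s, s = S + algebraMap K D C.k * (u + v) := ⟨_, rfl⟩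
    obtain ⟨w, hw⟩ : ∃ w, w = (s ^ 2 + 2 * algebraMap K D lam * u * v - W) *
      (algebraMap K D C.r * algebraMap K D 2⁻¹) := ⟨_, rfl⟩
    have hS : S = s - algebraMap K D C.k * (u + v) := by rw [hs]; ring
    have hU : U = u - algebraMap K D C.a * v := by rw [hu]; ring
    have hV : V = u + algebraMap K D C.a' * v := by
      rw [hu]
      linear_combination (algebraMap K D C.a + algebraMap K D C.a') * (-hv) - (V - U) * e1
    have hW : W = s ^ 2 + 2 * algebraMap K D lam * u * v - algebraMap K D C.r * w := by
      rw [hw]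
      linear_combination (s ^ 2 + 2 * algebraMap K D lam * u * v - W) *
        (e3 + algebraMap K D 2⁻¹ * e2)
    rw [hS, hU, hV, hW, isSolution_iff] at h
    obtain ⟨f, h1, h2, h3, h4⟩ := M.exists_lift D s u v w h
    refine ⟨f, ?_, ?_, ?_, ?_⟩
    · rw [lin_k, map_sub, map_mul, map_add, h1, h2, h3, AlgHom.commutes, hS]
    · rw [linU, map_sub, map_mul, h2, h3, AlgHom.commutes, hU]
    · rw [linU_neg, map_add, map_mul, h2, h3, AlgHom.commutes, hV]
    · rw [elX, A, map_sub, map_add, map_mul, map_mul, map_mul, map_mul, map_pow, h1, h2, h3, h4,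
        AlgHom.commutes, AlgHom.commutes, map_ofNat, hW]

theorem conic_n₂ : (M.conic C).n₂ = algebraMap K R C.c' * M.linU (-C.a) := by
  rw [linU_neg, ← formN₂_eq]
  change C.conicData.formN₂ (M.linU C.a) (M.linU (-C.a')) = _
  rw [linU_neg, linU]

theorem conic_n₃ : (M.conic C).n₃ = algebraMap K R C.c * M.linU C.a' := by
  rw [linU, ← formN₃_eq]
  change C.conicData.formN₃ (M.linU C.a) (M.linU (-C.a')) = _
  rw [linU_neg, linU]

theorem conic_den : (M.conic C).den =
    M.linU C.a * (algebraMap K R C.c' * M.linU (-C.a)) := by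
  rw [ConicPresentation.den, conic_n₂]; rfl

theorem prod_linU : M.linU C.a * M.linU (-C.a) * (M.linU C.a' * M.linU (-C.a')) =
    M.u ^ 4 + 2 * algebraMap K R lam ^ 2 * M.u ^ 2 * M.v ^ 2 + M.v ^ 4 := by
  rw [← prod_lin_eq C, linU_neg, linU_neg, linU, linU]

theorem elX_mul_elX' : M.elX C * M.elX' C =
    M.linU C.a * M.linU (-C.a) * (M.linU C.a' * M.linU (-C.a')) := by
  have e2 := congrArg (algebraMap K R) C.r_sq
  simp only [map_pow, map_ofNat] at e2
  rw [prod_linU, elX, elX', A]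
  linear_combination -M.w ^ 2 * e2 - M.equation

/-- Two expressions for the base parameter: x/den and Y·n₃/x'. The second one is needed along the
lines on which x and den vanish together. -/
theorem elX_mul_eq_den : M.elX C * M.elX' C = (M.conic C).den * (M.linU (-C.a') * (M.conic C).n₃) := by
  have e2 := congrArg (algebraMap K R) C.c_mul
  simp only [map_mul, map_one] at e2
  rw [elX_mul_elX', conic_den, conic_n₃]
  linear_combination -(M.linU C.a * M.linU (-C.a) * (M.linU C.a' * M.linU (-C.a'))) * e2

/-- With p = ℓ₁ℓ₂ the left side is Q - 2Ay²p + p², and ℓ₁ℓ₂ + ℓ₃ℓ₄ = 2(u² + λ²v²). What remains is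
-2y²p times A - y²(u² + λ²v²), which is the product of the forms for y and -y. This identifies the
fibres at ±c. -/
theorem fibre_one {y : K} (hy : y ^ 4 = 1) :
    (M.elX C - algebraMap K R (y ^ 2) * (M.linU C.a * M.linU (-C.a))) *
      (M.elX' C - algebraMap K R (y ^ 2) * (M.linU C.a * M.linU (-C.a))) =
    -(2 * algebraMap K R (y ^ 2)) * (M.linU C.a * M.linU (-C.a)) *
      (M.linOne y * M.linOne (-y)) := by
  have h1 := M.elX_mul_elX' C
  have h2 : M.elX C + M.elX' C = 2 * M.A := by rw [elX, elX']; ring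
  have h3 := congrArg (algebraMap K R) C.a_sq
  have h4 := congrArg (algebraMap K R) C.a'_sq
  have h5 := congrArg (algebraMap K R) hy
  simp only [map_sub, map_mul, map_pow, map_one, map_neg] at h3 h4 h5 ⊢
  have h6 : M.linU C.a * M.linU (-C.a) + M.linU C.a' * M.linU (-C.a') =
      2 * (M.u ^ 2 + algebraMap K R lam ^ 2 * M.v ^ 2) := by
    rw [linU_neg, linU_neg, linU, linU]
    linear_combination -M.v ^ 2 * (h3 + h4)
  have h7 : M.linOne y * M.linOne (-y) = M.A - algebraMap K R y ^ 2 *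
      (M.u ^ 2 + algebraMap K R lam ^ 2 * M.v ^ 2) := by
    rw [linOne, linOne, lin, lin, A]
    simp only [map_neg, map_mul, map_pow]
    linear_combination (2 * algebraMap K R lam * M.u * M.v - algebraMap K R y ^ 2 *
      algebraMap K R lam ^ 2 * M.v ^ 2) * h5
  rw [h7]
  generalize M.linU C.a * M.linU (-C.a) = p at *
  linear_combination h1 - algebraMap K R y ^ 2 * p * h2 + p ^ 2 * h5 + p * h6 -
    2 * p * (M.u ^ 2 + algebraMap K R lam ^ 2 * M.v ^ 2) * h5

/-- As for `fibre_one`, now with ℓ₃ℓ₄ + a'⁴ℓ₁ℓ₂ = -2a'²(λ²u² + v²). This identifies the fibres at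
±ca'². -/
theorem fibre_two {y : K} (hy : y ^ 4 = 1) :
    (M.elX C + algebraMap K R (y ^ 2 * C.a' ^ 2) * (M.linU C.a * M.linU (-C.a))) *
      (M.elX' C + algebraMap K R (y ^ 2 * C.a' ^ 2) * (M.linU C.a * M.linU (-C.a))) =
    2 * algebraMap K R (y ^ 2 * C.a' ^ 2) * (M.linU C.a * M.linU (-C.a)) *
      (M.linTwo y * M.linTwo (-y)) := by
  have h1 := M.elX_mul_elX' C
  have h2 : M.elX C + M.elX' C = 2 * M.A := by rw [elX, elX']; ring
  have h3 := congrArg (algebraMap K R) C.a_sq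
  have h4 := congrArg (algebraMap K R) C.a'_sq
  have h5 := congrArg (algebraMap K R) hy
  have h8 := congrArg (algebraMap K R) C.a_mul
  have h9 := congrArg (algebraMap K R) C.albe_sq
  simp only [map_sub, map_mul, map_pow, map_one, map_neg] at h3 h4 h5 h8 h9 ⊢
  have h6 : M.linU C.a' * M.linU (-C.a') + algebraMap K R C.a' ^ 4 *
      (M.linU C.a * M.linU (-C.a)) = -(2 * algebraMap K R C.a' ^ 2 *
        (algebraMap K R lam ^ 2 * M.u ^ 2 + M.v ^ 2)) := by
    rw [linU_neg, linU_neg, linU, linU]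
    generalize algebraMap K R C.a = a at *
    generalize algebraMap K R C.a' = a' at *
    generalize algebraMap K R C.al = al at *
    generalize algebraMap K R C.be = be at *
    generalize algebraMap K R lam = l at *
    grind
  have h7 : M.linTwo y * M.linTwo (-y) = M.A - algebraMap K R y ^ 2 *
      (algebraMap K R lam ^ 2 * M.u ^ 2 + M.v ^ 2) := by
    rw [linTwo, linTwo, lin, lin, A]
    simp only [map_neg, map_mul, map_pow]
    linear_combination (2 * algebraMap K R lam * M.u * M.v - algebraMap K R y ^ 2 *
      algebraMap K R lam ^ 2 * M.u ^ 2) * h5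
  rw [h7]
  generalize M.linU C.a * M.linU (-C.a) = p at *
  linear_combination h1 + algebraMap K R y ^ 2 * algebraMap K R C.a' ^ 2 * p * h2 +
    p ^ 2 * algebraMap K R C.a' ^ 4 * h5 + p * h6 +
    2 * p * algebraMap K R C.a' ^ 2 * (algebraMap K R lam ^ 2 * M.u ^ 2 + M.v ^ 2) * h5

/-- The linear forms of the pairs of lines that occur in the conic bundle. -/
def IsPairForm (ℓ : R) : Prop := ∃ π π', IsLinePair 𝒜 ℓ π π'

/-- The linear forms of the lines that are contained in the complement of the chart. -/
inductive IsBoundaryForm : R → Prop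
  | infinity : IsBoundaryForm (M.lin C.k C.k)
  | u (x y : K) (hx : x ^ 2 = 1) (hy : y ^ 2 = 1) : IsBoundaryForm (M.linU (C.root x y))
  | one (y : K) (hy : y ^ 4 = 1) : IsBoundaryForm (M.linOne y)
  | two (y : K) (hy : y ^ 4 = 1) : IsBoundaryForm (M.linTwo y)

theorem isPairForm {ℓ : R} (h : M.IsBoundaryForm C ℓ) : IsPairForm (𝒜 := 𝒜) ℓ := by
  cases h with
  | infinity => exact ⟨_, _, M.isLinePair_infinity C⟩
  | u x y hx hy => exact ⟨_, _, M.isLinePair_u (C.root_eq hx hy) C.half_r⟩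
  | one y hy => exact ⟨_, _, M.isLinePair_one C.lam_ne hy C.rho_sq⟩
  | two y hy => exact ⟨_, _, M.isLinePair_two C.lam_ne hy C.rho_sq⟩

theorem isBoundaryForm_u {b : K} (hb : b = C.a ∨ b = -C.a ∨ b = C.a' ∨ b = -C.a') :
    M.IsBoundaryForm C (M.linU b) := by
  have e1 : C.root 1 1 = C.a := by rw [Constants.root, Constants.a]; ring
  have e2 : C.root (-1) (-1) = -C.a := by rw [Constants.root, Constants.a]; ring
  have e3 : C.root 1 (-1) = C.a' := by rw [Constants.root, Constants.a']; ring
  have e4 : C.root (-1) 1 = -C.a' := by rw [Constants.root, Constants.a']; ring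
  rcases hb with rfl | rfl | rfl | rfl
  · rw [← e1]; exact .u 1 1 (by norm_num) (by norm_num)
  · rw [← e2]; exact .u (-1) (-1) (by norm_num) (by norm_num)
  · rw [← e3]; exact .u 1 (-1) (by norm_num) (by norm_num)
  · rw [← e4]; exact .u (-1) 1 (by norm_num) (by norm_num)

theorem mem_of_algebraMap_mul_mem {P : Ideal R} {a : K} (ha : a ≠ 0) {x : R}
    (h : algebraMap K R a * x ∈ P) : x ∈ P := by
  have := P.mul_mem_left (algebraMap K R a⁻¹) h
  rwa [← mul_assoc, ← map_mul, inv_mul_cancel₀ ha, map_one, one_mul] at this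

/-- A prime ideal that meets the multiplicative set of the first chart contains the linear form of a
pair of lines. -/
theorem exists_isBoundaryForm_mem {P : Ideal R} [hP : P.IsPrime] {e : R}
    (he : e ∈ (M.conic C).chart (M.conic C).den (M.conic C).x) (heP : e ∈ P) :
    ∃ ℓ, M.IsBoundaryForm C ℓ ∧ ℓ ∈ P := by
  have hl12 : M.linU C.a * M.linU (-C.a) ∈ P → ∃ ℓ, M.IsBoundaryForm C ℓ ∧ ℓ ∈ P := by
    intro h
    rcases hP.mem_or_mem h with h | h
    · exact ⟨_, M.isBoundaryForm_u C (by simp), h⟩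
    · exact ⟨_, M.isBoundaryForm_u C (by simp), h⟩
  have hl34 : M.linU C.a' * M.linU (-C.a') ∈ P → ∃ ℓ, M.IsBoundaryForm C ℓ ∧ ℓ ∈ P := by
    intro h
    rcases hP.mem_or_mem h with h | h
    · exact ⟨_, M.isBoundaryForm_u C (by simp), h⟩
    · exact ⟨_, M.isBoundaryForm_u C (by simp), h⟩
  have hone : ∀ y, y ^ 4 = 1 → M.elX C - algebraMap K R (y ^ 2) *
      (M.linU C.a * M.linU (-C.a)) ∈ P → ∃ ℓ, M.IsBoundaryForm C ℓ ∧ ℓ ∈ P := by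
    intro y hy h
    have h1 := P.mul_mem_right (M.elX' C - algebraMap K R (y ^ 2) *
      (M.linU C.a * M.linU (-C.a))) h
    rw [M.fibre_one C hy, mul_assoc] at h1
    have h2 : -(2 * algebraMap K R (y ^ 2)) = algebraMap K R (-(2 * y ^ 2)) := by
      simp only [map_neg, map_mul, map_ofNat]
    have hy0 : y ≠ 0 := by rintro rfl; norm_num at hy
    rw [h2] at h1
    rcases hP.mem_or_mem (mem_of_algebraMap_mul_mem (by simpa using hy0) h1) with h | h
    · exact hl12 h
    · rcases hP.mem_or_mem h with h | h
      · exact ⟨_, .one y hy, h⟩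
      · exact ⟨_, .one (-y) (by rw [← hy]; ring), h⟩
  have htwo : ∀ y, y ^ 4 = 1 → M.elX C + algebraMap K R (y ^ 2 * C.a' ^ 2) *
      (M.linU C.a * M.linU (-C.a)) ∈ P → ∃ ℓ, M.IsBoundaryForm C ℓ ∧ ℓ ∈ P := by
    intro y hy h
    have h1 := P.mul_mem_right (M.elX' C + algebraMap K R (y ^ 2 * C.a' ^ 2) *
      (M.linU C.a * M.linU (-C.a))) h
    rw [M.fibre_two C hy, mul_assoc] at h1
    have h2 : 2 * algebraMap K R (y ^ 2 * C.a' ^ 2) = algebraMap K R (2 * (y ^ 2 * C.a' ^ 2)) := by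
      simp only [map_mul, map_ofNat]
    have hy0 : y ≠ 0 := by rintro rfl; norm_num at hy
    rw [h2] at h1
    rcases hP.mem_or_mem (mem_of_algebraMap_mul_mem (by simpa [C.a'_ne] using hy0) h1) with h | h
    · exact hl12 h
    · rcases hP.mem_or_mem h with h | h
      · exact ⟨_, .two y hy, h⟩
      · exact ⟨_, .two (-y) (by rw [← hy]; ring), h⟩
  have hcc := congrArg (algebraMap K R) C.c_mul
  rw [map_mul, map_one] at hcc
  -- The chart is generated as a monoid, so a prime that meets it contains a generator.
  obtain ⟨g, hg, hgP⟩ : ∃ g ∈ ({(M.conic C).s, (M.conic C).den, (M.conic C).x} ∪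
      Set.range fun i => (M.conic C).x - algebraMap K R (C.conicData.rt i) * (M.conic C).den),
      g ∈ P := by
    by_contra! hno
    have hle : (M.conic C).chart (M.conic C).den (M.conic C).x ≤ P.primeCompl := by
      rw [ConicPresentation.chart, Submonoid.closure_le]
      exact fun g hg => hno g hg
    exact hle he heP
  rcases hg with (rfl | rfl | rfl) | ⟨i, rfl⟩
  · exact ⟨_, .infinity, hgP⟩
  · rw [conic_den] at hgP
    apply hl12
    apply mem_of_algebraMap_mul_mem C.c'_ne
    rwa [mul_left_comm]
  · have h1 := P.mul_mem_right (M.elX' C) hgP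
    change M.elX C * _ ∈ P at h1
    rw [elX_mul_elX'] at h1
    rcases hP.mem_or_mem h1 with h | h
    · exact hl12 h
    · exact hl34 h
  · change M.elX C - algebraMap K R (C.rt i) * (M.conic C).den ∈ P at hgP
    rw [conic_den] at hgP
    have hi := C.i_sq
    -- The four roots c, -c, ca'², -ca'² correspond to y = 1, i in the first family and y = i, 1 in
    -- the second, since y² enters with opposite signs.
    fin_cases i
    · refine hone 1 (by norm_num) ?_
      convert hgP using 2
      change _ = algebraMap K R C.c * _
      rw [one_pow, map_one]
      linear_combination -(M.linU C.a * M.linU (-C.a)) * hcc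
    · refine hone C.i C.i_pow_four ?_
      convert hgP using 2
      change _ = algebraMap K R (-C.c) * _
      rw [hi, map_neg, map_neg, map_one]
      linear_combination (M.linU C.a * M.linU (-C.a)) * hcc
    · refine htwo C.i C.i_pow_four ?_
      convert hgP using 1
      change _ = _ - algebraMap K R (C.c * C.a' ^ 2) * _
      rw [hi, neg_one_mul, map_neg, map_mul]
      linear_combination (M.linU C.a * M.linU (-C.a)) * algebraMap K R (C.a' ^ 2) * hcc
    · refine htwo 1 (by norm_num) ?_
      convert hgP using 1
      change _ = _ - algebraMap K R (-(C.c * C.a' ^ 2)) * _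
      rw [one_pow, one_mul, map_neg, map_mul]
      linear_combination -(M.linU C.a * M.linU (-C.a)) * algebraMap K R (C.a' ^ 2) * hcc

end Presentation
end Dwork

/-! ### Two charts cover the surface outside the boundary lines -/

namespace Dwork
open ProjDiv

instance {K : Type u} [Field K] [CharZero K] (d : ConicData K) :
    UniqueFactorizationMonoid d.Ring :=
  (isUniqueFactorization_of_isLocalization (N := d.Ring) (Submonoid.powers (∏ i, d.primes i))
    inferInstance (powers_le_nonZeroDivisors_of_noZeroDivisors d.prod_primes_ne_zero)).choose_spec

namespace Presentation

variable {K R : Type u} [Field K] [CharZero K] [IsAlgClosed K] [CommRing R] [IsDomain R]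
  [Algebra K R] [IsNoetherianRing R] {𝒜 : ℕ → Submodule K R} [GradedAlgebra 𝒜] {lam : K}
  (M : Presentation 𝒜 lam) (C : Constants lam)

/-- The multiplicative sets of the two charts. -/
noncomputable def charts (i : Bool) : Submonoid R :=
  bif i then (M.conic C).chart (M.conic C).den (M.conic C).x else
    (M.conic C).chart (M.elX' C) (M.linU (-C.a') * (M.conic C).n₃)

theorem hom_num : (M.conic C).hom (M.linU (-C.a') * (M.conic C).n₃) =
    C.conicData.tau * (M.conic C).hom (M.elX' C) := by
  have h1 := congrArg (M.conic C).hom (M.elX_mul_eq_den C)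
  have h2 : (M.conic C).hom (M.elX C) = _ := (M.conic C).hom_x
  rw [map_mul, map_mul, h2] at h1
  have h0 : (M.conic C).hom (M.conic C).den ≠ 0 := fun h =>
    (M.conic C).den_ne ((M.conic C).eq_zero_of_hom_eq_zero (n := 2) (by
      rw [conic_den, mul_left_comm]
      exact algebraMap_mul_mem _ (mul_mem_two (M.linU_mem _) (M.linU_mem _))) h)
  apply mul_left_cancel₀ h0
  rw [← h1]
  ring

theorem den_mem : (M.conic C).den ∈ 𝒜 2 := by
  rw [conic_den, mul_left_comm]
  exact algebraMap_mul_mem _ (mul_mem_two (M.linU_mem _) (M.linU_mem _))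

theorem num_mem : M.linU (-C.a') * (M.conic C).n₃ ∈ 𝒜 2 := by
  rw [conic_n₃, mul_left_comm]
  exact algebraMap_mul_mem _ (mul_mem_two (M.linU_mem _) (M.linU_mem _))

theorem isChart_charts (i : Bool) : IsChart (M.conic C).dehomogenization (M.charts C i) := by
  cases i
  · exact (M.conic C).isChart (M.elX'_mem C) (M.num_mem C) (M.hom_num C)
  · exact (M.conic C).isChart (M.den_mem C) (M.conic C).x_mem (M.conic C).hom_x

/-- All lines may serve as exceptional curves. The chart of x/den alone already shows that a prime
outside the charts contains a boundary form, hence one of the two lines over it. -/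
theorem isChartCover : IsChartCover (M.conic C).dehomogenization (M.charts C)
    (fun q : {q : R × R // IsLine 𝒜 q.1 q.2} => Ideal.span {q.1.1, q.1.2}) (fun q => q.1.1) where
  isChart := M.isChart_charts C
  isPrime q := q.2.isPrime
  isUniformizer q := q.2.isUniformizer
  isPrime_map q := q.2.isPrime_map
  exists_le P hP h := by
    obtain ⟨e, he, heP⟩ := h true
    obtain ⟨ℓ, hℓ, hℓP⟩ := M.exists_isBoundaryForm_mem C he heP
    obtain ⟨π, π', hp⟩ := M.isPairForm C hℓ
    obtain ⟨z, hz⟩ := hp.exists_mul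
    have h1 : π * π' ∈ P := by rw [hz]; exact P.mul_mem_right _ hℓP
    rcases hP.mem_or_mem h1 with h | h
    · refine ⟨⟨(ℓ, π), hp.fst⟩, ?_⟩
      rw [Ideal.span_le]
      rintro _ (rfl | rfl) <;> assumption
    · refine ⟨⟨(ℓ, π'), hp.snd⟩, ?_⟩
      rw [Ideal.span_le]
      rintro _ (rfl | rfl) <;> assumption

include M C in
theorem isDiscreteValuationRing (P : PrimeDivisor 𝒜) :
    IsDiscreteValuationRing (Localization.AtPrime P.ideal) :=
  (M.isChartCover C).isDiscreteValuationRing P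

include M C in
theorem algebraicallyTrivial_le : algebraicallyTrivial 𝒜 ≤ principalDivisors 𝒜 :=
  (M.isChartCover C).algebraicallyTrivial_le (fun a => (M.conic C).hom.commutes a)
    fun B _ _ _ _ => tensor_localization_isUniqueFactorization _ C.conicData.prod_primes_ne_zero
      C.conicData.Ring B

/-- A prime ideal that contains the forms `u - b v` and `u - b' v`. -/
theorem mem_of_linU_mem {P : Ideal R} {b b' : K} (h : b ≠ b') (h1 : M.linU b ∈ P)
    (h2 : M.linU b' ∈ P) : M.u ∈ P ∧ M.v ∈ P := by
  have h3 := P.sub_mem h2 h1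
  have h4 : M.linU b' - M.linU b = algebraMap K R (b - b') * M.v := by
    rw [linU, linU, map_sub]; ring
  rw [h4] at h3
  have h5 := mem_of_algebraMap_mul_mem (sub_ne_zero.2 h) h3
  refine ⟨?_, h5⟩
  have h6 := P.add_mem h1 (P.mul_mem_left (algebraMap K R b) h5)
  rwa [linU, sub_add_cancel] at h6

/-- The elements of the dehomogenized ring are defined on at least one of the charts. -/
theorem exists_forall_not_dvd (p : C.conicData.Ring) (hp : Prime p) :
    ∃ i, ∀ e ∈ M.charts C i, ¬ p ∣ (M.conic C).dehomogenization.hom e := by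
  by_contra! hno
  set P : Ideal R := (Ideal.span {p}).comap (M.conic C).hom with hPdef
  have hspan : (Ideal.span {p}).IsPrime := (Ideal.span_singleton_prime hp.ne_zero).2 hp
  have hP : P.IsPrime := Ideal.comap_isPrime _ _
  have hmem : ∀ x, x ∈ P ↔ p ∣ (M.conic C).hom x := fun x => by
    rw [hPdef, Ideal.mem_comap, Ideal.mem_span_singleton]
  have key : ∀ D' x' : R, (M.conic C).hom x' = C.conicData.tau * (M.conic C).hom D' →
      (∃ e ∈ (M.conic C).chart D' x', p ∣ (M.conic C).hom e) → D' ∈ P := by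
    rintro D' x' h ⟨e, he, hpe⟩
    obtain ⟨g, hg, hgP⟩ : ∃ g ∈ ({(M.conic C).s, D', x'} ∪
        Set.range fun i => x' - algebraMap K R (C.conicData.rt i) * D'), g ∈ P := by
      by_contra! h0
      have hle : (M.conic C).chart D' x' ≤ P.primeCompl := by
        rw [ConicPresentation.chart, Submonoid.closure_le]
        exact fun g hg => h0 g hg
      exact hle he ((hmem e).2 hpe)
    rw [hmem] at hgP
    rw [hmem]
    rcases hg with (rfl | rfl | rfl) | ⟨i, rfl⟩
    · rw [(M.conic C).hom_s] at hgP
      exact absurd (isUnit_of_dvd_one hgP) hp.not_isUnit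
    · exact hgP
    · rw [h] at hgP
      exact (C.conicData.isUnit_tau.dvd_mul_left).1 hgP
    · rw [map_sub, map_mul, AlgHom.commutes, h, ← sub_mul] at hgP
      exact ((C.conicData.isUnit_tau_sub i).dvd_mul_left).1 hgP
  -- A prime of Λ that divides an element of both charts would make den and x' vanish, and with them
  -- x and Y·n₃. Then A = 0, two different forms u - bv vanish, so u = v = s = 0, contradicting that
  -- the form s - k(u + v) dehomogenizes to 1.
  have hD : (M.conic C).den ∈ P := key _ _ (M.conic C).hom_x (hno true)
  have hx' : M.elX' C ∈ P := key _ _ (M.hom_num C) (hno false)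
  have hx : M.elX C ∈ P := by
    rw [hmem] at hD ⊢
    change p ∣ (M.conic C).hom (M.conic C).x
    rw [(M.conic C).hom_x]
    exact dvd_mul_of_dvd_right hD _
  have hn : M.linU (-C.a') * (M.conic C).n₃ ∈ P := by
    rw [hmem] at hx' ⊢
    rw [M.hom_num C]
    exact dvd_mul_of_dvd_right hx' _
  have hA : M.A ∈ P := by
    have h1 := P.add_mem hx hx'
    have h2 : M.elX C + M.elX' C = algebraMap K R 2 * M.A := by
      rw [elX, elX', map_ofNat]; ring
    rw [h2] at h1
    exact mem_of_algebraMap_mul_mem two_ne_zero h1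
  rw [conic_den] at hD
  rw [conic_n₃] at hn
  have n1 : C.a ≠ C.a' := sub_ne_zero.1 C.a_sub_ne
  have n2 : C.a ≠ -C.a' := fun h => C.a_add_ne (by rw [h]; ring)
  have n3 : -C.a ≠ C.a' := fun h => C.a_add_ne (by rw [← h]; ring)
  have n4 : -C.a ≠ -C.a' := fun h => n1 (neg_injective h)
  have huv : M.u ∈ P ∧ M.v ∈ P := by
    rcases hP.mem_or_mem hD with h | h
    · rcases hP.mem_or_mem hn with h' | h'
      · exact M.mem_of_linU_mem n2 h h'
      · exact M.mem_of_linU_mem n1 h (mem_of_algebraMap_mul_mem C.c_ne h')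
    · have h := mem_of_algebraMap_mul_mem C.c'_ne h
      rcases hP.mem_or_mem hn with h' | h'
      · exact M.mem_of_linU_mem n4 h h'
      · exact M.mem_of_linU_mem n3 h (mem_of_algebraMap_mul_mem C.c_ne h')
  have hs : M.s ∈ P := by
    have h1 := P.sub_mem hA (P.mul_mem_left (2 * algebraMap K R lam * M.u) huv.2)
    rw [A, add_sub_cancel_right] at h1
    exact hP.mem_of_pow_mem 2 h1
  have hs' : (M.conic C).s ∈ P := by
    change M.lin C.k C.k ∈ P
    rw [lin_k]
    exact P.sub_mem hs (P.mul_mem_left _ (P.add_mem huv.1 huv.2))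
  rw [hmem, (M.conic C).hom_s] at hs'
  exact hp.not_isUnit (isUnit_of_dvd_one hs')

end Presentation

namespace ConicPresentation

variable {K R : Type u} [Field K] [CharZero K] [CommRing R] [IsDomain R] [Algebra K R]
  {𝒜 : ℕ → Submodule K R} [GradedAlgebra 𝒜] {d : ConicData K} (N : ConicPresentation 𝒜 d)

theorem den_mem : N.den ∈ 𝒜 2 :=
  SetLike.mul_mem_graded (i := 1) (j := 1) N.X_mem (by
    rw [n₂, ConicData.formN₂, ← Algebra.smul_def, ← Algebra.smul_def]
    exact add_mem (Submodule.smul_mem _ _ N.X_mem) (Submodule.smul_mem _ _ N.Y_mem))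

theorem numT_mem : N.numT ∈ 𝒜 7 := by
  have hmul : ∀ {a : K} {n : ℕ} {x : R}, x ∈ 𝒜 n → algebraMap K R a * x ∈ 𝒜 n := fun hx => by
    rw [← Algebra.smul_def]; exact Submodule.smul_mem _ _ hx
  have hD := N.den_mem
  have hm : ∀ {i j : ℕ} {x y : R}, x ∈ 𝒜 i → y ∈ 𝒜 j → x * y ∈ 𝒜 (i + j) := fun hx hy =>
    SetLike.mul_mem_graded hx hy
  have hA : d.formA N.x N.den ∈ 𝒜 4 := by
    have : d.formA N.x N.den = algebraMap K R d.q₂ * (N.x * N.x) +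
        algebraMap K R (d.p₂ - d.q₃) * (N.x * N.den) - algebraMap K R d.p₃ * (N.den * N.den) := by
      rw [ConicData.formA, map_sub]; ring
    rw [this]
    exact sub_mem (add_mem (hmul (hm N.x_mem N.x_mem)) (hmul (hm N.x_mem hD))) (hmul (hm hD hD))
  have h2 : 4 * N.x * N.den * N.s * d.formM N.den N.x =
      algebraMap K R 4 * (N.x * N.den * N.s * (algebraMap K R d.m₁ * N.den +
        algebraMap K R d.m₂ * N.x)) := by
    rw [map_ofNat, ConicData.formM]; ring
  rw [numT, h2]
  exact sub_mem (hm (i := 4) (j := 3) hA (sub_mem (hm (i := 2) (j := 1) N.x_mem N.X_mem)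
      (hm (i := 1) (j := 2) N.Y_mem hD)))
    (hmul (hm (i := 5) (j := 2) (hm (i := 4) (j := 1) (hm (i := 2) (j := 2) N.x_mem hD) N.s_mem)
      (add_mem (hmul hD) (hmul N.x_mem))))

/-- The degree of `numT` is 7, that of `den` is 2 and that of `s` is 1: T is the fraction
numT/(den³s), and s dehomogenizes to 1. -/
theorem hom_numT : N.hom N.numT = N.hom N.den ^ 3 * d.elT := by
  have hY : d.xi = d.tau * d.elX - d.elY := by rw [ConicData.elY]; ring
  simp only [numT, ConicData.formA, ConicData.formM, map_add, map_mul, map_sub, map_pow, map_ofNat,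
    AlgHom.commutes, hom_x, hom_s, hom_X, hom_Y, ConicData.elT, ConicData.elA, ConicData.elB, hY]
  ring

/-- The zeros of the numerator of `T` lie outside of the first chart. -/
theorem exists_mem_chart_of_numT_mem {P : Ideal R} (h : N.numT ∈ P) :
    ∃ e ∈ N.chart N.den N.x, e ∈ P := by
  have hhom := N.homogeneous_of_mem_chart N.den_mem N.x_mem
  have hD : N.den ∈ N.chart N.den N.x := Submonoid.subset_closure (by simp)
  have hs : N.s ∈ N.chart N.den N.x := Submonoid.subset_closure (by simp)
  -- As T is a unit, multiplying `numT` by a numerator of its inverse gives an element of the chart,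
  -- up to powers of s.
  obtain ⟨y, hy⟩ := d.isUnit_elT.exists_right_inv
  obtain ⟨f, hf, e, he, hfe⟩ := (N.isChart N.den_mem N.x_mem N.hom_x).exists_eq_mul y
  obtain ⟨a, b, hab⟩ := N.dehomogenization.exists_mul_unit_pow_eq
    (f := N.numT * f) (g := N.den ^ 3 * e)
    (SetLike.IsHomogeneousElem.mul ⟨7, N.numT_mem⟩ hf)
    (hhom _ (mul_mem (pow_mem hD 3) he)) (by
      change N.hom _ = N.hom _
      change N.hom f = y * N.hom e at hfe
      rw [map_mul, map_mul, hfe, hom_numT, map_pow]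
      linear_combination N.hom N.den ^ 3 * N.hom e * hy)
  refine ⟨N.den ^ 3 * e * N.s ^ b, mul_mem (mul_mem (pow_mem hD 3) he) (pow_mem hs b), ?_⟩
  change _ = N.den ^ 3 * e * N.s ^ b at hab
  rw [← hab]
  exact P.mul_mem_right _ (P.mul_mem_right _ h)

end ConicPresentation

end Dwork

namespace Dwork
open ProjDiv

/-! ### Classes of divisors in the rational Néron-Severi group -/

section Classes

variable {K R : Type u} [Field K] [CommRing R] [Algebra K R] (𝒜 : ℕ → Submodule K R)
  [GradedAlgebra 𝒜]

/-- The class of a divisor in the rational Néron-Severi group. -/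
noncomputable def cl : Divisor 𝒜 →+ ℚ ⊗[ℤ] NS 𝒜 :=
  (TensorProduct.mk ℤ ℚ (NS 𝒜) 1).toAddMonoidHom.comp
    ((QuotientAddGroup.mk' (picZero 𝒜)).comp (QuotientAddGroup.mk' (principalDivisors 𝒜)))

variable {𝒜}

theorem cl_apply (D : Divisor 𝒜) : cl 𝒜 D = (1 : ℚ) ⊗ₜ[ℤ] (QuotientAddGroup.mk
    (QuotientAddGroup.mk D : Pic 𝒜) : NS 𝒜) := rfl

theorem cl_eq_zero {D : Divisor 𝒜} (h : D ∈ principalDivisors 𝒜) : cl 𝒜 D = 0 := by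
  have h1 : (QuotientAddGroup.mk D : Pic 𝒜) = 0 := (QuotientAddGroup.eq_zero_iff D).2 h
  rw [cl_apply, h1, QuotientAddGroup.mk_zero, TensorProduct.tmul_zero]

theorem eq_top_of_forall_cl_mem {W : Submodule ℚ (ℚ ⊗[ℤ] NS 𝒜)} (h : ∀ D, cl 𝒜 D ∈ W) : W = ⊤ := by
  rw [eq_top_iff]
  rintro x -
  induction x using TensorProduct.induction_on with
  | zero => exact zero_mem _
  | add x y hx hy => exact add_mem hx hy
  | tmul q x =>
    obtain ⟨x, rfl⟩ := QuotientAddGroup.mk_surjective x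
    obtain ⟨D, rfl⟩ := QuotientAddGroup.mk_surjective x
    have := W.smul_mem q (h D)
    rwa [cl_apply, TensorProduct.smul_tmul', smul_eq_mul, mul_one] at this

theorem mem_principalDivisors_of_mk_eq_zero (hA : algebraicallyTrivial 𝒜 ≤ principalDivisors 𝒜)
    {D : Divisor 𝒜} (h : (QuotientAddGroup.mk (QuotientAddGroup.mk D : Pic 𝒜) : NS 𝒜) = 0) :
    D ∈ principalDivisors 𝒜 := by
  obtain ⟨D', hD', h1⟩ := (QuotientAddGroup.eq_zero_iff _).1 h
  have h2 : D' ∈ principalDivisors 𝒜 := hA hD'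
  rw [← QuotientAddGroup.eq_zero_iff]
  rw [← h1]
  exact (QuotientAddGroup.eq_zero_iff D').2 h2

/-- As Pic⁰ is trivial, a relation in NS is a principal divisor. Independence over ℤ passes to ℚ ⊗
NS, the localization at the nonzero integers. -/
theorem linearIndependent_cl (hA : algebraicallyTrivial 𝒜 ≤ principalDivisors 𝒜) {ι : Type*}
    [Finite ι] (P : ι → PrimeDivisor 𝒜)
    (h : ∀ n : ι → ℤ, Finsupp.mapDomain P (Finsupp.equivFunOnFinite.symm n) ∈ principalDivisors 𝒜 →
      n = 0) : LinearIndependent ℚ fun i => cl 𝒜 (Finsupp.single (P i) 1) := by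
  have h1 : LinearIndependent ℤ fun i => (QuotientAddGroup.mk
      (QuotientAddGroup.mk (Finsupp.single (P i) 1) : Pic 𝒜) : NS 𝒜) := by
    rw [linearIndependent_iff]
    intro l hl
    have h2 : (QuotientAddGroup.mk (QuotientAddGroup.mk (Finsupp.mapDomain P l) : Pic 𝒜) : NS 𝒜) =
        0 := by
      rw [← hl, Finsupp.linearCombination_apply, Finsupp.mapDomain]
      change (QuotientAddGroup.mk' (picZero 𝒜)).comp
        (QuotientAddGroup.mk' (principalDivisors 𝒜)) _ = _
      rw [map_finsuppSum]
      refine Finsupp.sum_congr fun i _ => ?_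
      have : Finsupp.single (P i) (l i) = l i • Finsupp.single (P i) (1 : ℤ) := by simp
      rw [this, map_zsmul]
      rfl
    have h3 := h l (by
      rw [Finsupp.equivFunOnFinite_symm_coe]
      exact mem_principalDivisors_of_mk_eq_zero hA h2)
    exact DFunLike.coe_injective h3
  exact h1.of_isLocalizedModule (Rₛ := ℚ) (S := nonZeroDivisors ℤ)
    (f := TensorProduct.mk ℤ ℚ (NS 𝒜) 1)

theorem nsRep_cl {G : Type u} [Group G] [MulSemiringAction G K] (α : SemiAction G 𝒜) (g : G)
    (D : Divisor 𝒜) : α.nsRep g (cl 𝒜 D) = cl 𝒜 ((α.semiAut g).onDivisor D) := rfl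

variable [IsDomain R] [IsNoetherianRing R]

open Classical in
/-- The class of a line. -/
noncomputable def lineClass (𝒜 : ℕ → Submodule K R) [GradedAlgebra 𝒜] (ℓ π : R) :
    ℚ ⊗[ℤ] NS 𝒜 :=
  if h : IsLine 𝒜 ℓ π then cl 𝒜 (Finsupp.single h.divisor 1) else 0

theorem IsLine.lineClass_eq {ℓ π : R} (h : IsLine 𝒜 ℓ π) :
    lineClass 𝒜 ℓ π = cl 𝒜 (Finsupp.single h.divisor 1) := dif_pos h

theorem nsRep_lineClass {G : Type u} [Group G] [MulSemiringAction G K] (α : SemiAction G 𝒜) (g : G)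
    {ℓ π : R} (h : IsLine 𝒜 ℓ π) (h' : IsLine 𝒜 (α.act g ℓ) (α.act g π)) :
    α.nsRep g (lineClass 𝒜 ℓ π) = lineClass 𝒜 (α.act g ℓ) (α.act g π) := by
  rw [h.lineClass_eq, h'.lineClass_eq, nsRep_cl]
  congr 1
  have := onPrime_divisor α g h h' rfl rfl
  rw [← this]
  exact Finsupp.mapDomain_single

variable (hR : ∀ P : PrimeDivisor 𝒜, IsDiscreteValuationRing (Localization.AtPrime P.ideal))

theorem cl_divisorOf_eq {n : ℕ} {f g : R} (hf : f ≠ 0) (hg : g ≠ 0) (hfn : f ∈ 𝒜 n)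
    (hgn : g ∈ 𝒜 n) : cl 𝒜 (divisorOf hR f hf) = cl 𝒜 (divisorOf hR g hg) := by
  rw [← sub_eq_zero, ← map_sub]
  exact cl_eq_zero (divisorOf_sub_mem_principal hR hf hg hfn hgn)

theorem cl_divisorOf_pow {n : ℕ} {f : R} (hf : f ≠ 0) :
    cl 𝒜 (divisorOf hR (f ^ n) (pow_ne_zero n hf)) = n • cl 𝒜 (divisorOf hR f hf) := by
  induction n with
  | zero =>
    have : divisorOf hR (f ^ 0) (pow_ne_zero 0 hf) = 0 := by
      ext P
      have := hR P
      rw [divisorOf_apply, (ordAt_eq_zero_iff).2]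
      · rfl
      · rw [pow_zero]; exact P.point.isPrime.one_notMem
    rw [this, map_zero, zero_smul]
  | succ n ih =>
    have h : divisorOf hR (f ^ (n + 1)) (pow_ne_zero _ hf) =
        divisorOf hR (f ^ n) (pow_ne_zero n hf) + divisorOf hR f hf := by
      rw [← divisorOf_mul hR (pow_ne_zero n hf) hf]
      congr 1
      exact pow_succ f n
    rw [h, map_add, ih, succ_nsmul]

theorem cl_divisorOf_eq_nsmul {n : ℕ} {f g : R} (hf : f ≠ 0) (hg : g ≠ 0) (hfn : f ∈ 𝒜 n)
    (hgn : g ∈ 𝒜 1) : cl 𝒜 (divisorOf hR f hf) = n • cl 𝒜 (divisorOf hR g hg) := by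
  rw [← cl_divisorOf_pow hR hg]
  exact cl_divisorOf_eq hR hf _ hfn (by simpa using SetLike.pow_mem_graded n hgn)

theorem IsLinePair.lineClass_add {ℓ π π' g : R} (h : IsLinePair 𝒜 ℓ π π') (hg : g ≠ 0)
    (hgn : g ∈ 𝒜 1) :
    lineClass 𝒜 ℓ π + lineClass 𝒜 ℓ π' = cl 𝒜 (divisorOf hR g hg) := by
  rw [h.fst.lineClass_eq, h.snd.lineClass_eq, ← map_add, ← h.divisorOf_eq hR]
  exact cl_divisorOf_eq hR _ hg h.fst.fst_mem hgn

include hR in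
/-- A subspace that contains the classes of the prime divisors outside of the charts is the whole
space. -/
theorem eq_top_of_forall_cl_single_mem {Λ : Type u} {ι : Type*} [CommRing Λ] [IsDomain Λ]
    [UniqueFactorizationMonoid Λ] {δ : Dehomogenization 𝒜 Λ} {C : ι → Submonoid R}
    (hC : ∀ i, IsChart δ (C i)) {W : Submodule ℚ (ℚ ⊗[ℤ] NS 𝒜)}
    (h : ∀ P : PrimeDivisor 𝒜, ¬ IsCovered C P → cl 𝒜 (Finsupp.single P 1) ∈ W) : W = ⊤ := by
  have key : ∀ D : Divisor 𝒜, (∀ P, cl 𝒜 (Finsupp.single P (D P)) ∈ W) → cl 𝒜 D ∈ W := by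
    intro D hD
    have h1 : D = D.sum Finsupp.single := D.sum_single.symm
    rw [h1, map_finsuppSum]
    exact sum_mem fun P _ => hD P
  have hsmul : ∀ (P : PrimeDivisor 𝒜) (n : ℤ), cl 𝒜 (Finsupp.single P 1) ∈ W →
      cl 𝒜 (Finsupp.single P n) ∈ W := by
    intro P n hP
    have h1 : Finsupp.single P n = n • Finsupp.single P (1 : ℤ) := by simp
    rw [h1, map_zsmul]
    exact zsmul_mem hP n
  have all : ∀ P : PrimeDivisor 𝒜, cl 𝒜 (Finsupp.single P 1) ∈ W := by
    intro P
    by_cases hP : IsCovered C P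
    · obtain ⟨D, hD, hDP⟩ := IsCovered.exists_principal hC hR hP
      -- The principal divisor `D` agrees with `P` on the charts, so the difference is supported on
      -- the uncovered prime divisors.
      have h1 : cl 𝒜 (D - Finsupp.single P 1) ∈ W := by
        refine key _ fun Q => ?_
        by_cases hQ : IsCovered C Q
        · rw [Finsupp.sub_apply, hDP Q hQ, sub_self, Finsupp.single_zero, map_zero]
          exact zero_mem _
        · exact hsmul _ _ (h Q hQ)
      rw [map_sub, cl_eq_zero hD, zero_sub] at h1
      exact neg_mem_iff.1 h1
    · exact h P hP
  exact eq_top_of_forall_cl_mem fun D => key D fun P => hsmul _ _ (all P)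

end Classes

end Dwork

/-! ### Relations between differences of lines -/

namespace Dwork
open ProjDiv

namespace Presentation

variable {K R : Type u} [Field K] [CharZero K] [IsAlgClosed K] [CommRing R] [IsDomain R]
  [Algebra K R] [IsNoetherianRing R] {𝒜 : ℕ → Submodule K R} [GradedAlgebra 𝒜] {lam : K}
  (M : Presentation 𝒜 lam) (C : Constants lam)

/-- The equations of the lines on the surface. -/
inductive IsLineEquation : R → R → Prop
  | u (b q : K) (hb : b ^ 4 + 2 * lam ^ 2 * b ^ 2 + 1 = 0) (hq : 2 * q ^ 2 = 1) :
    IsLineEquation (M.linU b) (M.piU q)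
  | s (k₁ k₂ q₀ q₁ q₂ : K) (h : IsRootOn lam k₁ k₂ q₀ q₁ q₂) :
    IsLineEquation (M.lin k₁ k₂) (M.w - M.quad q₀ q₁ q₂)

theorem isLineEquation_one {y g : K} (hy : y ^ 4 = 1) (hg : 2 * g ^ 2 = lam ^ 4 - 1) :
    M.IsLineEquation (M.linOne y) (M.piOne g) := .s _ _ _ _ _ (isRootOn_one hy hg)

theorem isLineEquation_two {y g : K} (hy : y ^ 4 = 1) (hg : 2 * g ^ 2 = lam ^ 4 - 1) :
    M.IsLineEquation (M.linTwo y) (M.piTwo g) := .s _ _ _ _ _ (isRootOn_two hy hg)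

theorem lin_notMem_u {b q : K} (hb : b ^ 4 + 2 * lam ^ 2 * b ^ 2 + 1 = 0) (hq : 2 * q ^ 2 = 1)
    (k₁ k₂ : K) : M.lin k₁ k₂ ∉ Ideal.span {M.linU b, M.piU q} := by
  intro h0
  obtain ⟨f, hs, hu, hv, -, hle⟩ := M.exists_point_u hb hq 1 0
  have h1 : f _ = 0 := hle h0
  simp [lin, hs, hu, hv] at h1

theorem linU_notMem_u {b q : K} (hb : b ^ 4 + 2 * lam ^ 2 * b ^ 2 + 1 = 0) (hq : 2 * q ^ 2 = 1)
    {b' : K} (h : b ≠ b') : M.linU b' ∉ Ideal.span {M.linU b, M.piU q} := by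
  intro h0
  obtain ⟨f, -, hu, hv, -, hle⟩ := M.exists_point_u hb hq 0 1
  have h1 : f _ = 0 := hle h0
  simp [linU, hu, hv] at h1
  exact h (sub_eq_zero.1 h1)

theorem linU_notMem_s {k₁ k₂ q₀ q₁ q₂ : K} (h : IsRootOn lam k₁ k₂ q₀ q₁ q₂) (b : K) :
    M.linU b ∉ Ideal.span {M.lin k₁ k₂, M.w - M.quad q₀ q₁ q₂} := by
  intro h0
  obtain ⟨f, -, hu, hv, -, hle⟩ := M.exists_point_s h 1 0
  have h1 : f _ = 0 := hle h0
  simp [linU, hu, hv] at h1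

theorem lin_notMem_s {k₁ k₂ q₀ q₁ q₂ : K} (h : IsRootOn lam k₁ k₂ q₀ q₁ q₂) {k₁' k₂' : K}
    (hne : k₁ ≠ k₁' ∨ k₂ ≠ k₂') :
    M.lin k₁' k₂' ∉ Ideal.span {M.lin k₁ k₂, M.w - M.quad q₀ q₁ q₂} := by
  intro h0
  rcases hne with hne | hne
  · obtain ⟨f, hs, hu, hv, -, hle⟩ := M.exists_point_s h 1 0
    have h1 : f _ = 0 := hle h0
    simp [lin, hs, hu, hv] at h1
    exact hne (sub_eq_zero.1 h1)
  · obtain ⟨f, hs, hu, hv, -, hle⟩ := M.exists_point_s h 0 1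
    have h1 : f _ = 0 := hle h0
    simp [lin, hs, hu, hv] at h1
    exact hne (sub_eq_zero.1 h1)

/-- Lines with different linear forms are not contained in the zero set of each other's forms. -/
theorem IsLineEquation.notMem {ℓ π ℓ' π' : R} (h : M.IsLineEquation ℓ π)
    (h' : M.IsLineEquation ℓ' π') (hne : ℓ ≠ ℓ') : ℓ' ∉ Ideal.span {ℓ, π} := by
  cases h with
  | u b q hb hq =>
    cases h' with
    | u b' q' hb' hq' => exact M.linU_notMem_u hb hq fun h0 => hne (by rw [h0])
    | s k₁ k₂ q₀ q₁ q₂ h' => exact M.lin_notMem_u hb hq _ _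
  | s k₁ k₂ q₀ q₁ q₂ h =>
    cases h' with
    | u b' q' hb' hq' => exact M.linU_notMem_s h _
    | s k₁' k₂' q₀' q₁' q₂' h' =>
      apply M.lin_notMem_s h
      by_contra! h0
      exact hne (by rw [h0.1, h0.2])

theorem linU_ne {b b' : K} (hb : b ^ 4 + 2 * lam ^ 2 * b ^ 2 + 1 = 0) (h : b ≠ b') :
    M.linU b ≠ M.linU b' := by
  obtain ⟨q, hq⟩ := IsAlgClosed.exists_pow_nat_eq (1 / 2 : K) (n := 2) (by norm_num)
  have hq : 2 * q ^ 2 = 1 := by rw [hq]; norm_num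
  intro h0
  exact M.linU_notMem_u hb hq h (h0 ▸ Ideal.subset_span (by simp))

theorem lin_ne_linU {k₁ k₂ q₀ q₁ q₂ : K} (h : IsRootOn lam k₁ k₂ q₀ q₁ q₂) (b : K) :
    M.lin k₁ k₂ ≠ M.linU b := fun h0 =>
  M.linU_notMem_s h b (h0 ▸ Ideal.subset_span (by simp))

theorem lin_ne {k₁ k₂ q₀ q₁ q₂ : K} (h : IsRootOn lam k₁ k₂ q₀ q₁ q₂) {k₁' k₂' : K}
    (hne : k₁ ≠ k₁' ∨ k₂ ≠ k₂') : M.lin k₁ k₂ ≠ M.lin k₁' k₂' := fun h0 =>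
  M.lin_notMem_s h hne (h0 ▸ Ideal.subset_span (by simp))

variable (hR : ∀ P : PrimeDivisor 𝒜, IsDiscreteValuationRing (Localization.AtPrime P.ideal))

include hR in
/-- The relation between the classes of the components of two singular fibres of a conic bundle. -/
theorem lineClass_sum {ℓ π π' : Fin 4 → R} (h : ∀ i, IsLinePair 𝒜 (ℓ i) (π i) (π' i))
    (he : ∀ i, M.IsLineEquation (ℓ i) (π i)) (he' : ∀ i, M.IsLineEquation (ℓ i) (π' i))
    (hℓ : Function.Injective ℓ) {θ θ' : R} (hθ2 : θ ∈ 𝒜 2) {t : K} (ht : t ≠ 0)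
    (hθ : θ * θ' = algebraMap K R t * ∏ i, ℓ i)
    (hmem : ∀ i, θ ∈ Ideal.span {ℓ i, π i}) (hmem' : ∀ i, θ' ∈ Ideal.span {ℓ i, π' i}) :
    ∑ i, (lineClass 𝒜 (ℓ i) (π i) - lineClass 𝒜 (ℓ i) (π' i)) = 0 := by
  have h0 : algebraMap K R t ≠ 0 := by
    rwa [Ne, map_eq_zero_iff _ (algebraMap K R).injective]
  have hθ0 : θ ≠ 0 := by
    rintro rfl
    rw [zero_mul] at hθ
    exact mul_ne_zero h0 (Finset.prod_ne_zero_iff.2 fun i _ => (h i).fst.isUniformizer.ne_zero)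
      hθ.symm
  have h1 := divisorOf_eq_sum hR h hθ0 ht hθ hmem hmem'
    (fun i j hij => (h i).fst.ne_of_notMem ((he j).notMem M (he i) fun h => hij (hℓ h).symm))
    (fun i j hij => (h i).fst.ne_of_notMem ((he' j).notMem M (he i) fun h => hij (hℓ h).symm))
    (fun i j hij => (h i).snd.ne_of_notMem ((he' j).notMem M (he' i) fun h => hij (hℓ h).symm))
  have hg := (h 0).fst.isUniformizer.ne_zero
  have hg1 := (h 0).fst.fst_mem
  have h2 := congrArg (cl 𝒜) h1
  rw [map_sum, cl_divisorOf_eq_nsmul hR hθ0 hg hθ2 hg1] at h2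
  simp only [← (h _).fst.lineClass_eq] at h2
  -- Two conjugate lines add up to the hyperplane class H, so each difference is 2L - H. Since θ is
  -- quadratic, the four lines L add up to 2H, and the sum is 4H - 4H = 0.
  have h3 : ∀ i, lineClass 𝒜 (ℓ i) (π i) - lineClass 𝒜 (ℓ i) (π' i) =
      (2 : ℚ) • lineClass 𝒜 (ℓ i) (π i) - cl 𝒜 (divisorOf hR _ hg) := by
    intro i
    rw [← (h i).lineClass_add hR hg hg1, two_smul]
    abel
  rw [Finset.sum_congr rfl fun i _ => h3 i, Finset.sum_sub_distrib, ← Finset.smul_sum, ← h2,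
    Finset.sum_const, Finset.card_univ, Fintype.card_fin, ← Nat.cast_smul_eq_nsmul ℚ,
    ← Nat.cast_smul_eq_nsmul ℚ, smul_smul, ← sub_smul]
  norm_num

/-- The differences of the classes of the two lines over a linear form. -/
noncomputable def diffU (b q : K) : ℚ ⊗[ℤ] NS 𝒜 :=
  lineClass 𝒜 (M.linU b) (M.piU q) - lineClass 𝒜 (M.linU b) (M.piU (-q))

/-- The differences of the classes of the two lines over a linear form. -/
noncomputable def diffOne (y g : K) : ℚ ⊗[ℤ] NS 𝒜 :=
  lineClass 𝒜 (M.linOne y) (M.piOne g) - lineClass 𝒜 (M.linOne y) (M.piOne (-g))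

/-- The differences of the classes of the two lines over a linear form. -/
noncomputable def diffTwo (y g : K) : ℚ ⊗[ℤ] NS 𝒜 :=
  lineClass 𝒜 (M.linTwo y) (M.piTwo g) - lineClass 𝒜 (M.linTwo y) (M.piTwo (-g))

theorem diffU_neg (b q : K) : M.diffU b (-q) = -M.diffU b q := by
  rw [diffU, diffU, neg_neg, neg_sub]

theorem diffOne_neg (y g : K) : M.diffOne y (-g) = -M.diffOne y g := by
  rw [diffOne, diffOne, neg_neg, neg_sub]

theorem diffTwo_neg (y g : K) : M.diffTwo y (-g) = -M.diffTwo y g := by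
  rw [diffTwo, diffTwo, neg_neg, neg_sub]

theorem elX_eq : M.elX C = -(algebraMap K R C.r) * M.piU (C.r / 2) := by
  have h : algebraMap K R C.r * algebraMap K R (C.r / 2) = 1 := by
    rw [← map_mul, show C.r * (C.r / 2) = 1 by linear_combination C.r_sq / 2, map_one]
  rw [elX, piU]
  linear_combination -M.A * h

theorem elX'_eq : M.elX' C = algebraMap K R C.r * M.piU (-(C.r / 2)) := by
  have h : algebraMap K R C.r * algebraMap K R (C.r / 2) = 1 := by
    rw [← map_mul, show C.r * (C.r / 2) = 1 by linear_combination C.r_sq / 2, map_one]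
  rw [elX', piU, map_neg]
  linear_combination -M.A * h

theorem four_cases {P : Fin 4 → Prop} (h0 : P 0) (h1 : P 1) (h2 : P 2) (h3 : P 3) : ∀ i, P i := by
  intro i
  fin_cases i <;> assumption

theorem injective_four {α : Type*} {a b c d : α} (h1 : a ≠ b) (h2 : a ≠ c) (h3 : a ≠ d)
    (h4 : b ≠ c) (h5 : b ≠ d) (h6 : c ≠ d) : Function.Injective ![a, b, c, d] := by
  intro i j h
  fin_cases i <;> fin_cases j <;> first
    | rfl
    | exact absurd h ‹_›
    | exact absurd h.symm ‹_›

theorem a_ne_neg_a : C.a ≠ -C.a := self_ne_neg.2 C.a_ne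
theorem a'_ne_neg_a' : C.a' ≠ -C.a' := self_ne_neg.2 C.a'_ne

-- The relation from θ = x = A - rw and θ' = x', whose product is Q.
include hR in
theorem diffU_sum : M.diffU C.a (C.r / 2) + M.diffU (-C.a) (C.r / 2) +
    M.diffU C.a' (C.r / 2) + M.diffU (-C.a') (C.r / 2) = 0 := by
  have hq := C.half_r
  have hq' := C.half_neg_r
  have q1 := C.quartic (b := C.a) (by simp)
  have q2 := C.quartic (b := -C.a) (by simp)
  have q3 := C.quartic (b := C.a') (by simp)
  have q4 := C.quartic (b := -C.a') (by simp)
  have n1 : C.a ≠ C.a' := sub_ne_zero.1 C.a_sub_ne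
  have n2 : C.a ≠ -C.a' := fun h => C.a_add_ne (by rw [h]; ring)
  have n3 : -C.a ≠ C.a' := fun h => C.a_add_ne (by rw [← h]; ring)
  have n4 : -C.a ≠ -C.a' := fun h => n1 (neg_injective h)
  have := M.lineClass_sum hR (ℓ := ![M.linU C.a, M.linU (-C.a), M.linU C.a', M.linU (-C.a')])
    (π := fun _ => M.piU (C.r / 2)) (π' := fun _ => M.piU (-(C.r / 2)))
    (four_cases (M.isLinePair_u q1 hq) (M.isLinePair_u q2 hq) (M.isLinePair_u q3 hq)
      (M.isLinePair_u q4 hq))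
    (four_cases (.u _ _ q1 hq) (.u _ _ q2 hq) (.u _ _ q3 hq) (.u _ _ q4 hq))
    (four_cases (.u _ _ q1 hq') (.u _ _ q2 hq') (.u _ _ q3 hq') (.u _ _ q4 hq'))
    (injective_four (M.linU_ne q1 (a_ne_neg_a C)) (M.linU_ne q1 n1) (M.linU_ne q1 n2)
      (M.linU_ne q2 n3) (M.linU_ne q2 n4) (M.linU_ne q3 (a'_ne_neg_a' C)))
    (θ := M.elX C) (θ' := M.elX' C) (M.elX_mem C) (t := 1) one_ne_zero
    (by
      rw [Fin.prod_univ_four, elX_mul_elX', map_one, one_mul]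
      simp only [Matrix.cons_val]
      ring)
    (fun i => by
      rw [elX_eq]
      exact Ideal.mul_mem_left _ _ (Ideal.subset_span (by simp)))
    (fun i => by
      rw [elX'_eq]
      exact Ideal.mul_mem_left _ _ (Ideal.subset_span (by simp)))
  rw [Fin.sum_univ_four] at this
  exact this

theorem ne_neg_of_pow_four {y : K} (hy : y ^ 4 = 1) : y ≠ -y :=
  self_ne_neg.2 (by rintro rfl; norm_num at hy)

/-- On the form of index y one has A = y²(u² + λ²v²), so x - y²ℓ₁ℓ₂ reduces to a multiple of w -
y²ρv². Here rρ = al·be and a² = al·be - λ² decide which sign of w occurs. -/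
theorem elX_sub_mem_one {y : K} (hy : y ^ 4 = 1) :
    M.elX C - algebraMap K R (y ^ 2) * (M.linU C.a * M.linU (-C.a)) ∈
      Ideal.span {M.linOne y, M.piOne (y ^ 2 * C.rho)} := by
  rw [Ideal.mem_span_pair]
  refine ⟨M.linOne (-y), -(algebraMap K R C.r), ?_⟩
  have h3 := congrArg (algebraMap K R) C.a_sq
  have h5 := congrArg (algebraMap K R) hy
  have h6 := congrArg (algebraMap K R) (show C.r * C.rho = C.al * C.be by
    rw [Constants.rho]; linear_combination C.al * C.be / 2 * C.r_sq)
  rw [linOne, linOne, lin, lin, elX, A, piOne, quad, linU_neg, linU]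
  simp only [map_neg, map_mul, map_pow, map_sub, map_one, map_zero] at h3 h5 h6 ⊢
  linear_combination (2 * algebraMap K R lam * M.u * M.v - algebraMap K R y ^ 2 *
      algebraMap K R lam ^ 2 * M.v ^ 2) * h5 + algebraMap K R y ^ 2 * M.v ^ 2 * (h6 - h3)

theorem elX'_sub_mem_one {y : K} (hy : y ^ 4 = 1) :
    M.elX' C - algebraMap K R (y ^ 2) * (M.linU C.a * M.linU (-C.a)) ∈
      Ideal.span {M.linOne y, M.piOne (-(y ^ 2 * C.rho))} := by
  rw [Ideal.mem_span_pair]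
  refine ⟨M.linOne (-y), algebraMap K R C.r, ?_⟩
  have h3 := congrArg (algebraMap K R) C.a_sq
  have h5 := congrArg (algebraMap K R) hy
  have h6 := congrArg (algebraMap K R) (show C.r * C.rho = C.al * C.be by
    rw [Constants.rho]; linear_combination C.al * C.be / 2 * C.r_sq)
  rw [linOne, linOne, lin, lin, elX', A, piOne, quad, linU_neg, linU]
  simp only [map_neg, map_mul, map_pow, map_sub, map_one, map_zero] at h3 h5 h6 ⊢
  linear_combination (2 * algebraMap K R lam * M.u * M.v - algebraMap K R y ^ 2 *
      algebraMap K R lam ^ 2 * M.v ^ 2) * h5 + algebraMap K R y ^ 2 * M.v ^ 2 * (h6 - h3)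

theorem elX_add_mem_two {y : K} (hy : y ^ 4 = 1) :
    M.elX C + algebraMap K R (y ^ 2 * C.a' ^ 2) * (M.linU C.a * M.linU (-C.a)) ∈
      Ideal.span {M.linTwo y, M.piTwo (-(y ^ 2 * C.rho))} := by
  rw [Ideal.mem_span_pair]
  refine ⟨M.linTwo (-y), -(algebraMap K R C.r), ?_⟩
  have h2 := congrArg (algebraMap K R) C.a_mul
  have h3 := congrArg (algebraMap K R) C.a'_sq
  have h5 := congrArg (algebraMap K R) hy
  have h6 := congrArg (algebraMap K R) (show C.r * C.rho = C.al * C.be by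
    rw [Constants.rho]; linear_combination C.al * C.be / 2 * C.r_sq)
  rw [linTwo, linTwo, lin, lin, elX, A, piTwo, quad, linU_neg, linU]
  simp only [map_neg, map_mul, map_pow, map_sub, map_one, map_zero] at h2 h3 h5 h6 ⊢
  linear_combination (2 * algebraMap K R lam * M.u * M.v - algebraMap K R y ^ 2 *
      algebraMap K R lam ^ 2 * M.u ^ 2) * h5 - algebraMap K R y ^ 2 * M.u ^ 2 * (h6 + h3) +
      algebraMap K R y ^ 2 * M.v ^ 2 * (algebraMap K R C.a * algebraMap K R C.a' + 1) * h2

theorem elX'_add_mem_two {y : K} (hy : y ^ 4 = 1) :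
    M.elX' C + algebraMap K R (y ^ 2 * C.a' ^ 2) * (M.linU C.a * M.linU (-C.a)) ∈
      Ideal.span {M.linTwo y, M.piTwo (y ^ 2 * C.rho)} := by
  rw [Ideal.mem_span_pair]
  refine ⟨M.linTwo (-y), algebraMap K R C.r, ?_⟩
  have h2 := congrArg (algebraMap K R) C.a_mul
  have h3 := congrArg (algebraMap K R) C.a'_sq
  have h5 := congrArg (algebraMap K R) hy
  have h6 := congrArg (algebraMap K R) (show C.r * C.rho = C.al * C.be by
    rw [Constants.rho]; linear_combination C.al * C.be / 2 * C.r_sq)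
  rw [linTwo, linTwo, lin, lin, elX', A, piTwo, quad, linU_neg, linU]
  simp only [map_neg, map_mul, map_pow, map_sub, map_one, map_zero] at h2 h3 h5 h6 ⊢
  linear_combination (2 * algebraMap K R lam * M.u * M.v - algebraMap K R y ^ 2 *
      algebraMap K R lam ^ 2 * M.u ^ 2) * h5 - algebraMap K R y ^ 2 * M.u ^ 2 * (h6 + h3) +
      algebraMap K R y ^ 2 * M.v ^ 2 * (algebraMap K R C.a * algebraMap K R C.a' + 1) * h2

theorem sq_mul_rho_sq {y : K} (hy : y ^ 4 = 1) : 2 * (y ^ 2 * C.rho) ^ 2 = lam ^ 4 - 1 := by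
  linear_combination C.rho_sq + 2 * C.rho ^ 2 * hy

-- The relation from θ = x - y²ℓ₁ℓ₂ by `fibre_one`: two lines over the forms of index ±y and two
-- over u = ±av.
include hR in
theorem diffOne_sum {y : K} (hy : y ^ 4 = 1) :
    M.diffOne y (y ^ 2 * C.rho) + M.diffOne (-y) (y ^ 2 * C.rho) +
      M.diffU C.a (C.r / 2) + M.diffU (-C.a) (C.r / 2) = 0 := by
  have hq := C.half_r
  have hq' := C.half_neg_r
  have q1 := C.quartic (b := C.a) (by simp)
  have q2 := C.quartic (b := -C.a) (by simp)
  have hy' : (-y) ^ 4 = 1 := by rw [← hy]; ring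
  have hy0 : y ≠ 0 := by rintro rfl; norm_num at hy
  have hg := sq_mul_rho_sq C hy
  have hg' : 2 * (-(y ^ 2 * C.rho)) ^ 2 = lam ^ 4 - 1 := by rw [neg_sq, hg]
  have r1 := isRootOn_one hy hg
  have r2 := isRootOn_one hy' hg
  have m1 := M.elX_sub_mem_one C hy
  have m2 := M.elX_sub_mem_one C hy'
  have m3 := M.elX'_sub_mem_one C hy
  have m4 := M.elX'_sub_mem_one C hy'
  rw [neg_sq] at m2 m4
  have hl : M.elX C - algebraMap K R (y ^ 2) * (M.linU C.a * M.linU (-C.a)) =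
      -(algebraMap K R C.r) * M.piU (C.r / 2) +
        -(algebraMap K R (y ^ 2)) * (M.linU C.a * M.linU (-C.a)) := by rw [elX_eq]; ring
  have hl' : M.elX' C - algebraMap K R (y ^ 2) * (M.linU C.a * M.linU (-C.a)) =
      algebraMap K R C.r * M.piU (-(C.r / 2)) +
        -(algebraMap K R (y ^ 2)) * (M.linU C.a * M.linU (-C.a)) := by rw [elX'_eq]; ring
  have := M.lineClass_sum hR (ℓ := ![M.linOne y, M.linOne (-y), M.linU C.a, M.linU (-C.a)])
    (π := ![M.piOne (y ^ 2 * C.rho), M.piOne (y ^ 2 * C.rho), M.piU (C.r / 2), M.piU (C.r / 2)])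
    (π' := ![M.piOne (-(y ^ 2 * C.rho)), M.piOne (-(y ^ 2 * C.rho)), M.piU (-(C.r / 2)),
      M.piU (-(C.r / 2))])
    (four_cases (M.isLinePair_one C.lam_ne hy hg) (M.isLinePair_one C.lam_ne hy' hg)
      (M.isLinePair_u q1 hq) (M.isLinePair_u q2 hq))
    (four_cases (M.isLineEquation_one hy hg) (M.isLineEquation_one hy' hg) (.u _ _ q1 hq)
      (.u _ _ q2 hq))
    (four_cases (M.isLineEquation_one hy hg') (M.isLineEquation_one hy' hg') (.u _ _ q1 hq')
      (.u _ _ q2 hq'))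
    (injective_four (M.lin_ne r1 (Or.inl (ne_neg_of_pow_four hy))) (M.lin_ne_linU r1 _)
      (M.lin_ne_linU r1 _) (M.lin_ne_linU r2 _) (M.lin_ne_linU r2 _) (M.linU_ne q1 (a_ne_neg_a C)))
    (θ := M.elX C - algebraMap K R (y ^ 2) * (M.linU C.a * M.linU (-C.a)))
    (θ' := M.elX' C - algebraMap K R (y ^ 2) * (M.linU C.a * M.linU (-C.a)))
    (sub_mem (M.elX_mem C) (algebraMap_mul_mem _ (mul_mem_two (M.linU_mem _) (M.linU_mem _))))
    (t := -(2 * y ^ 2)) (by simpa using hy0)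
    (by
      rw [Fin.prod_univ_four, M.fibre_one C hy]
      simp only [Matrix.cons_val, map_neg, map_mul, map_ofNat]
      ring)
    (four_cases m1 m2 (by
        rw [hl]
        exact add_mem (Ideal.mul_mem_left _ _ (Ideal.subset_span (by simp)))
          (Ideal.mul_mem_left _ _ (Ideal.mul_mem_right _ _ (Ideal.subset_span (by simp))))) (by
        rw [hl]
        exact add_mem (Ideal.mul_mem_left _ _ (Ideal.subset_span (by simp)))
          (Ideal.mul_mem_left _ _ (Ideal.mul_mem_left _ _ (Ideal.subset_span (by simp))))))
    (four_cases m3 m4 (by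
        rw [hl']
        exact add_mem (Ideal.mul_mem_left _ _ (Ideal.subset_span (by simp)))
          (Ideal.mul_mem_left _ _ (Ideal.mul_mem_right _ _ (Ideal.subset_span (by simp))))) (by
        rw [hl']
        exact add_mem (Ideal.mul_mem_left _ _ (Ideal.subset_span (by simp)))
          (Ideal.mul_mem_left _ _ (Ideal.mul_mem_left _ _ (Ideal.subset_span (by simp))))))
  rw [Fin.sum_univ_four] at this
  exact this

-- The relation from θ = x + y²a'²ℓ₁ℓ₂ by `fibre_two`. The sign of ρ is opposite to that in
-- `diffOne_sum`, as in `elX_add_mem_two`.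
include hR in
theorem diffTwo_sum {y : K} (hy : y ^ 4 = 1) :
    M.diffTwo y (-(y ^ 2 * C.rho)) + M.diffTwo (-y) (-(y ^ 2 * C.rho)) +
      M.diffU C.a (C.r / 2) + M.diffU (-C.a) (C.r / 2) = 0 := by
  have hq := C.half_r
  have hq' := C.half_neg_r
  have q1 := C.quartic (b := C.a) (by simp)
  have q2 := C.quartic (b := -C.a) (by simp)
  have hy' : (-y) ^ 4 = 1 := by rw [← hy]; ring
  have hy0 : y ≠ 0 := by rintro rfl; norm_num at hy
  have hg := sq_mul_rho_sq C hy
  have hg' : 2 * (-(y ^ 2 * C.rho)) ^ 2 = lam ^ 4 - 1 := by rw [neg_sq, hg]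
  have p1 := M.isLinePair_two C.lam_ne hy hg'
  have p2 := M.isLinePair_two C.lam_ne hy' hg'
  rw [neg_neg] at p1 p2
  have r1 := isRootOn_two hy hg'
  have r2 := isRootOn_two hy' hg'
  have m1 := M.elX_add_mem_two C hy
  have m2 := M.elX_add_mem_two C hy'
  have m3 := M.elX'_add_mem_two C hy
  have m4 := M.elX'_add_mem_two C hy'
  rw [neg_sq] at m2 m4
  have hl : M.elX C + algebraMap K R (y ^ 2 * C.a' ^ 2) * (M.linU C.a * M.linU (-C.a)) =
      -(algebraMap K R C.r) * M.piU (C.r / 2) +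
        algebraMap K R (y ^ 2 * C.a' ^ 2) * (M.linU C.a * M.linU (-C.a)) := by rw [elX_eq]
  have hl' : M.elX' C + algebraMap K R (y ^ 2 * C.a' ^ 2) * (M.linU C.a * M.linU (-C.a)) =
      algebraMap K R C.r * M.piU (-(C.r / 2)) +
        algebraMap K R (y ^ 2 * C.a' ^ 2) * (M.linU C.a * M.linU (-C.a)) := by rw [elX'_eq]
  have := M.lineClass_sum hR (ℓ := ![M.linTwo y, M.linTwo (-y), M.linU C.a, M.linU (-C.a)])
    (π := ![M.piTwo (-(y ^ 2 * C.rho)), M.piTwo (-(y ^ 2 * C.rho)), M.piU (C.r / 2),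
      M.piU (C.r / 2)])
    (π' := ![M.piTwo (y ^ 2 * C.rho), M.piTwo (y ^ 2 * C.rho), M.piU (-(C.r / 2)),
      M.piU (-(C.r / 2))])
    (four_cases p1 p2
      (M.isLinePair_u q1 hq) (M.isLinePair_u q2 hq))
    (four_cases (M.isLineEquation_two hy hg') (M.isLineEquation_two hy' hg') (.u _ _ q1 hq)
      (.u _ _ q2 hq))
    (four_cases (M.isLineEquation_two hy hg) (M.isLineEquation_two hy' hg) (.u _ _ q1 hq')
      (.u _ _ q2 hq'))
    (injective_four (M.lin_ne r1 (Or.inr (ne_neg_of_pow_four hy))) (M.lin_ne_linU r1 _)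
      (M.lin_ne_linU r1 _) (M.lin_ne_linU r2 _) (M.lin_ne_linU r2 _) (M.linU_ne q1 (a_ne_neg_a C)))
    (θ := M.elX C + algebraMap K R (y ^ 2 * C.a' ^ 2) * (M.linU C.a * M.linU (-C.a)))
    (θ' := M.elX' C + algebraMap K R (y ^ 2 * C.a' ^ 2) * (M.linU C.a * M.linU (-C.a)))
    (add_mem (M.elX_mem C) (algebraMap_mul_mem _ (mul_mem_two (M.linU_mem _) (M.linU_mem _))))
    (t := 2 * (y ^ 2 * C.a' ^ 2)) (by simpa [C.a'_ne] using hy0)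
    (by
      rw [Fin.prod_univ_four, M.fibre_two C hy]
      simp only [Matrix.cons_val, map_mul, map_ofNat]
      ring)
    (four_cases m1 m2 (by
        rw [hl]
        exact add_mem (Ideal.mul_mem_left _ _ (Ideal.subset_span (by simp)))
          (Ideal.mul_mem_left _ _ (Ideal.mul_mem_right _ _ (Ideal.subset_span (by simp))))) (by
        rw [hl]
        exact add_mem (Ideal.mul_mem_left _ _ (Ideal.subset_span (by simp)))
          (Ideal.mul_mem_left _ _ (Ideal.mul_mem_left _ _ (Ideal.subset_span (by simp))))))
    (four_cases m3 m4 (by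
        rw [hl']
        exact add_mem (Ideal.mul_mem_left _ _ (Ideal.subset_span (by simp)))
          (Ideal.mul_mem_left _ _ (Ideal.mul_mem_right _ _ (Ideal.subset_span (by simp))))) (by
        rw [hl']
        exact add_mem (Ideal.mul_mem_left _ _ (Ideal.subset_span (by simp)))
          (Ideal.mul_mem_left _ _ (Ideal.mul_mem_left _ _ (Ideal.subset_span (by simp))))))
  rw [Fin.sum_univ_four] at this
  rw [diffTwo, diffTwo, neg_neg]
  exact this

end Presentation

end Dwork

namespace Dwork
open ProjDiv

namespace Presentation

variable {K R : Type u} [Field K] [CharZero K] [IsAlgClosed K] [CommRing R] [IsDomain R]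
  [Algebra K R] [IsNoetherianRing R] {𝒜 : ℕ → Submodule K R} [GradedAlgebra 𝒜] {lam : K}
  (M : Presentation 𝒜 lam) (C : Constants lam)

/-! ### The two lines over s = k(u + v) -/

section Infinity

theorem infinity_identities :
    -C.c' = C.r * (C.r * (C.c - C.c') / 4) - C.k ^ 2 ∧
    2 * lam - C.c' * (C.a + C.a') = C.r * -(C.al * (C.c + C.c') / 2) - 2 * C.k ^ 2 ∧
    -C.c = C.r * -(C.r * (C.c - C.c') / 4) - C.k ^ 2 ∧
    2 * lam + C.c * (C.a + C.a') = C.r * -(-(C.al * (C.c + C.c') / 2)) - 2 * C.k ^ 2 := by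
  rw [C.a_add]
  refine ⟨?_, ?_, ?_, ?_⟩
  · linear_combination -(C.c - C.c') / 4 * C.r_sq + C.k_sq / 2
  · linear_combination C.c_eq / 2 + C.k_sq
  · linear_combination (C.c - C.c') / 4 * C.r_sq + C.k_sq / 2
  · linear_combination C.c_eq / 2 + C.k_sq

/-- On the first line x = n₂Y, so the base parameter x/(Xn₂) equals Y/X there. On the second line x
= n₃X, by `elX_sub_n₃`. -/
theorem elX_sub_n₂ : M.elX C - (M.conic C).n₂ * M.linU (-C.a') =
    -(algebraMap K R C.r) * (M.w - M.quad (C.r * (C.c - C.c') / 4)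
      (-(C.al * (C.c + C.c') / 2)) (C.r * (C.c - C.c') / 4)) +
    (M.s + algebraMap K R C.k * (M.u + M.v)) * M.lin C.k C.k := by
  obtain ⟨h1, h2, -, -⟩ := infinity_identities C
  have h1 := congrArg (algebraMap K R) h1
  have h2 := congrArg (algebraMap K R) h2
  have h3 := congrArg (algebraMap K R) C.a_mul
  rw [conic_n₂, linU_neg, linU_neg, lin_k, elX, A, quad]
  generalize C.r * (C.c - C.c') / 4 = e at *
  generalize -(C.al * (C.c + C.c') / 2) = f at *
  simp only [map_sub, map_add, map_mul, map_pow, map_neg, map_one, map_ofNat] at h1 h2 h3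
  linear_combination (M.u ^ 2 + M.v ^ 2) * h1 + M.u * M.v * h2 -
    algebraMap K R C.c' * M.v ^ 2 * h3

theorem elX_sub_n₃ : M.elX C - (M.conic C).n₃ * M.linU C.a =
    -(algebraMap K R C.r) * (M.w - M.quad (-(C.r * (C.c - C.c') / 4))
      (-(-(C.al * (C.c + C.c') / 2))) (-(C.r * (C.c - C.c') / 4))) +
    (M.s + algebraMap K R C.k * (M.u + M.v)) * M.lin C.k C.k := by
  obtain ⟨-, -, h1, h2⟩ := infinity_identities C
  have h1 := congrArg (algebraMap K R) h1
  have h2 := congrArg (algebraMap K R) h2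
  have h3 := congrArg (algebraMap K R) C.a_mul
  rw [conic_n₃, linU, linU, lin_k, elX, A, quad]
  generalize C.r * (C.c - C.c') / 4 = e at *
  generalize -(C.al * (C.c + C.c') / 2) = f at *
  simp only [map_sub, map_add, map_mul, map_pow, map_neg, map_one, map_ofNat] at h1 h2 h3
  simp only [map_neg]
  linear_combination (M.u ^ 2 + M.v ^ 2) * h1 + M.u * M.v * h2 -
    algebraMap K R C.c * M.v ^ 2 * h3

/-- Both terms of `numT` vanish on the first line: xX - Y·den is X(x - n₂Y), and the other term
contains s. -/
theorem numT_mem_infinity : (M.conic C).numT ∈ (M.isLinePair_infinity C).fst.divisor.ideal := by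
  rw [IsLine.divisor_ideal]
  set I := Ideal.span {M.lin C.k C.k, M.w - M.quad (C.r * (C.c - C.c') / 4)
      (-(C.al * (C.c + C.c') / 2)) (C.r * (C.c - C.c') / 4)}
  have hs : (M.conic C).s ∈ I := Ideal.subset_span (by simp [conic])
  have hx : (M.conic C).x - (M.conic C).n₂ * (M.conic C).Y ∈ I := by
    have h := M.elX_sub_n₂ C
    change M.elX C - (M.conic C).n₂ * M.linU (-C.a') ∈ I
    rw [h]
    exact add_mem (Ideal.mul_mem_left _ _ (Ideal.subset_span (by simp)))
      (Ideal.mul_mem_left _ _ hs)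
  have h : (M.conic C).numT = C.conicData.formA (M.conic C).x (M.conic C).den * (M.conic C).X *
      ((M.conic C).x - (M.conic C).n₂ * (M.conic C).Y) -
      4 * (M.conic C).x * (M.conic C).den * C.conicData.formM (M.conic C).den (M.conic C).x *
        (M.conic C).s := by
    rw [ConicPresentation.numT, ConicPresentation.den]
    ring
  rw [h]
  exact sub_mem (Ideal.mul_mem_left _ _ hx) (Ideal.mul_mem_left _ _ hs)

theorem le_ker_infinity {f : R →ₐ[K] Polynomial K} (hs : f (M.conic C).s = 0)
    (hX : f (M.conic C).X = 1) (hY : f (M.conic C).Y = Polynomial.X)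
    (hx : f (M.conic C).x = C.conicData.formN₃ 1 Polynomial.X) :
    (M.isLinePair_infinity C).snd.divisor.ideal ≤ RingHom.ker f := by
  rw [IsLine.divisor_ideal, Ideal.span_le]
  have h := congrArg f (M.elX_sub_n₃ C)
  change f ((M.conic C).x - (M.conic C).n₃ * (M.conic C).X) = f (_ + _ * (M.conic C).s) at h
  rw [map_sub, map_add, map_mul, map_mul, map_mul, hs, hX, hx, ConicPresentation.n₃,
    ConicData.formN₃, ConicData.formN₃, map_add, map_mul, map_mul, hX, hY, AlgHom.commutes,
    AlgHom.commutes, map_neg, AlgHom.commutes, mul_one, mul_one, sub_self, mul_zero, add_zero, neg_mul,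
    eq_comm, neg_eq_zero] at h
  rintro _ (rfl | rfl)
  · exact hs
  · refine (mul_eq_zero.1 h).resolve_left ?_
    rw [map_eq_zero_iff _ (algebraMap K (Polynomial K)).injective]
    exact C.r_ne

/-- The second line is the one parametrized by `exists_point_infinity`, where `numT` is a product of
two nonzero polynomials. This asymmetry allows the two lines to be told apart by their orders along
T. -/
theorem numT_notMem_infinity :
    (M.conic C).numT ∉ (M.isLinePair_infinity C).snd.divisor.ideal := by
  obtain ⟨f, hs, hX, hY, hx⟩ := (M.conic C).exists_point_infinity
  exact fun h => (M.conic C).map_numT_ne hs hX hY hx (M.le_ker_infinity C hs hX hY hx h)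

end Infinity

/-! ### The eight eigenvectors span -/

section Span

/-- The class of a hyperplane section. -/
noncomputable def hyperplane : ℚ ⊗[ℤ] NS 𝒜 :=
  lineClass 𝒜 (M.linU C.a) (M.piU (C.r / 2)) + lineClass 𝒜 (M.linU C.a) (M.piU (-(C.r / 2)))

/-- The difference of the classes of two lines, as a function of the signs that define it. -/
noncomputable def diff (x y : K) : ℚ ⊗[ℤ] NS 𝒜 := M.diffU (C.root x y) (C.r / 2)

/-- A basis of the Néron-Severi group that consists of eigenvectors of the Galois group. -/
noncomputable def eigenvector : Fin 8 → ℚ ⊗[ℤ] NS 𝒜 :=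
  ![M.hyperplane C,
    M.diff C 1 1 + M.diff C 1 (-1) - M.diff C (-1) 1 - M.diff C (-1) (-1),
    M.diff C 1 1 - M.diff C 1 (-1) + M.diff C (-1) 1 - M.diff C (-1) (-1),
    M.diffOne C.i C.rho - M.diffOne (-C.i) C.rho,
    M.diffTwo C.i C.rho - M.diffTwo (-C.i) C.rho,
    M.diffOne 1 C.rho, M.diffOne (-1) C.rho, M.diffTwo 1 C.rho]

variable (hR : ∀ P : PrimeDivisor 𝒜, IsDiscreteValuationRing (Localization.AtPrime P.ideal))

theorem root_one_one : C.root 1 1 = C.a := by rw [Constants.root, Constants.a]; ring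
theorem root_neg_neg : C.root (-1) (-1) = -C.a := by rw [Constants.root, Constants.a]; ring
theorem root_one_neg : C.root 1 (-1) = C.a' := by rw [Constants.root, Constants.a']; ring
theorem root_neg_one : C.root (-1) 1 = -C.a' := by rw [Constants.root, Constants.a']; ring

theorem pow_four_eq_one_cases {y : K} (hy : y ^ 4 = 1) :
    y = 1 ∨ y = -1 ∨ y = C.i ∨ y = -C.i := by
  have h : (y - 1) * ((y + 1) * ((y - C.i) * (y + C.i))) = 0 := by
    linear_combination hy - (y ^ 2 - 1) * C.i_sq
  rcases mul_eq_zero.1 h with h | h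
  · exact Or.inl (sub_eq_zero.1 h)
  rcases mul_eq_zero.1 h with h | h
  · exact Or.inr (Or.inl (eq_neg_of_add_eq_zero_left h))
  rcases mul_eq_zero.1 h with h | h
  · exact Or.inr (Or.inr (Or.inl (sub_eq_zero.1 h)))
  · exact Or.inr (Or.inr (Or.inr (eq_neg_of_add_eq_zero_left h)))

variable {W : Submodule ℚ (ℚ ⊗[ℤ] NS 𝒜)}

theorem mem_of_two_smul {x : ℚ ⊗[ℤ] NS 𝒜} (h : (2 : ℚ) • x ∈ W) : x ∈ W := by
  have := W.smul_mem 2⁻¹ h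
  rwa [smul_smul, inv_mul_cancel₀ (by norm_num), one_smul] at this

theorem mem_of_add_sub {x y : ℚ ⊗[ℤ] NS 𝒜} (h1 : x + y ∈ W) (h2 : x - y ∈ W) : x ∈ W ∧ y ∈ W := by
  constructor
  · apply mem_of_two_smul
    have : (2 : ℚ) • x = (x + y) + (x - y) := by rw [two_smul]; abel
    rw [this]; exact add_mem h1 h2
  · apply mem_of_two_smul
    have : (2 : ℚ) • y = (x + y) - (x - y) := by rw [two_smul]; abel
    rw [this]; exact sub_mem h1 h2

include hR in
/-- The differences of lines are combinations of the eigenvectors. -/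
theorem diff_mem (hW : ∀ i, M.eigenvector C i ∈ W) :
    (∀ x y : K, x ^ 2 = 1 → y ^ 2 = 1 → M.diffU (C.root x y) (C.r / 2) ∈ W) ∧
    (∀ y : K, y ^ 4 = 1 → M.diffOne y C.rho ∈ W) ∧
    (∀ y : K, y ^ 4 = 1 → M.diffTwo y C.rho ∈ W) := by
  have h1 := hW 1
  have h2 := hW 2
  have h3 := hW 3
  have h4 := hW 4
  have h5 := hW 5
  have h6 := hW 6
  have h7 := hW 7
  simp only [eigenvector, diff, root_one_one, root_neg_neg, root_one_neg, root_neg_one,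
    Matrix.cons_val] at h1 h2 h3 h4 h5 h6 h7
  have s0 := M.diffU_sum C hR
  have s1 := M.diffOne_sum C hR (y := 1) (by norm_num)
  have s2 := M.diffOne_sum C hR C.i_pow_four
  have s3 := M.diffTwo_sum C hR (y := 1) (by norm_num)
  have s4 := M.diffTwo_sum C hR C.i_pow_four
  rw [one_pow, one_mul] at s1 s3
  rw [C.i_sq, neg_one_mul] at s2 s4
  rw [neg_neg] at s4
  rw [diffOne_neg, diffOne_neg] at s2
  rw [diffTwo_neg, diffTwo_neg] at s3
  generalize hu₁ : M.diffU C.a (C.r / 2) = u₁ at s0 s1 s2 s3 s4 h1 h2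
  generalize hu₂ : M.diffU (-C.a) (C.r / 2) = u₂ at s0 s1 s2 s3 s4 h1 h2
  generalize hu₃ : M.diffU C.a' (C.r / 2) = u₃ at s0 s1 s2 s3 s4 h1 h2
  generalize hu₄ : M.diffU (-C.a') (C.r / 2) = u₄ at s0 s1 s2 s3 s4 h1 h2
  -- The relation for y = 1 puts u₁ + u₂ into W, and the relation s0 then gives u₃ + u₄. Together
  -- with the two eigenvectors formed from the u's, and halving, all four lie in W. The remaining
  -- relations supply the differences not listed as eigenvectors.
  have t0 : u₁ + u₂ ∈ W := by
    have : u₁ + u₂ = -(M.diffOne 1 C.rho + M.diffOne (-1) C.rho) :=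
      eq_neg_of_add_eq_zero_left (by rw [← s1]; abel)
    rw [this]; exact neg_mem (add_mem h5 h6)
  have t1 : u₃ + u₄ ∈ W := by
    have : u₃ + u₄ = -(u₁ + u₂) := eq_neg_of_add_eq_zero_left (by rw [← s0]; abel)
    rw [this]; exact neg_mem t0
  have t2 : u₁ - u₂ ∈ W := by
    apply mem_of_two_smul
    have : (2 : ℚ) • (u₁ - u₂) = (u₁ + u₃ - u₄ - u₂) + (u₁ - u₃ + u₄ - u₂) := by
      rw [two_smul]; abel
    rw [this]; exact add_mem h1 h2
  have t3 : u₃ - u₄ ∈ W := by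
    apply mem_of_two_smul
    have : (2 : ℚ) • (u₃ - u₄) = (u₁ + u₃ - u₄ - u₂) - (u₁ - u₃ + u₄ - u₂) := by
      rw [two_smul]; abel
    rw [this]; exact sub_mem h1 h2
  obtain ⟨m1, m2⟩ := mem_of_add_sub t0 t2
  obtain ⟨m3, m4⟩ := mem_of_add_sub t1 t3
  have t4 : M.diffOne C.i C.rho + M.diffOne (-C.i) C.rho ∈ W := by
    have : M.diffOne C.i C.rho + M.diffOne (-C.i) C.rho = u₁ + u₂ := by
      rw [eq_comm, ← sub_eq_zero, ← s2]; abel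
    rw [this]; exact t0
  obtain ⟨m5, m6⟩ := mem_of_add_sub t4 h3
  have t5 : M.diffTwo C.i C.rho + M.diffTwo (-C.i) C.rho ∈ W := by
    have : M.diffTwo C.i C.rho + M.diffTwo (-C.i) C.rho = -(u₁ + u₂) :=
      eq_neg_of_add_eq_zero_left (by rw [← s4]; abel)
    rw [this]; exact neg_mem t0
  obtain ⟨m7, m8⟩ := mem_of_add_sub t5 h4
  have m9 : M.diffTwo (-1) C.rho ∈ W := by
    have : M.diffTwo (-1) C.rho = u₁ + u₂ - M.diffTwo 1 C.rho := by
      rw [eq_comm, ← sub_eq_zero, ← s3]; abel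
    rw [this]; exact sub_mem t0 h7
  refine ⟨fun x y hx hy => ?_, fun y hy => ?_, fun y hy => ?_⟩
  · rcases sq_eq_one_iff.1 hx with rfl | rfl <;>
      rcases sq_eq_one_iff.1 hy with rfl | rfl
    · rw [root_one_one, hu₁]; exact m1
    · rw [root_one_neg, hu₃]; exact m3
    · rw [root_neg_one, hu₄]; exact m4
    · rw [root_neg_neg, hu₂]; exact m2
  · rcases pow_four_eq_one_cases C hy with rfl | rfl | rfl | rfl <;> assumption
  · rcases pow_four_eq_one_cases C hy with rfl | rfl | rfl | rfl <;> assumption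

include hR in
theorem lineClass_mem (hW : ∀ i, M.eigenvector C i ∈ W) {ℓ π π' : R}
    (hp : IsLinePair 𝒜 ℓ π π') (h : lineClass 𝒜 ℓ π - lineClass 𝒜 ℓ π' ∈ W) :
    lineClass 𝒜 ℓ π ∈ W ∧ lineClass 𝒜 ℓ π' ∈ W := by
  have h0 : M.hyperplane C ∈ W := hW 0
  have hp' := M.isLinePair_u (C.quartic (b := C.a) (by simp)) C.half_r
  refine mem_of_add_sub ?_ h
  have hg := hp.fst.isUniformizer.ne_zero
  rw [hp.lineClass_add hR hg hp.fst.fst_mem]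
  rwa [hyperplane, hp'.lineClass_add hR hg hp.fst.fst_mem] at h0

include hR in
theorem divisorOf_mem (hW : ∀ i, M.eigenvector C i ∈ W) {n : ℕ} {f : R} (hf : f ≠ 0)
    (hfn : f ∈ 𝒜 n) : cl 𝒜 (divisorOf hR f hf) ∈ W := by
  have h0 : M.hyperplane C ∈ W := hW 0
  have hp' := M.isLinePair_u (C.quartic (b := C.a) (by simp)) C.half_r
  have hg := hp'.fst.isUniformizer.ne_zero
  rw [cl_divisorOf_eq_nsmul hR hf hg hfn hp'.fst.fst_mem]
  rw [hyperplane, hp'.lineClass_add hR hg hp'.fst.fst_mem] at h0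
  exact nsmul_mem h0 n

theorem eq_or_eq_of_mem {ℓ π π' : R} (hp : IsLinePair 𝒜 ℓ π π') {P : PrimeDivisor 𝒜}
    (h : ℓ ∈ P.ideal) : hp.fst.divisor = P ∨ hp.snd.divisor = P := by
  obtain ⟨z, hz⟩ := hp.exists_mul
  have h1 : π * π' ∈ P.ideal := by rw [hz]; exact P.ideal.mul_mem_right _ h
  rcases P.point.isPrime.mem_or_mem h1 with h2 | h2
  · refine Or.inl (hp.fst.eq_divisor ?_)
    rw [Ideal.span_le]
    rintro _ (rfl | rfl) <;> assumption
  · refine Or.inr (hp.snd.eq_divisor ?_)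
    rw [Ideal.span_le]
    rintro _ (rfl | rfl) <;> assumption

theorem cl_single_mem_of_pair {ℓ π π' : R} (hp : IsLinePair 𝒜 ℓ π π') {P : PrimeDivisor 𝒜}
    (h : ℓ ∈ P.ideal) (hW : lineClass 𝒜 ℓ π ∈ W ∧ lineClass 𝒜 ℓ π' ∈ W) :
    cl 𝒜 (Finsupp.single P 1) ∈ W := by
  rw [hp.fst.lineClass_eq, hp.snd.lineClass_eq] at hW
  rcases eq_or_eq_of_mem hp h with rfl | rfl
  · exact hW.1
  · exact hW.2

include hR in
/-- The class of a line over a boundary form different from the fibre at infinity. -/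
theorem cl_single_mem (hW : ∀ i, M.eigenvector C i ∈ W) {P : PrimeDivisor 𝒜} {ℓ : R}
    (hℓ : M.IsBoundaryForm C ℓ) (hℓP : ℓ ∈ P.ideal) :
    cl 𝒜 (Finsupp.single P 1) ∈ W ∨ M.lin C.k C.k ∈ P.ideal := by
  obtain ⟨d1, d2, d3⟩ := M.diff_mem C hR hW
  cases hℓ with
  | infinity => exact Or.inr hℓP
  | u x y hx hy =>
    have hp := M.isLinePair_u (C.root_eq hx hy) C.half_r
    exact Or.inl (cl_single_mem_of_pair hp hℓP (M.lineClass_mem C hR hW hp (d1 x y hx hy)))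
  | one y hy =>
    have hp := M.isLinePair_one C.lam_ne hy C.rho_sq
    exact Or.inl (cl_single_mem_of_pair hp hℓP (M.lineClass_mem C hR hW hp (d2 y hy)))
  | two y hy =>
    have hp := M.isLinePair_two C.lam_ne hy C.rho_sq
    exact Or.inl (cl_single_mem_of_pair hp hℓP (M.lineClass_mem C hR hW hp (d3 y hy)))

-- The divisor of `numT` is a multiple of H, contains the first line with nonzero multiplicity,
-- avoids the second, and otherwise consists of boundary lines known to lie in W. The class of the
-- first line is recovered by division in ℚ.
include hR in
theorem infinity_mem (hW : ∀ i, M.eigenvector C i ∈ W) :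
    cl 𝒜 (Finsupp.single (M.isLinePair_infinity C).fst.divisor 1) ∈ W := by
  classical
  have hp := M.isLinePair_infinity C
  have hn0 := (M.conic C).numT_ne
  have h1 := M.divisorOf_mem C hR hW hn0 (M.conic C).numT_mem
  set E := (M.isLinePair_infinity C).fst.divisor
  set D := divisorOf hR (M.conic C).numT hn0
  have h2 : cl 𝒜 (D.erase E) ∈ W := by
    rw [← (D.erase E).sum_single, map_finsuppSum]
    refine sum_mem fun P hP => ?_
    rw [Finsupp.support_erase, Finset.mem_erase, Finsupp.mem_support_iff] at hP
    obtain ⟨hPE, hDP⟩ := hP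
    have hmem : (M.conic C).numT ∈ P.ideal := by
      by_contra h
      have := hR P
      apply hDP
      rw [divisorOf_apply, ordAt_eq_zero_iff.2 h]
      rfl
    obtain ⟨e, he, heP⟩ := (M.conic C).exists_mem_chart_of_numT_mem hmem
    obtain ⟨ℓ, hℓ, hℓP⟩ := M.exists_isBoundaryForm_mem C he heP
    have h3 : cl 𝒜 (Finsupp.single P 1) ∈ W := by
      -- A remaining component over s = k(u + v) would be the first line, which was erased, or the
      -- second, on which `numT` does not vanish.
      rcases M.cl_single_mem C hR hW hℓ hℓP with h | h
      · exact h
      · rcases eq_or_eq_of_mem hp h with h | h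
        · exact absurd h.symm hPE
        · exact absurd (h ▸ hmem) (M.numT_notMem_infinity C)
    have h4 : Finsupp.single P (D.erase E P) = D.erase E P • Finsupp.single P (1 : ℤ) := by simp
    change cl 𝒜 (Finsupp.single P (D.erase E P)) ∈ W
    rw [h4, map_zsmul]
    exact zsmul_mem h3 _
  have h3 : cl 𝒜 (Finsupp.single E (D E)) ∈ W := by
    have h4 : Finsupp.single E (D E) = D - D.erase E :=
      eq_sub_of_add_eq (Finsupp.single_add_erase E D)
    rw [h4, map_sub]
    exact sub_mem h1 h2
  have hDE : D E ≠ 0 := by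
    have := hR E
    rw [divisorOf_apply]
    have h4 : ordAt E.ideal (M.conic C).numT ≠ 0 := fun h =>
      ordAt_eq_zero_iff.1 h (M.numT_mem_infinity C)
    have h5 : ordAt E.ideal (M.conic C).numT ≠ ⊤ := fun h => hn0 (ordAt_eq_top_iff.1 h)
    simp [h4, h5]
  have h4 : Finsupp.single E (D E) = D E • Finsupp.single E (1 : ℤ) := by simp
  rw [h4, map_zsmul, ← Int.cast_smul_eq_zsmul ℚ] at h3
  have h5 := W.smul_mem ((D E : ℚ)⁻¹) h3
  rwa [smul_smul, inv_mul_cancel₀ (by exact_mod_cast hDE), one_smul] at h5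

include hR in
/-- The eigenvectors span the Néron-Severi group. -/
theorem span_eigenvector : Submodule.span ℚ (Set.range (M.eigenvector C)) = ⊤ := by
  have hW : ∀ i, M.eigenvector C i ∈ Submodule.span ℚ (Set.range (M.eigenvector C)) := fun i =>
    Submodule.subset_span ⟨i, rfl⟩
  refine eq_top_of_forall_cl_single_mem hR (M.isChart_charts C) fun P hP => ?_
  unfold IsCovered at hP
  push Not at hP
  obtain ⟨e, he, heP⟩ := hP true
  obtain ⟨ℓ, hℓ, hℓP⟩ := M.exists_isBoundaryForm_mem C he heP
  rcases M.cl_single_mem C hR hW hℓ hℓP with h | h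
  · exact h
  · have hp := M.isLinePair_infinity C
    refine cl_single_mem_of_pair hp h ?_
    have h1 := M.infinity_mem C hR hW
    rw [← hp.fst.lineClass_eq] at h1
    refine ⟨h1, ?_⟩
    have hg := hp.fst.isUniformizer.ne_zero
    have h2 := M.divisorOf_mem C hR hW hg hp.fst.fst_mem
    rw [← hp.lineClass_add hR hg hp.fst.fst_mem] at h2
    exact (add_mem_cancel_left h1).1 h2

end Span

end Presentation

end Dwork

/-! ### Principal divisors supported on the boundary -/

namespace Dwork
open ProjDiv

/-- Compare orders along `P`: only the powers of `y` contribute beyond the equal orders of `f` and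
`g`. -/
theorem eq_of_mul_pow_eq {R : Type u} [CommRing R] [IsDomain R] [IsNoetherianRing R] {P : Ideal R}
    [P.IsPrime] [IsDiscreteValuationRing (Localization.AtPrime P)] {f g y A B : R} {a b : ℕ}
    (hg : g ≠ 0) (h : ordAt P f = ordAt P g) (hA : A ∉ P) (hB : B ∉ P) (hy : y ∈ P)
    (hy0 : y ≠ 0) (he : f * y ^ a * A = g * y ^ b * B) : a = b := by
  have h1 := congrArg (ordAt P) he
  simp only [ordAt_mul, ordAt_pow, ordAt_eq_zero_iff.2 hA, ordAt_eq_zero_iff.2 hB, h,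
    add_zero] at h1
  have h2 : ordAt P g ≠ ⊤ := fun h => hg (ordAt_eq_top_iff.1 h)
  have h3 : ordAt P y ≠ ⊤ := fun h => hy0 (ordAt_eq_top_iff.1 h)
  have h4 : ordAt P y ≠ 0 := fun h => ordAt_eq_zero_iff.1 h hy
  generalize ordAt P g = m at *
  generalize ordAt P y = n at *
  lift m to ℕ using h2
  lift n to ℕ using h3
  have h4 : n ≠ 0 := by simpa using h4
  have h5 : m + a * n = m + b * n := by
    simp only [nsmul_eq_mul] at h1
    exact_mod_cast h1
  exact Nat.eq_of_mul_eq_mul_right (Nat.pos_of_ne_zero h4) (Nat.add_left_cancel h5)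

namespace ConicPresentation

variable {K R : Type u} [Field K] [CharZero K] [IsAlgClosed K] [CommRing R] [IsDomain R]
  [Algebra K R] [IsNoetherianRing R] {𝒜 : ℕ → Submodule K R} [GradedAlgebra 𝒜] {d : ConicData K}
  (N : ConicPresentation 𝒜 d)

/-- The positions of the five singular fibres at finite distance. -/
def pos (d : ConicData K) (i : Option (Fin 4)) : K := i.elim 0 d.rt

theorem pos_injective : Function.Injective (pos d) := by
  rintro (_ | i) (_ | j) h
  · rfl
  · exact absurd h.symm (d.rt_ne j)
  · exact absurd h (d.rt_ne i)
  · exact congrArg some (d.rt_inj h)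

/-- The form that vanishes on a singular fibre. -/
def fibre (i : Option (Fin 4)) : R := N.x - algebraMap K R (pos d i) * N.den

theorem fibre_mem (i) : N.fibre i ∈ 𝒜 2 := by
  rw [fibre, ← Algebra.smul_def]
  exact sub_mem N.x_mem (Submodule.smul_mem _ _ N.den_mem)

theorem hom_fibre (i) : N.hom (N.fibre i) =
    (d.tau - algebraMap K d.Ring (pos d i)) * N.hom N.den := by
  rw [fibre, map_sub, map_mul, AlgHom.commutes, hom_x, sub_mul]

theorem den_mem_of_fibre_mem {P : Ideal R} {i j} (h : i ≠ j) (hi : N.fibre i ∈ P)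
    (hj : N.fibre j ∈ P) : N.den ∈ P := by
  have h1 := P.sub_mem hj hi
  have h2 : N.fibre j - N.fibre i = algebraMap K R (pos d i - pos d j) * N.den := by
    rw [fibre, fibre, map_sub]; ring
  rw [h2] at h1
  exact Presentation.mem_of_algebraMap_mul_mem (sub_ne_zero.2 fun h0 => h (pos_injective h0)) h1

theorem prod_fibres (m : Option (Fin 4) → ℕ) :
    d.tau ^ m none * ∏ i, (d.tau - algebraMap K d.Ring (d.rt i)) ^ m (some i) =
      ∏ i, (d.tau - algebraMap K d.Ring (pos d i)) ^ m i := by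
  rw [Fintype.prod_option]
  simp [pos]

theorem hom_prod_fibre (m : Option (Fin 4) → ℕ) : N.hom (∏ i, N.fibre i ^ m i) =
    (∏ i, (d.tau - algebraMap K d.Ring (pos d i)) ^ m i) * N.hom N.den ^ ∑ i, m i := by
  simp only [map_prod, map_pow, hom_fibre, mul_pow, Finset.prod_mul_distrib,
    Finset.prod_pow_eq_pow_sum]

/-- A relation between homogeneous elements with associated dehomogenizations. -/
theorem exists_relation {n : ℕ} {f g : R} (hf : f ∈ 𝒜 n) (hg : g ∈ 𝒜 n)
    (h : Associated (N.hom f) (N.hom g)) :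
    ∃ κ : K, κ ≠ 0 ∧ ∃ (p l : ℕ) (m : Option (Fin 4) → ℕ) (a b : ℕ),
      algebraMap K R κ * f * (N.numT ^ l * (∏ i, N.fibre i ^ m i) * N.den ^ (8 * p)) * N.s ^ a =
        g * (N.numT ^ p * (∏ i, N.fibre i ^ p) * N.den ^ (3 * l + ∑ i, m i)) * N.s ^ b := by
  obtain ⟨υ, hυ⟩ := h
  obtain ⟨κ, hκ, p, l, j, m', hm⟩ := d.exists_eq_of_isUnit υ.isUnit
  obtain ⟨m, rfl, rfl⟩ : ∃ m : Option (Fin 4) → ℕ, m none = j ∧ (fun i => m (some i)) = m' :=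
    ⟨fun i => i.elim j m', rfl, rfl⟩
  have hm1 := prod_fibres (d := d) m
  have hm2 := prod_fibres (d := d) fun _ => p
  rw [Finset.prod_pow, ← mul_pow] at hm2
  rw [hm1, mul_pow, hm2] at hm
  have hh : ∀ {k : ℕ} {y : R}, y ∈ 𝒜 k → SetLike.IsHomogeneousElem 𝒜 y := fun h => ⟨_, h⟩
  have hpow : ∀ {k : ℕ} {y : R} (e : ℕ), y ∈ 𝒜 k → SetLike.IsHomogeneousElem 𝒜 (y ^ e) :=
    fun e h => ⟨_, SetLike.pow_mem_graded e h⟩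
  have hprod : ∀ e : Option (Fin 4) → ℕ, SetLike.IsHomogeneousElem 𝒜 (∏ i, N.fibre i ^ e i) :=
    fun e => ⟨_, SetLike.prod_mem_graded _ _ _ fun i _ =>
      SetLike.pow_mem_graded (e i) (N.fibre_mem i)⟩
  have hκf : algebraMap K R κ * f ∈ 𝒜 n := by
    rw [← Algebra.smul_def]; exact Submodule.smul_mem _ _ hf
  -- Denominators are cleared by T = numT/(den³s) and τ - pos i = fibre i/den. The product of T and
  -- the five linear factors therefore has denominator den⁸, up to powers of s.
  obtain ⟨a, b, hab⟩ := N.dehomogenization.exists_mul_unit_pow_eq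
    (f := algebraMap K R κ * f * (N.numT ^ l * (∏ i, N.fibre i ^ m i) * N.den ^ (8 * p)))
    (g := g * (N.numT ^ p * (∏ i, N.fibre i ^ p) * N.den ^ (3 * l + ∑ i, m i)))
    ((hh hκf).mul (((hpow _ N.numT_mem).mul (hprod m)).mul (hpow _ N.den_mem)))
    ((hh hg).mul (((hpow _ N.numT_mem).mul (hprod fun _ => p)).mul (hpow _ N.den_mem)))
    (by
      have h2 := N.hom_prod_fibre fun _ => p
      have h3 : ∑ _i : Option (Fin 4), p = 5 * p := by simp
      rw [h3] at h2
      change N.hom _ = N.hom _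
      rw [map_mul, map_mul N.hom g, ← hυ]
      simp only [map_mul, map_pow N.hom N.numT, map_pow N.hom N.den, AlgHom.commutes, hom_numT,
        N.hom_prod_fibre m, h2]
      generalize ∏ i, (d.tau - algebraMap K d.Ring (pos d i)) ^ m i = A at *
      generalize ∏ i, (d.tau - algebraMap K d.Ring (pos d i)) ^ p = B at *
      generalize ∑ i, m i = e at *
      linear_combination (-N.hom f * N.hom N.den ^ (3 * l + e + 8 * p)) * hm)
  exact ⟨κ, hκ, p, l, m, a, b, hab⟩

/-- All exponents of the unit are forced to be trivial. The order along `E`, where only s vanishes,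
gives a = b. The degrees give l = p. The order along a component `Q` of each finite singular fibre
on which the divisor has coefficient zero gives m i = l. -/
theorem eq_of_relation {n : ℕ} {f g : R} (hf : f ∈ 𝒜 n) (hg : g ∈ 𝒜 n)
    (hg0 : g ≠ 0) {E : Ideal R} [E.IsPrime] [IsDiscreteValuationRing (Localization.AtPrime E)]
    (hE : ordAt E f = ordAt E g) (hsE : N.s ∈ E) (hTE : N.numT ∉ E) (hdE : N.den ∉ E)
    (hxE : ∀ i, N.fibre i ∉ E)
    (hQ : ∀ i, ∃ (Q : Ideal R) (_ : Q.IsPrime)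
      (_ : IsDiscreteValuationRing (Localization.AtPrime Q)),
      ordAt Q f = ordAt Q g ∧ N.fibre i ∈ Q ∧ N.den ∉ Q)
    {κ : K} (hκ : κ ≠ 0) {p l : ℕ} {m : Option (Fin 4) → ℕ} {a b : ℕ}
    (h : algebraMap K R κ * f * (N.numT ^ l * (∏ i, N.fibre i ^ m i) * N.den ^ (8 * p)) * N.s ^ a =
      g * (N.numT ^ p * (∏ i, N.fibre i ^ p) * N.den ^ (3 * l + ∑ i, m i)) * N.s ^ b) :
    algebraMap K R κ * f = g := by
  have hκP : ∀ {P : Ideal R} [P.IsPrime], algebraMap K R κ ∉ P := fun {P} _ h0 =>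
    Ideal.IsPrime.one_notMem ‹P.IsPrime› (Presentation.mem_of_algebraMap_mul_mem hκ (by rwa [mul_one]))
  have hpow : ∀ {P : Ideal R} [P.IsPrime] {y : R} (e : ℕ), y ∉ P → y ^ e ∉ P :=
    fun {P} _ _ e h h' => h (Ideal.IsPrime.mem_of_pow_mem ‹_› e h')
  have hmul : ∀ {P : Ideal R} [P.IsPrime] {y z : R}, y ∉ P → z ∉ P → y * z ∉ P :=
    fun {P} _ _ _ h h' h0 => (Ideal.IsPrime.mem_or_mem ‹_› h0).elim h h'
  have hprod : ∀ {P : Ideal R} [P.IsPrime] (s : Finset (Option (Fin 4)))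
      (e : Option (Fin 4) → ℕ), (∀ i ∈ s, N.fibre i ∉ P) → ∏ i ∈ s, N.fibre i ^ e i ∉ P := by
    intro P hP s e hi h0
    obtain ⟨i, his, h1⟩ := (Ideal.IsPrime.prod_mem_iff).1 h0
    exact hpow _ (hi i his) h1
  have hab : a = b := eq_of_mul_pow_eq hg0 hE
    (A := algebraMap K R κ * (N.numT ^ l * (∏ i, N.fibre i ^ m i) * N.den ^ (8 * p)))
    (B := N.numT ^ p * (∏ i, N.fibre i ^ p) * N.den ^ (3 * l + ∑ i, m i))
    (hmul hκP (hmul (hmul (hpow _ hTE) (hprod _ _ fun i _ => hxE i)) (hpow _ hdE)))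
    (hmul (hmul (hpow _ hTE) (hprod _ _ fun i _ => hxE i)) (hpow _ hdE)) hsE N.s_ne
    (by linear_combination h)
  subst hab
  have h := mul_right_cancel₀ (pow_ne_zero a N.s_ne) h
  have hT0 := N.numT_ne
  have hd0 := N.den_ne
  have hfib0 : ∀ i, N.fibre i ≠ 0 := fun i => N.x_sub_ne _
  have hκ0 : algebraMap K R κ ≠ 0 := by rwa [Ne, map_eq_zero_iff _ (algebraMap K R).injective]
  have hprod0 : ∀ e : Option (Fin 4) → ℕ, ∏ i, N.fibre i ^ e i ≠ 0 := fun e =>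
    Finset.prod_ne_zero_iff.2 fun i _ => pow_ne_zero _ (hfib0 i)
  have hdeg : ∀ e : Option (Fin 4) → ℕ, ∏ i, N.fibre i ^ e i ∈ 𝒜 (2 * ∑ i, e i) := by
    intro e
    rw [Finset.mul_sum]
    exact SetLike.prod_mem_graded _ _ _ fun i _ => by
      simpa [mul_comm] using SetLike.pow_mem_graded (e i) (N.fibre_mem i)
  have hlp : l = p := by
    have hT : ∀ e, N.numT ^ e ∈ 𝒜 (e * 7) := fun e => by
      simpa using SetLike.pow_mem_graded e N.numT_mem
    have hd : ∀ e, N.den ^ e ∈ 𝒜 (e * 2) := fun e => by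
      simpa using SetLike.pow_mem_graded e N.den_mem
    have hκf : algebraMap K R κ * f ∈ 𝒜 n := by
      rw [← Algebra.smul_def]; exact Submodule.smul_mem _ _ hf
    have h1 := SetLike.mul_mem_graded hκf
      (SetLike.mul_mem_graded (SetLike.mul_mem_graded (hT l) (hdeg m)) (hd (8 * p)))
    have h2 := SetLike.mul_mem_graded hg
      (SetLike.mul_mem_graded (SetLike.mul_mem_graded (hT p) (hdeg fun _ => p))
        (hd (3 * l + ∑ i, m i)))
    rw [h] at h1
    -- Degrees 7 for `numT` and 2 for the fibres and `den`: 7l + 2Σm + 16p = 7p + 10p + 2(3l + Σm),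
    -- that is l = p.
    have h3 := DirectSum.degree_eq_of_mem_mem 𝒜 h1 h2
      (mul_ne_zero hg0 (mul_ne_zero (mul_ne_zero (pow_ne_zero _ hT0) (hprod0 _))
        (pow_ne_zero _ hd0)))
    have h4 : ∑ _i : Option (Fin 4), p = 5 * p := by simp
    rw [h4] at h3
    omega
  subst hlp
  have hmi : ∀ i, m i = l := by
    intro i
    obtain ⟨Q, hQp, hQd, hord, hi, hden⟩ := hQ i
    have hne : ∀ j ∈ Finset.univ.erase i, N.fibre j ∉ Q := fun j hj h0 =>
      hden (N.den_mem_of_fibre_mem (Finset.ne_of_mem_erase hj) h0 hi)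
    refine eq_of_mul_pow_eq hg0 hord
      (A := algebraMap K R κ * ((∏ j ∈ Finset.univ.erase i, N.fibre j ^ m j) * N.den ^ (8 * l)))
      (B := (∏ j ∈ Finset.univ.erase i, N.fibre j ^ l) * N.den ^ (3 * l + ∑ i, m i))
      (hmul hκP (hmul (hprod _ _ hne) (hpow _ hden)))
      (hmul (hprod _ _ hne) (hpow _ hden)) hi (hfib0 i) ?_
    apply mul_left_cancel₀ (pow_ne_zero l hT0)
    rw [← Finset.mul_prod_erase _ _ (Finset.mem_univ i),
      ← Finset.mul_prod_erase _ _ (Finset.mem_univ i)] at h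
    linear_combination h
  obtain rfl : m = fun _ => l := funext hmi
  have h4 : ∑ _i : Option (Fin 4), l = 5 * l := by simp
  rw [h4, show 3 * l + 5 * l = 8 * l by ring] at h
  exact mul_right_cancel₀ (mul_ne_zero (mul_ne_zero (pow_ne_zero _ hT0) (hprod0 _))
    (pow_ne_zero _ hd0)) h

variable (hR : ∀ P : PrimeDivisor 𝒜, IsDiscreteValuationRing (Localization.AtPrime P.ideal))

include hR in
/-- Principal divisors that are supported on certain lines vanish. -/
theorem eq_zero_of_mem_principalDivisors {ι : Type*} {C : ι → Submonoid R}
    (hC : ∀ i, IsChart N.dehomogenization (C i))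
    (hcov : ∀ p : d.Ring, Prime p → ∃ i, ∀ e ∈ C i, ¬ p ∣ N.dehomogenization.hom e)
    {D : Divisor 𝒜} (hD : D ∈ principalDivisors 𝒜) (h0 : ∀ Q, IsCovered C Q → D Q = 0)
    {E : PrimeDivisor 𝒜} (hE : D E = 0) (hsE : N.s ∈ E.ideal) (hTE : N.numT ∉ E.ideal)
    (hdE : N.den ∉ E.ideal) (hxE : ∀ i, N.fibre i ∉ E.ideal)
    (hQ : ∀ i, ∃ Q : PrimeDivisor 𝒜, D Q = 0 ∧ N.fibre i ∈ Q.ideal ∧ N.den ∉ Q.ideal) : D = 0 := by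
  obtain ⟨n, f, hf, g, hg, hf0, hg0, rfl⟩ := (mem_principalDivisors_iff hR D).1 hD
  have hord : ∀ Q : PrimeDivisor 𝒜, (divisorOf hR f hf0 - divisorOf hR g hg0) Q = 0 →
      ordAt Q.ideal f = ordAt Q.ideal g := by
    intro Q h
    have := hR Q
    rw [Finsupp.sub_apply, sub_eq_zero, divisorOf_apply, divisorOf_apply, Nat.cast_inj] at h
    rw [← ordAt_toNat hf0, ← ordAt_toNat hg0, h]
  have h1 := associated_of_divisorOf_eq hC hR hcov ⟨n, hf⟩ ⟨n, hg⟩ hf0 hg0 fun Q hQ => by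
    have := h0 Q hQ
    rwa [Finsupp.sub_apply, sub_eq_zero] at this
  obtain ⟨κ, hκ, p, l, m, a, b, h2⟩ := N.exists_relation hf hg h1
  have := hR E
  have h3 := N.eq_of_relation hf hg hg0 (hord E hE) hsE hTE hdE hxE (fun i => by
    obtain ⟨Q, h4, h5, h6⟩ := hQ i
    exact ⟨Q.ideal, inferInstance, hR Q, hord Q h4, h5, h6⟩) hκ h2
  ext P
  have := hR P
  have h4 : ordAt P.ideal (algebraMap K R κ) = 0 := ordAt_eq_zero_iff.2 fun h =>
    P.point.isPrime.one_notMem (Presentation.mem_of_algebraMap_mul_mem hκ (by rwa [mul_one]))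
  rw [Finsupp.sub_apply, divisorOf_apply, divisorOf_apply, ← h3, ordAt_mul, h4, zero_add, sub_self]
  rfl

end ConicPresentation

end Dwork

/-! ### Eight independent boundary curves -/

namespace Dwork
open ProjDiv

namespace Presentation

variable {K R : Type u} [Field K] [CharZero K] [IsAlgClosed K] [CommRing R] [IsDomain R]
  [Algebra K R] [IsNoetherianRing R] {𝒜 : ℕ → Submodule K R} [GradedAlgebra 𝒜] {lam : K}
  (M : Presentation 𝒜 lam) (C : Constants lam)

/-- A component of a singular fibre of the conic bundle at finite distance. -/
def IsFibreComponent (i : Option (Fin 4)) (P : PrimeDivisor 𝒜) : Prop :=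
  (M.conic C).fibre i ∈ P.ideal ∧ (M.conic C).den ∉ P.ideal ∧ (M.conic C).s ∉ P.ideal

theorem isFibreComponent_of_isLine {i : Option (Fin 4)} {ℓ π : R} (h : IsLine 𝒜 ℓ π)
    (he : M.IsLineEquation ℓ π) (hi : (M.conic C).fibre i ∈ Ideal.span {ℓ, π})
    (h1 : ℓ ≠ M.linU C.a) (h2 : ℓ ≠ M.linU (-C.a)) (h3 : ℓ ≠ M.lin C.k C.k) :
    M.IsFibreComponent C i h.divisor := by
  have hP := h.isPrime
  refine ⟨hi, fun h0 => ?_, fun h0 => ?_⟩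
  · rw [conic_den] at h0
    rcases hP.mem_or_mem h0 with h0 | h0
    · exact he.notMem M (.u _ _ (C.quartic (by simp)) C.half_r) h1 h0
    · exact he.notMem M (.u _ _ (C.quartic (by simp)) C.half_r) h2
        (mem_of_algebraMap_mul_mem C.c'_ne h0)
  · exact he.notMem M (.s _ _ _ _ _ (isRootOn_infinity C)) h3 h0

theorem fibre_eq {i : Option (Fin 4)} {t : K} (h : ConicPresentation.pos C.conicData i = C.c * t) :
    (M.conic C).fibre i = M.elX C - algebraMap K R t * (M.linU C.a * M.linU (-C.a)) := by
  have h1 := congrArg (algebraMap K R) (show C.c * t * C.c' = t by linear_combination t * C.c_mul)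
  rw [ConicPresentation.fibre, h, conic_den]
  change M.elX C - _ = _
  rw [map_mul] at h1 ⊢
  rw [map_mul] at h1
  linear_combination -(M.linU C.a * M.linU (-C.a)) * h1

/-- Equality of the two forms would give y²λ = -1, hence λ⁴ = 1. -/
theorem one_ne_infinity {y : K} (hy : y ^ 4 = 1) (h : C.k = y) (h' : C.k = -(y ^ 3 * lam)) :
    False := by
  have hy0 : y ≠ 0 := by rintro rfl; norm_num at hy
  have h1 : y * (1 + y ^ 2 * lam) = 0 := by linear_combination h' - h
  have h2 := (mul_eq_zero.1 h1).resolve_left hy0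
  apply C.lam_ne
  linear_combination (y ^ 2 * lam - 1) * (1 + lam ^ 2 * y ^ 4) * h2 -
    (lam ^ 4 * (y ^ 4 + 1)) * hy

theorem exists_of_isLinePair {i : Option (Fin 4)} {ℓ π ℓ' π' : R} (h : IsLine 𝒜 ℓ π)
    (h' : IsLine 𝒜 ℓ' π') (he : M.IsLineEquation ℓ π) (he' : M.IsLineEquation ℓ' π')
    (hi : (M.conic C).fibre i ∈ Ideal.span {ℓ, π}) (hi' : (M.conic C).fibre i ∈ Ideal.span {ℓ', π'})
    (h1 : ℓ ≠ M.linU C.a) (h2 : ℓ ≠ M.linU (-C.a)) (h3 : ℓ ≠ M.lin C.k C.k)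
    (h1' : ℓ' ≠ M.linU C.a) (h2' : ℓ' ≠ M.linU (-C.a)) (h3' : ℓ' ≠ M.lin C.k C.k) (hne : ℓ ≠ ℓ') :
    ∃ P Q, P ≠ Q ∧ M.IsFibreComponent C i P ∧ M.IsFibreComponent C i Q :=
  ⟨h.divisor, h'.divisor, h.ne_of_notMem (he'.notMem M he hne.symm),
    M.isFibreComponent_of_isLine C h he hi h1 h2 h3,
    M.isFibreComponent_of_isLine C h' he' hi' h1' h2' h3'⟩

theorem exists_isFibreComponent_one {i : Option (Fin 4)} {y : K} (hy : y ^ 4 = 1)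
    (h : ConicPresentation.pos C.conicData i = C.c * y ^ 2) :
    ∃ P Q, P ≠ Q ∧ M.IsFibreComponent C i P ∧ M.IsFibreComponent C i Q := by
  have hy' : (-y) ^ 4 = 1 := by rw [← hy]; ring
  have hg := sq_mul_rho_sq C hy
  have r1 := isRootOn_one hy hg
  have r2 := isRootOn_one hy' hg
  have m1 := M.elX_sub_mem_one C hy
  have m2 := M.elX_sub_mem_one C hy'
  rw [neg_sq] at m2
  rw [← M.fibre_eq C h] at m1 m2
  exact M.exists_of_isLinePair C (M.isLinePair_one C.lam_ne hy hg).fst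
    (M.isLinePair_one C.lam_ne hy' hg).fst (M.isLineEquation_one hy hg)
    (M.isLineEquation_one hy' hg) m1 m2 (M.lin_ne_linU r1 _) (M.lin_ne_linU r1 _)
    (M.lin_ne r1 (by
      by_contra! h0
      exact one_ne_infinity C hy h0.1.symm h0.2.symm))
    (M.lin_ne_linU r2 _) (M.lin_ne_linU r2 _)
    (M.lin_ne r2 (by
      by_contra! h0
      exact one_ne_infinity C hy' h0.1.symm h0.2.symm))
    (M.lin_ne r1 (Or.inl (ne_neg_of_pow_four hy)))

theorem exists_isFibreComponent_two {i : Option (Fin 4)} {y : K} (hy : y ^ 4 = 1)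
    (h : ConicPresentation.pos C.conicData i = C.c * -(y ^ 2 * C.a' ^ 2)) :
    ∃ P Q, P ≠ Q ∧ M.IsFibreComponent C i P ∧ M.IsFibreComponent C i Q := by
  have hy' : (-y) ^ 4 = 1 := by rw [← hy]; ring
  have hg : 2 * (-(y ^ 2 * C.rho)) ^ 2 = lam ^ 4 - 1 := by rw [neg_sq, sq_mul_rho_sq C hy]
  have r1 := isRootOn_two hy hg
  have r2 := isRootOn_two hy' hg
  have m1 := M.elX_add_mem_two C hy
  have m2 := M.elX_add_mem_two C hy'
  rw [neg_sq] at m2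
  have h1 := M.fibre_eq C h
  rw [map_neg, neg_mul, sub_neg_eq_add] at h1
  rw [← h1] at m1 m2
  exact M.exists_of_isLinePair C (M.isLinePair_two C.lam_ne hy hg).fst
    (M.isLinePair_two C.lam_ne hy' hg).fst (M.isLineEquation_two hy hg)
    (M.isLineEquation_two hy' hg) m1 m2 (M.lin_ne_linU r1 _) (M.lin_ne_linU r1 _)
    (M.lin_ne r1 (by
      by_contra! h0
      exact one_ne_infinity C hy h0.2.symm h0.1.symm))
    (M.lin_ne_linU r2 _) (M.lin_ne_linU r2 _)
    (M.lin_ne r2 (by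
      by_contra! h0
      exact one_ne_infinity C hy' h0.2.symm h0.1.symm))
    (M.lin_ne r1 (Or.inr (ne_neg_of_pow_four hy)))

/-- Both components are exhibited because one enters the independent family and the other serves as
a test curve with coefficient zero. -/
theorem exists_isFibreComponent (i : Option (Fin 4)) :
    ∃ P Q, P ≠ Q ∧ M.IsFibreComponent C i P ∧ M.IsFibreComponent C i Q := by
  have hi := C.i_sq
  rcases i with _ | i
  · have hq := C.half_r
    have q3 := C.quartic (b := C.a') (by simp)
    have q4 := C.quartic (b := -C.a') (by simp)
    have n1 : C.a ≠ C.a' := sub_ne_zero.1 C.a_sub_ne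
    have n2 : C.a ≠ -C.a' := fun h => C.a_add_ne (by rw [h]; ring)
    have n3 : -C.a ≠ C.a' := fun h => C.a_add_ne (by rw [← h]; ring)
    have n4 : -C.a ≠ -C.a' := fun h => n1 (neg_injective h)
    have hm : ∀ b, (M.conic C).fibre none ∈ Ideal.span {M.linU b, M.piU (C.r / 2)} := by
      intro b
      rw [M.fibre_eq C (t := 0) (by rw [mul_zero]; rfl), map_zero, zero_mul, sub_zero, elX_eq]
      exact Ideal.mul_mem_left _ _ (Ideal.subset_span (by simp))
    have hl := fun b => (M.lin_ne_linU (isRootOn_infinity C) b).symm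
    exact M.exists_of_isLinePair C (M.isLinePair_u q3 hq).fst (M.isLinePair_u q4 hq).fst
      (.u _ _ q3 hq) (.u _ _ q4 hq) (hm _) (hm _) (M.linU_ne q3 n1.symm) (M.linU_ne q3 n3.symm)
      (hl _) (M.linU_ne q4 n2.symm) (M.linU_ne q4 n4.symm) (hl _) (M.linU_ne q3 (a'_ne_neg_a' C))
  · fin_cases i
    · refine M.exists_isFibreComponent_one C (y := 1) (by norm_num) ?_
      change C.c = _
      ring
    · refine M.exists_isFibreComponent_one C C.i_pow_four ?_
      change -C.c = _
      linear_combination -C.c * hi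
    · refine M.exists_isFibreComponent_two C C.i_pow_four ?_
      change C.c * C.a' ^ 2 = _
      linear_combination C.c * C.a' ^ 2 * hi
    · refine M.exists_isFibreComponent_two C (y := 1) (by norm_num) ?_
      change -(C.c * C.a' ^ 2) = _
      ring

variable {M C} in
theorem IsFibreComponent.eq {i j : Option (Fin 4)} {P : PrimeDivisor 𝒜}
    (h : M.IsFibreComponent C i P) (h' : M.IsFibreComponent C j P) : i = j := by
  by_contra hij
  exact h.2.1 ((M.conic C).den_mem_of_fibre_mem hij h.1 h'.1)

-- In the chart of den the form `fibre i` is itself inverted. In the other chart, multiply it by x':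
-- the product is den times the form inverted there, and den is nonzero on the component.
variable {M C} in
theorem IsFibreComponent.not_isCovered {i : Option (Fin 4)} {P : PrimeDivisor 𝒜}
    (h : M.IsFibreComponent C i P) : ¬ IsCovered (M.charts C) P := by
  have key : ∀ {D' x' : R}, x' - algebraMap K R (ConicPresentation.pos C.conicData i) * D' ∈
      (M.conic C).chart D' x' := by
    intro D' x'
    rcases i with _ | i
    · have : ConicPresentation.pos C.conicData none = 0 := rfl
      rw [this, map_zero, zero_mul, sub_zero]
      exact Submonoid.subset_closure (by simp)
    · exact Submonoid.subset_closure (Or.inr ⟨i, rfl⟩)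
  rintro ⟨_ | _, hc⟩
  · refine hc _ key ?_
    have h1 := P.ideal.mul_mem_right (M.elX' C) h.1
    have h2 : (M.conic C).fibre i * M.elX' C = (M.conic C).den *
        (M.linU (-C.a') * (M.conic C).n₃ -
          algebraMap K R (ConicPresentation.pos C.conicData i) * M.elX' C) := by
      have := M.elX_mul_eq_den C
      rw [ConicPresentation.fibre]
      change (M.elX C - _) * _ = _
      linear_combination this
    rw [h2] at h1
    exact (P.point.isPrime.mem_or_mem h1).resolve_left h.2.1
  · exact hc _ key h.1

/-- A component of a smooth fibre of the conic bundle that lies outside of the charts. -/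
theorem exists_base_points : ∃ P Q : PrimeDivisor 𝒜, P ≠ Q ∧ ∀ G, G = P ∨ G = Q →
    (M.conic C).den ∈ G.ideal ∧ (M.conic C).s ∉ G.ideal ∧ ¬ IsCovered (M.charts C) G := by
  have hq := C.half_neg_r
  have q1 := C.quartic (b := C.a) (by simp)
  have q2 := C.quartic (b := -C.a) (by simp)
  have key : ∀ b (h : IsLine 𝒜 (M.linU b) (M.piU (-(C.r / 2)))),
      b ^ 4 + 2 * lam ^ 2 * b ^ 2 + 1 = 0 → (M.conic C).den ∈ h.divisor.ideal →
      (M.conic C).den ∈ h.divisor.ideal ∧ (M.conic C).s ∉ h.divisor.ideal ∧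
        ¬ IsCovered (M.charts C) h.divisor := by
    intro b h hb hden
    refine ⟨hden, M.lin_notMem_u hb hq _ _, ?_⟩
    rintro ⟨_ | _, hc⟩
    · refine hc (M.elX' C) (Submonoid.subset_closure (by simp)) ?_
      rw [elX'_eq]
      exact Ideal.mul_mem_left _ _ (Ideal.subset_span (by simp))
    · exact hc _ (Submonoid.subset_closure (by simp)) hden
  have h1 := (M.isLinePair_u q1 hq).fst
  have h2 := (M.isLinePair_u q2 hq).fst
  refine ⟨h1.divisor, h2.divisor, h1.ne_of_notMem (M.linU_notMem_u q2 hq (a_ne_neg_a C).symm), ?_⟩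
  rintro G (rfl | rfl)
  · apply key _ h1 q1
    rw [conic_den]
    exact Ideal.mul_mem_right _ _ (Ideal.subset_span (by simp))
  · apply key _ h2 q2
    rw [conic_den]
    exact Ideal.mul_mem_left _ _ (Ideal.mul_mem_left _ _ (Ideal.subset_span (by simp)))

-- The family consists of one component of each of the five finite singular fibres, both components
-- of the fibre at den = 0 given by `exists_base_points`, and one of the two lines over s = k(u +
-- v). The omitted line over s = k(u + v) and the five omitted fibre components are the curves along
-- which a principal combination has order zero, so `eq_zero_of_mem_principalDivisors` applies.
include M C in
theorem eight_le_finrank [Module.Finite ℚ (ℚ ⊗[ℤ] NS 𝒜)] :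
    8 ≤ Module.finrank ℚ (ℚ ⊗[ℤ] NS 𝒜) := by
  choose P Q hPQ hP hQ using M.exists_isFibreComponent C
  obtain ⟨G₁, G₂, hG, hG'⟩ := M.exists_base_points C
  have hG₁ := hG' G₁ (Or.inl rfl)
  have hG₂ := hG' G₂ (Or.inr rfl)
  have hinf := M.isLinePair_infinity C
  have hE : (M.conic C).s ∈ hinf.fst.divisor.ideal := Ideal.subset_span (by simp [conic])
  have hE' : (M.conic C).s ∈ hinf.snd.divisor.ideal := Ideal.subset_span (by simp [conic])
  have hEE : hinf.snd.divisor ≠ hinf.fst.divisor := fun h =>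
    M.numT_notMem_infinity C (h ▸ M.numT_mem_infinity C)
  have hs : ∀ i, (M.conic C).s ∈ (M.charts C) i := by
    rintro (_ | _) <;> exact Submonoid.subset_closure (by simp)
  obtain ⟨φ, hs0, hX, hY, hx⟩ := (M.conic C).exists_point_infinity
  have hker := M.le_ker_infinity C hs0 hX hY hx
  set E := hinf.fst.divisor
  set E' := hinf.snd.divisor
  -- Five fibre components and three further curves: the expected rank 8.
  let S : Option (Fin 4) ⊕ Fin 3 → PrimeDivisor 𝒜 := Sum.elim P ![E, G₁, G₂]
  have hP1 : ∀ i, P i ≠ E := fun i h => (hP i).2.2 (h ▸ hE)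
  have hP2 : ∀ i, P i ≠ G₁ := fun i h => (hP i).2.1 (h ▸ hG₁.1)
  have hP3 : ∀ i, P i ≠ G₂ := fun i h => (hP i).2.1 (h ▸ hG₂.1)
  have h12 : E ≠ G₁ := fun h => hG₁.2.1 (h ▸ hE)
  have h13 : E ≠ G₂ := fun h => hG₂.2.1 (h ▸ hE)
  have hS : Function.Injective S := by
    refine Function.Injective.sumElim (fun i j h => (hP i).eq (h ▸ hP j)) ?_ ?_
    · intro i j h
      fin_cases i <;> fin_cases j <;> first
        | rfl
        | exact absurd h ‹_›
        | exact absurd h.symm ‹_›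
    · intro i j
      fin_cases j
      exacts [hP1 i, hP2 i, hP3 i]
  have hcov : ∀ q, ¬ IsCovered (M.charts C) (S q) := by
    rintro (i | j)
    · exact (hP i).not_isCovered
    · fin_cases j
      · rintro ⟨i, hi⟩
        exact hi _ (hs i) hE
      · exact hG₁.2.2
      · exact hG₂.2.2
  have hE'S : E' ∉ Set.range S := by
    rintro ⟨i | j, h⟩
    · exact (hP i).2.2 ((show P i = E' from h) ▸ hE')
    · fin_cases j
      · exact hEE h.symm
      · exact hG₁.2.1 ((show G₁ = E' from h) ▸ hE')
      · exact hG₂.2.1 ((show G₂ = E' from h) ▸ hE')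
  have hQS : ∀ i, Q i ∉ Set.range S := by
    rintro i ⟨j | j, h⟩
    · change P j = Q i at h
      obtain rfl := (hP j).eq (h ▸ hQ i)
      exact hPQ _ h
    · fin_cases j
      · exact (hQ i).2.2 ((show E = Q i from h) ▸ hE)
      · exact (hQ i).2.1 ((show G₁ = Q i from h) ▸ hG₁.1)
      · exact (hQ i).2.1 ((show G₂ = Q i from h) ▸ hG₂.1)
  have hlin := linearIndependent_cl (M.algebraicallyTrivial_le C) S fun n hn => by
    have h0 := (M.conic C).eq_zero_of_mem_principalDivisors (M.isDiscreteValuationRing C)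
      (M.isChart_charts C) (M.exists_forall_not_dvd C) hn
      (fun Q hQ => Finsupp.mapDomain_of_notMem_range _ _ (by
        rintro ⟨q, rfl⟩
        exact hcov q hQ))
      (Finsupp.mapDomain_of_notMem_range _ _ hE'S) hE' (M.numT_notMem_infinity C)
      (fun h => (M.conic C).map_den_ne hX hY (hker h))
      (fun i h => (M.conic C).map_x_sub_ne hX hY hx _ (hker h))
      fun i => ⟨Q i, Finsupp.mapDomain_of_notMem_range _ _ (hQS i), (hQ i).1, (hQ i).2.1⟩
    have h1 := Finsupp.mapDomain_injective hS (h0.trans Finsupp.mapDomain_zero.symm)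
    exact Finsupp.equivFunOnFinite.symm.injective (h1.trans (Finsupp.ext fun _ => rfl))
  have := hlin.fintype_card_le_finrank
  simpa using this

end Presentation

end Dwork

/-! ### Galois action on the eigenvectors -/

namespace Dwork
open ProjDiv

namespace Presentation

variable {K R : Type u} [Field K] [CharZero K] [IsAlgClosed K] [CommRing R] [IsDomain R]
  [Algebra K R] [IsNoetherianRing R] {𝒜 : ℕ → Submodule K R} [GradedAlgebra 𝒜] {lam : K}
  (M : Presentation 𝒜 lam) (C : Constants lam) {G : Type u} [Group G] [MulSemiringAction G K]
  (α : SemiAction G 𝒜) (g : G)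

theorem smul_two_eq : g • (2 : K) = 2 := by
  rw [← one_add_one_eq_two, smul_add, smul_one]

theorem act_algebraMap (c : K) : α.act g (algebraMap K R c) = algebraMap K R (g • c) := by
  rw [Algebra.algebraMap_eq_smul_one, α.act_smul, map_one, Algebra.algebraMap_eq_smul_one]

/-- An element of the group that fixes the generators and the parameter. -/
structure IsFixed : Prop where
  s : α.act g M.s = M.s
  u : α.act g M.u = M.u
  v : α.act g M.v = M.v
  w : α.act g M.w = M.w
  lam : g • lam = lam

namespace IsFixed

variable {M α g} (h : M.IsFixed α g)
include h

theorem act_A : α.act g M.A = M.A := by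
  rw [A]
  simp only [map_add, map_mul, map_pow, map_ofNat, act_algebraMap, h.s, h.u, h.v, h.lam]

theorem act_linU (b : K) : α.act g (M.linU b) = M.linU (g • b) := by
  simp only [linU, map_sub, map_mul, act_algebraMap, h.u, h.v]

theorem act_piU (q : K) : α.act g (M.piU q) = M.piU (g • q) := by
  simp only [piU, map_sub, map_mul, act_algebraMap, h.w, h.act_A]

theorem act_lin (k₁ k₂ : K) : α.act g (M.lin k₁ k₂) = M.lin (g • k₁) (g • k₂) := by
  simp only [lin, map_sub, map_mul, act_algebraMap, h.u, h.v, h.s]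

theorem act_quad (q₀ q₁ q₂ : K) :
    α.act g (M.quad q₀ q₁ q₂) = M.quad (g • q₀) (g • q₁) (g • q₂) := by
  simp only [quad, map_add, map_mul, map_pow, act_algebraMap, h.u, h.v]

theorem act_linOne (y : K) : α.act g (M.linOne y) = M.linOne (g • y) := by
  rw [linOne, h.act_lin, linOne, smul_neg, smul_mul', smul_pow', h.lam]

theorem act_linTwo (y : K) : α.act g (M.linTwo y) = M.linTwo (g • y) := by
  rw [linTwo, h.act_lin, linTwo, smul_neg, smul_mul', smul_pow', h.lam]

theorem act_piOne (q : K) : α.act g (M.piOne q) = M.piOne (g • q) := by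
  rw [piOne, map_sub, h.act_quad, piOne, h.w, smul_zero]

theorem act_piTwo (q : K) : α.act g (M.piTwo q) = M.piTwo (g • q) := by
  rw [piTwo, map_sub, h.act_quad, piTwo, h.w, smul_zero]

theorem smul_two_mul_sq {q t : K} (hq : 2 * q ^ 2 = t) : 2 * (g • q) ^ 2 = g • t := by
  rw [← hq, smul_mul', smul_pow', smul_two_eq]

theorem nsRep_lineClass_u {b q : K} (hb : b ^ 4 + 2 * lam ^ 2 * b ^ 2 + 1 = 0)
    (hq : 2 * q ^ 2 = 1) : α.nsRep g (lineClass 𝒜 (M.linU b) (M.piU q)) =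
      lineClass 𝒜 (M.linU (g • b)) (M.piU (g • q)) := by
  have hb' : (g • b) ^ 4 + 2 * lam ^ 2 * (g • b) ^ 2 + 1 = 0 := by
    have := congrArg (g • ·) hb
    simpa only [smul_add, smul_mul', smul_pow', h.lam, smul_one, smul_zero, smul_two_eq] using this
  have hq' : 2 * (g • q) ^ 2 = 1 := by rw [h.smul_two_mul_sq hq, smul_one]
  rw [nsRep_lineClass α g (M.isLinePair_u hb hq).fst
    (by rw [h.act_linU, h.act_piU]; exact (M.isLinePair_u hb' hq').fst), h.act_linU, h.act_piU]

theorem nsRep_diffU {b q : K} (hb : b ^ 4 + 2 * lam ^ 2 * b ^ 2 + 1 = 0) (hq : 2 * q ^ 2 = 1) :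
    α.nsRep g (M.diffU b q) = M.diffU (g • b) (g • q) := by
  rw [diffU, map_sub, h.nsRep_lineClass_u hb hq,
    h.nsRep_lineClass_u hb (by rw [neg_sq, hq]), smul_neg, diffU]

theorem nsRep_diffOne (hlam : lam ^ 4 ≠ 1) {y q : K} (hy : y ^ 4 = 1)
    (hq : 2 * q ^ 2 = lam ^ 4 - 1) : α.nsRep g (M.diffOne y q) = M.diffOne (g • y) (g • q) := by
  have hy' : (g • y) ^ 4 = 1 := by rw [← smul_pow', hy, smul_one]
  have hq' : 2 * (g • q) ^ 2 = lam ^ 4 - 1 := by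
    rw [h.smul_two_mul_sq hq, smul_sub, smul_pow', h.lam, smul_one]
  have h1 := M.isLinePair_one hlam hy hq
  have h2 := M.isLinePair_one hlam hy' hq'
  rw [diffOne, map_sub, nsRep_lineClass α g h1.fst (by rw [h.act_linOne, h.act_piOne]; exact h2.fst),
    nsRep_lineClass α g h1.snd (by rw [h.act_linOne, h.act_piOne, smul_neg]; exact h2.snd),
    h.act_linOne, h.act_piOne, h.act_piOne, smul_neg, diffOne]

theorem nsRep_diffTwo (hlam : lam ^ 4 ≠ 1) {y q : K} (hy : y ^ 4 = 1)
    (hq : 2 * q ^ 2 = lam ^ 4 - 1) : α.nsRep g (M.diffTwo y q) = M.diffTwo (g • y) (g • q) := by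
  have hy' : (g • y) ^ 4 = 1 := by rw [← smul_pow', hy, smul_one]
  have hq' : 2 * (g • q) ^ 2 = lam ^ 4 - 1 := by
    rw [h.smul_two_mul_sq hq, smul_sub, smul_pow', h.lam, smul_one]
  have h1 := M.isLinePair_two hlam hy hq
  have h2 := M.isLinePair_two hlam hy' hq'
  rw [diffTwo, map_sub, nsRep_lineClass α g h1.fst (by rw [h.act_linTwo, h.act_piTwo]; exact h2.fst),
    nsRep_lineClass α g h1.snd (by rw [h.act_linTwo, h.act_piTwo, smul_neg]; exact h2.snd),
    h.act_linTwo, h.act_piTwo, h.act_piTwo, smul_neg, diffTwo]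

theorem nsRep_hyperplane : α.nsRep g (M.hyperplane C) = M.hyperplane C := by
  have hR := M.isDiscreteValuationRing C
  have hb := C.quartic (b := C.a) (by simp)
  have hp := M.isLinePair_u hb C.half_r
  have hb' : (g • C.a) ^ 4 + 2 * lam ^ 2 * (g • C.a) ^ 2 + 1 = 0 := by
    have := congrArg (g • ·) hb
    simpa only [smul_add, smul_mul', smul_pow', h.lam, smul_one, smul_zero, smul_two_eq] using this
  have hq' : 2 * (g • (C.r / 2)) ^ 2 = 1 := by rw [h.smul_two_mul_sq C.half_r, smul_one]
  have hp' := M.isLinePair_u hb' hq'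
  have h0 := hp.fst.isUniformizer.ne_zero
  rw [hyperplane, map_add, h.nsRep_lineClass_u hb C.half_r, h.nsRep_lineClass_u hb C.half_neg_r,
    smul_neg, hp'.lineClass_add hR h0 hp.fst.fst_mem, hp.lineClass_add hR h0 hp.fst.fst_mem]

/-- The eigenvectors are eigenvectors, with eigenvalues given by the action on the constants. -/
theorem nsRep_eigenvector {e₁ e₂ e₃ e₄ : ℤˣ} (h₁ : g • C.al = ((e₁ : ℤ) : K) * C.al)
    (h₂ : g • C.be = ((e₂ : ℤ) : K) * C.be) (h₃ : g • C.r = ((e₃ : ℤ) : K) * C.r)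
    (h₄ : g • C.i = ((e₄ : ℤ) : K) * C.i) (j : Fin 8) :
    α.nsRep g (M.eigenvector C j) = (((![1, e₁, e₂, e₄ * (e₁ * e₂ * e₃), e₄ * (e₁ * e₂ * e₃),
      e₁ * e₂ * e₃, e₁ * e₂ * e₃, e₁ * e₂ * e₃] j : ℤˣ) : ℤ) : ℚ) • M.eigenvector C j := by
  have hdiv : ∀ x : K, g • (x / 2) = g • x / 2 := fun x => by rw [smul_div₀', smul_two_eq]
  -- Since ρ = al·be·r/2, the three signs multiply. A sign on ρ exchanges the two lines over a form
  -- and so changes the sign of the difference.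
  have hrho : g • C.rho = (((e₁ * e₂ * e₃ : ℤˣ) : ℤ) : K) * C.rho := by
    rw [Constants.rho, hdiv, smul_mul', smul_mul', h₁, h₂, h₃]
    push_cast
    ring
  have hneg : g • (-1 : K) = -1 := by rw [smul_neg, smul_one]
  have sgnOne : ∀ (e : ℤˣ) y, M.diffOne y (((e : ℤ) : K) * C.rho) =
      ((e : ℤ) : ℚ) • M.diffOne y C.rho := by
    intro e y
    rcases Int.units_eq_one_or e with rfl | rfl
    · simp
    · simp [diffOne_neg]
  have sgnTwo : ∀ (e : ℤˣ) y, M.diffTwo y (((e : ℤ) : K) * C.rho) =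
      ((e : ℤ) : ℚ) • M.diffTwo y C.rho := by
    intro e y
    rcases Int.units_eq_one_or e with rfl | rfl
    · simp
    · simp [diffTwo_neg]
  have one : ∀ y : K, y ^ 4 = 1 → α.nsRep g (M.diffOne y C.rho) =
      (((e₁ * e₂ * e₃ : ℤˣ) : ℤ) : ℚ) • M.diffOne (g • y) C.rho := fun y hy => by
    rw [h.nsRep_diffOne C.lam_ne hy C.rho_sq, hrho, sgnOne]
  have two : ∀ y : K, y ^ 4 = 1 → α.nsRep g (M.diffTwo y C.rho) =
      (((e₁ * e₂ * e₃ : ℤˣ) : ℤ) : ℚ) • M.diffTwo (g • y) C.rho := fun y hy => by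
    rw [h.nsRep_diffTwo C.lam_ne hy C.rho_sq, hrho, sgnTwo]
  have n1 : (-1 : K) ^ 4 = 1 := by norm_num
  have gi : g • -C.i = ((e₄ : ℤ) : K) * -C.i := by rw [smul_neg, h₄, mul_neg]
  -- The sign e₃ acts twice: on the root (x·al + y·be)r/2, where it multiplies both x and y, and on
  -- the choice r/2 of the line over it. In the signed sums the two effects cancel, which leaves e₁
  -- or e₂.
  have diff : ∀ x y : ℤˣ, α.nsRep g (M.diff C ((x : ℤ) : K) ((y : ℤ) : K)) =
      ((e₃ : ℤ) : ℚ) • M.diff C (((e₁ * e₃ * x : ℤˣ) : ℤ) : K) (((e₂ * e₃ * y : ℤˣ) : ℤ) : K) := by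
    intro x y
    have hsq : ∀ e : ℤˣ, ((e : ℤ) : K) ^ 2 = 1 := fun e => by
      rcases Int.units_eq_one_or e with rfl | rfl <;> simp
    have hx : ∀ e : ℤˣ, g • ((e : ℤ) : K) = ((e : ℤ) : K) := fun e => by
      rcases Int.units_eq_one_or e with rfl | rfl <;> simp
    rw [Presentation.diff, h.nsRep_diffU (C.root_eq (hsq x) (hsq y)) C.half_r, hdiv, h₃, Presentation.diff]
    have hroot : g • C.root ((x : ℤ) : K) ((y : ℤ) : K) =
        C.root (((e₁ * e₃ * x : ℤˣ) : ℤ) : K) (((e₂ * e₃ * y : ℤˣ) : ℤ) : K) := by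
      rw [Constants.root, hdiv, smul_mul', smul_add, smul_mul', smul_mul', hx, hx, h₁, h₂, h₃,
        Constants.root]
      push_cast
      ring
    rw [hroot]
    rcases Int.units_eq_one_or e₃ with rfl | rfl
    · simp
    · simp [neg_div, diffU_neg]
  have d1 := diff 1 1
  have d2 := diff 1 (-1)
  have d3 := diff (-1) 1
  have d4 := diff (-1) (-1)
  fin_cases j
  · exact (h.nsRep_hyperplane C).trans (one_smul ℚ _).symm
  · change α.nsRep g (M.diff C 1 1 + M.diff C 1 (-1) - M.diff C (-1) 1 - M.diff C (-1) (-1)) =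
      ((e₁ : ℤ) : ℚ) • (M.diff C 1 1 + M.diff C 1 (-1) - M.diff C (-1) 1 - M.diff C (-1) (-1))
    rcases Int.units_eq_one_or e₁ with rfl | rfl <;> rcases Int.units_eq_one_or e₂ with rfl | rfl <;>
      rcases Int.units_eq_one_or e₃ with rfl | rfl <;> simp at d1 d2 d3 d4 <;>
      simp [d1, d2, d3, d4] <;> abel
  · change α.nsRep g (M.diff C 1 1 - M.diff C 1 (-1) + M.diff C (-1) 1 - M.diff C (-1) (-1)) =
      ((e₂ : ℤ) : ℚ) • (M.diff C 1 1 - M.diff C 1 (-1) + M.diff C (-1) 1 - M.diff C (-1) (-1))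
    rcases Int.units_eq_one_or e₁ with rfl | rfl <;> rcases Int.units_eq_one_or e₂ with rfl | rfl <;>
      rcases Int.units_eq_one_or e₃ with rfl | rfl <;> simp at d1 d2 d3 d4 <;>
      simp [d1, d2, d3, d4] <;> abel
  · change α.nsRep g (M.diffOne C.i C.rho - M.diffOne (-C.i) C.rho) =
      (((e₄ * (e₁ * e₂ * e₃) : ℤˣ) : ℤ) : ℚ) • (M.diffOne C.i C.rho - M.diffOne (-C.i) C.rho)
    rw [map_sub, one _ C.i_pow_four, one _ C.neg_i_pow_four, h₄, gi]
    generalize e₁ * e₂ * e₃ = e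
    rcases Int.units_eq_one_or e₄ with rfl | rfl
    · simp [smul_sub]
    · simp only [smul_sub, Units.val_neg, Units.val_one, Int.cast_neg, Int.cast_one, neg_one_mul,
        neg_neg, neg_smul]
      abel
  · change α.nsRep g (M.diffTwo C.i C.rho - M.diffTwo (-C.i) C.rho) =
      (((e₄ * (e₁ * e₂ * e₃) : ℤˣ) : ℤ) : ℚ) • (M.diffTwo C.i C.rho - M.diffTwo (-C.i) C.rho)
    rw [map_sub, two _ C.i_pow_four, two _ C.neg_i_pow_four, h₄, gi]
    generalize e₁ * e₂ * e₃ = e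
    rcases Int.units_eq_one_or e₄ with rfl | rfl
    · simp [smul_sub]
    · simp only [smul_sub, Units.val_neg, Units.val_one, Int.cast_neg, Int.cast_one, neg_one_mul,
        neg_neg, neg_smul]
      abel
  · exact (one 1 (one_pow 4)).trans (by rw [smul_one]; rfl)
  · exact (one (-1) n1).trans (by rw [hneg]; rfl)
  · exact (two 1 (one_pow 4)).trans (by rw [smul_one]; rfl)

end IsFixed

end Presentation

end Dwork

/-! ### Quadratic characters and diagonal representations -/

section Characters

variable {F : Type u} [Field F] [CharZero F]

theorem quadraticCharacter_eq {a : F} {x : AlgebraicClosure F}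
    (hx : x ^ 2 = algebraMap F (AlgebraicClosure F) a) (hx0 : x ≠ 0)
    {σ : AlgebraicClosure F ≃ₐ[F] AlgebraicClosure F} {e : ℤˣ}
    (h : σ x = ((e : ℤ) : AlgebraicClosure F) * x) : quadraticCharacter a σ = e := by
  rcases Int.units_eq_one_or e with rfl | rfl
  · refine if_pos fun y hy => ?_
    have h : σ x = x := by simpa using h
    rcases sq_eq_sq_iff_eq_or_eq_neg.1 (hy.trans hx.symm) with rfl | rfl
    · exact h
    · rw [map_neg, h]
  · refine if_neg fun h1 => ?_
    rw [h1 x hx] at h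
    exact self_ne_neg.2 hx0 (by simpa using h)

theorem exists_unit_smul_eq {a : F} {x : AlgebraicClosure F}
    (hx : x ^ 2 = algebraMap F (AlgebraicClosure F) a)
    (σ : AlgebraicClosure F ≃ₐ[F] AlgebraicClosure F) :
    ∃ e : ℤˣ, σ x = ((e : ℤ) : AlgebraicClosure F) * x := by
  have h : σ x ^ 2 = x ^ 2 := by rw [← map_pow, hx, AlgEquiv.commutes]
  rcases sq_eq_sq_iff_eq_or_eq_neg.1 h with h | h
  · exact ⟨1, by simpa using h⟩
  · exact ⟨-1, by simpa using h⟩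

theorem nonempty_equiv_characterSum {G V ι : Type*} [Group G] [AddCommGroup V] [Module ℚ V]
    [Fintype ι] (ρ : Representation ℚ G V) (χ : ι → G →* ℤˣ) (b : Module.Basis ι ℚ V)
    (h : ∀ g i, ρ g (b i) = ((χ i g : ℤ) : ℚ) • b i) :
    Nonempty (Representation.Equiv ρ (characterSum χ)) := by
  classical
  refine ⟨.mk b.equivFun fun g => b.ext fun i => ?_⟩
  change b.equivFun (ρ g (b i)) = characterSum χ g (b.equivFun (b i))
  rw [h, map_smul]
  funext j
  change _ * b.equivFun (b i) j = ((χ j g : ℤ) : ℚ) * b.equivFun (b i) j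
  rw [Module.Basis.equivFun_self]
  rcases eq_or_ne i j with rfl | hij
  · rfl
  · simp [hij]

end Characters

/-! ### The quotient ring as a presentation, and the theorem -/

namespace Dwork
open ProjDiv

/-- The presentation of the homogeneous coordinate ring of the quotient surface. -/
noncomputable def presentation {K : Type u} [Field K] [CharZero K] (c : K) :
    Presentation (quotGrading K c) c where
  s := elS K c
  u := elU K c
  v := elV K c
  w := elW K c
  s_mem := elS_mem
  u_mem := elU_mem
  v_mem := elV_mem
  w_mem := elW_mem
  equation := equation
  adjoin_eq_top := adjoin_eq_top
  exists_lift _ _ _ _ S U V W h := exists_lift S U V W h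

theorem isFixed_galoisAction (F : Type u) [Field F] [CharZero F] (lam : F)
    (σ : AlgebraicClosure F ≃ₐ[F] AlgebraicClosure F) :
    (presentation (param F lam)).IsFixed (galoisAction F lam) σ := by
  have hX : ∀ j : Fin 4, conj (σ : AlgebraicClosure F ≃+* AlgebraicClosure F) (σ.commutes lam)
      (Ideal.Quotient.mk _ (MvPolynomial.X j)) = Ideal.Quotient.mk _ (MvPolynomial.X j) := fun j => by
    rw [conj_mk, MvPolynomial.map_X]
  have hs : (galoisAction F lam).act σ (elS _ (param F lam)) = elS _ (param F lam) := by
    apply Subtype.ext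
    change conj _ _ (_ + _) = _ + _
    rw [map_add, hX, hX]
  have hu : (galoisAction F lam).act σ (elU _ (param F lam)) = elU _ (param F lam) :=
    Subtype.ext (hX 2)
  have hv : (galoisAction F lam).act σ (elV _ (param F lam)) = elV _ (param F lam) :=
    Subtype.ext (hX 3)
  have hp : (galoisAction F lam).act σ (elP _ (param F lam)) = elP _ (param F lam) := by
    apply Subtype.ext
    change conj _ _ (_ * _) = _ * _
    rw [map_mul, hX, hX]
  have hlam : σ • param F lam = param F lam := σ.commutes lam
  refine ⟨hs, hu, hv, ?_, hlam⟩
  change (galoisAction F lam).act σ (elW _ (param F lam)) = elW _ (param F lam)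
  have key : ∀ {R : Type u} [CommRing R] (e : R ≃+* R) {p s a u v : R}, e p = p → e s = s →
      e a = a → e u = u → e v = v → e (p - s ^ 2 - a * u * v) = p - s ^ 2 - a * u * v :=
    fun e _ _ _ _ _ h1 h2 h3 h4 h5 => by simp [h1, h2, h3, h4, h5]
  refine key _ hp hs ?_ hu hv
  rw [Presentation.act_algebraMap, hlam]

end Dwork

open Dwork ProjDiv in
theorem lemma6p1 (F : Type u) [Field F] [NumberField F] (lam : F) (hlam : lam ^ 4 ≠ 1) :
    Nonempty (Representation.Equiv (Dwork.nsRep F lam)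
      (characterSum ![1,
        quadraticCharacter (-(lam ^ 2 - 1)),
        quadraticCharacter (-(lam ^ 2 + 1)),
        quadraticCharacter (-2 * (lam ^ 4 - 1)), quadraticCharacter (-2 * (lam ^ 4 - 1)),
        quadraticCharacter (2 * (lam ^ 4 - 1)), quadraticCharacter (2 * (lam ^ 4 - 1)),
        quadraticCharacter (2 * (lam ^ 4 - 1))])) := by
  set M := presentation (param F lam) with hM
  obtain ⟨C⟩ := Constants.nonempty (lam := param F lam) (by
    rw [← map_pow, Ne, map_eq_one_iff _ (algebraMap F (AlgebraicClosure F)).injective]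
    exact hlam)
  have hspan := M.span_eigenvector C (M.isDiscreteValuationRing C)
  have : Module.Finite ℚ (ℚ ⊗[ℤ] geomNS F lam) := by
    rw [Module.finite_def, ← hspan]
    exact Submodule.fg_span (Set.finite_range _)
  have h8 := M.eight_le_finrank C
  -- Eight spanning vectors in a space of dimension at least eight form a basis.
  have hrank : Fintype.card (Fin 8) = Module.finrank ℚ (ℚ ⊗[ℤ] geomNS F lam) := by
    refine le_antisymm h8 ?_
    rw [← finrank_top, ← hspan]
    exact finrank_range_le_card _
  have hli := linearIndependent_of_top_le_span_of_card_eq_finrank hspan.ge hrank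
  refine nonempty_equiv_characterSum _ _ (Module.Basis.mk hli hspan.ge) fun σ j => ?_
  have e₁ : C.al ^ 2 = algebraMap F (AlgebraicClosure F) (-(lam ^ 2 - 1)) := by
    rw [C.al_sq]; simp
  have e₂ : C.be ^ 2 = algebraMap F (AlgebraicClosure F) (-(lam ^ 2 + 1)) := by
    rw [C.be_sq]; simp; ring
  have e₃ : C.r ^ 2 = algebraMap F (AlgebraicClosure F) 2 := by rw [C.r_sq, map_ofNat]
  have e₄ : C.i ^ 2 = algebraMap F (AlgebraicClosure F) (-1) := by rw [C.i_sq]; simp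
  -- The products al·be·r and i·al·be·r are square roots of 2(λ⁴ - 1) and -2(λ⁴ - 1), so the
  -- products of signs are the characters of the statement.
  have e₅ : (C.al * C.be * C.r) ^ 2 = algebraMap F (AlgebraicClosure F) (2 * (lam ^ 4 - 1)) := by
    rw [mul_pow, C.albe_sq, C.r_sq, map_mul, map_sub, map_pow, map_one, map_ofNat, mul_comm]
  have e₆ : (C.i * (C.al * C.be * C.r)) ^ 2 =
      algebraMap F (AlgebraicClosure F) (-2 * (lam ^ 4 - 1)) := by
    rw [mul_pow, C.i_sq, e₅, neg_one_mul, neg_mul (2 : F), map_neg]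
  obtain ⟨ε₁, h₁⟩ := exists_unit_smul_eq e₁ σ
  obtain ⟨ε₂, h₂⟩ := exists_unit_smul_eq e₂ σ
  obtain ⟨ε₃, h₃⟩ := exists_unit_smul_eq e₃ σ
  obtain ⟨ε₄, h₄⟩ := exists_unit_smul_eq e₄ σ
  have n₅ : C.al * C.be * C.r ≠ 0 := mul_ne_zero (mul_ne_zero C.al_ne C.be_ne) C.r_ne
  have n₄ : C.i ≠ 0 := by
    intro h
    have := C.i_sq
    rw [h] at this
    norm_num at this
  have h₅ : σ (C.al * C.be * C.r) =
      (((ε₁ * ε₂ * ε₃ : ℤˣ) : ℤ) : AlgebraicClosure F) * (C.al * C.be * C.r) := by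
    rw [map_mul, map_mul, h₁, h₂, h₃]
    push_cast
    ring
  have h₆ : σ (C.i * (C.al * C.be * C.r)) =
      (((ε₄ * (ε₁ * ε₂ * ε₃) : ℤˣ) : ℤ) : AlgebraicClosure F) * (C.i * (C.al * C.be * C.r)) := by
    rw [map_mul, h₅, h₄]
    push_cast
    ring
  have key := (isFixed_galoisAction F lam σ).nsRep_eigenvector C h₁ h₂ h₃ h₄ j
  rw [Module.Basis.mk_apply]
  refine key.trans ?_
  congr 3
  have c₁ := quadraticCharacter_eq e₁ C.al_ne h₁
  have c₂ := quadraticCharacter_eq e₂ C.be_ne h₂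
  have c₅ := quadraticCharacter_eq e₅ n₅ h₅
  have c₆ := quadraticCharacter_eq e₆ (mul_ne_zero n₄ n₅) h₆
  fin_cases j
  · rfl
  · exact c₁.symm
  · exact c₂.symm
  · exact c₆.symm
  · exact c₆.symm
  · exact c₅.symm
  · exact c₅.symm
  · exact c₅.symm
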